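/- Notation. Let $n\ge 1$ and let $\mathcal D=\{Q_{j,m}=\prod_{i=1}^n[2^{-j}m_i,2^{-j}(m_i+1)) : j\in\mathbb Z,\ m\in\mathbb Z^n\}$ be the dyadic cubes of $\mathbb R^n$. Functions are complex valued and measurable, and are identified when equal a.e. For $0<p,q<\infty$ put $\|f\|_{L^{p,q}(E)}=\big(\int_0^\infty (s^{1/p}f^*(s))^q\,\frac{ds}{s}\big)^{1/q}$, where $f^*$ is the decreasing rearrangement of $f|_E$. The Bourgain–Morrey–Lorentz space $M^{t,r}_{p,q}(\mathbb R^n)$ is the set of all $f$ with $$\|f\|_{M^{t,r}_{p,q}}=\Big(\sum_{Q\in\mathcal D}|Q|^{r/t-r/p}\|f\|_{L^{p,q}(Q)}^r\Big)^{1/r}<\infty$$ (the supremum over $Q \in \mathcal D$ of $|Q|^{1/t-1/p}\|f\|_{L^{p,q}(Q)}$ if $r=\infty$). With conjugate exponents $p',q',t',r'$, the block space $\mathcal H^{t',r'}_{p',q'}(\mathbb R^n)$ is the set of all $g=\sum_{j,m}\lambda_{j,m}b_{j,m}$ (convergence in $L^1_{loc}$) with $\lambda\in\ell^{r'}$, $b_{j,m}$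 supported on $Q_{j,m}$ and $\|b_{j,m}\|_{L^{p',q'}}\le|Q_{j,m}|^{1/p'-1/t'}$; $\|g\|_{\mathcal H}$ is the infimum of $\|\lambda\|_{\ell^{r'}}$ over all such representations. $\mathrm{BMO}$ is the set of all locally integrable $b$ with $\sup_Q\frac1{|Q|}\int_Q|b-b_Q|<\infty$, the supremum being over all cubes $Q$. A standard kernel, with constants $\delta,A>0$, is a function $K$ on $\{x\ne y\}$ such that $|K(x,y)|\le A|x-y|^{-n}$; $|K(x,y)-K(x',y)|\le A|x-x'|^\delta(|x-y|+|x'-y|)^{-n-\delta}$ whenever $|x-x'|\le\frac12\max(|x-y|,|x'-y|)$; and $|K(x,y)-K(x,y')|\le A|y-y'|^\delta(|x-y|+|x-y'|)^{-n-\delta}$ whenever $|y-y'|\le\frac12\max(|x-y|,|x-y'|)$. A Calderón–Zygmund operator is a continuous linear $T:\mathscr S(\mathbb R^n)\to\mathscr S'(\mathbb R^n)$ which extends to a bounded operator on $L^2(\mathbb R^n)$ and satisfies, for some standard kernel $K$, $Tf(x)=\int K(x,y)f(y)\,dy$ for all $f\in C_c^\infty$ and almost all $x\notin\operatorname{supp}f$.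 $T^*$ denotes its transpose, $\int (Tf)\,g=\int f\,(T^*g)$. For $b\in\mathrm{BMO}$ and $g\in L^\infty_c$ (bounded, compactly supported) put $[b,T^*]g=b\,T^*g-T^*(bg)$; on $\mathcal H^{t',r'}_{p',q'}$, $[b,T^*]$ denotes the continuous extension from the dense subspace $L_c^\infty$. For $f\in M^{t,r}_{p,q}$, $[b,T]f$ is defined by duality as the unique $h\in M^{t,r}_{p,q}$ such that $$\int h\,g\,dx=-\int f\,[b,T^*]g\,dx\qquad\text{for all } g\in\mathcal H^{t',r'}_{p',q'}(\mathbb R^n).$$ Theorem. Let $1<q<\infty$, and let $1<p<t<r<\infty$ or $1<p\le t<r=\infty$. Let $T$ be a Calderón–Zygmund operator and $b\in\mathrm{BMO}$. Then $[b,T]$ is a well-defined bounded linear operator on $M^{t,r}_{p,q}(\mathbb R^n)$: the extension of $[b,T^*]$ to $\mathcal H^{t',r'}_{p',q'}(\mathbb R^n)$ exists, for every $f\in M^{t,r}_{p,q}(\mathbb R^n)$ there is exactly one $h=[b,T]f\in M^{t,r}_{p,q}(\mathbb R^n)$ as above, it depends linearly on $f$, and there is a constant $C<\infty$ such that $\|[b,T]f\|_{M^{t,r}_{p,q}}\le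 C\|f\|_{M^{t,r}_{p,q}}$ for all $f\in M^{t,r}_{p,q}(\mathbb R^n)$. -/

import Mathlib

open MeasureTheory Set Filter Topology
open scoped ENNReal SchwartzMap ComplexConjugate

noncomputable section

namespace BourgainMorreyLorentz

/-! ### Lorentz quasi-norms -/

/-- The decreasing rearrangement `f^*(s) = inf {a ≥ 0 : μ {x : |f x| > a} ≤ s}`
(with `inf ∅ = ∞`; the value `a = ∞` is always admissible). -/
def rearrangement {X : Type*} [MeasurableSpace X] (μ : Measure X) (f : X → ℂ) (s : ℝ≥0∞) : ℝ≥0∞ :=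
  sInf {a : ℝ≥0∞ | μ {x | a < ‖f x‖ₑ} ≤ s}

/-- The Lorentz quasi-norm
`‖f‖_{L^{p,q}(μ)} = (∫_0^∞ (s^{1/p} f^*(s))^q ds/s)^{1/q}` for finite `p, q > 0`. -/
def lorentzNorm {X : Type*} [MeasurableSpace X] (p q : ℝ) (μ : Measure X) (f : X → ℂ) : ℝ≥0∞ :=
  (∫⁻ s in Ioi (0 : ℝ),
    (ENNReal.ofReal (s ^ (1 / p)) * rearrangement μ f (ENNReal.ofReal s)) ^ q
      / ENNReal.ofReal s) ^ (1 / q)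

/-! ### Cubes -/

/-- Indices `(j, m)` of the dyadic cubes of `ℝⁿ`. -/
abbrev DyadicIndex (n : ℕ) : Type := ℤ × (Fin n → ℤ)

/-- The dyadic cube `Q_{j,m} = ∏ᵢ [2^{-j} mᵢ, 2^{-j} (mᵢ + 1))`. -/
def dyadicCube {n : ℕ} (i : DyadicIndex n) : Set (EuclideanSpace ℝ (Fin n)) :=
  {x | ∀ k, (2 : ℝ) ^ (-i.1) * (i.2 k : ℝ) ≤ x k ∧ x k < (2 : ℝ) ^ (-i.1) * ((i.2 k : ℝ) + 1)}

/-- The cube with sides parallel to the axes, centre `c` and side length `l`. -/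
def cube {n : ℕ} (c : EuclideanSpace ℝ (Fin n)) (l : ℝ) : Set (EuclideanSpace ℝ (Fin n)) :=
  {x | ∀ k, |x k - c k| ≤ l / 2}

/-! ### Bourgain–Morrey–Lorentz spaces -/

/-- The `ℓ^r` norm, `0 < r ≤ ∞`, of a family of extended nonnegative reals. -/
def seqNorm {ι : Type*} (r : ℝ≥0∞) (a : ι → ℝ≥0∞) : ℝ≥0∞ :=
  if r = ∞ then ⨆ i, a i else (∑' i, a i ^ r.toReal) ^ (1 / r.toReal)

/-- `‖f‖_{M^{t,r}_{p,q}(ℝⁿ)}`: the `ℓ^r` norm over all dyadic cubes `Q` of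
`|Q|^{1/t - 1/p} ‖f‖_{L^{p,q}(Q)}`. -/
def bmlNorm {n : ℕ} (p q t : ℝ) (r : ℝ≥0∞) (f : EuclideanSpace ℝ (Fin n) → ℂ) : ℝ≥0∞ :=
  seqNorm r fun i : DyadicIndex n =>
    volume (dyadicCube i) ^ (1 / t - 1 / p) * lorentzNorm p q (volume.restrict (dyadicCube i)) f

/-- Membership in `M^{t,r}_{p,q}(ℝⁿ)`. -/
def MemBML {n : ℕ} (p q t : ℝ) (r : ℝ≥0∞) (f : EuclideanSpace ℝ (Fin n) → ℂ) : Prop :=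
  AEStronglyMeasurable f volume ∧ bmlNorm p q t r f < ∞

/-! ### Block spaces

In this section the parameters `p q t r` play the role of the conjugate exponents. -/

/-- `b` is a `(p, q, t)`-block supported on the dyadic cube with index `i`:
`‖b‖_{L^{p,q}} ≤ |Q|^{1/p - 1/t}`. -/
def IsBlock {n : ℕ} (p q t : ℝ) (i : DyadicIndex n) (b : EuclideanSpace ℝ (Fin n) → ℂ) : Prop :=
  AEStronglyMeasurable b volume ∧ (∀ x, x ∉ dyadicCube i → b x = 0) ∧
    lorentzNorm p q volume b ≤ volume (dyadicCube i) ^ (1 / p - 1 / t)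

/-- `f = ∑ λ_{j,k} b_{j,k}` with convergence in `L¹_loc`, each `b_{j,k}` being a block supported on
the dyadic cube `Q_{j,k}`. -/
def IsBlockDecomposition {n : ℕ} (p q t : ℝ) (f : EuclideanSpace ℝ (Fin n) → ℂ)
    (lam : DyadicIndex n → ℂ) (b : DyadicIndex n → EuclideanSpace ℝ (Fin n) → ℂ) : Prop :=
  (∀ i, IsBlock p q t i (b i)) ∧
    ∀ S : Set (EuclideanSpace ℝ (Fin n)), IsCompact S →
      Tendsto (fun s : Finset (DyadicIndex n) =>
        ∫⁻ x in S, ‖f x - ∑ i ∈ s, lam i * b i x‖ₑ) atTop (𝓝 0)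

/-- The norm of the block space `H^{t,r}_{p,q}(ℝⁿ)`: the infimum of `‖λ‖_{ℓ^r}` over all block
decompositions (it is `∞` if there is none). -/
def blockNorm {n : ℕ} (p q t : ℝ) (r : ℝ≥0∞) (f : EuclideanSpace ℝ (Fin n) → ℂ) : ℝ≥0∞ :=
  ⨅ (lam : DyadicIndex n → ℂ) (b : DyadicIndex n → EuclideanSpace ℝ (Fin n) → ℂ)
    (_ : IsBlockDecomposition p q t f lam b), seqNorm r fun i => ‖lam i‖ₑ

/-- Membership in the block space: `f` is measurable and has a block decomposition with
coefficients in `ℓ^r`. -/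
def MemBlock {n : ℕ} (p q t : ℝ) (r : ℝ≥0∞) (f : EuclideanSpace ℝ (Fin n) → ℂ) : Prop :=
  AEStronglyMeasurable f volume ∧ blockNorm p q t r f < ∞

/-! ### Functions of bounded mean oscillation -/

/-- `‖b‖_BMO = sup_Q |Q|⁻¹ ∫_Q |b - b_Q|`, over all cubes `Q`. -/
def bmoNorm {n : ℕ} (b : EuclideanSpace ℝ (Fin n) → ℂ) : ℝ≥0∞ :=
  ⨆ (c : EuclideanSpace ℝ (Fin n)) (l : ℝ) (_ : 0 < l),
    (volume (cube c l))⁻¹ * ∫⁻ x in cube c l, ‖b x - ⨍ y in cube c l, b y‖ₑ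

def MemBMO {n : ℕ} (b : EuclideanSpace ℝ (Fin n) → ℂ) : Prop :=
  LocallyIntegrable b volume ∧ bmoNorm b < ∞

/-! ### Calderón–Zygmund operators -/

/-- Standard kernels with constants `δ, A > 0`; the values on the diagonal are irrelevant. -/
structure IsStandardKernel {n : ℕ} (δ A : ℝ)
    (K : EuclideanSpace ℝ (Fin n) → EuclideanSpace ℝ (Fin n) → ℂ) : Prop where
  delta_pos : 0 < δ
  const_pos : 0 < A
  size : ∀ x y, x ≠ y → ‖K x y‖ ≤ A / ‖x - y‖ ^ n
  regular_left : ∀ x x' y, x ≠ y → x' ≠ y → ‖x - x'‖ ≤ max ‖x - y‖ ‖x' - y‖ / 2 →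
    ‖K x y - K x' y‖ ≤ A * ‖x - x'‖ ^ δ / (‖x - y‖ + ‖x' - y‖) ^ ((n : ℝ) + δ)
  regular_right : ∀ x y y', x ≠ y → x ≠ y' → ‖y - y'‖ ≤ max ‖x - y‖ ‖x - y'‖ / 2 →
    ‖K x y - K x y'‖ ≤ A * ‖y - y'‖ ^ δ / (‖x - y‖ + ‖x - y'‖) ^ ((n : ℝ) + δ)

/-- `S` is a bounded extension to `L²(ℝⁿ)` of the operator `T : 𝓢 → 𝓢'`. -/
def IsL2Extension {n : ℕ}
    (T : 𝓢(EuclideanSpace ℝ (Fin n), ℂ) →L[ℂ] 𝓢'(EuclideanSpace ℝ (Fin n), ℂ))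
    (S : Lp ℂ 2 (volume : Measure (EuclideanSpace ℝ (Fin n))) →L[ℂ]
      Lp ℂ 2 (volume : Measure (EuclideanSpace ℝ (Fin n)))) : Prop :=
  ∀ f : 𝓢(EuclideanSpace ℝ (Fin n), ℂ),
    Lp.toTemperedDistribution (S (f.toLp 2 volume)) = T f

open Classical in
/-- The bounded extension of `T` to `L²(ℝⁿ)` if there is one (it is then unique), and `0` if there
is none. -/
def l2Extension {n : ℕ}
    (T : 𝓢(EuclideanSpace ℝ (Fin n), ℂ) →L[ℂ] 𝓢'(EuclideanSpace ℝ (Fin n), ℂ)) :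
    Lp ℂ 2 (volume : Measure (EuclideanSpace ℝ (Fin n))) →L[ℂ]
      Lp ℂ 2 (volume : Measure (EuclideanSpace ℝ (Fin n))) :=
  if h : ∃ S, IsL2Extension T S then h.choose else 0

/-- `T : 𝓢 → 𝓢'` is a Calderón–Zygmund operator associated with the standard kernel `K`: it has a
bounded extension to `L²`, and `T f (x) = ∫ K(x,y) f(y) dy` for `f ∈ C_c^∞` and (almost all) `x`
outside the support of `f`. -/
structure IsCalderonZygmund {n : ℕ} (δ A : ℝ)
    (K : EuclideanSpace ℝ (Fin n) → EuclideanSpace ℝ (Fin n) → ℂ)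
    (T : 𝓢(EuclideanSpace ℝ (Fin n), ℂ) →L[ℂ] 𝓢'(EuclideanSpace ℝ (Fin n), ℂ)) : Prop where
  kernel : IsStandardKernel δ A K
  bounded : ∃ S, IsL2Extension T S
  repr : ∀ f : 𝓢(EuclideanSpace ℝ (Fin n), ℂ), HasCompactSupport f →
    ∀ᵐ x, x ∉ tsupport f → l2Extension T (f.toLp 2 volume) x = ∫ y, K x y * f y

/-- The transpose `S^*` of a bounded operator `S` on `L²` with respect to the bilinear pairing:
`∫ (S f) g = ∫ f (S^* g)`, see `integral_transpose`. -/
def transpose {n : ℕ}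
    (S : Lp ℂ 2 (volume : Measure (EuclideanSpace ℝ (Fin n))) →L[ℂ]
      Lp ℂ 2 (volume : Measure (EuclideanSpace ℝ (Fin n))))
    (g : Lp ℂ 2 (volume : Measure (EuclideanSpace ℝ (Fin n)))) :
    Lp ℂ 2 (volume : Measure (EuclideanSpace ℝ (Fin n))) :=
  star (ContinuousLinearMap.adjoint S (star g))

theorem integral_transpose {n : ℕ}
    (S : Lp ℂ 2 (volume : Measure (EuclideanSpace ℝ (Fin n))) →L[ℂ]
      Lp ℂ 2 (volume : Measure (EuclideanSpace ℝ (Fin n))))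
    (f g : Lp ℂ 2 (volume : Measure (EuclideanSpace ℝ (Fin n)))) :
    ∫ x, S f x * g x = ∫ x, f x * transpose S g x := by
  have h := ContinuousLinearMap.adjoint_inner_left S f (star g)
  rw [L2.inner_def, L2.inner_def] at h
  have h1 : ∫ x, f x * transpose S g x
      = ∫ x, inner ℂ ((ContinuousLinearMap.adjoint S (star g)) x) (f x) := by
    apply integral_congr_ae
    filter_upwards [Lp.coeFn_star (ContinuousLinearMap.adjoint S (star g))] with x hx
    simp only [transpose, hx, Pi.star_apply, RCLike.inner_apply, RCLike.star_def]
  have h2 : ∫ x, S f x * g x = ∫ x, inner ℂ ((star g : Lp ℂ 2 _) x) (S f x) := by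
    apply integral_congr_ae
    filter_upwards [Lp.coeFn_star g] with x hx
    simp [hx, RCLike.inner_apply]
  rw [h1, h2, h]

/-! ### Commutators -/

/-- Bounded functions with compact support. -/
def MemLcInfty {n : ℕ} (f : EuclideanSpace ℝ (Fin n) → ℂ) : Prop :=
  MemLp f ∞ volume ∧ HasCompactSupport f

open Classical in
/-- The class in `L²` of a square integrable function. -/
def toL2 {n : ℕ} (f : EuclideanSpace ℝ (Fin n) → ℂ) :
    Lp ℂ 2 (volume : Measure (EuclideanSpace ℝ (Fin n))) :=
  if h : MemLp f 2 volume then h.toLp f else 0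

/-- The commutator `[b, S] f = b S(f) - S(b f)` of an operator `S` on `L²`, for `f ∈ L_c^∞`
(both `f` and `b f` are square integrable if `b ∈ BMO`). -/
def commutator {n : ℕ}
    (S : Lp ℂ 2 (volume : Measure (EuclideanSpace ℝ (Fin n))) →
      Lp ℂ 2 (volume : Measure (EuclideanSpace ℝ (Fin n))))
    (b f : EuclideanSpace ℝ (Fin n) → ℂ) : EuclideanSpace ℝ (Fin n) → ℂ :=
  fun x => b x * S (toL2 f) x - S (toL2 fun y => b y * f y) x

/-- `k` is the value at `g` of the continuous extension of `[b, S]` from `L_c^∞` to the block space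
`H^{t,r}_{p,q}`: whenever `g_j ∈ L_c^∞` tends to `g` in the block space, `[b, S] g_j` tends to
`k`. -/
def IsBlockCommutator {n : ℕ} (p q t : ℝ) (r : ℝ≥0∞)
    (S : Lp ℂ 2 (volume : Measure (EuclideanSpace ℝ (Fin n))) →
      Lp ℂ 2 (volume : Measure (EuclideanSpace ℝ (Fin n))))
    (b g k : EuclideanSpace ℝ (Fin n) → ℂ) : Prop :=
  MemBlock p q t r g ∧ MemBlock p q t r k ∧
    ∀ u : ℕ → EuclideanSpace ℝ (Fin n) → ℂ, (∀ j, MemLcInfty (u j)) →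
      Tendsto (fun j => blockNorm p q t r (u j - g)) atTop (𝓝 0) →
      Tendsto (fun j => blockNorm p q t r (commutator S b (u j) - k)) atTop (𝓝 0)

/-- `h = [b, T] f` in `M^{t,r}_{p,q}(ℝⁿ)`, defined by duality with the block space:
`∫ h g = - ∫ f [b, T^*] g` for all `g ∈ H^{t',r'}_{p',q'}(ℝⁿ)`. -/
def IsCommutator {n : ℕ} (p q t : ℝ) (r : ℝ≥0∞)
    (T : 𝓢(EuclideanSpace ℝ (Fin n), ℂ) →L[ℂ] 𝓢'(EuclideanSpace ℝ (Fin n), ℂ))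
    (b f h : EuclideanSpace ℝ (Fin n) → ℂ) : Prop :=
  MemBML p q t r f ∧ MemBML p q t r h ∧
    ∀ g, MemBlock p.conjExponent q.conjExponent t.conjExponent r.conjExponent g →
      ∃ k, IsBlockCommutator p.conjExponent q.conjExponent t.conjExponent r.conjExponent
          (transpose (l2Extension T)) b g k ∧
        Integrable (fun x => h x * g x) volume ∧ Integrable (fun x => f x * k x) volume ∧
        ∫ x, h x * g x = -∫ x, f x * k x

end BourgainMorreyLorentz

end

/-! The commutator on the Bourgain–Morrey–Lorentz space is, up to sign, the dual of the commutator
of the transpose on the block space, so the core is an estimate of commutators on single blocks that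
is summable over dyadic cubes. Lorentz quasi-norms are replaced throughout by the comparable sums
`lorSum` over the levels 2^k of the distribution function; Hölder's inequality, its converse and
Minkowski's inequality are derived for these.

Local theory. The mean oscillation of Sf on a cube is at most a geometrically weighted sum of L^s
averages of f over tripled ancestors (`exists_osc_le`), as soon as S satisfies a local bound from
L^s to L¹. A local Fefferman–Stein inequality, proved by good λ (`exists_fefferman_stein`), and the
maximal theorem turn this into Lorentz bounds for all p > s. The L² bound starts with s = 2; applied
to the transpose and dualized, the result for p > 2 gives every s in (1,2) (`locType_of_lt_two`), so
that no weak type (1,1) bound of S is needed. For the commutator, [b,S] = [b - c,S] with c a mean of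
b and the John–Nirenberg inequality bound the oscillation of [b,S]g by M_s(Sg) + M_{s²}g. Far from
the support the size of the kernel suffices. The outcome is `exists_lorN_commutator_shell_le`: if g
lives on Q, then on the k-th shell around Q the L^{p,q} norm of [b,S]g is at most
C(1+k)2^{-kn(1-1/p)} times that of g.

Block space. Applied with the conjugate exponents, this turns a block on Q into a superposition of
multiples of blocks on neighbours of ancestors of Q, with coefficients of size (1+k)2^{-kn/t}. A
cube arises in this way from at most 2^{kn} cubes of the k-th later generation, which costs 2^{kn/r}
in ℓ^{r'}; the series converges because t < r (`exists_sn_shell_le`). Elements of the block space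
are sums of bounded pieces (`exists_decomposition`), so the commutator can be applied termwise. The
result does not depend on the decomposition, since pairings with test functions determine it
(`integral_commutator_transpose`).

Morrey side. `IsWeakCommutator` demands the duality relation only for test functions in L_c^∞. A
solution h is built on unit cubes by summing [b,S] over bounded pieces of f on shells, and is glued.
Testing it against a family of nearly norming functions, one per cube, gives the a priori bound
`exists_mN_le_of_isWeakCommutator`. For functions with finite norm the weak relation is equivalent
to the relation with the whole block space, which yields existence, uniqueness, linearity and
boundedness. -/

open scoped NNReal

noncomputable section

namespace BourgainMorreyLorentz

/-! ### Powers of two and geometric sums -/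

/-- `2 ^ x` as an extended nonnegative real. -/
def tp (x : ℝ) : ℝ≥0∞ := (2 : ℝ≥0∞) ^ x

lemma tp_ne_zero (x : ℝ) : tp x ≠ 0 := by
  simp [tp, ENNReal.rpow_eq_zero_iff]

lemma tp_ne_top (x : ℝ) : tp x ≠ ∞ := by
  simp [tp, ENNReal.rpow_eq_top_iff]

@[simp] lemma tp_zero : tp 0 = 1 := by simp [tp]

@[simp] lemma tp_one : tp 1 = 2 := by simp [tp]

lemma tp_add (x y : ℝ) : tp (x + y) = tp x * tp y :=
  ENNReal.rpow_add x y (by simp) (by simp)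

lemma tp_rpow (x y : ℝ) : tp x ^ y = tp (x * y) := (ENNReal.rpow_mul 2 x y).symm

lemma tp_le_tp {x y : ℝ} (h : x ≤ y) : tp x ≤ tp y :=
  ENNReal.rpow_le_rpow_of_exponent_le (by norm_num) h

lemma tp_lt_tp {x y : ℝ} (h : x < y) : tp x < tp y :=
  ENNReal.rpow_lt_rpow_of_exponent_lt (by norm_num) (by simp) h

lemma tp_mul_tp_neg (x : ℝ) : tp x * tp (-x) = 1 := by
  rw [← tp_add]; simp

lemma tp_inv (x : ℝ) : (tp x)⁻¹ = tp (-x) := (ENNReal.rpow_neg 2 x).symm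

lemma tp_nat (k : ℕ) : tp k = (2 : ℝ≥0∞) ^ k := by simp [tp]

lemma tp_int (k : ℤ) : tp k = (2 : ℝ≥0∞) ^ k := by simp [tp]

lemma tp_eq_ofReal (x : ℝ) : tp x = ENNReal.ofReal (2 ^ x) := by
  rw [tp, ← ENNReal.ofReal_rpow_of_pos (by norm_num)]; simp

lemma tp_mul_nat (x : ℝ) (k : ℕ) : tp (x * k) = tp x ^ k := by
  rw [← tp_rpow]; simp

/-- The value of `tp` as a nonnegative real. -/
def tpn (x : ℝ) : ℝ≥0 := (tp x).toNNReal

@[simp] lemma coe_tpn (x : ℝ) : (tpn x : ℝ≥0∞) = tp x := ENNReal.coe_toNNReal (tp_ne_top x)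

lemma exists_geom {ε : ℝ} (hε : 0 < ε) : ∃ C : ℝ≥0, ∑' i : ℕ, tp (-(ε * i)) = C := by
  have h : ∑' i : ℕ, tp (-(ε * i)) = (1 - tp (-ε))⁻¹ := by
    rw [← ENNReal.tsum_geometric]
    congr 1; ext i
    rw [← tp_mul_nat]; congr 1; ring
  have h2 : ∑' i : ℕ, tp (-(ε * i)) ≠ ∞ := by
    rw [h]
    have : tp (-ε) < 1 := by
      rw [← tp_zero]; exact tp_lt_tp (by linarith)
    exact ENNReal.inv_ne_top.2 (tsub_pos_of_lt this).ne'
  exact ⟨(∑' i : ℕ, tp (-(ε * i))).toNNReal, (ENNReal.coe_toNNReal h2).symm⟩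

lemma exists_tp_lt_le {y : ℝ≥0∞} (h0 : y ≠ 0) (ht : y ≠ ∞) :
    ∃ k : ℤ, tp k < y ∧ y ≤ tp (k + 1) := by
  obtain ⟨k, hk1, hk2⟩ := ENNReal.exists_mem_Ioc_zpow h0 ht (y := 2) (by norm_num) (by simp)
  refine ⟨k, by rwa [tp_int], ?_⟩
  rw [show ((k : ℝ) + 1) = ((k + 1 : ℤ) : ℝ) by push_cast; ring, tp_int]; exact hk2

lemma exists_lt_tp {y : ℝ≥0∞} (ht : y ≠ ∞) : ∃ k : ℕ, y < tp k := by
  obtain ⟨k, hk⟩ := ENNReal.exists_nat_gt ht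
  refine ⟨k, hk.trans_le ?_⟩
  rw [tp_nat]; exact_mod_cast k.lt_two_pow_self.le

lemma rpow_sup_le_tsum {ι : Type*} {q : ℝ} (hq : 0 < q) (a : ι → ℝ≥0∞) :
    (⨆ i, a i) ^ q ≤ ∑' i, a i ^ q := by
  have h : ⨆ i, a i ≤ (∑' i, a i ^ q) ^ (1 / q) := by
    refine iSup_le fun i => ?_
    calc a i = (a i ^ q) ^ (1 / q) := by
          rw [← ENNReal.rpow_mul, mul_one_div_cancel hq.ne', ENNReal.rpow_one]
      _ ≤ _ := ENNReal.rpow_le_rpow (ENNReal.le_tsum i) (by positivity)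
  calc (⨆ i, a i) ^ q ≤ ((∑' i, a i ^ q) ^ (1 / q)) ^ q := ENNReal.rpow_le_rpow h hq.le
    _ = _ := by rw [← ENNReal.rpow_mul, one_div_mul_cancel hq.ne', ENNReal.rpow_one]

/-- A geometrically weighted sum is controlled in `ℓ^q` sense, for every `q > 0`. -/
lemma exists_geom_rpow {ε q : ℝ} (hε : 0 < ε) (hq : 0 < q) : ∃ C : ℝ≥0, ∀ a : ℕ → ℝ≥0∞,
    (∑' j : ℕ, tp (-(ε * j)) * a j) ^ q ≤ C * ∑' j : ℕ, tp (-(ε / 2 * q * j)) * a j ^ q := by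
  obtain ⟨C, hC⟩ := exists_geom (ε := ε / 2) (by positivity)
  refine ⟨C ^ q, fun a => ?_⟩
  -- Half of the exponential weight makes the series converge. The other half stays inside a
  -- supremum, which is dominated by an ℓ^q sum even when q < 1.
  have h1 : ∑' j : ℕ, tp (-(ε * j)) * a j ≤ C * ⨆ j : ℕ, tp (-(ε / 2 * j)) * a j := by
    rw [← hC, ← ENNReal.tsum_mul_right]
    refine ENNReal.tsum_le_tsum fun j => ?_
    rw [show -(ε * j) = -(ε / 2 * j) + -(ε / 2 * j) by ring, tp_add, mul_assoc]
    gcongr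
    exact le_iSup (fun j : ℕ => tp (-(ε / 2 * j)) * a j) j
  calc _ ≤ (C * ⨆ j : ℕ, tp (-(ε / 2 * j)) * a j) ^ q := ENNReal.rpow_le_rpow h1 hq.le
    _ = (C : ℝ≥0∞) ^ q * (⨆ j : ℕ, tp (-(ε / 2 * j)) * a j) ^ q := by
        rw [ENNReal.mul_rpow_of_nonneg _ _ hq.le]
    _ ≤ _ := by
        rw [ENNReal.coe_rpow_of_nonneg _ hq.le]
        gcongr
        refine (rpow_sup_le_tsum hq _).trans (le_of_eq ?_)
        congr 1; ext j
        rw [ENNReal.mul_rpow_of_nonneg _ _ hq.le, tp_rpow]; congr 2; ring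

/-- A discrete Young inequality valid for all q > 0: once the q-th power has been moved inside by
`exists_geom_rpow`, only translation invariance of the sum over ℤ is needed. -/
lemma exists_conv {ε q : ℝ} (hε : 0 < ε) (hq : 0 < q) : ∃ C : ℝ≥0, ∀ φ : ℤ → ℝ≥0∞,
    ∑' k : ℤ, (∑' j : ℕ, tp (-(ε * j)) * φ (k + j)) ^ q ≤ C * ∑' k, φ k ^ q := by
  obtain ⟨C, hC⟩ := exists_geom_rpow hε hq
  obtain ⟨D, hD⟩ := exists_geom (ε := ε / 2 * q) (by positivity)
  refine ⟨C * D, fun φ => ?_⟩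
  calc _ ≤ ∑' k : ℤ, C * ∑' j : ℕ, tp (-(ε / 2 * q * j)) * φ (k + j) ^ q :=
        ENNReal.tsum_le_tsum fun k => hC _
    _ = C * ∑' j : ℕ, tp (-(ε / 2 * q * j)) * ∑' k : ℤ, φ (k + j) ^ q := by
        rw [ENNReal.tsum_mul_left, ENNReal.tsum_comm]
        simp_rw [ENNReal.tsum_mul_left]
    _ = C * ∑' j : ℕ, tp (-(ε / 2 * q * j)) * ∑' k : ℤ, φ k ^ q := by
        congr 2; ext j; congr 1
        exact (Equiv.addRight (j : ℤ)).tsum_eq (fun k => φ k ^ q)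
    _ = _ := by
        rw [ENNReal.tsum_mul_right, hD]; push_cast; ring

lemma exists_conv_neg {ε q : ℝ} (hε : 0 < ε) (hq : 0 < q) : ∃ C : ℝ≥0, ∀ φ : ℤ → ℝ≥0∞,
    ∑' k : ℤ, (∑' j : ℕ, tp (-(ε * j)) * φ (k - j)) ^ q ≤ C * ∑' k, φ k ^ q := by
  obtain ⟨C, hC⟩ := exists_conv hε hq
  refine ⟨C, fun φ => ?_⟩
  have := hC (fun k => φ (-k))
  rw [show ∑' k : ℤ, φ (-k) ^ q = ∑' k, φ k ^ q from
    (Equiv.neg ℤ).tsum_eq (fun k => φ k ^ q)] at this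
  refine le_trans (le_of_eq ?_) this
  rw [← (Equiv.neg ℤ).tsum_eq]
  simp only [Equiv.neg_apply, neg_add_rev]
  congr 1; ext k; congr 2; ext j; congr 2; ring

/-- Sum over the integers `k ≤ K`. -/
lemma tsum_int_le (K : ℤ) (a : ℤ → ℝ≥0∞) :
    ∑' k : ℤ, (if k ≤ K then a k else 0) = ∑' j : ℕ, a (K - j) := by
  have hinj : Function.Injective (fun j : ℕ => K - (j : ℤ)) := by
    intro i j h; simpa using h
  have := hinj.tsum_eq (f := fun k => if k ≤ K then a k else 0) (by
    intro k hk
    have : k ≤ K := by by_contra h; simp [h] at hk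
    exact ⟨(K - k).toNat, by simp; omega⟩)
  rw [← this]
  congr 1; ext j; simp

lemma tsum_int_ge (K : ℤ) (a : ℤ → ℝ≥0∞) :
    ∑' k : ℤ, (if K ≤ k then a k else 0) = ∑' j : ℕ, a (K + j) := by
  have hinj : Function.Injective (fun j : ℕ => K + (j : ℤ)) := by
    intro i j h; simpa using h
  have := hinj.tsum_eq (f := fun k => if K ≤ k then a k else 0) (by
    intro k hk
    have : K ≤ k := by by_contra h; simp [h] at hk
    exact ⟨(k - K).toNat, by simp; omega⟩)
  rw [← this]
  congr 1; ext j; simp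

lemma exists_tsum_tp_le {q : ℝ} (hq : 0 < q) : ∃ C : ℝ≥0, ∀ K : ℤ,
    ∑' k : ℤ, (if k ≤ K then tp (k * q) else 0) = C * tp (K * q) := by
  obtain ⟨C, hC⟩ := exists_geom hq
  refine ⟨C, fun K => ?_⟩
  rw [tsum_int_le K (fun k => tp (k * q)), ← hC, ← ENNReal.tsum_mul_right]
  congr 1; ext j
  rw [← tp_add]; congr 1; push_cast; ring

/-- With `exists_tsum_le_rpow` this is the layer-cake formula over powers of two: the sum is
geometric and dominated by its last term. The strict inequality here and the weak one there match
the two one-sided relations between a function's levels and its rearrangement. -/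
lemma exists_rpow_le_tsum {q : ℝ} (hq : 0 < q) : ∃ C : ℝ≥0, ∀ y : ℝ≥0∞,
    y ^ q ≤ C * ∑' k : ℤ, (if tp k < y then tp (k * q) else 0) := by
  refine ⟨tpn q, fun y => ?_⟩
  rcases eq_or_ne y 0 with rfl | h0
  · simp [hq]
  rcases eq_or_ne y ∞ with rfl | ht
  · have : ∑' k : ℤ, (if tp k < ∞ then tp (k * q) else 0) = ∞ := by
      have hinj : Function.Injective (fun j : ℕ => (j : ℤ)) := Nat.cast_injective
      refine top_le_iff.1 ?_
      calc ∞ = ∑' _ : ℕ, (1 : ℝ≥0∞) := (ENNReal.tsum_const_eq_top_of_ne_zero one_ne_zero).symm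
        _ ≤ ∑' j : ℕ, (if tp (j : ℤ) < ∞ then tp ((j : ℤ) * q) else 0) := by
          refine ENNReal.tsum_le_tsum fun j => ?_
          rw [if_pos (tp_ne_top _).lt_top, ← tp_zero]
          apply tp_le_tp; push_cast; positivity
        _ ≤ _ := ENNReal.tsum_comp_le_tsum_of_injective hinj _
    rw [this, ENNReal.mul_top (by simp [tp_ne_zero])]; exact le_top
  obtain ⟨k, hk1, hk2⟩ := exists_tp_lt_le h0 ht
  calc y ^ q ≤ tp (k + 1) ^ q := ENNReal.rpow_le_rpow hk2 hq.le
    _ = tpn q * (if tp k < y then tp (k * q) else 0) := by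
        rw [if_pos hk1, tp_rpow, coe_tpn, ← tp_add]; congr 1; ring
    _ ≤ _ := by gcongr; exact ENNReal.le_tsum (f := fun k : ℤ => if tp k < y then tp (k * q) else 0) k

lemma exists_tsum_le_rpow {q : ℝ} (hq : 0 < q) : ∃ C : ℝ≥0, ∀ y : ℝ≥0∞,
    ∑' k : ℤ, (if tp k ≤ y then tp (k * q) else 0) ≤ C * y ^ q := by
  obtain ⟨C, hC⟩ := exists_tsum_tp_le hq
  -- The summand 1 keeps the constant nonzero, which matters at y = ∞.
  refine ⟨C * tpn q + 1, fun y => ?_⟩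
  rcases eq_or_ne y 0 with rfl | h0
  · simp [tp_ne_zero]
  rcases eq_or_ne y ∞ with rfl | ht
  · simp [hq]
  obtain ⟨K, hK1, hK2⟩ := exists_tp_lt_le h0 ht
  calc _ ≤ ∑' k : ℤ, (if k ≤ K + 1 then tp (k * q) else 0) := by
        refine ENNReal.tsum_le_tsum fun k => ?_
        by_cases h : tp k ≤ y
        · have : k ≤ K + 1 := by
            by_contra h'
            have h2 : tp (K + 1) < tp k := tp_lt_tp (by exact_mod_cast not_le.1 h')
            exact absurd (h.trans hK2) (not_le.2 h2)
          simp [h, this]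
        · simp [h]
    _ = C * tpn q * tp K ^ q := by
        rw [hC, coe_tpn, tp_rpow, mul_assoc, ← tp_add]; congr 2; push_cast; ring
    _ ≤ C * tpn q * y ^ q := by gcongr
    _ ≤ _ := by push_cast; gcongr; exact le_self_add

/-! ### The discretized Lorentz quasi-norm -/

section Lorentz

variable {X : Type*} [MeasurableSpace X] {μ : Measure X} {p q : ℝ} {f g : X → ℝ≥0∞}

/-- The sum `∑ₖ (2^k μ{f > 2^k}^{1/p})^q`, comparable to the `q`-th power of the Lorentz norm. -/
def lorSum (p q : ℝ) (μ : Measure X) (f : X → ℝ≥0∞) : ℝ≥0∞ :=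
  ∑' k : ℤ, (tp k * μ {x | tp k < f x} ^ (1 / p)) ^ q

/-- The discretized Lorentz quasi-norm. -/
def lorN (p q : ℝ) (μ : Measure X) (f : X → ℝ≥0∞) : ℝ≥0∞ := lorSum p q μ f ^ (1 / q)

/-- The decreasing rearrangement of a nonnegative function. -/
def rearr (μ : Measure X) (f : X → ℝ≥0∞) (s : ℝ≥0∞) : ℝ≥0∞ := sInf {a : ℝ≥0∞ | μ {x | a < f x} ≤ s}

lemma rearr_antitone (μ : Measure X) (f : X → ℝ≥0∞) : Antitone (rearr μ f) := by
  intro s t h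
  exact sInf_le_sInf fun a ha => le_trans ha h

/-- The rearrangement and the distribution function are generalized inverses of each other. This
implication and the converse one in `le_rearr_of_lt`, which loses strictness, are all that is used.
-/
lemma lt_of_lt_rearr {a s : ℝ≥0∞} (h : a < rearr μ f s) : s < μ {x | a < f x} := by
  by_contra h'
  exact absurd (sInf_le (show a ∈ {a : ℝ≥0∞ | μ {x | a < f x} ≤ s} from not_lt.1 h')) (not_le.2 h)

lemma le_rearr_of_lt {a s : ℝ≥0∞} (h : s < μ {x | a < f x}) : a ≤ rearr μ f s := by
  refine le_sInf fun b hb => ?_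
  by_contra h'
  exact absurd (h.trans_le (measure_mono fun x hx => (not_le.1 h').trans hx)) (not_lt.2 hb)

/-- The integral in the definition of the Lorentz norm. -/
def lorI (p q : ℝ) (μ : Measure X) (f : X → ℝ≥0∞) : ℝ≥0∞ :=
  ∫⁻ s in Ioi (0 : ℝ), (ENNReal.ofReal (s ^ (1 / p)) * rearr μ f (ENNReal.ofReal s)) ^ q
      / ENNReal.ofReal s

lemma lorentzNorm_eq (p q : ℝ) (μ : Measure X) (f : X → ℂ) :
    lorentzNorm p q μ f = lorI p q μ (fun x => ‖f x‖ₑ) ^ (1 / q) := rfl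

lemma lorI_eq (hq : 0 < q) : lorI p q μ f =
    ∫⁻ s in Ioi (0 : ℝ), ENNReal.ofReal (s ^ (q / p - 1)) * rearr μ f (ENNReal.ofReal s) ^ q := by
  refine setLIntegral_congr_fun measurableSet_Ioi fun s hs => ?_
  have hs : (0 : ℝ) < s := hs
  rw [ENNReal.mul_rpow_of_nonneg _ _ hq.le, ENNReal.ofReal_rpow_of_nonneg (by positivity) hq.le,
    ← Real.rpow_mul hs.le, div_eq_mul_inv, mul_right_comm, ← ENNReal.ofReal_inv_of_pos hs,
    ← ENNReal.ofReal_mul (by positivity), Real.rpow_sub_one hs.ne']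
  congr 3
  rw [div_mul_eq_mul_div, one_mul]

lemma lintegral_rpow_indicator {θ : ℝ} (hθ : 0 < θ) (a : ℝ≥0∞) :
    ∫⁻ s in Ioi (0 : ℝ), (if ENNReal.ofReal s < a then ENNReal.ofReal (s ^ (θ - 1)) else 0)
      = ENNReal.ofReal (1 / θ) * a ^ θ := by
  have key : ∀ b : ℝ, 0 ≤ b → ∫⁻ s in Ioi (0 : ℝ),
      (if ENNReal.ofReal s < ENNReal.ofReal b then ENNReal.ofReal (s ^ (θ - 1)) else 0)
      = ENNReal.ofReal (1 / θ) * ENNReal.ofReal b ^ θ := by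
    intro b hb
    have h1 : ∫⁻ s in Ioi (0 : ℝ),
      (if ENNReal.ofReal s < ENNReal.ofReal b then ENNReal.ofReal (s ^ (θ - 1)) else 0)
        = ∫⁻ s in Ioo 0 b, ENNReal.ofReal (s ^ (θ - 1)) := by
      rw [← lintegral_indicator measurableSet_Ioi, ← lintegral_indicator measurableSet_Ioo]
      congr 1; ext s
      by_cases hs : 0 < s
      · by_cases hsb : s < b
        · have : ENNReal.ofReal s < ENNReal.ofReal b :=
            (ENNReal.ofReal_lt_ofReal_iff (hs.trans hsb)).2 hsb
          simp [indicator, hs, hsb, this]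
        · have : ¬ ENNReal.ofReal s < ENNReal.ofReal b :=
            not_lt.2 (ENNReal.ofReal_le_ofReal (not_lt.1 hsb))
          simp only [indicator, hs, hsb, this, mem_Ioi, mem_Ioo, if_true, if_false, and_false]
      · simp [indicator, hs]
    have hint : IntegrableOn (fun s : ℝ => s ^ (θ - 1)) (Ioo 0 b) := by
      have := intervalIntegral.intervalIntegrable_rpow' (a := 0) (b := b) (r := θ - 1) (by linarith)
      rw [intervalIntegrable_iff_integrableOn_Ioo_of_le hb] at this
      exact this
    rw [h1, ← ofReal_integral_eq_lintegral_ofReal hint, ← integral_Ioc_eq_integral_Ioo,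
      ← intervalIntegral.integral_of_le hb, integral_rpow (Or.inl (by linarith)),
      ENNReal.ofReal_rpow_of_nonneg hb hθ.le, ← ENNReal.ofReal_mul (by positivity)]
    · congr 1
      rw [sub_add_cancel, Real.zero_rpow hθ.ne']; ring
    · filter_upwards [ae_restrict_mem measurableSet_Ioo] with s hs
      have := hs.1.le
      positivity
  rcases eq_or_ne a ∞ with rfl | ha
  · rw [ENNReal.top_rpow_of_pos hθ, ENNReal.mul_top (by simpa using hθ)]
    refine (ENNReal.eq_top_of_forall_nnreal_le fun r => ?_)
    -- The integral up to b equals the prescribed number r, so the full integral exceeds every real.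
    set b : ℝ := (θ * r) ^ (1 / θ) with hb
    have h := key b (by positivity)
    have h2 : ENNReal.ofReal (1 / θ) * ENNReal.ofReal b ^ θ = r := by
      rw [ENNReal.ofReal_rpow_of_nonneg (by positivity) hθ.le, ← ENNReal.ofReal_mul (by positivity),
        hb, ← Real.rpow_mul (by positivity), one_div_mul_cancel hθ.ne', Real.rpow_one]
      rw [show 1 / θ * (θ * (r : ℝ)) = r by field_simp]; simp
    rw [← h2, ← h]
    refine lintegral_mono fun s => ?_
    simp only [ENNReal.ofReal_lt_top, if_true]
    split_ifs <;> simp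
  · have := key a.toReal ENNReal.toReal_nonneg
    rwa [ENNReal.ofReal_toReal ha] at this

/-- Each power μ{f > 2^k}^{q/p} is written as an integral of s^{q/p-1} over s < μ{f > 2^k}, and
Tonelli exchanges sum and integral. The inner sum is then comparable to f*(s)^q. -/
lemma lorSum_eq (hq : 0 < q) (hp : 0 < p) : lorSum p q μ f = ENNReal.ofReal (q / p) *
    ∫⁻ s in Ioi (0 : ℝ), ENNReal.ofReal (s ^ (q / p - 1)) *
      ∑' k : ℤ, (if ENNReal.ofReal s < μ {x | tp k < f x} then tp (k * q) else 0) := by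
  have hθ : 0 < q / p := by positivity
  have h1 : ∀ k : ℤ, (tp k * μ {x | tp k < f x} ^ (1 / p)) ^ q = ENNReal.ofReal (q / p) *
      ∫⁻ s in Ioi (0 : ℝ), tp (k * q) *
      (if ENNReal.ofReal s < μ {x | tp k < f x} then ENNReal.ofReal (s ^ (q / p - 1)) else 0) := by
    intro k
    rw [lintegral_const_mul' _ _ (tp_ne_top _), lintegral_rpow_indicator hθ,
      ENNReal.mul_rpow_of_nonneg _ _ hq.le, tp_rpow, ← ENNReal.rpow_mul, ← mul_assoc, ← mul_assoc,
      mul_comm (ENNReal.ofReal (q / p)), mul_assoc (tp _), ← ENNReal.ofReal_mul (by positivity),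
      mul_one_div_cancel hθ.ne', ENNReal.ofReal_one, mul_one]
    congr 2; ring
  rw [lorSum]
  simp_rw [h1]
  rw [ENNReal.tsum_mul_left, ← lintegral_tsum]
  · congr 2; ext s
    rw [← ENNReal.tsum_mul_left]
    congr 1; ext k
    split_ifs <;> simp [mul_comm]
  · intro k
    refine (Measurable.const_mul (Measurable.ite ?_ (by fun_prop) measurable_const) _).aemeasurable
    exact measurableSet_lt ENNReal.measurable_ofReal measurable_const

lemma exists_lorI_le (hp : 0 < p) (hq : 0 < q) : ∃ C : ℝ≥0, ∀ {X : Type*} [MeasurableSpace X]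
    (μ : Measure X) (f : X → ℝ≥0∞), lorI p q μ f ≤ C * lorSum p q μ f := by
  obtain ⟨C, hC⟩ := exists_rpow_le_tsum hq
  have hθ : 0 < q / p := by positivity
  refine ⟨C * (q / p).toNNReal⁻¹, fun μ f => ?_⟩
  have e : ((q / p).toNNReal⁻¹ : ℝ≥0) * ENNReal.ofReal (q / p) = 1 := by
    rw [ENNReal.ofReal, ← ENNReal.coe_mul, inv_mul_cancel₀ (by simpa using hθ)]; simp
  rw [lorSum_eq hq hp, lorI_eq hq, ENNReal.coe_mul, mul_assoc, ← mul_assoc (((q / p).toNNReal⁻¹ : ℝ≥0) : ℝ≥0∞),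
    e, one_mul, ← lintegral_const_mul' _ _ ENNReal.coe_ne_top]
  refine lintegral_mono fun s => ?_
  rw [mul_left_comm]
  gcongr
  refine (hC _).trans ?_
  gcongr with k
  split_ifs with h1 h2 h2
  · exact le_rfl
  · exact absurd (lt_of_lt_rearr h1) h2
  · exact zero_le
  · exact le_rfl

lemma exists_lorSum_le (hp : 0 < p) (hq : 0 < q) : ∃ C : ℝ≥0, ∀ {X : Type*} [MeasurableSpace X]
    (μ : Measure X) (f : X → ℝ≥0∞), lorSum p q μ f ≤ C * lorI p q μ f := by
  obtain ⟨C, hC⟩ := exists_tsum_le_rpow hq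
  refine ⟨(q / p).toNNReal * C, fun μ f => ?_⟩
  rw [lorSum_eq hq hp, lorI_eq hq, ENNReal.coe_mul, mul_assoc,
    ← lintegral_const_mul' _ _ ENNReal.coe_ne_top]
  refine mul_le_mul' le_rfl (lintegral_mono fun s => ?_)
  simp only
  rw [mul_left_comm]
  gcongr
  refine le_trans ?_ (hC _)
  gcongr with k
  split_ifs with h1 h2 h2
  · exact le_rfl
  · exact absurd (le_rearr_of_lt h1) h2
  · exact zero_le
  · exact le_rfl

lemma exists_lorentzNorm_le (hp : 0 < p) (hq : 0 < q) : ∃ C : ℝ≥0, ∀ {X : Type*}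
    [MeasurableSpace X] (μ : Measure X) (f : X → ℂ),
    lorentzNorm p q μ f ≤ C * lorN p q μ (fun x => ‖f x‖ₑ) := by
  obtain ⟨C, hC⟩ := exists_lorI_le hp hq
  refine ⟨C ^ (1 / q), fun μ f => ?_⟩
  rw [lorentzNorm_eq, lorN, ENNReal.coe_rpow_of_nonneg _ (by positivity),
    ← ENNReal.mul_rpow_of_nonneg _ _ (by positivity)]
  exact ENNReal.rpow_le_rpow (hC _ _) (by positivity)

lemma exists_lorN_le (hp : 0 < p) (hq : 0 < q) : ∃ C : ℝ≥0, ∀ {X : Type*}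
    [MeasurableSpace X] (μ : Measure X) (f : X → ℂ),
    lorN p q μ (fun x => ‖f x‖ₑ) ≤ C * lorentzNorm p q μ f := by
  obtain ⟨C, hC⟩ := exists_lorSum_le hp hq
  refine ⟨C ^ (1 / q), fun μ f => ?_⟩
  rw [lorentzNorm_eq, lorN, ENNReal.coe_rpow_of_nonneg _ (by positivity),
    ← ENNReal.mul_rpow_of_nonneg _ _ (by positivity)]
  exact ENNReal.rpow_le_rpow (hC _ _) (by positivity)

/-! ### Elementary properties -/

lemma lorSum_mono_meas {ν : Measure X} (hq : 0 < q) (hp : 0 < p)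
    (h : ∀ k : ℤ, μ {x | tp k < f x} ≤ ν {x | tp k < g x}) : lorSum p q μ f ≤ lorSum p q ν g :=
  ENNReal.tsum_le_tsum fun k => ENNReal.rpow_le_rpow
    (mul_le_mul' le_rfl (ENNReal.rpow_le_rpow (h k) (by positivity))) hq.le

lemma lorN_mono_meas {ν : Measure X} (hq : 0 < q) (hp : 0 < p)
    (h : ∀ k : ℤ, μ {x | tp k < f x} ≤ ν {x | tp k < g x}) : lorN p q μ f ≤ lorN p q ν g :=
  ENNReal.rpow_le_rpow (lorSum_mono_meas hq hp h) (by positivity)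

lemma lorN_mono_ae (hq : 0 < q) (hp : 0 < p) (h : ∀ᵐ x ∂μ, f x ≤ g x) :
    lorN p q μ f ≤ lorN p q μ g :=
  lorN_mono_meas hq hp fun k => measure_mono_ae (by
    filter_upwards [h] with x hx h2 using lt_of_lt_of_le h2 hx)

lemma lorN_mono (hq : 0 < q) (hp : 0 < p) (h : ∀ x, f x ≤ g x) : lorN p q μ f ≤ lorN p q μ g :=
  lorN_mono_ae hq hp (Eventually.of_forall h)

lemma lorN_congr_ae (h : f =ᵐ[μ] g) : lorN p q μ f = lorN p q μ g := by
  have : ∀ k : ℤ, μ {x | tp k < f x} = μ {x | tp k < g x} := fun k => measure_congr (by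
    filter_upwards [h] with x hx
    exact propext (by change tp k < f x ↔ tp k < g x; rw [hx]))
  simp only [lorN, lorSum, this]

lemma lorN_mono_measure {ν : Measure X} (hq : 0 < q) (hp : 0 < p) (h : μ ≤ ν) :
    lorN p q μ f ≤ lorN p q ν f := lorN_mono_meas hq hp fun _ => h _

lemma lorN_rpow (hq : 0 < q) : lorN p q μ f ^ q = lorSum p q μ f := by
  rw [lorN, ← ENNReal.rpow_mul, one_div_mul_cancel hq.ne', ENNReal.rpow_one]

lemma lorN_restrict {Q : Set X} (hQ : MeasurableSet Q) :
    lorN p q (μ.restrict Q) f = lorN p q μ (Q.indicator f) := by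
  have : ∀ k : ℤ, μ.restrict Q {x | tp k < f x} = μ {x | tp k < Q.indicator f x} := by
    intro k
    rw [Measure.restrict_apply' hQ]
    congr 1; ext x
    by_cases h : x ∈ Q <;> simp [h]
  simp only [lorN, lorSum, this]

lemma lorSum_tp_mul (j : ℤ) (hq : 0 < q) :
    lorSum p q μ (fun x => tp j * f x) = tp j ^ q * lorSum p q μ f := by
  rw [lorSum, lorSum, ← ENNReal.tsum_mul_left, ← (Equiv.addRight j).tsum_eq]
  congr 1; ext k
  simp only [Equiv.coe_addRight]
  rw [← ENNReal.mul_rpow_of_nonneg _ _ hq.le, ← mul_assoc]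
  congr 3
  · push_cast; rw [← tp_add]; congr 1; ring
  · congr 1; ext x; simp only [mem_ofPred_eq]
    push_cast
    rw [add_comm, tp_add, ENNReal.mul_lt_mul_iff_right (tp_ne_zero _) (tp_ne_top _)]

lemma lorN_tp_mul (j : ℤ) (hq : 0 < q) :
    lorN p q μ (fun x => tp j * f x) = tp j * lorN p q μ f := by
  rw [lorN, lorSum_tp_mul j hq, ENNReal.mul_rpow_of_nonneg _ _ (by positivity),
    ← ENNReal.rpow_mul, mul_one_div_cancel hq.ne', ENNReal.rpow_one, lorN]

lemma lorN_zero (hp : 0 < p) (hq : 0 < q) : lorN p q μ (fun _ => 0) = 0 := by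
  simp [lorN, lorSum, hp, hq]

/-- The discretized norm is exactly homogeneous only for powers of two, which shift the index of
summation. Rounding c up to such a power costs the factor 2. -/
lemma lorN_const_mul_le (hp : 0 < p) (hq : 0 < q) (c : ℝ≥0∞) (hc : c ≠ ∞) :
    lorN p q μ (fun x => c * f x) ≤ 2 * c * lorN p q μ f := by
  rcases eq_or_ne c 0 with rfl | h0
  · simp [lorN_zero hp hq]
  obtain ⟨k, hk1, hk2⟩ := exists_tp_lt_le h0 hc
  calc _ ≤ lorN p q μ (fun x => tp ((k + 1 : ℤ)) * f x) :=
        lorN_mono hq hp fun x => mul_le_mul' (hk2.trans (by push_cast; exact le_rfl)) le_rfl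
    _ = 2 * tp k * lorN p q μ f := by
        rw [lorN_tp_mul _ hq]; push_cast; rw [tp_add, tp_one]; ring
    _ ≤ _ := by gcongr

/-- Since {f + g > 2^{k+1}} is contained in {f > 2^k} ∪ {g > 2^k}, a shift of the index costs 2, the
doubled measure costs 2^{1/p}, and the sum of two q-th powers costs 2^{1/q}. -/
lemma exists_lorN_add_le (hp : 0 < p) (hq : 0 < q) : ∃ C : ℝ≥0, ∀ {X : Type*} [MeasurableSpace X]
    (μ : Measure X) (f g : X → ℝ≥0∞),
    lorN p q μ (fun x => f x + g x) ≤ C * (lorN p q μ f + lorN p q μ g) := by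
  refine ⟨(2 * 2 ^ (1 / p)) * 2 ^ (1 / q), fun {X} _ μ f g => ?_⟩
  set m : ℤ → ℝ≥0∞ := fun k => max (μ {x | tp k < f x}) (μ {x | tp k < g x}) with hm
  have h1 : ∀ k : ℤ, μ {x | tp (k + 1 : ℤ) < f x + g x} ≤ 2 * m k := by
    intro k
    refine (measure_mono (t := {x | tp k < f x} ∪ {x | tp k < g x}) ?_).trans
      ((measure_union_le _ _).trans ?_)
    · intro x hx
      by_contra h
      simp only [mem_union, mem_ofPred_eq, not_or, not_lt] at h
      have : f x + g x ≤ tp k + tp k := add_le_add h.1 h.2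
      simp only [mem_ofPred_eq] at hx
      push_cast at hx
      rw [tp_add, tp_one, mul_two] at hx
      exact absurd this (not_le.2 hx)
    · rw [two_mul]; exact add_le_add (le_max_left _ _) (le_max_right _ _)
  have h2 : lorSum p q μ (fun x => f x + g x) ≤
      (2 * 2 ^ (1 / p)) ^ q * (lorSum p q μ f + lorSum p q μ g) := by
    rw [lorSum, ← (Equiv.addRight (1 : ℤ)).tsum_eq, lorSum, lorSum, ← ENNReal.tsum_add,
      ← ENNReal.tsum_mul_left]
    refine ENNReal.tsum_le_tsum fun k => ?_
    simp only [Equiv.coe_addRight]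
    calc _ ≤ ((2 * 2 ^ (1 / p)) * (tp k * m k ^ (1 / p))) ^ q := by
          refine ENNReal.rpow_le_rpow ?_ hq.le
          calc _ ≤ tp (k + 1 : ℤ) * (2 * m k) ^ (1 / p) := by
                gcongr; exact h1 k
            _ = _ := by
                rw [ENNReal.mul_rpow_of_nonneg _ _ (by positivity)]; push_cast
                rw [tp_add, tp_one]; ring
      _ ≤ _ := by
          rw [ENNReal.mul_rpow_of_nonneg _ _ hq.le]
          gcongr
          simp only [hm]
          rcases le_total (μ {x | tp k < f x}) (μ {x | tp k < g x}) with h | h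
          · rw [max_eq_right h]; exact le_add_self
          · rw [max_eq_left h]; exact le_self_add
  calc _ ≤ ((2 * 2 ^ (1 / p)) ^ q * (lorSum p q μ f + lorSum p q μ g)) ^ (1 / q) :=
        ENNReal.rpow_le_rpow h2 (by positivity)
    _ ≤ (2 * 2 ^ (1 / p)) * (2 * max (lorSum p q μ f) (lorSum p q μ g)) ^ (1 / q) := by
        rw [ENNReal.mul_rpow_of_nonneg _ _ (by positivity), ← ENNReal.rpow_mul,
          mul_one_div_cancel hq.ne', ENNReal.rpow_one]
        refine mul_le_mul' le_rfl (ENNReal.rpow_le_rpow ((add_le_add (le_max_left _ _)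
          (le_max_right _ _)).trans_eq (two_mul _).symm) (by positivity))
    _ ≤ _ := by
        rw [ENNReal.mul_rpow_of_nonneg _ _ (by positivity)]
        push_cast
        rw [mul_assoc, ENNReal.coe_rpow_of_nonneg _ (by positivity),
          ENNReal.coe_rpow_of_nonneg _ (by positivity), mul_assoc, mul_assoc]
        push_cast
        gcongr
        rcases le_total (lorSum p q μ f) (lorSum p q μ g) with h | h
        · rw [max_eq_right h]; exact le_add_self
        · rw [max_eq_left h]; exact le_self_add

end Lorentz

/-! ### Duality of Lorentz spaces: Hölder's inequality. -/

section LorentzDuality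

variable {X : Type*} [MeasurableSpace X] {μ : Measure X} {p q p' q' : ℝ} {f g : X → ℝ≥0∞}

lemma ennreal_rpow_anti {x y : ℝ≥0∞} {z : ℝ} (hz : z ≤ 0) (h : x ≤ y) : y ^ z ≤ x ^ z := by
  rw [← neg_neg z, ENNReal.rpow_neg y, ENNReal.rpow_neg x]
  exact ENNReal.inv_le_inv.2 (ENNReal.rpow_le_rpow h (by linarith))

lemma exists_le_tsum_tp : ∃ C : ℝ≥0, ∀ y : ℝ≥0∞,
    y ≤ C * ∑' k : ℤ, (if tp k < y then tp k else 0) := by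
  obtain ⟨C, hC⟩ := exists_rpow_le_tsum (q := 1) one_pos
  exact ⟨C, fun y => by simpa using hC y⟩

lemma exists_tsum_tp_le' : ∃ C : ℝ≥0, ∀ y : ℝ≥0∞,
    ∑' k : ℤ, (if tp k ≤ y then tp k else 0) ≤ C * y := by
  obtain ⟨C, hC⟩ := exists_tsum_le_rpow (q := 1) one_pos
  exact ⟨C, fun y => by simpa using hC y⟩

/-- The Hardy–Littlewood inequality, up to a constant. -/
lemma exists_lintegral_mul_le_rearr : ∃ C : ℝ≥0, ∀ {X : Type*} [MeasurableSpace X] (μ : Measure X)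
    (f g : X → ℝ≥0∞), Measurable f → Measurable g → ∫⁻ x, f x * g x ∂μ ≤
      C * ∫⁻ s in Ioi (0 : ℝ), rearr μ f (ENNReal.ofReal s) * rearr μ g (ENNReal.ofReal s) := by
  obtain ⟨C, hC⟩ := exists_le_tsum_tp
  obtain ⟨D, hD⟩ := exists_tsum_tp_le'
  refine ⟨C * C * (D * D), fun {X} _ μ f g hf hg => ?_⟩
  set F : (X → ℝ≥0∞) → ℤ → X → ℝ≥0∞ := fun f k x => if tp k < f x then tp k else 0 with hF
  have hFm : ∀ f, Measurable f → ∀ k, Measurable (F f k) := fun f hf k =>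
    Measurable.ite (measurableSet_lt measurable_const hf) measurable_const measurable_const
  set R : (X → ℝ≥0∞) → ℤ → ℝ → ℝ≥0∞ := fun f k s =>
    if ENNReal.ofReal s < μ {x | tp k < f x} then tp k else 0 with hR
  have hRm : ∀ f k, Measurable (R f k) := fun f k =>
    Measurable.ite (measurableSet_lt ENNReal.measurable_ofReal measurable_const) measurable_const
      measurable_const
  -- For a pair of level sets the claim is μ(A ∩ B) ≤ min(μ A, μ B), and the minimum is the length
  -- of the set of s below both measures. The general case follows by summing over dyadic levels.
  have key : ∀ j k, ∫⁻ x, F f j x * F g k x ∂μ ≤ ∫⁻ s in Ioi (0 : ℝ), R f j s * R g k s := by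
    intro j k
    have e1 : ∫⁻ x, F f j x * F g k x ∂μ ≤
        tp j * tp k * min (μ {x | tp j < f x}) (μ {x | tp k < g x}) := by
      calc _ = ∫⁻ x, ({x | tp j < f x} ∩ {x | tp k < g x}).indicator (fun _ => tp j * tp k) x ∂μ := by
            congr 1; ext x
            by_cases h1 : tp j < f x <;> by_cases h2 : tp k < g x <;> simp [hF, h1, h2]
        _ = tp j * tp k * μ ({x | tp j < f x} ∩ {x | tp k < g x}) :=
            lintegral_indicator_const ((measurableSet_lt measurable_const hf).inter
              (measurableSet_lt measurable_const hg)) _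
        _ ≤ _ := by
            gcongr
            exact le_min (measure_mono inter_subset_left) (measure_mono inter_subset_right)
    have e2 : ∫⁻ s in Ioi (0 : ℝ), R f j s * R g k s =
        tp j * tp k * min (μ {x | tp j < f x}) (μ {x | tp k < g x}) := by
      have := lintegral_rpow_indicator one_pos (min (μ {x | tp j < f x}) (μ {x | tp k < g x}))
      simp only [sub_self, Real.rpow_zero, ENNReal.ofReal_one, ENNReal.rpow_one, one_mul,
        div_one] at this
      rw [← this, ← lintegral_const_mul' _ _ (ENNReal.mul_ne_top (tp_ne_top _) (tp_ne_top _))]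
      congr 1; ext s
      by_cases h1 : ENNReal.ofReal s < μ {x | tp j < f x} <;>
        by_cases h2 : ENNReal.ofReal s < μ {x | tp k < g x} <;> simp [hR, h1, h2]
    rw [e2]; exact e1
  calc ∫⁻ x, f x * g x ∂μ ≤ ∫⁻ x, (C * ∑' j, F f j x) * (C * ∑' k, F g k x) ∂μ :=
        lintegral_mono fun x => mul_le_mul' (hC _) (hC _)
    _ = C * C * ∫⁻ x, ∑' j, ∑' k, F f j x * F g k x ∂μ := by
        rw [← lintegral_const_mul' _ _ (by finiteness)]
        congr 1; ext x
        simp_rw [ENNReal.tsum_mul_left, ENNReal.tsum_mul_right]; ring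
    _ = C * C * ∑' j, ∑' k, ∫⁻ x, F f j x * F g k x ∂μ := by
        rw [lintegral_tsum]
        · congr 2; ext j
          rw [lintegral_tsum]
          exact fun k => ((hFm f hf j).mul (hFm g hg k)).aemeasurable
        · exact fun j => (Measurable.tsum fun k =>
            (hFm f hf j).mul (hFm g hg k)).aemeasurable
    _ ≤ C * C * ∑' j, ∑' k, ∫⁻ s in Ioi (0 : ℝ), R f j s * R g k s := by
        gcongr with j k; exact key j k
    _ = C * C * ∫⁻ s in Ioi (0 : ℝ), (∑' j, R f j s) * (∑' k, R g k s) := by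
        congr 1
        have : ∀ j, ∑' k, ∫⁻ s in Ioi (0 : ℝ), R f j s * R g k s
            = ∫⁻ s in Ioi (0 : ℝ), ∑' k, R f j s * R g k s := fun j =>
          (lintegral_tsum fun k => ((hRm f j).mul (hRm g k)).aemeasurable).symm
        simp_rw [this]
        rw [← lintegral_tsum (f := fun j s => ∑' k, R f j s * R g k s) fun j =>
          (Measurable.tsum fun k => (hRm f j).mul (hRm g k)).aemeasurable]
        congr 1; ext s
        simp_rw [ENNReal.tsum_mul_left, ENNReal.tsum_mul_right]
    _ ≤ C * C * ∫⁻ s in Ioi (0 : ℝ), (D * D) *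
          (rearr μ f (ENNReal.ofReal s) * rearr μ g (ENNReal.ofReal s)) := by
        have hle : ∀ f s, ∑' k, R f k s ≤ D * rearr μ f (ENNReal.ofReal s) := by
          intro f s
          refine le_trans (ENNReal.tsum_le_tsum fun k => ?_) (hD _)
          simp only [hR]
          split_ifs with h1 h2 h2
          · exact le_rfl
          · exact absurd (le_rearr_of_lt h1) h2
          · exact zero_le
          · exact le_rfl
        refine mul_le_mul' le_rfl (lintegral_mono fun s => ?_)
        calc _ ≤ (D * rearr μ f (ENNReal.ofReal s)) * (D * rearr μ g (ENNReal.ofReal s)) :=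
              mul_le_mul' (hle f s) (hle g s)
          _ = _ := by ring
    _ = _ := by
        rw [lintegral_const_mul' _ _ (by finiteness)]; push_cast; ring

/-- The weights s^{1/p-1/q} and s^{1/p'-1/q'} have product 1, so this is the ordinary Hölder
inequality with exponents q and q' on the half-line. -/
lemma lintegral_rearr_mul_le (hp : p.HolderConjugate p') (hq : q.HolderConjugate q') :
    ∫⁻ s in Ioi (0 : ℝ), rearr μ f (ENNReal.ofReal s) * rearr μ g (ENNReal.ofReal s) ≤
      lorI p q μ f ^ (1 / q) * lorI p' q' μ g ^ (1 / q') := by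
  have hm : ∀ f : X → ℝ≥0∞, Measurable fun s : ℝ => rearr μ f (ENNReal.ofReal s) := fun f =>
    (rearr_antitone μ f).measurable.comp ENNReal.measurable_ofReal
  have e : ∀ {p q : ℝ} (f : X → ℝ≥0∞), 0 < q → lorI p q μ f = ∫⁻ s in Ioi (0 : ℝ),
      (ENNReal.ofReal (s ^ (1 / p - 1 / q)) * rearr μ f (ENNReal.ofReal s)) ^ q := by
    intro p q f hq
    rw [lorI_eq hq]
    refine setLIntegral_congr_fun measurableSet_Ioi fun s hs => ?_
    have hs : (0 : ℝ) < s := hs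
    rw [ENNReal.mul_rpow_of_nonneg _ _ hq.le, ENNReal.ofReal_rpow_of_nonneg (by positivity) hq.le,
      ← Real.rpow_mul hs.le]
    congr 3
    field_simp
  rw [e f hq.pos, e g hq.symm.pos]
  refine le_trans (le_of_eq ?_) (ENNReal.lintegral_mul_le_Lp_mul_Lq _ hq
    (f := fun s => ENNReal.ofReal (s ^ (1 / p - 1 / q)) * rearr μ f (ENNReal.ofReal s))
    (g := fun s => ENNReal.ofReal (s ^ (1 / p' - 1 / q')) * rearr μ g (ENNReal.ofReal s)) ?_ ?_)
  · refine setLIntegral_congr_fun measurableSet_Ioi fun s hs => ?_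
    have hs : (0 : ℝ) < s := hs
    simp only [Pi.mul_apply]
    rw [mul_mul_mul_comm, ← ENNReal.ofReal_mul (by positivity), ← Real.rpow_add hs]
    have h1 := hp.inv_add_inv_eq_one
    have h2 := hq.inv_add_inv_eq_one
    rw [show 1 / p - 1 / q + (1 / p' - 1 / q') = 0 by simp only [one_div]; linarith]
    simp
  · exact ((by fun_prop : Measurable fun s : ℝ => ENNReal.ofReal (s ^ (1 / p - 1 / q))).mul
      (hm f)).aemeasurable
  · exact ((by fun_prop : Measurable fun s : ℝ => ENNReal.ofReal (s ^ (1 / p' - 1 / q'))).mul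
      (hm g)).aemeasurable

/-- Hölder's inequality in Lorentz spaces. -/
lemma exists_lorentz_holder (hp : p.HolderConjugate p') (hq : q.HolderConjugate q') :
    ∃ C : ℝ≥0, ∀ {X : Type*} [MeasurableSpace X] (μ : Measure X)
    (f g : X → ℝ≥0∞), AEMeasurable f μ → AEMeasurable g μ →
      ∫⁻ x, f x * g x ∂μ ≤ C * (lorN p q μ f * lorN p' q' μ g) := by
  obtain ⟨C, hC⟩ := exists_lintegral_mul_le_rearr
  obtain ⟨D, hD⟩ := exists_lorI_le hp.pos hq.pos
  obtain ⟨D', hD'⟩ := exists_lorI_le hp.symm.pos hq.symm.pos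
  refine ⟨C * (D ^ (1 / q) * D' ^ (1 / q')), fun {X} _ μ f g hf hg => ?_⟩
  have e : ∫⁻ x, f x * g x ∂μ = ∫⁻ x, hf.mk f x * hg.mk g x ∂μ := by
    refine lintegral_congr_ae ?_
    filter_upwards [hf.ae_eq_mk, hg.ae_eq_mk] with x h1 h2
    rw [h1, h2]
  rw [e, lorN_congr_ae hf.ae_eq_mk, lorN_congr_ae hg.ae_eq_mk]
  refine (hC μ _ _ hf.measurable_mk hg.measurable_mk).trans ?_
  rw [ENNReal.coe_mul, mul_assoc]
  gcongr
  refine (lintegral_rearr_mul_le hp hq).trans ?_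
  have hq0 : 0 ≤ 1 / q := one_div_nonneg.2 hq.nonneg
  have hq0' : 0 ≤ 1 / q' := one_div_nonneg.2 hq.symm.nonneg
  calc _ ≤ (D * lorSum p q μ (hf.mk f)) ^ (1 / q) * (D' * lorSum p' q' μ (hg.mk g)) ^ (1 / q') := by
        gcongr
        · exact hD _ _
        · exact hD' _ _
    _ = _ := by
        rw [ENNReal.mul_rpow_of_nonneg _ _ hq0, ENNReal.mul_rpow_of_nonneg _ _ hq0']
        push_cast
        rw [ENNReal.coe_rpow_of_nonneg _ hq0, ENNReal.coe_rpow_of_nonneg _ hq0', lorN, lorN]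
        ring

/-! ### The converse of Hölder's inequality -/

/-- The Lorentz norm of an increasing step function of `f`. -/
lemma exists_lorSum_step_le (hp : 0 < p) (hq : 0 < q) : ∃ C : ℝ≥0, ∀ {X : Type*}
    [MeasurableSpace X] (μ : Measure X) (f : X → ℝ≥0∞) (c : ℤ → ℝ≥0∞),
    lorSum p q μ (fun x => ∑' j : ℤ, if tp j < f x then c j else 0) ≤
      C * ∑' k : ℤ, (μ {x | tp k < f x} ^ (1 / p) * ∑' j : ℕ, c (k - j)) ^ q := by
  obtain ⟨C, hC⟩ := exists_tsum_le_rpow hq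
  refine ⟨C, fun {X} _ μ f c => ?_⟩
  set G : ℤ → ℝ≥0∞ := fun k => ∑' j : ℕ, c (k - j) with hG
  -- If the step function exceeds 2^m at x, then so does a finite partial sum. With K the largest
  -- index contributing to it, that partial sum is at most G K, while f x > 2^K.
  have h1 : ∀ m : ℤ, {x | tp m < ∑' j : ℤ, if tp j < f x then c j else 0} ⊆
      ⋃ k : {k : ℤ // tp m < G k}, {x | tp k < f x} := by
    intro m x hx
    simp only [mem_ofPred_eq] at hx
    rw [ENNReal.tsum_eq_iSup_sum, lt_iSup_iff] at hx
    obtain ⟨s, hs⟩ := hx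
    rw [← Finset.sum_filter] at hs
    have hne : (s.filter fun j : ℤ => tp j < f x).Nonempty := by
      by_contra h
      rw [Finset.not_nonempty_iff_eq_empty.1 h] at hs
      simp at hs
    set K := (s.filter fun j : ℤ => tp j < f x).max' hne with hK
    have hKf : tp K < f x := (Finset.mem_filter.1 (Finset.max'_mem _ hne)).2
    refine mem_iUnion.2 ⟨⟨K, hs.trans_le ?_⟩, hKf⟩
    simp only [hG]
    rw [← tsum_int_le K c]
    refine le_trans (Finset.sum_le_sum fun j hj => ?_) (ENNReal.sum_le_tsum
      (s.filter fun j : ℤ => tp j < f x))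
    rw [if_pos (Finset.le_max' _ _ hj)]
  have h2 : ∀ m : ℤ, (tp m * μ {x | tp m < ∑' j : ℤ, if tp j < f x then c j else 0} ^ (1 / p)) ^ q
      ≤ ∑' k : ℤ, (if tp m ≤ G k then tp (m * q) else 0) * μ {x | tp k < f x} ^ (q / p) := by
    intro m
    -- The level sets are nested, so the measure of their union is a supremum, whose power q/p is at
    -- most the sum of the powers.
    have hdir : Directed (· ⊆ ·) (fun k : {k : ℤ // tp m < G k} => {x | tp (k : ℤ) < f x}) := by
      intro a b
      rcases le_total (a : ℤ) b with h | h
      · exact ⟨a, subset_rfl, fun x hx => lt_of_le_of_lt (tp_le_tp (by exact_mod_cast h)) hx⟩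
      · exact ⟨b, fun x hx => lt_of_le_of_lt (tp_le_tp (by exact_mod_cast h)) hx, subset_rfl⟩
    rw [ENNReal.mul_rpow_of_nonneg _ _ hq.le, tp_rpow, ← ENNReal.rpow_mul,
      show 1 / p * q = q / p by ring]
    calc _ ≤ tp (m * q) * (⨆ k : {k : ℤ // tp m < G k}, μ {x | tp (k : ℤ) < f x}) ^ (q / p) := by
          gcongr
          exact (measure_mono (h1 m)).trans (le_of_eq hdir.measure_iUnion)
      _ ≤ tp (m * q) * ∑' k : {k : ℤ // tp m < G k}, μ {x | tp (k : ℤ) < f x} ^ (q / p) := by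
          gcongr
          exact rpow_sup_le_tsum (by positivity) _
      _ = ∑' k : {k : ℤ // tp m < G k}, (if tp m ≤ G k then tp (m * q) else 0) *
            μ {x | tp (k : ℤ) < f x} ^ (q / p) := by
          rw [← ENNReal.tsum_mul_left]
          congr 1; ext k; rw [if_pos k.2.le]
      _ ≤ _ := ENNReal.tsum_comp_le_tsum_of_injective Subtype.val_injective
          (fun k : ℤ => (if tp m ≤ G k then tp (m * q) else 0) * μ {x | tp k < f x} ^ (q / p))
  calc _ ≤ ∑' m : ℤ, ∑' k : ℤ, (if tp m ≤ G k then tp (m * q) else 0) *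
          μ {x | tp k < f x} ^ (q / p) := ENNReal.tsum_le_tsum h2
    _ = ∑' k : ℤ, (∑' m : ℤ, (if tp m ≤ G k then tp (m * q) else 0)) *
          μ {x | tp k < f x} ^ (q / p) := by
        rw [ENNReal.tsum_comm]
        simp_rw [ENNReal.tsum_mul_right]
    _ ≤ ∑' k : ℤ, (C * G k ^ q) * μ {x | tp k < f x} ^ (q / p) := by
        gcongr with k; exact hC _
    _ = _ := by
        rw [← ENNReal.tsum_mul_left]
        congr 1; ext k
        rw [ENNReal.mul_rpow_of_nonneg _ _ hq.le, ← ENNReal.rpow_mul,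
          show 1 / p * q = q / p by ring]
        ring

/-- The c k are the jumps at height 2^k of a norming function for a function with distribution m.
The choice c k = 2^{k(q-1)} m(k)^{q/p-1} gives equality in the first claim when m k is nonzero. As
q/p - 1 ≤ 0 and m decreases, the partial sums of c are geometric and comparable to their last term,
and (q-1)q' = q gives the second claim. -/
lemma exists_converse_coeff_of_le (hp : p.HolderConjugate p') (hq : q.HolderConjugate q')
    (hqp : q ≤ p) : ∃ C : ℝ≥0, ∀ m : ℤ → ℝ≥0∞, Antitone m → (∀ k, m k ≠ ∞) →
      ∃ c : ℤ → ℝ≥0∞, (∀ k : ℤ, (tp k * m k ^ (1 / p)) ^ q ≤ c k * (tp k * m k)) ∧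
        ∑' k : ℤ, (m k ^ (1 / p') * ∑' j : ℕ, c (k - j)) ^ q' ≤
          C * ∑' k : ℤ, (tp k * m k ^ (1 / p)) ^ q := by
  have hp0 := hp.pos
  have hq0 := hq.pos
  have hq1 := hq.lt
  obtain ⟨D, hD⟩ := exists_geom (ε := q - 1) (by linarith)
  refine ⟨D ^ q', fun m hm hmt => ⟨fun k => tp (k * (q - 1)) * m k ^ (q / p - 1), ?_, ?_⟩⟩
  · intro k
    rcases eq_or_ne (m k) 0 with h0 | h0
    · simp [h0, hp0, hq0]
    · rw [mul_mul_mul_comm, ← tp_add, ENNReal.mul_rpow_of_nonneg _ _ hq0.le, tp_rpow,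
        ← ENNReal.rpow_mul]
      nth_rw 3 [← ENNReal.rpow_one (m k)]
      rw [← ENNReal.rpow_add _ _ h0 (hmt k)]
      refine le_of_eq ?_
      congr 2 <;> ring
  · rw [← ENNReal.tsum_mul_left]
    refine ENNReal.tsum_le_tsum fun k => ?_
    have hq'0 := hq.symm.pos
    rcases eq_or_ne (m k) 0 with h0 | h0
    · simp [h0, hp.symm.pos, hq'0]
    have h1 : ∑' j : ℕ, tp ((k - j : ℤ) * (q - 1)) * m (k - j) ^ (q / p - 1) ≤
        D * (tp (k * (q - 1)) * m k ^ (q / p - 1)) := by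
      rw [← hD, ← ENNReal.tsum_mul_right]
      refine ENNReal.tsum_le_tsum fun j => ?_
      rw [← mul_assoc, ← tp_add]
      have e : ((k - j : ℤ) : ℝ) * (q - 1) = -((q - 1) * j) + k * (q - 1) := by push_cast; ring
      rw [e]
      refine mul_le_mul' le_rfl (ennreal_rpow_anti (z := q / p - 1) ?_ (hm (by omega)))
      rw [sub_nonpos, div_le_one hp0]; exact hqp
    calc _ ≤ (m k ^ (1 / p') * (D * (tp (k * (q - 1)) * m k ^ (q / p - 1)))) ^ q' := by
          gcongr
      _ = (D * (tp k * m k ^ (1 / p)) ^ (q - 1)) ^ q' := by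
          congr 1
          rw [mul_left_comm, mul_left_comm (m k ^ (1 / p')), ← ENNReal.rpow_add _ _ h0 (hmt k),
            ENNReal.mul_rpow_of_nonneg _ _ (by linarith), tp_rpow, ← ENNReal.rpow_mul]
          congr 3
          have := hp.inv_add_inv_eq_one
          rw [show 1 / p' = 1 - 1 / p by simp only [one_div]; linarith]
          ring
      _ = _ := by
          rw [ENNReal.mul_rpow_of_nonneg _ _ hq'0.le, ← ENNReal.rpow_mul,
            hq.sub_one_mul_conj, ENNReal.coe_rpow_of_nonneg _ hq'0.le]

/-- For q > p the power of m has the wrong sign, so φ(k) = 2^k m(k)^{1/p} is replaced by the slowly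
varying majorant ψ(k) = Σ_i 2^{-εi} φ(k-i), which satisfies ψ(k-j) ≤ 2^{εj} ψ(k). With c k =
2^{k(p-1)} ψ(k)^{q-p} and (q-p)ε = (p-1)/2 the partial sums are again geometric, and ψ is bounded by
φ in ℓ^q. -/
lemma exists_converse_coeff_of_lt (hp : p.HolderConjugate p') (hq : q.HolderConjugate q')
    (hqp : p < q) : ∃ C : ℝ≥0, ∀ m : ℤ → ℝ≥0∞,
      ∃ c : ℤ → ℝ≥0∞, (∀ k : ℤ, (tp k * m k ^ (1 / p)) ^ q ≤ c k * (tp k * m k)) ∧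
        ∑' k : ℤ, (m k ^ (1 / p') * ∑' j : ℕ, c (k - j)) ^ q' ≤
          C * ∑' k : ℤ, (tp k * m k ^ (1 / p)) ^ q := by
  have hp0 := hp.pos
  have hp1 := hp.lt
  have hq0 := hq.pos
  have hq1 := hq.lt
  have hq'0 := hq.symm.pos
  have hd : 0 < q - p := by linarith
  set ε : ℝ := (p - 1) / 2 / (q - p) with hε
  have hε0 : 0 < ε := div_pos (by linarith) hd
  obtain ⟨D, hD⟩ := exists_geom (ε := (p - 1) / 2) (by linarith)
  obtain ⟨D', hD'⟩ := exists_conv_neg hε0 hq0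
  refine ⟨D ^ q' * D', fun m => ?_⟩
  set φ : ℤ → ℝ≥0∞ := fun k => tp k * m k ^ (1 / p) with hφ
  set ψ : ℤ → ℝ≥0∞ := fun k => ∑' i : ℕ, tp (-(ε * i)) * φ (k - i) with hψ
  have hφψ : ∀ k, φ k ≤ ψ k := by
    intro k
    refine le_trans (le_of_eq ?_) (ENNReal.le_tsum 0)
    simp
  have hψ2 : ∀ (k : ℤ) (j : ℕ), ψ (k - j) ≤ tp (ε * j) * ψ k := by
    intro k j
    simp only [hψ]
    rw [← ENNReal.tsum_mul_left]
    have hinj : Function.Injective (fun i : ℕ => i + j) := fun a b h => by simpa using h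
    refine le_trans (le_of_eq ?_) (ENNReal.tsum_comp_le_tsum_of_injective hinj _)
    congr 1; ext i
    rw [← mul_assoc (tp (ε * j)), ← tp_add (ε * j)]
    rw [show k - ((i + j : ℕ) : ℤ) = k - j - i by push_cast; ring,
      show ε * j + -(ε * ((i + j : ℕ) : ℝ)) = -(ε * i) by push_cast; ring]
  refine ⟨fun k => tp (k * (p - 1)) * ψ k ^ (q - p), ?_, ?_⟩
  · intro k
    have e1 : tp (k * (p - 1)) * (tp k * m k) = φ k ^ p := by
      simp only [hφ]
      rw [ENNReal.mul_rpow_of_nonneg _ _ hp0.le, ← ENNReal.rpow_mul, one_div_mul_cancel hp0.ne',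
        ENNReal.rpow_one, tp_rpow, ← mul_assoc, ← tp_add]
      congr 2; ring
    calc φ k ^ q = φ k ^ (q - p) * φ k ^ p := by
          rw [← ENNReal.rpow_add_of_nonneg _ _ hd.le hp0.le]; congr 1; ring
      _ ≤ ψ k ^ (q - p) * φ k ^ p := by gcongr; exact hφψ k
      _ = _ := by rw [← e1]; ring
  · have h1 : ∀ k, ∑' j : ℕ, tp ((k - j : ℤ) * (p - 1)) * ψ (k - j) ^ (q - p) ≤
        D * (tp (k * (p - 1)) * ψ k ^ (q - p)) := by
      intro k
      rw [← hD, ← ENNReal.tsum_mul_right]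
      refine ENNReal.tsum_le_tsum fun j => ?_
      calc _ ≤ tp ((k - j : ℤ) * (p - 1)) * (tp (ε * j) * ψ k) ^ (q - p) := by
            gcongr; exact hψ2 k j
        _ = _ := by
            rw [ENNReal.mul_rpow_of_nonneg _ _ hd.le, tp_rpow, ← mul_assoc, ← mul_assoc, ← tp_add,
              ← tp_add]
            congr 2
            rw [hε]; field_simp; push_cast; ring
    have h2 : ∀ k, (m k ^ (1 / p') * ∑' j : ℕ, tp ((k - j : ℤ) * (p - 1)) * ψ (k - j) ^ (q - p)) ^ q'
        ≤ D ^ q' * ψ k ^ q := by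
      intro k
      have e2 : m k ^ (1 / p') * tp (k * (p - 1)) = φ k ^ (p - 1) := by
        simp only [hφ]
        rw [ENNReal.mul_rpow_of_nonneg _ _ (by linarith), ← ENNReal.rpow_mul, tp_rpow, mul_comm]
        congr 2
        have := hp.inv_add_inv_eq_one
        rw [show 1 / p' = 1 - 1 / p by simp only [one_div]; linarith]
        field_simp
      calc _ ≤ (m k ^ (1 / p') * (D * (tp (k * (p - 1)) * ψ k ^ (q - p)))) ^ q' := by
            gcongr; exact h1 k
        _ = (D * (φ k ^ (p - 1) * ψ k ^ (q - p))) ^ q' := by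
            rw [← e2]; congr 1; ring
        _ ≤ (D * (ψ k ^ (p - 1) * ψ k ^ (q - p))) ^ q' := by
            have : 0 ≤ p - 1 := by linarith
            gcongr; exact hφψ k
        _ = _ := by
            rw [← ENNReal.rpow_add_of_nonneg _ _ (by linarith) hd.le,
              ENNReal.mul_rpow_of_nonneg _ _ hq'0.le, ← ENNReal.rpow_mul,
              show p - 1 + (q - p) = q - 1 by ring, hq.sub_one_mul_conj]
    calc _ ≤ ∑' k, D ^ q' * ψ k ^ q := ENNReal.tsum_le_tsum h2
      _ = D ^ q' * ∑' k, ψ k ^ q := ENNReal.tsum_mul_left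
      _ ≤ D ^ q' * (D' * ∑' k, φ k ^ q) := by gcongr; exact hD' φ
      _ = _ := by
        push_cast
        rw [ENNReal.coe_rpow_of_nonneg _ hq'0.le, mul_assoc]

lemma exists_converse_coeff (hp : p.HolderConjugate p') (hq : q.HolderConjugate q') :
    ∃ C : ℝ≥0, ∀ m : ℤ → ℝ≥0∞, Antitone m → (∀ k, m k ≠ ∞) →
      ∃ c : ℤ → ℝ≥0∞, (∀ k : ℤ, (tp k * m k ^ (1 / p)) ^ q ≤ c k * (tp k * m k)) ∧
        ∑' k : ℤ, (m k ^ (1 / p') * ∑' j : ℕ, c (k - j)) ^ q' ≤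
          C * ∑' k : ℤ, (tp k * m k ^ (1 / p)) ^ q := by
  rcases le_or_gt q p with h | h
  · exact exists_converse_coeff_of_le hp hq h
  · obtain ⟨C, hC⟩ := exists_converse_coeff_of_lt hp hq h
    exact ⟨C, fun m _ _ => hC m⟩

end LorentzDuality

section LorentzDuality

variable {X : Type*} [MeasurableSpace X] {μ : Measure X} {p q p' q' : ℝ} {f g : X → ℝ≥0∞}

lemma meas_ne_top_of_lorSum (hp : 0 < p) (hq : 0 < q) (h : lorSum p q μ f ≠ ∞) (k : ℤ) :
    μ {x | tp k < f x} ≠ ∞ := by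
  intro h'
  refine h (top_le_iff.1 (le_trans (le_of_eq ?_) (ENNReal.le_tsum k)))
  rw [h', ENNReal.top_rpow_of_pos (by positivity), ENNReal.mul_top (tp_ne_zero _),
    ENNReal.top_rpow_of_pos hq]

/-- The function g with jump c k at the level {f > 2^k} plays the role that f^{q-1} plays in L^q:
the pairing dominates the q-th power of the norm of f, and the q'-th power of the norm of g is
controlled by the same quantity. -/
lemma exists_norming (hp : p.HolderConjugate p') (hq : q.HolderConjugate q') :
    ∃ C : ℝ≥0, ∀ {X : Type*} [MeasurableSpace X] (μ : Measure X) (f : X → ℝ≥0∞), Measurable f →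
      lorSum p q μ f ≠ ∞ → ∃ g : X → ℝ≥0∞, Measurable g ∧ lorSum p q μ f ≤ ∫⁻ x, f x * g x ∂μ ∧
        lorSum p' q' μ g ≤ C * lorSum p q μ f := by
  obtain ⟨C, hC⟩ := exists_converse_coeff hp hq
  obtain ⟨D, hD⟩ := exists_lorSum_step_le hp.symm.pos hq.symm.pos
  refine ⟨D * C, fun {X} _ μ f hf hfin => ?_⟩
  obtain ⟨c, hc1, hc2⟩ := hC (fun k => μ {x | tp k < f x})
    (fun i j h => measure_mono fun x hx => lt_of_le_of_lt (tp_le_tp (by exact_mod_cast h)) hx)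
    (meas_ne_top_of_lorSum hp.pos hq.pos hfin)
  have hm : ∀ j : ℤ, Measurable fun x => if tp j < f x then c j else 0 := fun j =>
    Measurable.ite (measurableSet_lt measurable_const hf) measurable_const measurable_const
  refine ⟨fun x => ∑' j : ℤ, if tp j < f x then c j else 0, Measurable.tsum hm, ?_, ?_⟩
  · calc lorSum p q μ f ≤ ∑' k : ℤ, c k * (tp k * μ {x | tp k < f x}) :=
          ENNReal.tsum_le_tsum hc1
      _ ≤ ∑' k : ℤ, ∫⁻ x, f x * (if tp k < f x then c k else 0) ∂μ := by
          refine ENNReal.tsum_le_tsum fun k => ?_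
          rw [← mul_assoc, ← lintegral_indicator_const (measurableSet_lt measurable_const hf)]
          refine lintegral_mono fun x => ?_
          by_cases h : tp k < f x
          · simp only [indicator, mem_ofPred_eq, h, if_true]
            rw [mul_comm]; gcongr
          · simp [h]
      _ = _ := by
          simp_rw [← ENNReal.tsum_mul_left]
          rw [lintegral_tsum (f := fun (k : ℤ) x => f x * if tp k < f x then c k else 0)
            fun k => (hf.mul (hm k)).aemeasurable]
  · refine (hD μ f c).trans ?_
    rw [ENNReal.coe_mul, mul_assoc]
    gcongr
    exact hc2

/-- The Fatou property: the level sets of an increasing sequence increase, so continuity of the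
measure from below passes to the limit in each finite part of the sum. -/
lemma lorSum_le_of_monotone (hp : 0 < p) (hq : 0 < q) {F : ℕ → X → ℝ≥0∞} (hF : Monotone F)
    (hf : ∀ᵐ x ∂μ, f x ≤ ⨆ N, F N x) {B : ℝ≥0∞} (hB : ∀ N, lorSum p q μ (F N) ≤ B) :
    lorSum p q μ f ≤ B := by
  have h1 : ∀ k : ℤ, μ {x | tp k < f x} ≤ ⨆ N, μ {x | tp k < F N x} := by
    intro k
    have hmon : Monotone fun N => {x | tp k < F N x} :=
      fun i j h x hx => lt_of_lt_of_le hx (hF h x)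
    rw [← hmon.measure_iUnion]
    refine measure_mono_ae ?_
    filter_upwards [hf] with x hx h2
    obtain ⟨N, hN⟩ := lt_iSup_iff.1 (lt_of_lt_of_le h2 hx)
    exact mem_iUnion.2 ⟨N, hN⟩
  rw [lorSum, ENNReal.tsum_eq_iSup_sum]
  refine iSup_le fun s => ?_
  have hcont : Tendsto (fun N => ∑ k ∈ s, (tp k * μ {x | tp k < F N x} ^ (1 / p)) ^ q) atTop
      (𝓝 (∑ k ∈ s, (tp k * (⨆ N, μ {x | tp k < F N x}) ^ (1 / p)) ^ q)) := by
    refine tendsto_finsetSum _ fun k _ => ?_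
    have hmon : Monotone fun N => μ {x | tp k < F N x} :=
      fun i j h => measure_mono fun x hx => lt_of_lt_of_le hx (hF h x)
    exact (ENNReal.Tendsto.const_mul ((tendsto_atTop_iSup hmon).ennrpow_const _)
      (Or.inr (tp_ne_top _))).ennrpow_const _
  calc _ ≤ ∑ k ∈ s, (tp k * (⨆ N, μ {x | tp k < F N x}) ^ (1 / p)) ^ q := by
        gcongr with k _; exact h1 k
    _ ≤ B := le_of_tendsto' hcont fun N => (ENNReal.sum_le_tsum s).trans (hB N)

lemma lorN_le_of_monotone (hp : 0 < p) (hq : 0 < q) {F : ℕ → X → ℝ≥0∞} (hF : Monotone F)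
    (hf : ∀ᵐ x ∂μ, f x ≤ ⨆ N, F N x) {B : ℝ≥0∞} (hB : ∀ N, lorN p q μ (F N) ≤ B) :
    lorN p q μ f ≤ B := by
  have := lorSum_le_of_monotone hp hq hF hf (B := B ^ q) fun N => by
    rw [← lorN_rpow hq]; exact ENNReal.rpow_le_rpow (hB N) hq.le
  calc lorN p q μ f ≤ (B ^ q) ^ (1 / q) := ENNReal.rpow_le_rpow this (by positivity)
    _ = B := by rw [← ENNReal.rpow_mul, mul_one_div_cancel hq.ne', ENNReal.rpow_one]

lemma lorSum_ne_top_of_bdd (hp : 0 < p) (hq : 0 < q) {A : Set X} (hA : μ A ≠ ∞)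
    (hsupp : ∀ x, x ∉ A → f x = 0) {M : ℝ≥0∞} (hM : M ≠ ∞) (hf : ∀ᵐ x ∂μ, f x ≤ M) :
    lorSum p q μ f ≠ ∞ := by
  obtain ⟨K, hK⟩ := exists_lt_tp hM
  obtain ⟨C, hC⟩ := exists_tsum_tp_le hq
  have : lorSum p q μ f ≤ μ A ^ (q / p) * (C * tp ((K : ℤ) * q)) := by
    rw [← hC, ← ENNReal.tsum_mul_left]
    refine ENNReal.tsum_le_tsum fun k => ?_
    rw [ENNReal.mul_rpow_of_nonneg _ _ hq.le, tp_rpow, ← ENNReal.rpow_mul,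
      show 1 / p * q = q / p by ring]
    by_cases hk : k ≤ K
    · rw [if_pos hk, mul_comm]
      gcongr
      intro x hx
      by_contra h
      rw [mem_ofPred_eq, hsupp x h] at hx
      exact not_lt_zero hx
    · have : μ {x | tp k < f x} = 0 := by
        refine measure_mono_null (t := {x | ¬ f x ≤ M}) ?_ hf
        intro x hx h
        have h2 : tp K ≤ tp k := tp_le_tp (by exact_mod_cast (not_le.1 hk).le)
        exact absurd (lt_of_lt_of_le hx h) (not_lt.2 (hK.le.trans h2))
      rw [this, ENNReal.zero_rpow_of_pos (by positivity)]; simp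
  refine ne_top_of_le_ne_top ?_ this
  exact ENNReal.mul_ne_top (ENNReal.rpow_ne_top_of_nonneg (by positivity) hA)
    (ENNReal.mul_ne_top ENNReal.coe_ne_top (tp_ne_top _))

lemma lorN_ne_top_of_bdd (hp : 0 < p) (hq : 0 < q) {A : Set X} (hA : μ A ≠ ∞)
    (hsupp : ∀ x, x ∉ A → f x = 0) {M : ℝ≥0∞} (hM : M ≠ ∞) (hf : ∀ᵐ x ∂μ, f x ≤ M) :
    lorN p q μ f ≠ ∞ :=
  ENNReal.rpow_ne_top_of_nonneg (by positivity) (lorSum_ne_top_of_bdd hp hq hA hsupp hM hf)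

/-- The converse of Hölder's inequality in Lorentz spaces, tested on bounded functions. -/
lemma exists_lorN_le_of_forall (hp : p.HolderConjugate p') (hq : q.HolderConjugate q') :
    ∃ C : ℝ≥0, ∀ {X : Type*} [MeasurableSpace X] (μ : Measure X) [SigmaFinite μ] (f : X → ℝ≥0∞)
      (H : ℝ≥0∞), AEMeasurable f μ →
      (∀ g : X → ℝ≥0∞, Measurable g → (∃ M : ℝ≥0, ∀ x, g x ≤ M) →
        ∫⁻ x, f x * g x ∂μ ≤ H * lorN p' q' μ g) → lorN p q μ f ≤ C * H := by
  obtain ⟨C, hC⟩ := exists_norming hp hq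
  refine ⟨C ^ (1 / q'), fun {X} _ μ _ f₀ H hf₀ h₀ => ?_⟩
  set f := hf₀.mk f₀ with hfdef
  have hf : Measurable f := hf₀.measurable_mk
  have h : ∀ g : X → ℝ≥0∞, Measurable g → (∃ M : ℝ≥0, ∀ x, g x ≤ M) →
      ∫⁻ x, f x * g x ∂μ ≤ H * lorN p' q' μ g := by
    intro g hg hM
    refine le_trans (le_of_eq (lintegral_congr_ae ?_)) (h₀ g hg hM)
    filter_upwards [hf₀.ae_eq_mk] with x hx
    rw [hx]
  rw [lorN_congr_ae hf₀.ae_eq_mk]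
  have hq'0 := hq.symm.pos
  have hq0 := hq.pos
  -- functions of finite norm dominated by `f`
  have key : ∀ u : X → ℝ≥0∞, Measurable u → (∀ x, u x ≤ f x) → lorSum p q μ u ≠ ∞ →
      lorN p q μ u ≤ C ^ (1 / q') * H := by
    intro u hu huf hfin
    obtain ⟨g, hg, h1, h2⟩ := hC μ u hu hfin
    have h3 : ∫⁻ x, u x * g x ∂μ ≤ H * lorN p' q' μ g := by
      -- The norming function may be unbounded while the hypothesis covers bounded test functions
      -- only, so g is reached through its truncations.
      have hmono : ∫⁻ x, u x * g x ∂μ = ⨆ N : ℕ, ∫⁻ x, u x * min (g x) N ∂μ := by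
        rw [← lintegral_iSup (f := fun (N : ℕ) x => u x * min (g x) N) (fun N => hu.mul (hg.min measurable_const))]
        · congr 1; ext x
          rw [← ENNReal.mul_iSup]
          congr 1
          refine le_antisymm ?_ (iSup_le fun N => min_le_left _ _)
          rcases eq_or_ne (g x) ∞ with ht | ht
          · simp [ht, ENNReal.iSup_natCast]
          · obtain ⟨N, hN⟩ := ENNReal.exists_nat_gt ht
            exact le_iSup_of_le N (by rw [min_eq_left hN.le])
        · intro i j hij x
          simp only
          gcongr
      rw [hmono]
      refine iSup_le fun N => ?_
      calc _ ≤ ∫⁻ x, f x * min (g x) N ∂μ := by gcongr with x; exact huf x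
        _ ≤ H * lorN p' q' μ (fun x => min (g x) N) :=
          h _ (hg.min measurable_const) ⟨N, fun x => by simp⟩
        _ ≤ _ := by
          gcongr
          exact lorN_mono hq'0 hp.symm.pos fun x => min_le_left _ _
    -- Dividing by the power 1/q' of the sum leaves its power 1/q, the norm. This requires the sum
    -- to be finite, hence the detour through functions u dominated by f.
    have h4 : lorSum p q μ u ≤ C ^ (1 / q') * H * lorSum p q μ u ^ (1 / q') := by
      refine (h1.trans h3).trans ?_
      rw [lorN]
      calc _ ≤ H * (C * lorSum p q μ u) ^ (1 / q') := by gcongr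
        _ = _ := by rw [ENNReal.mul_rpow_of_nonneg _ _ (by positivity)]; ring
    rcases eq_or_ne (lorSum p q μ u) 0 with h0 | h0
    · rw [lorN, h0, ENNReal.zero_rpow_of_pos (by positivity)]; exact zero_le
    · have e : lorSum p q μ u = lorN p q μ u * lorSum p q μ u ^ (1 / q') := by
        rw [lorN, ← ENNReal.rpow_add _ _ h0 hfin]
        have := hq.inv_add_inv_eq_one
        simp only [one_div]
        rw [this, ENNReal.rpow_one]
      rw [e] at h4
      have hne : lorSum p q μ u ^ (1 / q') ≠ 0 := by
        simp [ENNReal.rpow_eq_zero_iff, h0, hfin]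
      have hnt : lorSum p q μ u ^ (1 / q') ≠ ∞ :=
        ENNReal.rpow_ne_top_of_nonneg (by positivity) hfin
      rw [← e] at h4
      nth_rw 1 [e] at h4
      exact (ENNReal.mul_le_mul_iff_left hne hnt).1 h4
  rw [ENNReal.coe_rpow_of_nonneg _ (by positivity)]
  -- Truncations in height and in space have finite norm and increase to f.
  set F : ℕ → X → ℝ≥0∞ := fun N => (spanningSets μ N).indicator fun x => min (f x) N with hF
  refine lorN_le_of_monotone hp.pos hq0 (F := F) ?_ ?_ fun N => key _ ?_ ?_ ?_
  · intro i j hij x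
    simp only [hF]
    refine (indicator_le_indicator_of_subset (monotone_spanningSets μ hij)
      (fun _ => zero_le) x).trans (indicator_le_indicator ?_)
    gcongr
  · refine Eventually.of_forall fun x => ?_
    have hx : x ∈ ⋃ N, spanningSets μ N := by rw [iUnion_spanningSets]; trivial
    obtain ⟨N₀, hN₀⟩ := mem_iUnion.1 hx
    refine le_of_forall_lt fun a ha => ?_
    obtain ⟨N₁, hN₁⟩ := ENNReal.exists_nat_gt (ne_top_of_lt ha)
    refine lt_of_lt_of_le ?_ (le_iSup (fun N => F N x) (max N₀ N₁))
    simp only [hF]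
    rw [indicator_of_mem (monotone_spanningSets μ (le_max_left _ _) hN₀)]
    refine lt_min ha (hN₁.trans_le ?_)
    exact_mod_cast le_max_right N₀ N₁
  · exact (hf.min measurable_const).indicator (measurableSet_spanningSets μ N)
  · intro x
    simp only [hF]
    by_cases hx : x ∈ spanningSets μ N
    · rw [indicator_of_mem hx]; exact min_le_left _ _
    · rw [indicator_of_notMem hx]; exact zero_le
  · refine lorSum_ne_top_of_bdd hp.pos hq0 (measure_spanningSets_lt_top μ N).ne
      (fun x hx => indicator_of_notMem hx _) (M := N) (by simp) (Eventually.of_forall fun x => ?_)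
    simp only [hF]
    by_cases hx : x ∈ spanningSets μ N
    · rw [indicator_of_mem hx]; exact min_le_right _ _
    · rw [indicator_of_notMem hx]; exact zero_le

lemma exists_conj (hp : 1 < p) : ∃ p', p.HolderConjugate p' := ⟨_, Real.HolderConjugate.conjExponent hp⟩

/-- Minkowski's inequality for countable sums, up to a constant. -/
lemma exists_lorN_tsum_le (hp : 1 < p) (hq : 1 < q) :
    ∃ C : ℝ≥0, ∀ {X : Type*} [MeasurableSpace X] (μ : Measure X) [SigmaFinite μ] {ι : Type}
      [Countable ι] (f : ι → X → ℝ≥0∞), (∀ i, AEMeasurable (f i) μ) →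
      lorN p q μ (fun x => ∑' i, f i x) ≤ C * ∑' i, lorN p q μ (f i) := by
  obtain ⟨p', hp'⟩ := exists_conj hp
  obtain ⟨q', hq'⟩ := exists_conj hq
  obtain ⟨C, hC⟩ := exists_lorentz_holder hp' hq'
  obtain ⟨D, hD⟩ := exists_lorN_le_of_forall hp' hq'
  refine ⟨D * C, fun {X} _ μ _ ι _ f hf => ?_⟩
  rw [ENNReal.coe_mul, mul_assoc]
  -- The dual characterization is linear in the function, so a countable triangle inequality holds
  -- with a constant independent of the number of terms, which the quasi-triangle inequality cannot
  -- give.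
  refine hD μ _ _ (AEMeasurable.tsum hf) fun g hg _ => ?_
  simp_rw [← ENNReal.tsum_mul_right]
  rw [lintegral_tsum (f := fun i x => f i x * g x) fun i => (hf i).mul hg.aemeasurable, mul_assoc, ← ENNReal.tsum_mul_right,
    ← ENNReal.tsum_mul_left]
  exact ENNReal.tsum_le_tsum fun i => hC μ _ _ (hf i) hg.aemeasurable

/-! ### Lebesgue spaces -/

lemma lorSum_self (hp : 0 < p) : lorSum p p μ f = ∑' k : ℤ, tp (k * p) * μ {x | tp k < f x} := by
  rw [lorSum]
  congr 1; ext k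
  rw [ENNReal.mul_rpow_of_nonneg _ _ hp.le, tp_rpow, ← ENNReal.rpow_mul, one_div_mul_cancel hp.ne',
    ENNReal.rpow_one]

lemma lorSum_self_eq_lintegral (hp : 0 < p) (hf : Measurable f) :
    lorSum p p μ f = ∫⁻ x, ∑' k : ℤ, (if tp k < f x then tp (k * p) else 0) ∂μ := by
  rw [lorSum_self hp, lintegral_tsum]
  · congr 1; ext k
    rw [← lintegral_indicator_const (measurableSet_lt measurable_const hf)]
    congr 1; ext x
    simp [indicator]
  · exact fun k => (Measurable.ite (measurableSet_lt measurable_const hf) measurable_const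
      measurable_const).aemeasurable

lemma exists_lintegral_rpow_le (hp : 0 < p) : ∃ C : ℝ≥0, ∀ {X : Type*} [MeasurableSpace X]
    (μ : Measure X) (f : X → ℝ≥0∞), AEMeasurable f μ →
      (∫⁻ x, f x ^ p ∂μ) ^ (1 / p) ≤ C * lorN p p μ f := by
  obtain ⟨C, hC⟩ := exists_rpow_le_tsum hp
  refine ⟨C ^ (1 / p), fun μ f hf => ?_⟩
  rw [lorN_congr_ae hf.ae_eq_mk, ENNReal.coe_rpow_of_nonneg _ (by positivity), lorN,
    ← ENNReal.mul_rpow_of_nonneg _ _ (by positivity)]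
  refine ENNReal.rpow_le_rpow ?_ (by positivity)
  rw [lorSum_self_eq_lintegral hp hf.measurable_mk, ← lintegral_const_mul' _ _ (by simp)]
  refine lintegral_mono_ae ?_
  filter_upwards [hf.ae_eq_mk] with x hx
  rw [hx]; exact hC _

end LorentzDuality

/-! ### Dyadic cubes -/

/-- Euclidean space. -/
abbrev Eu (n : ℕ) : Type := EuclideanSpace ℝ (Fin n)

section Dyadic

variable {n : ℕ}

/-- The index of the dyadic cube of generation `j` containing `x`. -/
def idxAt (j : ℤ) (x : Eu n) : DyadicIndex n := (j, fun l => ⌊(2 : ℝ) ^ j * x l⌋)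

/-- The `k`-th ancestor. -/
def anc (k : ℕ) (i : DyadicIndex n) : DyadicIndex n := (i.1 - k, fun l => i.2 l / 2 ^ k)

/-- The neighbours of a cube (including itself). -/
def nb (v : Fin n → Fin 3) (i : DyadicIndex n) : DyadicIndex n :=
  (i.1, fun l => i.2 l + ((v l : ℕ) : ℤ) - 1)

/-- The union of the neighbours of a dyadic cube: the cube dilated by `3`. -/
def tri (i : DyadicIndex n) : Set (Eu n) := {y | ∀ l, |(idxAt i.1 y).2 l - i.2 l| ≤ 1}

/-- The geometry of dyadic cubes is thereby reduced to integer arithmetic: cubes are indexed by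
floors, and passing to an ancestor is integer division by 2^k. -/
lemma mem_dyadicCube_iff {i : DyadicIndex n} {x : Eu n} : x ∈ dyadicCube i ↔ idxAt i.1 x = i := by
  have h2 : (0 : ℝ) < 2 ^ i.1 := by positivity
  have key : ∀ l, ((2 : ℝ) ^ (-i.1) * (i.2 l : ℝ) ≤ x l ∧ x l < (2 : ℝ) ^ (-i.1) * ((i.2 l : ℝ) + 1))
      ↔ ⌊(2 : ℝ) ^ i.1 * x l⌋ = i.2 l := by
    intro l
    rw [Int.floor_eq_iff, zpow_neg]
    constructor
    · rintro ⟨h, h'⟩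
      rw [inv_mul_le_iff₀ h2] at h
      rw [lt_inv_mul_iff₀ h2] at h'
      exact ⟨h, h'⟩
    · rintro ⟨h, h'⟩
      rw [inv_mul_le_iff₀ h2, lt_inv_mul_iff₀ h2]
      exact ⟨h, h'⟩
  constructor
  · intro h
    exact Prod.ext rfl (funext fun l => (key l).1 (h l))
  · intro h l
    exact (key l).2 (congrFun (congrArg Prod.snd h) l)

lemma mem_idxAt (j : ℤ) (x : Eu n) : x ∈ dyadicCube (idxAt j x) := mem_dyadicCube_iff.2 rfl

lemma anc_idxAt (k : ℕ) (j : ℤ) (x : Eu n) : anc k (idxAt j x) = idxAt (j - k) x := by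
  refine Prod.ext rfl (funext fun l => ?_)
  have := Int.floor_div_natCast ((2 : ℝ) ^ j * x l) (2 ^ k)
  simp only [anc, idxAt]
  push_cast at this
  rw [← this]
  congr 1
  rw [zpow_sub₀ (by norm_num), zpow_natCast]; ring

@[simp] lemma anc_zero (i : DyadicIndex n) : anc 0 i = i := by simp [anc]

lemma anc_anc (k l : ℕ) (i : DyadicIndex n) : anc k (anc l i) = anc (l + k) i := by
  refine Prod.ext ?_ (funext fun m => ?_)
  · simp [anc]; ring
  · simp only [anc]
    rw [Int.ediv_ediv_of_nonneg (by positivity), pow_add]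

lemma mem_anc {i : DyadicIndex n} {x : Eu n} (k : ℕ) (h : x ∈ dyadicCube i) :
    x ∈ dyadicCube (anc k i) := by
  rw [mem_dyadicCube_iff] at h ⊢
  conv_rhs => rw [← h]
  rw [anc_idxAt]; rfl

lemma dyadicCube_subset_anc (k : ℕ) (i : DyadicIndex n) : dyadicCube i ⊆ dyadicCube (anc k i) :=
  fun _ h => mem_anc k h

lemma eq_anc_of_mem {i i' : DyadicIndex n} {x : Eu n} (h : x ∈ dyadicCube i)
    (h' : x ∈ dyadicCube i') (hle : i'.1 ≤ i.1) : i' = anc (i.1 - i'.1).toNat i := by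
  rw [mem_dyadicCube_iff] at h h'
  rw [← h, ← h', anc_idxAt]
  congr 1
  simp only [idxAt]; omega

lemma dyadicCube_nonempty (i : DyadicIndex n) : (dyadicCube i).Nonempty :=
  ⟨WithLp.toLp 2 fun l => (2 : ℝ) ^ (-i.1) * (i.2 l : ℝ), fun l => ⟨le_rfl, by
    simp only []; gcongr; linarith⟩⟩

lemma measurableSet_dyadicCube (i : DyadicIndex n) : MeasurableSet (dyadicCube i) := by
  have : dyadicCube i = ⋂ l, {x : Eu n | (2 : ℝ) ^ (-i.1) * (i.2 l : ℝ) ≤ x l} ∩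
      {x : Eu n | x l < (2 : ℝ) ^ (-i.1) * ((i.2 l : ℝ) + 1)} := by
    ext x; simp [dyadicCube]
  rw [this]
  refine MeasurableSet.iInter fun l => ?_
  have hm : Measurable fun x : Eu n => x l := by fun_prop
  exact (measurableSet_le measurable_const hm).inter (measurableSet_lt hm measurable_const)

lemma volume_dyadicCube (i : DyadicIndex n) : volume (dyadicCube i) = tp (-(i.1 * n)) := by
  have h : dyadicCube i = (@WithLp.ofLp 2 (Fin n → ℝ)) ⁻¹' (Set.pi univ fun l =>
      Ico ((2 : ℝ) ^ (-i.1) * (i.2 l : ℝ)) ((2 : ℝ) ^ (-i.1) * ((i.2 l : ℝ) + 1))) := by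
    ext x; simp [dyadicCube]
  rw [h, (PiLp.volume_preserving_ofLp (Fin n)).measure_preimage
    (MeasurableSet.univ_pi fun _ => measurableSet_Ico).nullMeasurableSet, Real.volume_pi_Ico]
  have : ∀ l, (2 : ℝ) ^ (-i.1) * ((i.2 l : ℝ) + 1) - (2 : ℝ) ^ (-i.1) * (i.2 l : ℝ)
      = (2 : ℝ) ^ (-(i.1 : ℝ)) := by
    intro l
    rw [← Int.cast_neg, Real.rpow_intCast]; ring
  simp only [this, Finset.prod_const, Finset.card_univ, Fintype.card_fin]
  rw [← tp_eq_ofReal, ← tp_mul_nat]; congr 1; ring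

lemma volume_dyadicCube_ne_zero (i : DyadicIndex n) : volume (dyadicCube i) ≠ 0 := by
  rw [volume_dyadicCube]; exact tp_ne_zero _

lemma volume_dyadicCube_ne_top (i : DyadicIndex n) : volume (dyadicCube i) ≠ ∞ := by
  rw [volume_dyadicCube]; exact tp_ne_top _

lemma volume_anc (k : ℕ) (i : DyadicIndex n) :
    volume (dyadicCube (anc k i)) = tp (k * n) * volume (dyadicCube i) := by
  rw [volume_dyadicCube, volume_dyadicCube, ← tp_add]
  congr 1; simp only [anc]; push_cast; ring

lemma volume_nb (v : Fin n → Fin 3) (i : DyadicIndex n) :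
    volume (dyadicCube (nb v i)) = volume (dyadicCube i) := by
  rw [volume_dyadicCube, volume_dyadicCube]; rfl

lemma mem_tri_iff {i : DyadicIndex n} {y : Eu n} : y ∈ tri i ↔ ∃ v, y ∈ dyadicCube (nb v i) := by
  constructor
  · intro h
    have h' : ∀ l, -1 ≤ (idxAt i.1 y).2 l - i.2 l ∧ (idxAt i.1 y).2 l - i.2 l ≤ 1 :=
      fun l => abs_le.1 (h l)
    refine ⟨fun l => ⟨((idxAt i.1 y).2 l - i.2 l + 1).toNat, by have := h' l; omega⟩, ?_⟩
    rw [mem_dyadicCube_iff]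
    refine Prod.ext rfl (funext fun l => ?_)
    have := h' l
    simp only [nb]
    omega
  · rintro ⟨v, hv⟩ l
    rw [mem_dyadicCube_iff] at hv
    have : (idxAt i.1 y).2 l = i.2 l + ((v l : ℕ) : ℤ) - 1 := congrFun (congrArg Prod.snd hv) l
    rw [this, abs_le]
    have := (v l).2
    omega

lemma tri_eq (i : DyadicIndex n) : tri i = ⋃ v, dyadicCube (nb v i) := by
  ext y; rw [mem_tri_iff, mem_iUnion]

lemma measurableSet_tri (i : DyadicIndex n) : MeasurableSet (tri i) := by
  rw [tri_eq]; exact MeasurableSet.iUnion fun v => measurableSet_dyadicCube _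

lemma volume_tri_le (i : DyadicIndex n) : volume (tri i) ≤ 3 ^ n * volume (dyadicCube i) := by
  rw [tri_eq]
  refine (measure_iUnion_le _).trans ?_
  simp only [volume_nb, tsum_fintype, Finset.sum_const, Finset.card_univ]
  simp

lemma dyadicCube_subset_tri (i : DyadicIndex n) : dyadicCube i ⊆ tri i := by
  intro x hx l
  rw [mem_dyadicCube_iff.1 hx]; simp

lemma tri_subset_tri_anc (k : ℕ) (i : DyadicIndex n) : tri i ⊆ tri (anc k i) := by
  intro y hy l
  have h := abs_le.1 (hy l)
  have e : (idxAt (anc k i).1 y).2 l = (idxAt i.1 y).2 l / 2 ^ k := by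
    rw [show (anc k i).1 = i.1 - k from rfl, ← anc_idxAt]; rfl
  rw [e]
  simp only [anc]
  have h2 : (0 : ℤ) < 2 ^ k := by positivity
  -- Flooring division by 2^k does not enlarge a gap of at most 1, because a ≤ b + 1 ≤ b + 2^k.
  have key : ∀ a b : ℤ, a ≤ b + 1 → a / 2 ^ k ≤ b / 2 ^ k + 1 := by
    intro a b hab
    calc a / 2 ^ k ≤ (b + 2 ^ k) / 2 ^ k := Int.ediv_le_ediv h2 (by omega)
      _ = _ := by rw [Int.add_ediv_of_dvd_right (dvd_refl _), Int.ediv_self h2.ne']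
  have h3 := key ((idxAt i.1 y).2 l) (i.2 l) (by omega)
  have h4 := key (i.2 l) ((idxAt i.1 y).2 l) (by omega)
  rw [abs_le]; omega

lemma tri_anc_mono (i : DyadicIndex n) {k l : ℕ} (h : k ≤ l) : tri (anc k i) ⊆ tri (anc l i) := by
  obtain ⟨d, rfl⟩ := Nat.exists_eq_add_of_le h
  rw [← anc_anc]; exact tri_subset_tri_anc d _

/-- Dyadic ancestors never leave their orthant, but the tripled ones exhaust the space: for large k,
floor division by 2^k sends any given integer to -1 or 0, so two indices end up at distance at most
1. -/
lemma exists_mem_tri_anc (i : DyadicIndex n) (x : Eu n) : ∃ k, x ∈ tri (anc k i) := by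
  have h1 : ∀ a : ℤ, ∀ᶠ k : ℕ in atTop, -1 ≤ a / 2 ^ k ∧ a / 2 ^ k ≤ 0 := by
    intro a
    filter_upwards [eventually_ge_atTop a.natAbs] with k hk
    have h2 : (0 : ℤ) < 2 ^ k := by positivity
    have h3 : (a.natAbs : ℤ) < 2 ^ k := by
      exact_mod_cast lt_of_le_of_lt hk k.lt_two_pow_self
    constructor
    · rw [Int.le_ediv_iff_mul_le h2]; omega
    · have : a / 2 ^ k < 1 := by rw [Int.ediv_lt_iff_lt_mul h2]; omega
      omega
  have h2 : ∀ᶠ k : ℕ in atTop, ∀ l : Fin n, |(idxAt i.1 x).2 l / 2 ^ k - i.2 l / 2 ^ k| ≤ 1 := by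
    rw [eventually_all]
    intro l
    filter_upwards [h1 ((idxAt i.1 x).2 l), h1 (i.2 l)] with k h3 h4
    rw [abs_le]; omega
  obtain ⟨k, hk⟩ := h2.exists
  refine ⟨k, fun l => ?_⟩
  have e : (idxAt (anc k i).1 x).2 l = (idxAt i.1 x).2 l / 2 ^ k := by
    rw [show (anc k i).1 = i.1 - k from rfl, ← anc_idxAt]; rfl
  rw [e]; exact hk l

/-- The side length of a dyadic cube. -/
def side (i : DyadicIndex n) : ℝ := (2 : ℝ) ^ (-i.1)

lemma side_pos (i : DyadicIndex n) : 0 < side i := by unfold side; positivity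

lemma side_anc (k : ℕ) (i : DyadicIndex n) : side (anc k i) = 2 ^ k * side i := by
  simp only [side, anc]
  rw [← zpow_natCast, ← zpow_add₀ (by norm_num)]; congr 1; ring

lemma abs_sub_le_norm (x y : Eu n) (l : Fin n) : |x l - y l| ≤ ‖x - y‖ := by
  have := PiLp.norm_apply_le (x - y) l
  simpa using this

lemma side_le_norm_sub {i : DyadicIndex n} {x y : Eu n} (hx : x ∉ tri i) (hy : y ∈ dyadicCube i) :
    side i ≤ ‖x - y‖ := by
  simp only [tri, mem_ofPred_eq, not_forall, not_le] at hx
  obtain ⟨l, hl⟩ := hx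
  refine le_trans ?_ (abs_sub_le_norm x y l)
  rw [← mem_dyadicCube_iff.1 hy] at hl
  simp only [idxAt] at hl
  have h2 : (0 : ℝ) < 2 ^ i.1 := by positivity
  -- Floors that differ by at least 2 force their arguments to differ by at least 1, which is one
  -- side length after rescaling.
  have h3 : 1 ≤ |(2 : ℝ) ^ i.1 * x l - 2 ^ i.1 * y l| := by
    set a := (2 : ℝ) ^ i.1 * x l
    set b := (2 : ℝ) ^ i.1 * y l
    have ha := Int.floor_le a
    have ha' := Int.lt_floor_add_one a
    have hb := Int.floor_le b
    have hb' := Int.lt_floor_add_one b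
    rcases lt_abs.1 hl with h | h
    · have : (2 : ℝ) ≤ ⌊a⌋ - ⌊b⌋ := by exact_mod_cast h
      exact le_abs.2 (Or.inl (by linarith))
    · have : (2 : ℝ) ≤ ⌊b⌋ - ⌊a⌋ := by
        have h' : (2 : ℤ) ≤ ⌊b⌋ - ⌊a⌋ := by omega
        exact_mod_cast h'
      exact le_abs.2 (Or.inr (by linarith))
  rw [← mul_sub, abs_mul, abs_of_pos h2] at h3
  rw [side, zpow_neg, inv_le_iff_one_le_mul₀ h2, mul_comm]; exact h3

lemma norm_le_of_forall_abs_le {x : Eu n} {c : ℝ} (hc : 0 ≤ c) (h : ∀ l, |x l| ≤ c) :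
    ‖x‖ ≤ n * c := by
  rw [EuclideanSpace.norm_eq]
  refine Real.sqrt_le_iff.2 ⟨by positivity, ?_⟩
  calc ∑ l, ‖x l‖ ^ 2 ≤ ∑ _l : Fin n, c ^ 2 := by
        gcongr with l _; exact h l
    _ = n * c ^ 2 := by simp
    _ ≤ (n * c) ^ 2 := by
        rw [mul_pow]
        have : (n : ℝ) ≤ n ^ 2 := by
          exact_mod_cast Nat.le_self_pow (by norm_num) n
        gcongr

lemma norm_sub_le_of_mem {i : DyadicIndex n} {x y : Eu n} (hx : x ∈ dyadicCube i)
    (hy : y ∈ dyadicCube i) : ‖x - y‖ ≤ n * side i := by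
  refine norm_le_of_forall_abs_le (side_pos i).le fun l => ?_
  have h1 := hx l
  have h2 := hy l
  simp only [PiLp.sub_apply, side]
  rw [abs_le]; constructor <;> nlinarith

lemma isBounded_dyadicCube (i : DyadicIndex n) : Bornology.IsBounded (dyadicCube i) := by
  obtain ⟨x, hx⟩ := dyadicCube_nonempty i
  refine (Metric.isBounded_iff_subset_closedBall x).2 ⟨n * side i, fun y hy => ?_⟩
  rw [mem_closedBall_iff_norm]; exact norm_sub_le_of_mem hy hx

lemma isBounded_tri (i : DyadicIndex n) : Bornology.IsBounded (tri i) := by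
  rw [tri_eq, Bornology.isBounded_iUnion]; exact fun v => isBounded_dyadicCube _

/-! ### Maximal cubes -/

/-- The maximal elements of a family of dyadic cubes. -/
def maxCubes (𝒞 : Set (DyadicIndex n)) : Set (DyadicIndex n) :=
  {i | i ∈ 𝒞 ∧ ∀ k : ℕ, 0 < k → anc k i ∉ 𝒞}

/-- The lower bound J on the generations leaves only finitely many ancestors in the family, so there
is a largest one. -/
lemma exists_maxCubes {𝒞 : Set (DyadicIndex n)} {J : ℤ} (hJ : ∀ i ∈ 𝒞, J ≤ i.1)
    {i : DyadicIndex n} (hi : i ∈ 𝒞) : ∃ k, anc k i ∈ maxCubes 𝒞 := by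
  classical
  set s : Set ℕ := {k | anc k i ∈ 𝒞} with hs
  have hfin : s.Finite := by
    refine (finite_Iic (i.1 - J).toNat).subset fun k hk => ?_
    have := hJ _ hk
    simp only [anc] at this
    simp only [mem_Iic]; omega
  have hne : s.Nonempty := ⟨0, by simpa [hs] using hi⟩
  obtain ⟨k, hk, hmax⟩ := hfin.exists_maximalFor id s hne
  refine ⟨k, hk, fun l hl h => ?_⟩
  rw [anc_anc] at h
  have := hmax (j := k + l) h (by simp)
  simp at this; omega

lemma disjoint_maxCubes {𝒞 : Set (DyadicIndex n)} {i i' : DyadicIndex n} (hi : i ∈ maxCubes 𝒞)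
    (hi' : i' ∈ maxCubes 𝒞) (hne : i ≠ i') : Disjoint (dyadicCube i) (dyadicCube i') := by
  rw [Set.disjoint_left]
  intro x hx hx'
  wlog hle : i'.1 ≤ i.1 generalizing i i'
  · exact this hi' hi hne.symm hx' hx (by omega)
  have h := eq_anc_of_mem hx hx' hle
  rcases Nat.eq_zero_or_pos (i.1 - i'.1).toNat with h0 | h0
  · rw [h0, anc_zero] at h; exact hne h.symm
  · rw [h] at hi'
    exact hi.2 _ h0 hi'.1

end Dyadic

/-! ### Maximal functions over tripled dyadic cubes and their Lorentz bounds. -/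

section Maximal

variable {n : ℕ} {p q s : ℝ}

/-- The maximal function over (dilated) dyadic cubes. -/
def mx (f : Eu n → ℝ≥0∞) (x : Eu n) : ℝ≥0∞ :=
  ⨆ (i : DyadicIndex n) (_ : x ∈ dyadicCube i), (volume (dyadicCube i))⁻¹ * ∫⁻ y in tri i, f y

lemma le_mx (f : Eu n → ℝ≥0∞) {x : Eu n} {i : DyadicIndex n} (h : x ∈ dyadicCube i) :
    (volume (dyadicCube i))⁻¹ * ∫⁻ y in tri i, f y ≤ mx f x :=
  le_iSup₂_of_le i h le_rfl

lemma lintegral_tri_le (f : Eu n → ℝ≥0∞) (i : DyadicIndex n) :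
    ∫⁻ y in tri i, f y ≤ ∑ v, ∫⁻ y in dyadicCube (nb v i), f y := by
  rw [tri_eq]
  refine (lintegral_iUnion_le _ _).trans ?_
  rw [tsum_fintype]

lemma lt_of_volume_lt (hn : 0 < n) {B : ℝ≥0∞} (hB : B ≠ ∞) :
    ∃ J : ℤ, ∀ i : DyadicIndex n, volume (dyadicCube i) < B → J ≤ i.1 := by
  obtain ⟨K, hK⟩ := exists_lt_tp hB
  refine ⟨-K, fun i hi => ?_⟩
  by_contra h
  rw [volume_dyadicCube] at hi
  have h1 : (K : ℝ) ≤ -(i.1 * n) := by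
    have h2 : i.1 ≤ -K := by omega
    have h3 : i.1 * n ≤ -K := by
      have : (1 : ℤ) ≤ n := by exact_mod_cast hn
      nlinarith
    have h4 : (i.1 : ℝ) * n ≤ -K := by exact_mod_cast h3
    linarith
  exact absurd (hi.trans hK) (not_lt.2 (tp_le_tp h1))

/-- The weak type `(1,1)` inequality. -/
lemma volume_lt_mx_le (hn : 0 < n) (f : Eu n → ℝ≥0∞) {a : ℝ≥0∞} (ha : a ≠ 0) (hat : a ≠ ∞) :
    volume {x | a < mx f x} ≤ 9 ^ n * a⁻¹ * ∫⁻ x, f x := by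
  rcases eq_or_ne (∫⁻ x, f x) ∞ with hf | hf
  · rw [hf, ENNReal.mul_top]
    · exact le_top
    · simp [hat]
  -- The selected cubes have average above 3^{-n} a. One factor 3^n in the final constant comes from
  -- this threshold, the other from the volume of the tripled maximal cubes.
  set 𝒞 : Set (DyadicIndex n) :=
    {i | a * volume (dyadicCube i) < 3 ^ n * ∫⁻ y in dyadicCube i, f y} with h𝒞
  obtain ⟨J, hJ⟩ := lt_of_volume_lt hn (B := a⁻¹ * (3 ^ n * ∫⁻ x, f x))
    (ENNReal.mul_ne_top (by simpa using ha) (ENNReal.mul_ne_top (by simp) hf))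
  have hJ' : ∀ i ∈ 𝒞, J ≤ i.1 := by
    intro i hi
    refine hJ i ?_
    rw [mul_comm, ← div_eq_mul_inv, ENNReal.lt_div_iff_mul_lt (Or.inl ha) (Or.inl hat), mul_comm]
    refine lt_of_lt_of_le hi ?_
    gcongr
    exact Measure.restrict_le_self
  have hsub : {x | a < mx f x} ⊆ ⋃ i : maxCubes 𝒞, tri (i : DyadicIndex n) := by
    intro x hx
    simp only [mem_ofPred_eq, mx, lt_iSup_iff] at hx
    obtain ⟨i, hxi, hi⟩ := hx
    have h1 : a * volume (dyadicCube i) < ∫⁻ y in tri i, f y := by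
      rw [mul_comm, ← div_eq_mul_inv] at hi
      exact (ENNReal.lt_div_iff_mul_lt (Or.inl (volume_dyadicCube_ne_zero i))
        (Or.inl (volume_dyadicCube_ne_top i))).1 hi
    -- Pigeonhole: an average over the tripled cube above a forces one of its 3^n constituents to
    -- carry at least the share 3^{-n}. The point x then lies in the triple of that constituent.
    obtain ⟨v, hv⟩ : ∃ v, nb v i ∈ 𝒞 := by
      by_contra hcon
      push Not at hcon
      have h2 : ∀ v, 3 ^ n * ∫⁻ y in dyadicCube (nb v i), f y ≤ a * volume (dyadicCube i) := by
        intro v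
        have := hcon v
        simp only [h𝒞, mem_ofPred_eq, not_lt, volume_nb] at this
        exact this
      have h3 : 3 ^ n * (a * volume (dyadicCube i)) < 3 ^ n * (a * volume (dyadicCube i)) := by
        calc 3 ^ n * (a * volume (dyadicCube i)) < 3 ^ n * ∫⁻ y in tri i, f y := by
              rw [ENNReal.mul_lt_mul_iff_right (by simp) (by simp)]; exact h1
          _ ≤ 3 ^ n * ∑ v, ∫⁻ y in dyadicCube (nb v i), f y := by
              gcongr; exact lintegral_tri_le f i
          _ ≤ ∑ _v : Fin n → Fin 3, a * volume (dyadicCube i) := by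
              rw [Finset.mul_sum]
              exact Finset.sum_le_sum fun v _ => h2 v
          _ = _ := by simp
      exact lt_irrefl _ h3
    obtain ⟨k, hk⟩ := exists_maxCubes hJ' hv
    refine mem_iUnion.2 ⟨⟨_, hk⟩, tri_subset_tri_anc k _ ?_⟩
    intro l
    rw [show (nb v i).1 = i.1 from rfl, mem_dyadicCube_iff.1 hxi, abs_le]
    simp only [nb]
    have := (v l).2
    omega
  calc volume {x | a < mx f x} ≤ ∑' i : maxCubes 𝒞, volume (tri (i : DyadicIndex n)) :=
        (measure_mono hsub).trans (measure_iUnion_le _)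
    _ ≤ ∑' i : maxCubes 𝒞, 9 ^ n * a⁻¹ * ∫⁻ y in dyadicCube (i : DyadicIndex n), f y := by
        refine ENNReal.tsum_le_tsum fun i => (volume_tri_le _).trans ?_
        have h1 : a * volume (dyadicCube (i : DyadicIndex n)) ≤
          3 ^ n * ∫⁻ y in dyadicCube (i : DyadicIndex n), f y := le_of_lt i.2.1
        calc 3 ^ n * volume (dyadicCube (i : DyadicIndex n))
            = 3 ^ n * (a⁻¹ * (a * volume (dyadicCube (i : DyadicIndex n)))) := by
              rw [← mul_assoc a⁻¹, ENNReal.inv_mul_cancel ha hat, one_mul]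
          _ ≤ 3 ^ n * (a⁻¹ * (3 ^ n * ∫⁻ y in dyadicCube (i : DyadicIndex n), f y)) := by gcongr
          _ = _ := by
              rw [show (9 : ℝ≥0∞) ^ n = 3 ^ n * 3 ^ n by rw [← mul_pow]; norm_num]; ring
    _ = 9 ^ n * a⁻¹ * ∫⁻ y in ⋃ i : maxCubes 𝒞, dyadicCube (i : DyadicIndex n), f y := by
        rw [ENNReal.tsum_mul_left, lintegral_iUnion (fun i => measurableSet_dyadicCube _)]
        intro i j hij
        exact disjoint_maxCubes i.2 j.2 fun h => hij (Subtype.ext h)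
    _ ≤ _ := by gcongr; exact Measure.restrict_le_self

lemma mx_congr_ae {f g : Eu n → ℝ≥0∞} (h : f =ᵐ[volume] g) : mx f = mx g := by
  ext x
  have : ∀ i : DyadicIndex n, ∫⁻ y in tri i, f y = ∫⁻ y in tri i, g y := fun i =>
    lintegral_congr_ae (ae_restrict_of_ae h)
  simp only [mx, this]

lemma mx_add_le {f g : Eu n → ℝ≥0∞} (hf : Measurable f) (x : Eu n) :
    mx (fun x => f x + g x) x ≤ mx f x + mx g x := by
  refine iSup₂_le fun i hi => ?_
  rw [lintegral_add_left hf, mul_add]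
  exact add_le_add (le_mx f hi) (le_mx g hi)

lemma mx_le_of_le {f : Eu n → ℝ≥0∞} {a : ℝ≥0∞} (h : ∀ x, f x ≤ a) (x : Eu n) :
    mx f x ≤ 3 ^ n * a := by
  refine iSup₂_le fun i _ => ?_
  calc _ ≤ (volume (dyadicCube i))⁻¹ * (a * volume (tri i)) := by
        gcongr
        rw [← setLIntegral_const]
        exact lintegral_mono h
    _ ≤ (volume (dyadicCube i))⁻¹ * (a * (3 ^ n * volume (dyadicCube i))) := by
        gcongr; exact volume_tri_le i
    _ = 3 ^ n * a * ((volume (dyadicCube i))⁻¹ * volume (dyadicCube i)) := by ring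
    _ = _ := by
        rw [ENNReal.inv_mul_cancel (volume_dyadicCube_ne_zero i) (volume_dyadicCube_ne_top i),
          mul_one]

lemma rpow_indicator_le_tsum (hs : 0 < s) (k : ℤ) (y : ℝ≥0∞) :
    (if tp k < y then y ^ s else 0) ≤
      ∑' j : ℕ, (if tp (k + j : ℤ) < y then tp ((k + j + 1) * s) else 0) := by
  by_cases hk : tp k < y
  · rw [if_pos hk]
    rcases eq_or_ne y ∞ with rfl | ht
    · refine le_of_le_of_eq le_top (Eq.symm ?_)
      refine top_le_iff.1 ?_
      calc ∞ = ∑' _ : ℕ, tp (k * s) := (ENNReal.tsum_const_eq_top_of_ne_zero (tp_ne_zero _)).symm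
        _ ≤ _ := by
          refine ENNReal.tsum_le_tsum fun j => ?_
          rw [if_pos (tp_ne_top _).lt_top]
          exact tp_le_tp (mul_le_mul_of_nonneg_right
            (by have : (0 : ℝ) ≤ j := by positivity
                linarith) hs.le)
    · obtain ⟨l, hl1, hl2⟩ := exists_tp_lt_le (ne_bot_of_gt hk) ht
      have hkl : k ≤ l := by
        by_contra h
        have : tp (l + 1) ≤ tp k := tp_le_tp (by exact_mod_cast not_le.1 h)
        exact absurd (hk.trans_le hl2) (not_lt.2 this)
      refine le_trans ?_ (ENNReal.le_tsum (l - k).toNat)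
      have e : k + ((l - k).toNat : ℤ) = l := by omega
      have e' : (k : ℝ) + ((l - k).toNat : ℝ) = l := by exact_mod_cast e
      rw [e, e', if_pos hl1, ← tp_rpow]
      exact ENNReal.rpow_le_rpow hl2 hs.le
  · rw [if_neg hk]; exact zero_le

/-- The `s`-maximal function. -/
def mxs (s : ℝ) (f : Eu n → ℝ≥0∞) (x : Eu n) : ℝ≥0∞ := mx (fun y => f y ^ s) x ^ (1 / s)

lemma le_mxs (hs : 0 < s) (f : Eu n → ℝ≥0∞) {x : Eu n} {i : DyadicIndex n}
    (h : x ∈ dyadicCube i) :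
    ((volume (dyadicCube i))⁻¹ * ∫⁻ y in tri i, f y ^ s) ^ (1 / s) ≤ mxs s f x :=
  ENNReal.rpow_le_rpow (le_mx _ h) (by positivity)

/-- The function f^s is cut at height 2^{ks}. The low part contributes at most 3^n 2^{ks} to the
maximal function, and 1 + 3^n ≤ 2^{2n+1} accounts for the shift of the level. The high part is
handled by the weak type inequality and sliced into dyadic levels. -/
lemma volume_lt_mxs_le (hn : 0 < n) (hs : 1 ≤ s) {f : Eu n → ℝ≥0∞} (hf : Measurable f) (k : ℤ) :
    volume {x | tp (k + (2 * n + 1) : ℤ) < mxs s f x} ≤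
      9 ^ n * tp s * ∑' j : ℕ, tp (j * s) * volume {x | tp (k + j : ℤ) < f x} := by
  have hs0 : 0 < s := by linarith
  set f₁ : Eu n → ℝ≥0∞ := fun x => if tp k < f x then f x ^ s else 0 with hf₁
  set f₂ : Eu n → ℝ≥0∞ := fun x => if tp k < f x then 0 else f x ^ s with hf₂
  have hm : Measurable f₁ := Measurable.ite (measurableSet_lt measurable_const hf)
    (hf.pow_const s) measurable_const
  have hsub : {x | tp (k + (2 * n + 1) : ℤ) < mxs s f x} ⊆ {x | tp (k * s) < mx f₁ x} := by
    intro x hx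
    simp only [mem_ofPred_eq] at hx ⊢
    by_contra hcon
    have h1 : mx (fun y => f y ^ s) x ≤ mx f₁ x + mx f₂ x := by
      have : (fun y => f y ^ s) = fun y => f₁ y + f₂ y := by
        ext y; simp only [hf₁, hf₂]; split_ifs <;> simp
      rw [this]; exact mx_add_le hm x
    have h2 : mx f₂ x ≤ 3 ^ n * tp (k * s) := by
      refine mx_le_of_le (fun y => ?_) x
      simp only [hf₂]; split_ifs with h
      · exact zero_le
      · rw [← tp_rpow]; exact ENNReal.rpow_le_rpow (not_lt.1 h) hs0.le
    have h3 : mx (fun y => f y ^ s) x ≤ tp ((k + (2 * n + 1) : ℤ) * s) := by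
      calc _ ≤ tp (k * s) + 3 ^ n * tp (k * s) := h1.trans (add_le_add (not_lt.1 hcon) h2)
        _ = (1 + 3 ^ n) * tp (k * s) := by ring
        _ ≤ tp (2 * n + 1) * tp (k * s) := by
            gcongr
            rw [show (2 * (n : ℝ) + 1) = ((2 * n + 1 : ℕ) : ℝ) by push_cast; ring, tp_nat, pow_succ,
              pow_mul, mul_two]
            gcongr
            · exact one_le_pow₀ (by norm_num)
            · norm_num
        _ ≤ _ := by
            rw [← tp_add]; apply tp_le_tp; push_cast
            have : (0 : ℝ) ≤ n := by positivity
            nlinarith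
    have h4 : mxs s f x ≤ tp (k + (2 * n + 1) : ℤ) := by
      calc mxs s f x ≤ tp ((k + (2 * n + 1) : ℤ) * s) ^ (1 / s) :=
            ENNReal.rpow_le_rpow h3 (by positivity)
        _ = _ := by rw [tp_rpow, mul_assoc, mul_one_div_cancel hs0.ne', mul_one]
    exact absurd hx (not_lt.2 h4)
  refine (measure_mono hsub).trans ((volume_lt_mx_le hn f₁ (tp_ne_zero _) (tp_ne_top _)).trans ?_)
  rw [mul_assoc, mul_assoc]
  refine mul_le_mul' le_rfl ?_
  calc (tp (k * s))⁻¹ * ∫⁻ x, f₁ x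
      ≤ (tp (k * s))⁻¹ * ∫⁻ x, ∑' j : ℕ, (if tp (k + j : ℤ) < f x then tp ((k + j + 1) * s) else 0) := by
        gcongr with x
        exact rpow_indicator_le_tsum hs0 k (f x)
    _ = (tp (k * s))⁻¹ * ∑' j : ℕ, tp ((k + j + 1) * s) * volume {x | tp (k + j : ℤ) < f x} := by
        rw [lintegral_tsum]
        · congr 2; ext j
          rw [← lintegral_indicator_const (measurableSet_lt measurable_const hf)]
          congr 1; ext x; simp [indicator]
        · exact fun j => (Measurable.ite (measurableSet_lt measurable_const hf) measurable_const
            measurable_const).aemeasurable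
    _ = _ := by
        rw [← ENNReal.tsum_mul_left, ← ENNReal.tsum_mul_left]
        congr 1; ext j
        rw [← mul_assoc, ← mul_assoc, tp_inv, ← tp_add, ← tp_add]
        congr 2; ring

/-- Boundedness of the `s`-maximal function on Lorentz spaces. -/
lemma exists_lorN_mxs_le (hn : 0 < n) (hs : 1 ≤ s) (hsp : s < p) (hq : 0 < q) :
    ∃ C : ℝ≥0, ∀ f : Eu n → ℝ≥0∞, AEMeasurable f →
      lorN p q volume (mxs s f) ≤ C * lorN p q volume f := by
  have hp : 0 < p := by linarith
  -- Writing 2^{js} = 2^{-εj} 2^{jp} isolates the geometric decay that makes the sum over higher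
  -- levels a bounded convolution.
  set ε := p - s with hε
  have hε0 : 0 < ε := by simp only [hε]; linarith
  obtain ⟨C, hC⟩ := exists_geom_rpow (q := 1 / p) hε0 (by positivity)
  obtain ⟨D, hD⟩ := exists_conv (ε := ε / 2 * (1 / p)) (q := q) (by positivity) hq
  set A : ℝ≥0 := tpn (2 * n + 1) * ((9 ^ n * tpn s) ^ (1 / p) * C) with hA
  refine ⟨A * D ^ (1 / q), fun f₀ hf₀ => ?_⟩
  set f := hf₀.mk f₀
  have hf : Measurable f := hf₀.measurable_mk
  have hmm : mxs s f₀ = mxs s f := by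
    have : mx (fun y => f₀ y ^ s) = mx fun y => f y ^ s := mx_congr_ae (by
      filter_upwards [hf₀.ae_eq_mk] with y hy
      rw [hy])
    funext x; rw [mxs, mxs, this]
  rw [hmm, lorN_congr_ae hf₀.ae_eq_mk]
  set φ : ℤ → ℝ≥0∞ := fun k => tp k * volume {x | tp k < f x} ^ (1 / p) with hφ
  have h1 : ∀ k : ℤ, tp (k + (2 * n + 1) : ℤ) *
      volume {x | tp (k + (2 * n + 1) : ℤ) < mxs s f x} ^ (1 / p) ≤
      A * ∑' j : ℕ, tp (-(ε / 2 * (1 / p) * j)) * φ (k + j) := by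
    intro k
    have h2 : (∑' j : ℕ, tp (j * s) * volume {x | tp (k + j : ℤ) < f x}) ^ (1 / p) ≤
        C * ∑' j : ℕ, tp (-(ε / 2 * (1 / p) * j)) * (tp j * volume {x | tp (k + j : ℤ) < f x} ^ (1 / p)) := by
      have := hC fun j => tp (j * p) * volume {x | tp (k + j : ℤ) < f x}
      refine le_trans (le_of_eq ?_) (this.trans (le_of_eq ?_))
      · congr 2; ext j; rw [← mul_assoc, ← tp_add]; congr 2; simp only [hε]; ring
      · congr 2; ext j
        rw [ENNReal.mul_rpow_of_nonneg _ _ (by positivity), tp_rpow]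
        congr 3; field_simp
    calc _ ≤ tp (k + (2 * n + 1) : ℤ) * (9 ^ n * tp s *
          ∑' j : ℕ, tp (j * s) * volume {x | tp (k + j : ℤ) < f x}) ^ (1 / p) := by
          gcongr; exact volume_lt_mxs_le hn hs hf k
      _ ≤ tp (k + (2 * n + 1) : ℤ) * ((9 ^ n * tp s) ^ (1 / p) * (C *
            ∑' j : ℕ, tp (-(ε / 2 * (1 / p) * j)) * (tp j * volume {x | tp (k + j : ℤ) < f x} ^ (1 / p)))) := by
          rw [ENNReal.mul_rpow_of_nonneg _ _ (by positivity)]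
          gcongr
      _ = A * (tp k * ∑' j : ℕ, tp (-(ε / 2 * (1 / p) * j)) * (tp j * volume {x | tp (k + j : ℤ) < f x} ^ (1 / p))) := by
          rw [hA]; push_cast
          rw [coe_tpn, ENNReal.coe_rpow_of_nonneg _ (by positivity)]; push_cast
          rw [coe_tpn, tp_add]; ring
      _ = _ := by
          rw [← ENNReal.tsum_mul_left]
          congr 2; ext j
          simp only [hφ]; push_cast; rw [tp_add]; ring
  have h3 : lorSum p q volume (mxs s f) ≤ A ^ q * (D * lorSum p q volume f) := by
    rw [lorSum, ← (Equiv.addRight ((2 * n + 1 : ℤ))).tsum_eq]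
    simp only [Equiv.coe_addRight]
    calc _ ≤ ∑' k : ℤ, (A * ∑' j : ℕ, tp (-(ε / 2 * (1 / p) * j)) * φ (k + j)) ^ q :=
          ENNReal.tsum_le_tsum fun k => ENNReal.rpow_le_rpow (h1 k) hq.le
      _ = A ^ q * ∑' k : ℤ, (∑' j : ℕ, tp (-(ε / 2 * (1 / p) * j)) * φ (k + j)) ^ q := by
          rw [← ENNReal.tsum_mul_left]
          congr 1; ext k; rw [ENNReal.mul_rpow_of_nonneg _ _ hq.le]
      _ ≤ _ := by gcongr; exact hD φ
  calc lorN p q volume (mxs s f) ≤ (A ^ q * (D * lorSum p q volume f)) ^ (1 / q) :=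
        ENNReal.rpow_le_rpow h3 (by positivity)
    _ = _ := by
        rw [ENNReal.mul_rpow_of_nonneg _ _ (by positivity), ENNReal.mul_rpow_of_nonneg _ _ (by positivity),
          ← ENNReal.rpow_mul, mul_one_div_cancel hq.ne', ENNReal.rpow_one, lorN]
        push_cast
        rw [ENNReal.coe_rpow_of_nonneg _ (by positivity), mul_assoc]

lemma le_lorN {X : Type*} [MeasurableSpace X] {μ : Measure X} {f : X → ℝ≥0∞} (hq : 0 < q) (k : ℤ) :
    tp k * μ {x | tp k < f x} ^ (1 / p) ≤ lorN p q μ f := by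
  calc _ = ((tp k * μ {x | tp k < f x} ^ (1 / p)) ^ q) ^ (1 / q) := by
        rw [← ENNReal.rpow_mul, mul_one_div_cancel hq.ne', ENNReal.rpow_one]
    _ ≤ _ := ENNReal.rpow_le_rpow
      (ENNReal.le_tsum (f := fun k : ℤ => (tp k * μ {x | tp k < f x} ^ (1 / p)) ^ q) k) (by positivity)

/-- Chebyshev's inequality: Q lies in {f > 2^k} for every power 2^k < a, and rounding a down to a
power of two costs the factor 2. -/
lemma mul_le_lorN {X : Type*} [MeasurableSpace X] {μ : Measure X} {f : X → ℝ≥0∞} (hp : 0 < p)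
    (hq : 0 < q) {Q : Set X} {a : ℝ≥0∞} (h : ∀ x ∈ Q, a ≤ f x) :
    a * μ Q ^ (1 / p) ≤ 2 * lorN p q μ f := by
  have key : ∀ k : ℤ, tp k < a → tp k * μ Q ^ (1 / p) ≤ lorN p q μ f := fun k hk =>
    le_trans (by gcongr; exact fun x hx => lt_of_lt_of_le hk (h x hx)) (le_lorN (p := p) hq k)
  rcases eq_or_ne a 0 with rfl | h0
  · simp
  rcases eq_or_ne a ∞ with rfl | ht
  · rcases eq_or_ne (μ Q) 0 with hQ | hQ
    · simp [hQ, hp]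
    suffices lorN p q μ f = ∞ by rw [this]; simp
    refine top_le_iff.1 ?_
    have hB : μ Q ^ (1 / p) ≠ 0 := by
      simp only [ne_eq, ENNReal.rpow_eq_zero_iff, hQ, false_and, false_or, not_and, not_lt]
      intro _; positivity
    refine le_of_forall_lt fun b hb => ?_
    obtain ⟨K, hK⟩ := exists_lt_tp (y := b / μ Q ^ (1 / p)) (ENNReal.div_ne_top hb.ne hB)
    refine lt_of_lt_of_le ?_ (key K (tp_ne_top _).lt_top)
    rcases eq_or_ne (μ Q ^ (1 / p)) ∞ with hBt | hBt
    · rw [hBt, ENNReal.mul_top (tp_ne_zero _)]; exact hb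
    · exact (ENNReal.div_lt_iff (Or.inl hB) (Or.inl hBt)).1 (by exact_mod_cast hK)
  · obtain ⟨k, hk1, hk2⟩ := exists_tp_lt_le h0 ht
    calc a * μ Q ^ (1 / p) ≤ tp (k + 1) * μ Q ^ (1 / p) := by gcongr
      _ = 2 * (tp k * μ Q ^ (1 / p)) := by rw [tp_add, tp_one]; ring
      _ ≤ _ := by gcongr; exact key k hk1

/-- Averages are controlled by the Lorentz norm. -/
lemma exists_average_le (hn : 0 < n) (hs : 1 ≤ s) (hsp : s < p) (hq : 0 < q) :
    ∃ C : ℝ≥0, ∀ (f : Eu n → ℝ≥0∞) (i : DyadicIndex n), AEMeasurable f →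
      ((volume (dyadicCube i))⁻¹ * ∫⁻ y in tri i, f y ^ s) ^ (1 / s) *
        volume (dyadicCube i) ^ (1 / p) ≤ C * lorN p q volume f := by
  obtain ⟨C, hC⟩ := exists_lorN_mxs_le hn hs hsp hq
  refine ⟨2 * C, fun f i hf => ?_⟩
  calc _ ≤ 2 * lorN p q volume (mxs s f) :=
        mul_le_lorN (by linarith) hq fun x hx => le_mxs (by linarith) f hx
    _ ≤ 2 * (C * lorN p q volume f) := by gcongr; exact hC f hf
    _ = _ := by push_cast; ring

end Maximal

/-! ### Good-λ inequalities and the local Fefferman–Stein inequality. -/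

section Sharp

variable {n : ℕ} {p q s : ℝ}

lemma add_rpow_le {θ : ℝ} (hθ : 0 < θ) (x y : ℝ≥0∞) : (x + y) ^ θ ≤ tp θ * (x ^ θ + y ^ θ) := by
  calc (x + y) ^ θ ≤ (2 * max x y) ^ θ := by
        gcongr; rw [two_mul]; exact add_le_add (le_max_left _ _) (le_max_right _ _)
    _ = tp θ * max x y ^ θ := by rw [ENNReal.mul_rpow_of_nonneg _ _ hθ.le]; rfl
    _ ≤ _ := by
        gcongr
        rcases le_total x y with h | h
        · rw [max_eq_right h]; exact le_add_self
        · rw [max_eq_left h]; exact le_self_add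

/-- Absorption of a good-`λ` inequality. -/
lemma exists_absorb (hp : 0 < p) (hq : 0 < q) (d : ℕ) (c : ℝ≥0) : ∃ C : ℝ≥0,
    ∀ (a b : ℤ → ℝ≥0∞) (V A : ℝ≥0∞), (∀ k, a k ≤ V) → V ≠ ∞ → A ≠ ∞ →
      (∀ (k : ℤ) (m : ℕ), A ≤ tp k → a (k + d) ≤ c * tp (-m) * a k + b (k - m)) →
      ∑' k : ℤ, (tp k * a k ^ (1 / p)) ^ q ≤
        C * (∑' k : ℤ, (tp k * b k ^ (1 / p)) ^ q + (A * V ^ (1 / p)) ^ q) := by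
  have hθ : 0 < q / p := by positivity
  set W : ℝ≥0∞ := tp (d * q) * tp (q / p) * (c : ℝ≥0∞) ^ (q / p) with hW
  have hWt : W ≠ ∞ := ENNReal.mul_ne_top (ENNReal.mul_ne_top (tp_ne_top _) (tp_ne_top _))
    (ENNReal.rpow_ne_top_of_nonneg hθ.le ENNReal.coe_ne_top)
  obtain ⟨K, hK⟩ := exists_lt_tp hWt
  -- W collects the constants in front of the term to be absorbed. This m makes W 2^{-m q/p} at most
  -- 1/2.
  obtain ⟨m, hm⟩ := exists_nat_ge ((K + 1) / (q / p))
  have hWm : W * tp (-m * (q / p)) ≤ tp (-1) := by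
    calc W * tp (-m * (q / p)) ≤ tp K * tp (-m * (q / p)) := by gcongr
      _ = tp (K + -m * (q / p)) := (tp_add _ _).symm
      _ ≤ tp (-1) := by
          apply tp_le_tp
          rw [div_le_iff₀ hθ] at hm
          linarith
  obtain ⟨G, hG⟩ := exists_tsum_le_rpow hq
  refine ⟨2 * (tpn (d * q) * tpn (q / p) * tpn (m * q) + G * tpn (d * q)), ?_⟩
  intro a b V A haV hV hA h
  set B := ∑' k : ℤ, (tp k * b k ^ (1 / p)) ^ q with hB
  have e : ∀ (x : ℝ≥0∞) (k : ℤ), (tp k * x ^ (1 / p)) ^ q = tp (k * q) * x ^ (q / p) := by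
    intro x k
    rw [ENNReal.mul_rpow_of_nonneg _ _ hq.le, tp_rpow, ← ENNReal.rpow_mul,
      show 1 / p * q = q / p by ring]
  set φ : ℤ → ℝ≥0∞ := fun k => (tp k * a k ^ (1 / p)) ^ q with hφ
  -- one step
  have step : ∀ k : ℤ, φ (k + d) ≤ tp (-1) * φ k +
      (tpn (d * q) * tpn (q / p) * tpn (m * q) : ℝ≥0) *
        (tp (k - m : ℤ) * b (k - m) ^ (1 / p)) ^ q +
      (if tp (k + d : ℤ) ≤ tp d * A then tp ((k + d : ℤ) * q) else 0) * V ^ (q / p) := by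
    intro k
    rcases le_or_gt A (tp k) with hAk | hAk
    · refine le_trans ?_ le_self_add
      simp only [hφ]
      rw [e, e, e]
      calc tp ((k + d : ℤ) * q) * a (k + d) ^ (q / p)
          ≤ tp ((k + d : ℤ) * q) * (c * tp (-m) * a k + b (k - m)) ^ (q / p) := by
            gcongr; exact h k m hAk
        _ ≤ tp ((k + d : ℤ) * q) * (tp (q / p) * ((c * tp (-m) * a k) ^ (q / p) +
              b (k - m) ^ (q / p))) := by
            gcongr; exact add_rpow_le hθ _ _
        _ = (W * tp (-m * (q / p))) * (tp (k * q) * a k ^ (q / p)) +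
              tp (d * q) * tp (q / p) * tp (m * q) * (tp ((k - m : ℤ) * q) * b (k - m) ^ (q / p)) := by
            rw [ENNReal.mul_rpow_of_nonneg _ _ hθ.le, ENNReal.mul_rpow_of_nonneg _ _ hθ.le, tp_rpow,
              hW, show ((k + d : ℤ) * q) = k * q + d * q by push_cast; ring, tp_add,
              show tp (k * q) = tp (m * q) * tp ((k - m : ℤ) * q) by
                rw [← tp_add]; congr 1; push_cast; ring]
            ring
        _ ≤ _ := by
            push_cast
            simp only [coe_tpn]
            gcongr
    -- Below the height A no good-λ inequality is available; there the trivial bound by V is used,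
    -- and the geometric sum over these levels gives (A V^{1/p})^q.
    · refine le_trans ?_ le_add_self
      have h1 : tp (k + d : ℤ) ≤ tp d * A := by
        push_cast; rw [add_comm, tp_add]; gcongr
      rw [if_pos h1]
      simp only [hφ]
      rw [e]; gcongr; exact haV _
  -- truncated sums
  have trunc : ∀ N : ℤ, ∑' k : ℤ, (if k ≤ N then φ k else 0) ≤
      (2 * (tpn (d * q) * tpn (q / p) * tpn (m * q) + G * tpn (d * q)) : ℝ≥0) *
        (B + (A * V ^ (1 / p)) ^ q) := by
    intro N
    set S := ∑' k : ℤ, (if k ≤ N then φ k else 0) with hS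
    -- The truncation at N together with the bound by V makes S finite, so half of it may be
    -- subtracted from both sides. No a priori finiteness of the full sum is required.
    have hSfin : S ≠ ∞ := by
      obtain ⟨D, hD⟩ := exists_tsum_tp_le hq
      have : S ≤ (D * tp (N * q)) * V ^ (q / p) := by
        rw [← hD, ← ENNReal.tsum_mul_right]
        refine ENNReal.tsum_le_tsum fun k => ?_
        split_ifs
        · simp only [hφ]; rw [e]; gcongr; exact haV _
        · simp
      refine ne_top_of_le_ne_top ?_ this
      exact ENNReal.mul_ne_top (ENNReal.mul_ne_top ENNReal.coe_ne_top (tp_ne_top _))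
        (ENNReal.rpow_ne_top_of_nonneg hθ.le hV)
    set Y : ℝ≥0∞ := (tpn (d * q) * tpn (q / p) * tpn (m * q) : ℝ≥0) * B +
        G * (tp d * A) ^ q * V ^ (q / p) with hY
    have h1 : S ≤ tp (-1) * S + Y := by
      calc S = ∑' k : ℤ, (if k + d ≤ N then φ (k + d) else 0) := by
            rw [hS, ← (Equiv.addRight (d : ℤ)).tsum_eq]; rfl
        _ ≤ ∑' k : ℤ, (tp (-1) * (if k ≤ N then φ k else 0) +
              (tpn (d * q) * tpn (q / p) * tpn (m * q) : ℝ≥0) *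
                (tp (k - m : ℤ) * b (k - m) ^ (1 / p)) ^ q +
              (if tp (k + d : ℤ) ≤ tp d * A then tp ((k + d : ℤ) * q) else 0) * V ^ (q / p)) := by
            refine ENNReal.tsum_le_tsum fun k => ?_
            by_cases hk : k + d ≤ N
            · rw [if_pos hk, if_pos (by omega : k ≤ N)]; exact step k
            · rw [if_neg hk]; exact zero_le
        _ = tp (-1) * S + (tpn (d * q) * tpn (q / p) * tpn (m * q) : ℝ≥0) * B +
              (∑' k : ℤ, (if tp k ≤ tp d * A then tp (k * q) else 0)) * V ^ (q / p) := by
            rw [ENNReal.tsum_add, ENNReal.tsum_add, ENNReal.tsum_mul_left, ENNReal.tsum_mul_left,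
              ENNReal.tsum_mul_right]
            congr 2
            · congr 1
              exact (Equiv.subRight (m : ℤ)).tsum_eq (fun k => (tp k * b k ^ (1 / p)) ^ q)
            · exact (Equiv.addRight (d : ℤ)).tsum_eq
                (fun k => if tp k ≤ tp d * A then tp (k * q) else 0)
        _ ≤ _ := by
            rw [hY, add_assoc]
            gcongr; exact hG _
    have h2 : S ≤ 2 * Y := by
      have h3 : S + S ≤ S + 2 * Y := by
        calc S + S = 2 * S := (two_mul S).symm
          _ ≤ 2 * (tp (-1) * S + Y) := by gcongr
          _ = S + 2 * Y := by
            rw [mul_add, ← mul_assoc, ← tp_one, tp_mul_tp_neg, one_mul]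
      exact (ENNReal.add_le_add_iff_left hSfin).1 h3
    refine h2.trans ?_
    rw [hY]; push_cast
    rw [mul_assoc 2]
    refine mul_le_mul' le_rfl ?_
    rw [ENNReal.mul_rpow_of_nonneg _ _ hq.le, ENNReal.mul_rpow_of_nonneg _ _ hq.le, tp_rpow,
      ← ENNReal.rpow_mul, show 1 / p * q = q / p by ring]
    simp only [coe_tpn]
    rw [add_mul, mul_add, mul_add]
    refine add_le_add le_self_add ?_
    refine le_trans (le_of_eq ?_) le_add_self
    ring
  rw [ENNReal.tsum_eq_iSup_sum]
  refine iSup_le fun t => ?_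
  obtain ⟨N, hN⟩ := t.exists_le
  refine le_trans ?_ (trunc N)
  refine le_trans (le_of_eq ?_) (ENNReal.sum_le_tsum t)
  exact Finset.sum_congr rfl fun k hk => by rw [if_pos (hN k hk)]

/-- Lebesgue differentiation along dyadic cubes. -/
lemma ae_enorm_le_iSup (hn : 0 < n) {F : Eu n → ℂ} (hF : LocallyIntegrable F volume) :
    ∀ᵐ x : Eu n, ∀ J : ℤ, ‖F x‖ₑ ≤ ⨆ (j : ℤ) (_ : J ≤ j),
      (volume (dyadicCube (idxAt j x)))⁻¹ * ∫⁻ y in dyadicCube (idxAt j x), ‖F y‖ₑ := by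
  filter_upwards [IsUnifLocDoublingMeasure.ae_tendsto_average_norm_sub
    (volume : Measure (Eu n)) hF 1] with x hx J
  -- The radius bounds the diameter of dyadic cubes of generation J + j, so the ball around x
  -- contains the cube of that generation at x, and their volumes are comparable.
  set δ : ℕ → ℝ := fun j => n * (2 : ℝ) ^ (-(J + j)) with hδ
  have hδpos : ∀ j, 0 < δ j := fun j => by
    have : (0 : ℝ) < n := by exact_mod_cast hn
    simp only [hδ]; positivity
  have hδ0 : Tendsto δ atTop (𝓝[>] 0) := by
    rw [tendsto_nhdsWithin_iff]
    refine ⟨?_, Eventually.of_forall hδpos⟩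
    have h1 : ∀ j : ℕ, δ j = (n * (2 : ℝ) ^ (-J)) * (1 / 2) ^ j := by
      intro j
      rw [hδ]
      simp only []
      rw [neg_add, zpow_add₀ (by norm_num), zpow_neg _ (j : ℤ), zpow_natCast]
      simp only [one_div, inv_pow]; ring
    rw [show δ = fun j : ℕ => (n * (2 : ℝ) ^ (-J)) * (1 / 2) ^ j from funext h1]
    simpa using (tendsto_pow_atTop_nhds_zero_of_lt_one (by norm_num : (0 : ℝ) ≤ 1 / 2)
      (by norm_num)).const_mul (n * (2 : ℝ) ^ (-J))
  have hlim := hx (fun _ => x) δ hδ0 (Eventually.of_forall fun j => by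
    simpa using (hδpos j).le)
  -- the averages over cubes
  set Q : ℕ → Set (Eu n) := fun j => dyadicCube (idxAt (J + j) x) with hQ
  obtain ⟨c, hc⟩ : ∃ c : ℝ≥0, ∀ j, volume (Metric.closedBall x (δ j)) ≤ c * volume (Q j) := by
    refine ⟨(ENNReal.ofReal ((n : ℝ) ^ n) * volume (Metric.ball (0 : Eu n) 1)).toNNReal, fun j => ?_⟩
    rw [ENNReal.coe_toNNReal (ENNReal.mul_ne_top ENNReal.ofReal_ne_top measure_ball_lt_top.ne),
      Measure.addHaar_closedBall _ _ (hδpos j).le]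
    simp only [hQ, volume_dyadicCube, finrank_euclideanSpace, Fintype.card_fin, idxAt]
    rw [hδ, mul_pow, ENNReal.ofReal_mul (by positivity), mul_right_comm]
    gcongr
    rw [tp_eq_ofReal]
    refine ENNReal.ofReal_le_ofReal (le_of_eq ?_)
    rw [← Real.rpow_intCast, ← Real.rpow_mul_natCast (by norm_num)]
    congr 1; push_cast; ring
  have hT : Tendsto (fun j => (volume (Q j))⁻¹ * ∫⁻ y in Q j, ‖F y - F x‖ₑ) atTop (𝓝 0) := by
    have hlim2 : Tendsto (fun j => c * ENNReal.ofReal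
        (⨍ y in Metric.closedBall x (δ j), ‖F y - F x‖)) atTop (𝓝 0) := by
      have := ENNReal.Tendsto.const_mul (a := (c : ℝ≥0∞)) (ENNReal.tendsto_ofReal hlim)
        (Or.inr ENNReal.coe_ne_top)
      simpa using this
    refine tendsto_of_tendsto_of_tendsto_of_le_of_le tendsto_const_nhds hlim2
      (fun _ => zero_le) fun j => ?_
    simp only
    have hint : IntegrableOn (fun y => F y - F x) (Metric.closedBall x (δ j)) :=
      (hF.integrableOn_isCompact (isCompact_closedBall x _)).sub
        (integrableOn_const (measure_closedBall_lt_top.ne))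
    have hB0 : volume (Metric.closedBall x (δ j)) ≠ 0 :=
      (Metric.measure_closedBall_pos _ _ (hδpos j)).ne'
    have hBt : volume (Metric.closedBall x (δ j)) ≠ ∞ := measure_closedBall_lt_top.ne
    rw [setAverage_eq, smul_eq_mul, ENNReal.ofReal_mul (by positivity),
      ofReal_integral_norm_eq_lintegral_enorm hint, Measure.real,
      ENNReal.ofReal_inv_of_pos (ENNReal.toReal_pos hB0 hBt), ENNReal.ofReal_toReal hBt, ← mul_assoc]
    gcongr
    · rw [← ENNReal.inv_le_inv, inv_inv]
      rw [ENNReal.mul_inv (Or.inr (by simpa using hB0)) (Or.inr (by simpa using hBt)), inv_inv]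
      rcases eq_or_ne c 0 with h0 | h0
      · have := hc j; rw [h0] at this
        simp only [ENNReal.coe_zero, zero_mul, nonpos_iff_eq_zero] at this
        exact absurd this hB0
      · rw [mul_comm, ← div_eq_mul_inv]
        exact ENNReal.div_le_of_le_mul' (hc j)
    · intro y hy
      rw [mem_closedBall_iff_norm]
      exact norm_sub_le_of_mem hy (mem_idxAt _ x)
  refine ENNReal.le_of_forall_pos_le_add fun ε hε _ => ?_
  obtain ⟨j, hj⟩ := ((hT.eventually_lt_const (by simpa using hε : (0 : ℝ≥0∞) < ε))).exists
  have hQ0 := volume_dyadicCube_ne_zero (idxAt (J + j) x)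
  have hQt := volume_dyadicCube_ne_top (idxAt (J + j) x)
  calc ‖F x‖ₑ = (volume (Q j))⁻¹ * ∫⁻ y in Q j, ‖F x‖ₑ := by
        rw [setLIntegral_const, mul_comm ‖F x‖ₑ, ← mul_assoc, ENNReal.inv_mul_cancel hQ0 hQt, one_mul]
    _ ≤ (volume (Q j))⁻¹ * ∫⁻ y in Q j, (‖F y‖ₑ + ‖F y - F x‖ₑ) := by
        gcongr with y
        calc ‖F x‖ₑ = ‖F y - (F y - F x)‖ₑ := by congr 1; ring
          _ ≤ _ := enorm_sub_le
    _ = (volume (Q j))⁻¹ * (∫⁻ y in Q j, ‖F y‖ₑ) +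
          (volume (Q j))⁻¹ * ∫⁻ y in Q j, ‖F y - F x‖ₑ := by
        rw [lintegral_add_left', mul_add]
        exact (hF.aestronglyMeasurable.enorm).restrict
    _ ≤ _ := by
        refine add_le_add ?_ hj.le
        exact le_iSup₂_of_le (J + j) (by omega) le_rfl

end Sharp

section Sharp

variable {n : ℕ} {p q s : ℝ}

/-- The local dyadic maximal function relative to the cube `i₀`. -/
def mxLoc (i₀ : DyadicIndex n) (f : Eu n → ℝ≥0∞) (x : Eu n) : ℝ≥0∞ :=
  ⨆ (i : DyadicIndex n) (_ : (∃ k, anc k i = i₀) ∧ x ∈ dyadicCube i),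
    (volume (dyadicCube i))⁻¹ * ∫⁻ y in dyadicCube i, f y

lemma mem_of_lt_mxLoc {i₀ : DyadicIndex n} {f : Eu n → ℝ≥0∞} {x : Eu n} {a : ℝ≥0∞}
    (h : a < mxLoc i₀ f x) : ∃ i : DyadicIndex n, (∃ k, anc k i = i₀) ∧ x ∈ dyadicCube i ∧
      a * volume (dyadicCube i) < ∫⁻ y in dyadicCube i, f y := by
  simp only [mxLoc, lt_iSup_iff] at h
  obtain ⟨i, hi, h⟩ := h
  refine ⟨i, hi.1, hi.2, ?_⟩
  rw [mul_comm, ← div_eq_mul_inv] at h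
  exact (ENNReal.lt_div_iff_mul_lt (Or.inl (volume_dyadicCube_ne_zero i))
        (Or.inl (volume_dyadicCube_ne_top i))).1 h

lemma lt_mxLoc {i₀ i : DyadicIndex n} {f : Eu n → ℝ≥0∞} {x : Eu n} {a : ℝ≥0∞}
    (hi : ∃ k, anc k i = i₀) (hx : x ∈ dyadicCube i)
    (h : a * volume (dyadicCube i) < ∫⁻ y in dyadicCube i, f y) : a < mxLoc i₀ f x := by
  refine lt_of_lt_of_le ?_ (le_iSup₂_of_le i ⟨hi, hx⟩ le_rfl)
  rw [mul_comm, ← div_eq_mul_inv]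
  exact (ENNReal.lt_div_iff_mul_lt (Or.inl (volume_dyadicCube_ne_zero i))
        (Or.inl (volume_dyadicCube_ne_top i))).2 h

/-- Closeness of F to c and the bound on its average give ‖c‖ ≤ (2^n + 1)a. On a subcube where the
average of F exceeds 2^{n+2} a, the average of F - c therefore still exceeds a. The weak type
inequality for F - c, whose mass on the cube is at most b times the volume, bounds the union of
these subcubes. -/
lemma good_lambda_cube (hn : 0 < n) {F : Eu n → ℂ} {i : DyadicIndex n}
    (hFm : AEStronglyMeasurable F (volume.restrict (dyadicCube i))) {c : ℂ} {a b : ℝ≥0∞}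
    (ha0 : a ≠ 0) (hat : a ≠ ∞) (hba : b ≤ a)
    (hF : ∫⁻ y in dyadicCube i, ‖F y‖ₑ ≤ 2 ^ n * a * volume (dyadicCube i))
    (hc : ∫⁻ y in dyadicCube i, ‖F y - c‖ₑ ≤ b * volume (dyadicCube i)) :
    volume {x | ∃ i' : DyadicIndex n, x ∈ dyadicCube i' ∧ dyadicCube i' ⊆ dyadicCube i ∧
      2 ^ (n + 2) * a * volume (dyadicCube i') < ∫⁻ y in dyadicCube i', ‖F y‖ₑ} ≤
      9 ^ n * a⁻¹ * (b * volume (dyadicCube i)) := by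
  have hv0 := volume_dyadicCube_ne_zero i
  have hvt := volume_dyadicCube_ne_top i
  have hcn : ‖c‖ₑ ≤ 2 ^ n * a + a := by
    have h1 : ‖c‖ₑ * volume (dyadicCube i) ≤ (2 ^ n * a + a) * volume (dyadicCube i) := by
      calc ‖c‖ₑ * volume (dyadicCube i) = ∫⁻ y in dyadicCube i, ‖c‖ₑ := (setLIntegral_const _ _).symm
        _ ≤ ∫⁻ y in dyadicCube i, (‖F y‖ₑ + ‖F y - c‖ₑ) := by
            refine lintegral_mono fun y => ?_
            calc ‖c‖ₑ = ‖F y - (F y - c)‖ₑ := by congr 1; ring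
              _ ≤ _ := enorm_sub_le
        _ = (∫⁻ y in dyadicCube i, ‖F y‖ₑ) + ∫⁻ y in dyadicCube i, ‖F y - c‖ₑ :=
            lintegral_add_left' hFm.enorm _
        _ ≤ 2 ^ n * a * volume (dyadicCube i) + a * volume (dyadicCube i) := by
            gcongr; exact hc.trans (by gcongr)
        _ = _ := by ring
    exact (ENNReal.mul_le_mul_iff_left hv0 hvt).1 h1
  calc _ ≤ volume {x | a < mx ((dyadicCube i).indicator fun y => ‖F y - c‖ₑ) x} := by
        refine measure_mono ?_
        rintro x ⟨i', hx, hsub, hi'⟩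
        refine lt_of_lt_of_le ?_ (le_mx _ hx)
        rw [mul_comm, ← div_eq_mul_inv, ENNReal.lt_div_iff_mul_lt
          (Or.inl (volume_dyadicCube_ne_zero i')) (Or.inl (volume_dyadicCube_ne_top i'))]
        have h2 : ∫⁻ y in dyadicCube i', ‖F y‖ₑ ≤
            (∫⁻ y in dyadicCube i', ‖F y - c‖ₑ) + ‖c‖ₑ * volume (dyadicCube i') := by
          rw [← setLIntegral_const, ← lintegral_add_right _ measurable_const]
          refine lintegral_mono fun y => ?_
          calc ‖F y‖ₑ = ‖(F y - c) + c‖ₑ := by congr 1; ring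
            _ ≤ _ := enorm_add_le _ _
        have h3 : ∫⁻ y in dyadicCube i', ‖F y - c‖ₑ ≤
            ∫⁻ y in tri i', (dyadicCube i).indicator (fun y => ‖F y - c‖ₑ) y := by
          calc _ = ∫⁻ y in dyadicCube i', (dyadicCube i).indicator (fun y => ‖F y - c‖ₑ) y := by
                refine setLIntegral_congr_fun (measurableSet_dyadicCube _) fun y hy => ?_
                rw [indicator_of_mem (hsub hy)]
            _ ≤ _ := lintegral_mono_set (dyadicCube_subset_tri i')
        refine lt_of_lt_of_le ?_ h3
        by_contra hcon
        have hv'0 := volume_dyadicCube_ne_zero i'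
        have hv't := volume_dyadicCube_ne_top i'
        have h4 : 2 ^ (n + 2) * a * volume (dyadicCube i') <
            2 ^ (n + 2) * a * volume (dyadicCube i') := by
          calc _ < _ := hi'
            _ ≤ a * volume (dyadicCube i') + (2 ^ n * a + a) * volume (dyadicCube i') :=
                h2.trans (add_le_add (not_lt.1 hcon) (by gcongr))
            _ = (2 ^ n + (1 + 1)) * a * volume (dyadicCube i') := by ring
            _ ≤ _ := by
                gcongr
                rw [pow_add]
                have : (1 : ℝ≥0∞) ≤ 2 ^ n := one_le_pow₀ (by norm_num)
                calc (2 : ℝ≥0∞) ^ n + (1 + 1) ≤ 2 ^ n + (2 ^ n + 2 ^ n) := by gcongr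
                  _ ≤ 2 ^ n + (2 ^ n + 2 ^ n) + 2 ^ n := le_self_add
                  _ = _ := by ring
        exact lt_irrefl _ h4
    _ ≤ 9 ^ n * a⁻¹ * ∫⁻ y, (dyadicCube i).indicator (fun y => ‖F y - c‖ₑ) y :=
        volume_lt_mx_le hn _ ha0 hat
    _ ≤ _ := by
        rw [lintegral_indicator (measurableSet_dyadicCube i)]
        gcongr

/-- The set where the local maximal function exceeds 2^k is a disjoint union of maximal cubes.
Hypothesis `hk` says that the top cube is not selected, so every maximal cube has an unselected
parent inside it, whence the average of F is at most 2^n 2^k. `good_lambda_cube` with b = 2^{k-m}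
then yields the small factor 2^{-m}. -/
lemma good_lambda (hn : 0 < n) {F : Eu n → ℂ} {N : Eu n → ℝ≥0∞} {i₀ : DyadicIndex n}
    (hF : AEStronglyMeasurable F (volume.restrict (dyadicCube i₀)))
    (h : ∀ i k, anc k i = i₀ → ∃ c : ℂ, ∀ x ∈ dyadicCube i,
      ∫⁻ y in dyadicCube i, ‖F y - c‖ₑ ≤ N x * volume (dyadicCube i)) (k : ℤ) (m : ℕ)
    (hk : (volume (dyadicCube i₀))⁻¹ * ∫⁻ y in dyadicCube i₀, ‖F y‖ₑ ≤ tp k) :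
    volume {x | tp (k + (n + 2 : ℕ) : ℤ) < mxLoc i₀ (fun y => ‖F y‖ₑ) x} ≤
      9 ^ n * tp (-m) * volume {x | tp k < mxLoc i₀ (fun y => ‖F y‖ₑ) x} +
        volume.restrict (dyadicCube i₀) {x | tp (k - m : ℤ) < N x} := by
  set 𝒞 : Set (DyadicIndex n) := {i | (∃ l, anc l i = i₀) ∧
    tp k * volume (dyadicCube i) < ∫⁻ y in dyadicCube i, ‖F y‖ₑ} with h𝒞
  have hJ : ∀ i ∈ 𝒞, i₀.1 ≤ i.1 := by
    rintro i ⟨⟨l, hl⟩, -⟩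
    rw [← hl]; simp only [anc]; omega
  have hsubset : ∀ {i : DyadicIndex n}, (∃ l, anc l i = i₀) → dyadicCube i ⊆ dyadicCube i₀ := by
    rintro i ⟨l, hl⟩
    rw [← hl]; exact dyadicCube_subset_anc l i
  set G : Eu n → ℝ≥0∞ := mxLoc i₀ fun y => ‖F y‖ₑ with hG
  have hGset : {x | tp k < G x} = ⋃ i : maxCubes 𝒞, dyadicCube (i : DyadicIndex n) := by
    ext x
    simp only [mem_ofPred_eq, mem_iUnion]
    constructor
    · intro hx
      obtain ⟨i, hi1, hi2, hi3⟩ := mem_of_lt_mxLoc hx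
      obtain ⟨l, hl⟩ := exists_maxCubes hJ (show i ∈ 𝒞 from ⟨hi1, hi3⟩)
      exact ⟨⟨_, hl⟩, mem_anc l hi2⟩
    · rintro ⟨i, hi⟩
      exact lt_mxLoc i.2.1.1 hi i.2.1.2
  have hdisj : Pairwise (Function.onFun Disjoint fun i : maxCubes 𝒞 => dyadicCube (i : DyadicIndex n)) :=
    fun i j hij => disjoint_maxCubes i.2 j.2 fun h => hij (Subtype.ext h)
  have hGvol : volume {x | tp k < G x} = ∑' i : maxCubes 𝒞, volume (dyadicCube (i : DyadicIndex n)) := by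
    rw [hGset, measure_iUnion hdisj fun i => measurableSet_dyadicCube _]
  set E : Set (Eu n) := {x | tp (k + (n + 2 : ℕ) : ℤ) < G x} with hE
  set B : Set (Eu n) := {x | tp (k - m : ℤ) < N x} with hB
  have hEG : E ⊆ {x | tp k < G x} := fun x hx => lt_of_le_of_lt (tp_le_tp (by
    push_cast
    have : (0 : ℝ) ≤ n := by positivity
    linarith)) hx
  have hcube : ∀ i : maxCubes 𝒞, volume ((E ∩ dyadicCube (i : DyadicIndex n)) \ B) ≤
      9 ^ n * tp (-m) * volume (dyadicCube (i : DyadicIndex n)) := by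
    rintro ⟨i, hi⟩
    simp only
    -- A single point with small N controls the oscillation on the whole cube; without such a point
    -- the cube lies in B and contributes nothing.
    by_cases hex : ∃ x ∈ dyadicCube i, x ∉ B
    · obtain ⟨x₀, hx₀, hx₀B⟩ := hex
      have hN : N x₀ ≤ tp (k - m : ℤ) := not_lt.1 hx₀B
      obtain ⟨l, hl⟩ := hi.1.1
      obtain ⟨c, hc⟩ := h i l hl
      -- the parent is not selected
      have hl0 : l ≠ 0 := by
        rintro rfl
        rw [anc_zero] at hl
        have h1 := hi.1.2
        rw [hl] at h1
        rw [mul_comm, ← div_eq_mul_inv] at hk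
        exact absurd ((ENNReal.div_le_iff (volume_dyadicCube_ne_zero _)
          (volume_dyadicCube_ne_top _)).1 hk) (not_le.2 h1)
      have hpar : ∫⁻ y in dyadicCube i, ‖F y‖ₑ ≤ 2 ^ n * tp k * volume (dyadicCube i) := by
        have h1 : anc 1 i ∉ 𝒞 := hi.2 1 one_pos
        have h2 : ∃ l', anc l' (anc 1 i) = i₀ := ⟨l - 1, by
          rw [anc_anc, show 1 + (l - 1) = l by omega, hl]⟩
        have h3 : ¬ tp k * volume (dyadicCube (anc 1 i)) < ∫⁻ y in dyadicCube (anc 1 i), ‖F y‖ₑ :=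
          fun h3 => h1 ⟨h2, h3⟩
        calc _ ≤ ∫⁻ y in dyadicCube (anc 1 i), ‖F y‖ₑ :=
              lintegral_mono_set (dyadicCube_subset_anc 1 i)
          _ ≤ tp k * volume (dyadicCube (anc 1 i)) := not_lt.1 h3
          _ = _ := by
              rw [volume_anc]; push_cast; rw [one_mul, tp_nat]; ring
      have hgl := good_lambda_cube hn (F := F) (i := i) (c := c) (a := tp k) (b := tp (k - m : ℤ))
        (hF.mono_measure (Measure.restrict_mono (hsubset hi.1.1) le_rfl)) (tp_ne_zero _) (tp_ne_top _)
        (tp_le_tp (by push_cast; have : (0 : ℝ) ≤ m := by positivity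
                      linarith)) hpar
        ((hc x₀ hx₀).trans (by gcongr))
      refine le_trans (measure_mono ?_) (hgl.trans (le_of_eq ?_))
      · rintro x ⟨⟨hxE, hxi⟩, -⟩
        obtain ⟨i', hi1, hi2, hi3⟩ := mem_of_lt_mxLoc hxE
        refine ⟨i', hi2, ?_, ?_⟩
        · have hi'𝒞 : i' ∈ 𝒞 := ⟨hi1, lt_of_le_of_lt (by
            gcongr; apply tp_le_tp; push_cast
            have : (0 : ℝ) ≤ n := by positivity
            linarith) hi3⟩
          -- The maximal cube above i' meets i in x, and distinct maximal cubes are disjoint, so i'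
          -- lies inside i.
          obtain ⟨l', hl'⟩ := exists_maxCubes hJ hi'𝒞
          have : anc l' i' = i := by
            by_contra hne
            exact Set.disjoint_left.1 (disjoint_maxCubes hl' hi hne) (mem_anc l' hi2) hxi
          rw [← this]; exact dyadicCube_subset_anc l' i'
        · refine lt_of_eq_of_lt ?_ hi3
          congr 1
          push_cast
          rw [tp_add, ← tp_nat]; push_cast; ring
      · rw [← mul_assoc, mul_assoc (9 ^ n), tp_inv, ← tp_add]
        congr 3; push_cast; ring
    · push Not at hex
      have : (E ∩ dyadicCube i) \ B = ∅ := by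
        ext x; simp only [Set.mem_sdiff, mem_inter_iff, mem_empty_iff_false, iff_false, not_and, not_not]
        exact fun hx => hex x hx.2
      rw [this]; simp
  calc volume E ≤ volume ((⋃ i : maxCubes 𝒞, (E ∩ dyadicCube (i : DyadicIndex n)) \ B) ∪
          (B ∩ dyadicCube i₀)) := by
        refine measure_mono fun x hx => ?_
        have hx2 := hEG hx
        rw [hGset, mem_iUnion] at hx2
        obtain ⟨i, hi⟩ := hx2
        by_cases hxB : x ∈ B
        · exact Or.inr ⟨hxB, hsubset i.2.1.1 hi⟩
        · exact Or.inl (mem_iUnion.2 ⟨i, ⟨hx, hi⟩, hxB⟩)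
    _ ≤ (∑' i : maxCubes 𝒞, volume ((E ∩ dyadicCube (i : DyadicIndex n)) \ B)) +
          volume (B ∩ dyadicCube i₀) :=
        (measure_union_le _ _).trans (add_le_add (measure_iUnion_le _) le_rfl)
    _ ≤ (∑' i : maxCubes 𝒞, 9 ^ n * tp (-m) * volume (dyadicCube (i : DyadicIndex n))) +
          volume.restrict (dyadicCube i₀) B := by
        rw [Measure.restrict_apply' (measurableSet_dyadicCube i₀)]
        exact add_le_add (ENNReal.tsum_le_tsum hcube) le_rfl
    _ = _ := by rw [ENNReal.tsum_mul_left, hGvol]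

/-- The local Fefferman–Stein inequality in Lorentz spaces. -/
lemma exists_fefferman_stein (hn : 0 < n) (hp : 0 < p) (hq : 0 < q) : ∃ C : ℝ≥0,
    ∀ (i₀ : DyadicIndex n) (F : Eu n → ℂ) (N : Eu n → ℝ≥0∞), IntegrableOn F (dyadicCube i₀) →
      (∀ i k, anc k i = i₀ → ∃ c : ℂ, ∀ x ∈ dyadicCube i,
        ∫⁻ y in dyadicCube i, ‖F y - c‖ₑ ≤ N x * volume (dyadicCube i)) →
      lorN p q (volume.restrict (dyadicCube i₀)) (fun x => ‖F x‖ₑ) ≤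
        C * (lorN p q (volume.restrict (dyadicCube i₀)) N +
          (volume (dyadicCube i₀))⁻¹ * (∫⁻ y in dyadicCube i₀, ‖F y‖ₑ) *
            volume (dyadicCube i₀) ^ (1 / p)) := by
  obtain ⟨C, hC⟩ := exists_absorb hp hq (n + 2) (9 ^ n)
  refine ⟨(C * tpn 1) ^ (1 / q), fun i₀ F N hF h => ?_⟩
  set V := volume (dyadicCube i₀) with hV
  set A := V⁻¹ * ∫⁻ y in dyadicCube i₀, ‖F y‖ₑ with hA
  have hAt : A ≠ ∞ := ENNReal.mul_ne_top (by simpa [hV] using volume_dyadicCube_ne_zero i₀)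
    hF.2.ne
  set G : Eu n → ℝ≥0∞ := mxLoc i₀ fun y => ‖F y‖ₑ with hG
  -- Absorption runs above the height A, the average over the top cube. The set where the local
  -- maximal function is positive lies in that cube, which supplies the uniform bound V.
  have h1 := hC (fun k => volume {x | tp k < G x})
    (fun k => volume.restrict (dyadicCube i₀) {x | tp k < N x}) V A
    (fun k => measure_mono fun x hx => by
      obtain ⟨i, ⟨l, hl⟩, hi2, -⟩ := mem_of_lt_mxLoc hx
      rw [← hl]; exact mem_anc l hi2)
    (volume_dyadicCube_ne_top _) hAt (fun k m hk => by
      have := good_lambda hn hF.1 h k m hk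
      exact_mod_cast this)
  have h2 : lorN p q (volume.restrict (dyadicCube i₀)) (fun x => ‖F x‖ₑ) ≤ lorN p q volume G := by
    rw [lorN_restrict (measurableSet_dyadicCube i₀)]
    refine lorN_mono_ae hq hp ?_
    set F' : Eu n → ℂ := (dyadicCube i₀).indicator F with hF'
    have hF'i : Integrable F' := hF.integrable_indicator (measurableSet_dyadicCube i₀)
    -- Lebesgue differentiation restricted to generations at least that of the top cube: for a point
    -- of the top cube, all cubes that occur are its descendants, so F is dominated by the local
    -- maximal function.
    filter_upwards [ae_enorm_le_iSup hn hF'i.locallyIntegrable] with x hx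
    by_cases hxi : x ∈ dyadicCube i₀
    · rw [indicator_of_mem hxi]
      have := hx i₀.1
      rw [hF', indicator_of_mem hxi] at this
      refine this.trans (iSup₂_le fun j hj => ?_)
      have hanc : anc (j - i₀.1).toNat (idxAt j x) = i₀ := by
        have := eq_anc_of_mem (mem_idxAt j x) hxi (by simpa [idxAt] using hj)
        exact this.symm
      refine le_iSup₂_of_le (idxAt j x) ⟨⟨_, hanc⟩, mem_idxAt j x⟩ ?_
      gcongr 1
      refine lintegral_mono fun y => ?_
      by_cases hy : y ∈ dyadicCube i₀
      · rw [indicator_of_mem hy]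
      · rw [indicator_of_notMem hy]; simp
    · rw [indicator_of_notMem hxi]; exact zero_le
  refine h2.trans ?_
  calc lorN p q volume G ≤ (C * (lorSum p q (volume.restrict (dyadicCube i₀)) N +
          (A * V ^ (1 / p)) ^ q)) ^ (1 / q) := ENNReal.rpow_le_rpow h1 (by positivity)
    _ ≤ (C * (2 * (lorN p q (volume.restrict (dyadicCube i₀)) N + A * V ^ (1 / p)) ^ q)) ^ (1 / q) := by
        gcongr
        rw [two_mul, ← lorN_rpow hq]
        gcongr
        · exact le_self_add
        · exact le_add_self
    _ = _ := by
        rw [← mul_assoc, ENNReal.mul_rpow_of_nonneg _ _ (by positivity), ← ENNReal.rpow_mul,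
          mul_one_div_cancel hq.ne', ENNReal.rpow_one, ENNReal.coe_rpow_of_nonneg _ (by positivity)]
        push_cast
        rw [coe_tpn, tp_one]

end Sharp

/-! ### Averages over tripled cubes and Hölder's inequality for them. -/

section Averages

variable {n : ℕ} {p q s : ℝ}

/-- The `L^s` average of `f` over the dilated cube. -/
def av (s : ℝ) (f : Eu n → ℝ≥0∞) (i : DyadicIndex n) : ℝ≥0∞ :=
  ((volume (dyadicCube i))⁻¹ * ∫⁻ y in tri i, f y ^ s) ^ (1 / s)

lemma av_le_mxs (hs : 0 < s) (f : Eu n → ℝ≥0∞) {x : Eu n} {i : DyadicIndex n}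
    (h : x ∈ dyadicCube i) (k : ℕ) : av s f (anc k i) ≤ mxs s f x :=
  le_mxs hs f (mem_anc k h)

lemma av_mono (hs : 0 < s) {f g : Eu n → ℝ≥0∞} {i : DyadicIndex n} (h : ∀ x ∈ tri i, f x ≤ g x) :
    av s f i ≤ av s g i := by
  unfold av
  gcongr ((volume (dyadicCube i))⁻¹ * ?_) ^ (1 / s)
  exact setLIntegral_mono' (measurableSet_tri i) fun x hx => ENNReal.rpow_le_rpow (h x hx) hs.le

lemma av_mul_le {u u' : ℝ} (hs : 0 < s) (hu : u.HolderConjugate u') {f g : Eu n → ℝ≥0∞}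
    (hf : AEMeasurable f) (hg : AEMeasurable g) (i : DyadicIndex n) :
    av s (fun x => f x * g x) i ≤ av (s * u) f i * av (s * u') g i := by
  have hu0 := hu.pos
  have hu0' := hu.symm.pos
  have hVt : (volume (dyadicCube i))⁻¹ ≠ ∞ := by simpa using volume_dyadicCube_ne_zero i
  have hV0 : (volume (dyadicCube i))⁻¹ ≠ 0 := by simpa using volume_dyadicCube_ne_top i
  set V := (volume (dyadicCube i))⁻¹
  have h1 : V * ∫⁻ y in tri i, (f y * g y) ^ s ≤
      (V * ∫⁻ y in tri i, f y ^ (s * u)) ^ (1 / u) * (V * ∫⁻ y in tri i, g y ^ (s * u')) ^ (1 / u') := by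
    calc V * ∫⁻ y in tri i, (f y * g y) ^ s = V * ∫⁻ y in tri i, f y ^ s * g y ^ s := by
          simp_rw [ENNReal.mul_rpow_of_nonneg _ _ hs.le]
      _ ≤ V * ((∫⁻ y in tri i, (f y ^ s) ^ u) ^ (1 / u) * (∫⁻ y in tri i, (g y ^ s) ^ u') ^ (1 / u')) := by
          gcongr
          exact ENNReal.lintegral_mul_le_Lp_mul_Lq _ hu (hf.restrict.pow_const s)
            (hg.restrict.pow_const s)
      _ = _ := by
          simp_rw [← ENNReal.rpow_mul]
          rw [ENNReal.mul_rpow_of_nonneg _ _ (by positivity),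
            ENNReal.mul_rpow_of_nonneg _ _ (by positivity)]
          have : V = V ^ (1 / u) * V ^ (1 / u') := by
            rw [← ENNReal.rpow_add _ _ hV0 hVt, one_div, one_div, hu.inv_add_inv_eq_one,
              ENNReal.rpow_one]
          nth_rewrite 1 [this]
          ring
  calc av s (fun x => f x * g x) i ≤ ((V * ∫⁻ y in tri i, f y ^ (s * u)) ^ (1 / u) *
        (V * ∫⁻ y in tri i, g y ^ (s * u')) ^ (1 / u')) ^ (1 / s) :=
        ENNReal.rpow_le_rpow h1 (by positivity)
    _ = _ := by
        rw [ENNReal.mul_rpow_of_nonneg _ _ (by positivity), ← ENNReal.rpow_mul, ← ENNReal.rpow_mul]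
        unfold av
        congr 2 <;> · field_simp

lemma av_one_le (hs : 0 < s) (i : DyadicIndex n) : av s (fun _ => 1) i ≤ tpn (n * 2 / s) := by
  rw [coe_tpn]
  calc av s (fun _ => 1) i ≤ ((volume (dyadicCube i))⁻¹ * (tp (n * 2) * volume (dyadicCube i))) ^ (1 / s) := by
        unfold av
        simp only [ENNReal.one_rpow, lintegral_const, one_mul, Measure.restrict_apply_univ]
        gcongr
        refine (volume_tri_le i).trans ?_
        gcongr
        calc (3 : ℝ≥0∞) ^ n ≤ 4 ^ n := by gcongr; norm_num
          _ = tp (n * 2) := by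
            rw [mul_comm, tp_mul_nat]; congr 1
            have := tp_nat 2
            push_cast at this
            rw [this]; norm_num
    _ = tp (n * 2 / s) := by
        rw [mul_left_comm, ENNReal.inv_mul_cancel (volume_dyadicCube_ne_zero i)
          (volume_dyadicCube_ne_top i), mul_one, tp_rpow, mul_one_div]

lemma av_one_exponent_le (hs : 1 < s) {f : Eu n → ℝ≥0∞} (hf : AEMeasurable f) (i : DyadicIndex n) :
    av 1 f i ≤ tpn (n * 2 / s.conjExponent) * av s f i := by
  have h := av_mul_le one_pos (Real.HolderConjugate.conjExponent hs) hf
    (g := fun _ => 1) aemeasurable_const i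
  simp only [mul_one, one_mul] at h
  rw [mul_comm]
  exact h.trans (by gcongr; exact av_one_le (Real.HolderConjugate.conjExponent hs).symm.pos i)

lemma exists_av_le_lorN (hn : 0 < n) (hs : 1 ≤ s) (hsp : s < p) (hq : 0 < q) :
    ∃ C : ℝ≥0, ∀ (f : Eu n → ℝ≥0∞) (i : DyadicIndex n), AEMeasurable f →
      av s f i * volume (dyadicCube i) ^ (1 / p) ≤ C * lorN p q volume f :=
  exists_average_le hn hs hsp hq

lemma setLIntegral_tri_eq_av (f : Eu n → ℝ≥0∞) (i : DyadicIndex n) :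
    ∫⁻ x in tri i, f x = volume (dyadicCube i) * av 1 f i := by
  unfold av
  simp only [ENNReal.rpow_one, div_one]
  rw [← mul_assoc, ENNReal.mul_inv_cancel (volume_dyadicCube_ne_zero i) (volume_dyadicCube_ne_top i),
    one_mul]

lemma setLIntegral_le_av (f : Eu n → ℝ≥0∞) {i : DyadicIndex n} {E : Set (Eu n)} (hE : E ⊆ tri i) :
    ∫⁻ x in E, f x ≤ volume (dyadicCube i) * av 1 f i := by
  rw [← setLIntegral_tri_eq_av]; exact lintegral_mono_set hE

lemma setLIntegral_mul_le_av {u u' : ℝ} (hu : u.HolderConjugate u') {f g : Eu n → ℝ≥0∞}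
    (hf : AEMeasurable f) (hg : AEMeasurable g) {i : DyadicIndex n} {E : Set (Eu n)} (hE : E ⊆ tri i) :
    ∫⁻ x in E, f x * g x ≤ volume (dyadicCube i) * (av u f i * av u' g i) := by
  refine (setLIntegral_le_av _ hE).trans ?_
  gcongr
  have := av_mul_le one_pos hu hf hg i
  simpa using this

lemma exists_lorN_const_le (hp : 0 < p) (hq : 0 < q) : ∃ C : ℝ≥0,
    ∀ {X : Type*} [MeasurableSpace X] (μ : Measure X) (c : ℝ≥0∞), c ≠ ∞ →
      lorN p q μ (fun _ => c) ≤ C * (c * μ univ ^ (1 / p)) := by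
  obtain ⟨C, hC⟩ := exists_tsum_tp_le hq
  refine ⟨C ^ (1 / q), fun μ c hc => ?_⟩
  rcases eq_or_ne c 0 with rfl | hc0
  · rw [lorN_zero hp hq]; exact zero_le
  obtain ⟨k, hk1, hk2⟩ := exists_tp_lt_le hc0 hc
  have h : lorSum p q μ (fun _ => c) ≤ C * (c * μ univ ^ (1 / p)) ^ q := by
    calc lorSum p q μ (fun _ => c) ≤
        ∑' j : ℤ, (if j ≤ k then tp (j * q) else 0) * (μ univ ^ (1 / p)) ^ q := by
          refine ENNReal.tsum_le_tsum fun j => ?_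
          split_ifs with hj
          · rw [ENNReal.mul_rpow_of_nonneg _ _ hq.le, tp_rpow]
            gcongr
            exact subset_univ _
          · have : ¬ tp j < c := not_lt.2 (hk2.trans (tp_le_tp (by exact_mod_cast not_le.1 hj)))
            simp only [this, ofPred_false, measure_empty]
            rw [ENNReal.zero_rpow_of_pos (by positivity), mul_zero, ENNReal.zero_rpow_of_pos hq]
            exact zero_le
      _ = C * (tp k ^ q * (μ univ ^ (1 / p)) ^ q) := by
          rw [ENNReal.tsum_mul_right, hC, tp_rpow, mul_assoc]
      _ ≤ _ := by
          rw [ENNReal.mul_rpow_of_nonneg _ _ hq.le]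
          gcongr
  calc lorN p q μ (fun _ => c) ≤ (C * (c * μ univ ^ (1 / p)) ^ q) ^ (1 / q) :=
        ENNReal.rpow_le_rpow h (by positivity)
    _ = _ := by
        rw [ENNReal.mul_rpow_of_nonneg _ _ (by positivity), ← ENNReal.rpow_mul,
          mul_one_div_cancel hq.ne', ENNReal.rpow_one, ENNReal.coe_rpow_of_nonneg _ (by positivity)]

lemma exists_av_le_of_forall_nb (hp : 0 < p) : ∃ C : ℝ≥0, ∀ (f : Eu n → ℝ≥0∞) (i : DyadicIndex n)
    (B : ℝ≥0∞), AEMeasurable f → (∀ v, lorN p p (volume.restrict (dyadicCube (nb v i))) f ≤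
      B * volume (dyadicCube i) ^ (1 / p)) → av p f i ≤ C * B := by
  obtain ⟨D, hD⟩ := exists_lintegral_rpow_le hp
  refine ⟨(3 ^ n : ℝ≥0) ^ (1 / p) * D, fun f i B hf hB => ?_⟩
  set V := volume (dyadicCube i) with hV
  have hV0 : V ≠ 0 := volume_dyadicCube_ne_zero _
  have hVt : V ≠ ∞ := volume_dyadicCube_ne_top _
  have h1 : ∀ v, ∫⁻ y in dyadicCube (nb v i), f y ^ p ≤ (D * B) ^ p * V := fun v => by
    have h2 := (hD (volume.restrict (dyadicCube (nb v i))) f hf.restrict).trans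
      (mul_le_mul' le_rfl (hB v))
    have h3 := ENNReal.rpow_le_rpow h2 hp.le
    rw [← ENNReal.rpow_mul, one_div_mul_cancel hp.ne', ENNReal.rpow_one] at h3
    refine h3.trans (le_of_eq ?_)
    rw [← mul_assoc, ENNReal.mul_rpow_of_nonneg _ _ hp.le, ← ENNReal.rpow_mul,
      one_div_mul_cancel hp.ne', ENNReal.rpow_one]
  calc _ ≤ (V⁻¹ * (3 ^ n * ((D * B) ^ p * V))) ^ (1 / p) := by
        unfold av
        gcongr
        refine (lintegral_tri_le _ _).trans ((Finset.sum_le_sum fun v _ => h1 v).trans ?_)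
        simp
    _ = (3 ^ n * (D * B) ^ p) ^ (1 / p) := by
        congr 1
        calc _ = (V⁻¹ * V) * (3 ^ n * (D * B) ^ p) := by ring
          _ = _ := by rw [ENNReal.inv_mul_cancel hV0 hVt, one_mul]
    _ = _ := by
        rw [ENNReal.mul_rpow_of_nonneg _ _ (by positivity), ← ENNReal.rpow_mul,
          mul_one_div_cancel hp.ne', ENNReal.rpow_one]
        push_cast
        rw [ENNReal.coe_rpow_of_nonneg _ (by positivity)]
        push_cast
        ring

end Averages

/-! ### Functions of bounded mean oscillation -/

section BMO

variable {n : ℕ} {p q s : ℝ} {b : Eu n → ℂ}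

/-- The cube with the same centre as `Q_i` and four times its side. -/
def bigCube (i : DyadicIndex n) : Set (Eu n) :=
  cube (WithLp.toLp 2 fun l => side i * ((i.2 l : ℝ) + 1 / 2)) (4 * side i)

/-- The mean of `b` over the big cube. -/
def bmean (b : Eu n → ℂ) (i : DyadicIndex n) : ℂ := ⨍ y in bigCube i, b y

lemma volume_cube (c : Eu n) (l : ℝ) : volume (cube c l) = ENNReal.ofReal l ^ n := by
  have h : cube c l = (@WithLp.ofLp 2 (Fin n → ℝ)) ⁻¹' (Set.pi univ fun k =>
      Icc (c k - l / 2) (c k + l / 2)) := by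
    ext x
    simp only [cube, abs_le, mem_ofPred_eq, mem_preimage, Set.mem_pi, mem_univ, forall_const, mem_Icc]
    refine forall_congr' fun k => ?_
    constructor <;> rintro ⟨h1, h2⟩ <;> constructor <;> linarith
  rw [h, (PiLp.volume_preserving_ofLp (Fin n)).measure_preimage
    (MeasurableSet.univ_pi fun _ => measurableSet_Icc).nullMeasurableSet, volume_pi_pi]
  simp_rw [Real.volume_Icc]
  have : ∀ k, c k + l / 2 - (c k - l / 2) = l := fun k => by ring
  simp [this]

lemma volume_bigCube (i : DyadicIndex n) :
    volume (bigCube i) = 4 ^ n * volume (dyadicCube i) := by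
  rw [bigCube, volume_cube, volume_dyadicCube]
  rw [ENNReal.ofReal_mul (by norm_num), mul_pow]
  congr 1
  · norm_num
  · rw [side, ← neg_mul, tp_mul_nat, tp_eq_ofReal]
    congr 2
    rw [← Real.rpow_intCast]; push_cast; rfl

lemma tri_subset_bigCube (i : DyadicIndex n) : tri i ⊆ bigCube i := by
  intro x hx k
  obtain ⟨v, hv⟩ := mem_tri_iff.1 hx
  have h := hv k
  have h3 : ((v k : ℕ) : ℝ) ≤ 2 := by
    have : (v k : ℕ) ≤ 2 := by omega
    exact_mod_cast this
  have h4 : (0 : ℝ) ≤ ((v k : ℕ) : ℝ) := by positivity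
  have hs := side_pos i
  simp only [nb] at h
  push_cast at h
  rw [← side] at h
  have h1 : side i * (i.2 k - 1) ≤ side i * (i.2 k + ((v k : ℕ) : ℝ) - 1) :=
    mul_le_mul_of_nonneg_left (by linarith) hs.le
  have h2 : side i * (i.2 k + ((v k : ℕ) : ℝ) - 1 + 1) ≤ side i * (i.2 k + 2) :=
    mul_le_mul_of_nonneg_left (by linarith) hs.le
  simp only [abs_le]
  constructor <;> nlinarith

/-- Oscillations are measured on the concentric closed cube of four times the side because it
contains the tripled cube; 4^n is the ratio of volumes. -/
lemma setLIntegral_tri_sub_bmean_le (b : Eu n → ℂ) (i : DyadicIndex n) :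
    ∫⁻ x in tri i, ‖b x - bmean b i‖ₑ ≤ 4 ^ n * bmoNorm b * volume (dyadicCube i) := by
  have h1 : (volume (bigCube i))⁻¹ * ∫⁻ x in bigCube i, ‖b x - bmean b i‖ₑ ≤ bmoNorm b := by
    unfold bmoNorm
    refine le_iSup_of_le (WithLp.toLp 2 fun l => side i * ((i.2 l : ℝ) + 1 / 2)) ?_
    refine le_iSup₂_of_le (4 * side i) (by have := side_pos i; positivity) ?_
    exact le_rfl
  have h0 : volume (bigCube i) ≠ 0 := by
    rw [volume_bigCube]; exact mul_ne_zero (by simp) (volume_dyadicCube_ne_zero i)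
  have ht : volume (bigCube i) ≠ ∞ := by
    rw [volume_bigCube]; exact ENNReal.mul_ne_top (by simp) (volume_dyadicCube_ne_top i)
  refine (lintegral_mono_set (tri_subset_bigCube i)).trans ?_
  rw [mul_comm, ← div_eq_mul_inv, ENNReal.div_le_iff h0 ht, volume_bigCube] at h1
  exact h1.trans (le_of_eq (by ring))

lemma enorm_sub_mul_le {E : Set (Eu n)} {b : Eu n → ℂ}
    (hb : AEStronglyMeasurable b volume) (c c' : ℂ) :
    ‖c - c'‖ₑ * volume E ≤ (∫⁻ x in E, ‖b x - c‖ₑ) + ∫⁻ x in E, ‖b x - c'‖ₑ := by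
  rw [← lintegral_add_left' (by fun_prop), ← setLIntegral_const]
  refine lintegral_mono fun x => ?_
  calc ‖c - c'‖ₑ = ‖(b x - c') - (b x - c)‖ₑ := by congr 1; ring
    _ ≤ _ := enorm_sub_le
    _ = _ := add_comm _ _

lemma enorm_bmean_nb_sub_le (hb : AEStronglyMeasurable b volume) (v : Fin n → Fin 3)
    (i : DyadicIndex n) : ‖bmean b (nb v i) - bmean b i‖ₑ ≤ 2 * 8 ^ n * bmoNorm b := by
  have h := enorm_sub_mul_le (E := dyadicCube (nb v i)) hb (bmean b (nb v i)) (bmean b i)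
  have h1 : ∫⁻ x in dyadicCube (nb v i), ‖b x - bmean b (nb v i)‖ₑ ≤
      4 ^ n * bmoNorm b * volume (dyadicCube i) := by
    rw [← volume_nb v i]
    exact (lintegral_mono_set (dyadicCube_subset_tri _)).trans (setLIntegral_tri_sub_bmean_le b _)
  have h2 : ∫⁻ x in dyadicCube (nb v i), ‖b x - bmean b i‖ₑ ≤
      4 ^ n * bmoNorm b * volume (dyadicCube i) :=
    (lintegral_mono_set fun x hx => mem_tri_iff.2 ⟨v, hx⟩).trans (setLIntegral_tri_sub_bmean_le b _)
  rw [volume_nb] at h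
  have h3 := h.trans (add_le_add h1 h2)
  rw [← add_mul] at h3
  refine ((ENNReal.mul_le_mul_iff_left (volume_dyadicCube_ne_zero i)
    (volume_dyadicCube_ne_top i)).1 h3).trans ?_
  calc 4 ^ n * bmoNorm b + 4 ^ n * bmoNorm b = 2 * 4 ^ n * bmoNorm b := by ring
    _ ≤ _ := by gcongr; norm_num

lemma enorm_bmean_anc_one_sub_le (hb : AEStronglyMeasurable b volume)
    (i : DyadicIndex n) : ‖bmean b (anc 1 i) - bmean b i‖ₑ ≤ 2 * 8 ^ n * bmoNorm b := by
  have h := enorm_sub_mul_le (E := dyadicCube i) hb (bmean b (anc 1 i)) (bmean b i)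
  have h1 : ∫⁻ x in dyadicCube i, ‖b x - bmean b (anc 1 i)‖ₑ ≤
      8 ^ n * bmoNorm b * volume (dyadicCube i) := by
    refine (lintegral_mono_set ((dyadicCube_subset_anc 1 i).trans
      (dyadicCube_subset_tri _))).trans ((setLIntegral_tri_sub_bmean_le b _).trans ?_)
    rw [volume_anc]; push_cast
    rw [one_mul, tp_nat, show (8 : ℝ≥0∞) = 4 * 2 by norm_num, mul_pow]
    exact le_of_eq (by ring)
  have h2 : ∫⁻ x in dyadicCube i, ‖b x - bmean b i‖ₑ ≤
      8 ^ n * bmoNorm b * volume (dyadicCube i) := by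
    refine (lintegral_mono_set (dyadicCube_subset_tri _)).trans
      ((setLIntegral_tri_sub_bmean_le b _).trans ?_)
    gcongr; norm_num
  have h3 := h.trans (add_le_add h1 h2)
  rw [← add_mul] at h3
  refine ((ENNReal.mul_le_mul_iff_left (volume_dyadicCube_ne_zero i)
    (volume_dyadicCube_ne_top i)).1 h3).trans (le_of_eq (by ring))

/-- Telescoping over generations. The growth in k is only linear, so it is later absorbed by
geometric decay. -/
lemma enorm_bmean_anc_sub_le (hb : AEStronglyMeasurable b volume)
    (i : DyadicIndex n) (k : ℕ) : ‖bmean b (anc k i) - bmean b i‖ₑ ≤ k * (2 * 8 ^ n * bmoNorm b) := by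
  induction k with
  | zero => simp [anc_zero]
  | succ k ih =>
    calc ‖bmean b (anc (k + 1) i) - bmean b i‖ₑ = ‖(bmean b (anc 1 (anc k i)) - bmean b (anc k i)) +
          (bmean b (anc k i) - bmean b i)‖ₑ := by rw [anc_anc]; congr 1; ring
      _ ≤ _ := enorm_add_le _ _
      _ ≤ (2 * 8 ^ n * bmoNorm b) + k * (2 * 8 ^ n * bmoNorm b) :=
          add_le_add (enorm_bmean_anc_one_sub_le hb _) ih
      _ = _ := by push_cast; ring

lemma enorm_bmean_nb_anc_sub_le (hb : AEStronglyMeasurable b volume) (v : Fin n → Fin 3)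
    (i : DyadicIndex n) (k : ℕ) :
    ‖bmean b (nb v (anc k i)) - bmean b i‖ₑ ≤ (1 + k) * (2 * 8 ^ n * bmoNorm b) := by
  calc _ = ‖(bmean b (nb v (anc k i)) - bmean b (anc k i)) + (bmean b (anc k i) - bmean b i)‖ₑ := by
        congr 1; ring
    _ ≤ _ := enorm_add_le _ _
    _ ≤ _ := by
        rw [add_mul, one_mul]
        exact add_le_add (enorm_bmean_nb_sub_le hb _ _) (enorm_bmean_anc_sub_le hb _ _)

/-- The John–Nirenberg inequality in Lorentz spaces. -/
lemma exists_lorN_sub_bmean_self_le (hn : 0 < n) (hb : MemBMO b) (hp : 0 < p) (hq : 0 < q) :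
    ∃ C : ℝ≥0, ∀ i : DyadicIndex n, lorN p q (volume.restrict (dyadicCube i))
      (fun x => ‖b x - bmean b i‖ₑ) ≤ C * volume (dyadicCube i) ^ (1 / p) := by
  obtain ⟨C, hC⟩ := exists_fefferman_stein hn hp hq
  obtain ⟨D, hD⟩ := exists_lorN_const_le hp hq
  have hM : (4 : ℝ≥0∞) ^ n * bmoNorm b ≠ ∞ := ENNReal.mul_ne_top (by simp) hb.2.ne
  lift (4 : ℝ≥0∞) ^ n * bmoNorm b to ℝ≥0 using hM with M hM'
  refine ⟨C * (D * M + M), fun i => ?_⟩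
  have hbm := hb.1.aestronglyMeasurable
  have hle : ∀ i : DyadicIndex n, ∫⁻ y in dyadicCube i, ‖b y - bmean b i‖ₑ ≤
      M * volume (dyadicCube i) := fun i => by
    rw [hM']
    exact (lintegral_mono_set (dyadicCube_subset_tri _)).trans (setLIntegral_tri_sub_bmean_le b _)
  -- The John–Nirenberg inequality appears as the Fefferman–Stein inequality with a constant
  -- majorant: on each subcube j, subtracting the mean of b there leaves oscillation at most M.
  refine (hC i (fun x => b x - bmean b i) (fun _ => M) ?_ ?_).trans ?_
  · refine ⟨(hbm.sub aestronglyMeasurable_const).restrict, ?_⟩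
    exact lt_of_le_of_lt (hle i) (ENNReal.mul_lt_top ENNReal.coe_lt_top
      (volume_dyadicCube_ne_top i).lt_top)
  · intro j k _
    refine ⟨bmean b j - bmean b i, fun x _ => ?_⟩
    simp only [sub_sub_sub_cancel_right]
    exact hle j
  · push_cast
    rw [mul_assoc (C : ℝ≥0∞), add_mul]
    gcongr
    · refine (hD _ _ ENNReal.coe_ne_top).trans ?_
      rw [Measure.restrict_apply_univ, mul_assoc]
    · calc _ ≤ (volume (dyadicCube i))⁻¹ * (M * volume (dyadicCube i)) := by gcongr; exact hle i
        _ = _ := by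
          rw [mul_left_comm, ENNReal.inv_mul_cancel (volume_dyadicCube_ne_zero i)
            (volume_dyadicCube_ne_top i), mul_one]

lemma exists_lorN_sub_bmean_le (hn : 0 < n) (hb : MemBMO b) (hp : 0 < p) (hq : 0 < q) :
    ∃ C : ℝ≥0, ∀ (i : DyadicIndex n) (k : ℕ) (v : Fin n → Fin 3),
      lorN p q (volume.restrict (dyadicCube (nb v (anc k i)))) (fun x => ‖b x - bmean b i‖ₑ) ≤
        C * (1 + k) * volume (dyadicCube (anc k i)) ^ (1 / p) := by
  obtain ⟨C, hC⟩ := exists_lorN_sub_bmean_self_le hn hb hp hq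
  obtain ⟨D, hD⟩ := exists_lorN_const_le hp hq
  obtain ⟨A, hA⟩ := exists_lorN_add_le hp hq
  have hM : (2 : ℝ≥0∞) * 8 ^ n * bmoNorm b ≠ ∞ := ENNReal.mul_ne_top
    (ENNReal.mul_ne_top (by simp) (by simp)) hb.2.ne
  have hbd := enorm_bmean_nb_anc_sub_le hb.1.aestronglyMeasurable
  lift (2 : ℝ≥0∞) * 8 ^ n * bmoNorm b to ℝ≥0 using hM with M hM'
  refine ⟨A * (C + D * M), fun i k v => ?_⟩
  set j := nb v (anc k i) with hj
  have hvol : volume (dyadicCube j) = volume (dyadicCube (anc k i)) := volume_nb _ _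
  have hct : ‖bmean b j - bmean b i‖ₑ ≠ ∞ := by simp
  calc _ ≤ lorN p q (volume.restrict (dyadicCube j))
        (fun x => ‖b x - bmean b j‖ₑ + ‖bmean b j - bmean b i‖ₑ) :=
        lorN_mono hq hp fun x => by
          calc ‖b x - bmean b i‖ₑ = ‖(b x - bmean b j) + (bmean b j - bmean b i)‖ₑ := by congr 1; ring
            _ ≤ _ := enorm_add_le _ _
    _ ≤ A * (C * volume (dyadicCube (anc k i)) ^ (1 / p) +
          D * (((1 + k) * M) * volume (dyadicCube (anc k i)) ^ (1 / p))) := by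
        refine (hA _ _ _).trans ?_
        gcongr
        · rw [← hvol]; exact hC j
        · refine (hD _ _ hct).trans ?_
          rw [Measure.restrict_apply_univ, hvol]
          gcongr
          exact hbd v i k
    _ ≤ A * (C * (1 + k) * volume (dyadicCube (anc k i)) ^ (1 / p) +
          D * (((1 + k) * M) * volume (dyadicCube (anc k i)) ^ (1 / p))) := by
        gcongr
        exact le_mul_of_one_le_right zero_le (le_self_add)
    _ = _ := by push_cast; ring

lemma exists_av_sub_bmean_le (hn : 0 < n) (hb : MemBMO b) (hp : 0 < p) :
    ∃ C : ℝ≥0, ∀ (i : DyadicIndex n) (k : ℕ),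
      av p (fun x => ‖b x - bmean b i‖ₑ) (anc k i) ≤ C * (1 + k) := by
  obtain ⟨C, hC⟩ := exists_lorN_sub_bmean_le hn hb hp hp
  obtain ⟨D, hD⟩ := exists_av_le_of_forall_nb (n := n) hp
  refine ⟨D * C, fun i k => ?_⟩
  have hbm := hb.1.aestronglyMeasurable
  refine (hD _ (anc k i) (C * (1 + k)) (by fun_prop) fun v => hC i k v).trans (le_of_eq ?_)
  push_cast; ring

end BMO

/-! ### Square integrable functions -/

section L2

variable {n : ℕ}

/-- The space `L²(ℝⁿ)`. -/
abbrev LTwo (n : ℕ) : Type := Lp ℂ 2 (volume : Measure (Eu n))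

lemma toL2_of_memLp {f : Eu n → ℂ} (hf : MemLp f 2 volume) : toL2 f = hf.toLp f := by
  rw [toL2, dif_pos hf]

lemma coeFn_toL2 {f : Eu n → ℂ} (hf : MemLp f 2 volume) : toL2 f =ᵐ[volume] f := by
  rw [toL2_of_memLp hf]; exact hf.coeFn_toLp

lemma toL2_add {f g : Eu n → ℂ} (hf : MemLp f 2 volume) (hg : MemLp g 2 volume) :
    toL2 (f + g) = toL2 f + toL2 g := by
  rw [toL2_of_memLp hf, toL2_of_memLp hg, toL2_of_memLp (hf.add hg)]; rfl

lemma toL2_sub {f g : Eu n → ℂ} (hf : MemLp f 2 volume) (hg : MemLp g 2 volume) :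
    toL2 (f - g) = toL2 f - toL2 g := by
  rw [toL2_of_memLp hf, toL2_of_memLp hg, toL2_of_memLp (hf.sub hg)]; rfl

lemma toL2_smul (c : ℂ) {f : Eu n → ℂ} (hf : MemLp f 2 volume) :
    toL2 (c • f) = c • toL2 f := by
  rw [toL2_of_memLp hf, toL2_of_memLp (hf.const_smul c)]; rfl

lemma toL2_congr {f g : Eu n → ℂ} (h : f =ᵐ[volume] g) : toL2 f = toL2 g := by
  by_cases hf : MemLp f 2 volume
  · have hg : MemLp g 2 volume := (memLp_congr_ae h).1 hf
    rw [toL2_of_memLp hf, toL2_of_memLp hg]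
    exact (MemLp.toLp_eq_toLp_iff hf hg).2 h
  · have hg : ¬ MemLp g 2 volume := fun hg => hf ((memLp_congr_ae h).2 hg)
    rw [toL2, toL2, dif_neg hf, dif_neg hg]

lemma toL2_finset_sum {ι : Type*} (s : Finset ι) {f : ι → Eu n → ℂ}
    (hf : ∀ i ∈ s, MemLp (f i) 2 volume) : toL2 (∑ i ∈ s, f i) = ∑ i ∈ s, toL2 (f i) := by
  classical
  induction s using Finset.induction_on with
  | empty =>
    simp only [Finset.sum_empty]
    rw [toL2_of_memLp (MemLp.zero (p := 2) (μ := volume) (ε := ℂ))]; rfl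
  | insert a s ha ih =>
    rw [Finset.sum_insert ha, Finset.sum_insert ha, toL2_add (hf a (by simp))
      (memLp_finsetSum' s fun i hi => hf i (by simp [hi])), ih fun i hi => hf i (by simp [hi])]

lemma eLpNorm_apply_toL2_le (S : LTwo n →L[ℂ] LTwo n) {f : Eu n → ℂ} (hf : MemLp f 2 volume) :
    eLpNorm (S (toL2 f)) 2 volume ≤ ‖S‖ₑ * eLpNorm f 2 volume := by
  have h1 : ‖S (toL2 f)‖ₑ ≤ ‖S‖ₑ * ‖toL2 f‖ₑ := S.le_opENorm _
  rw [Lp.enorm_def, Lp.enorm_def, eLpNorm_congr_ae (coeFn_toL2 hf)] at h1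
  exact h1

lemma eLpNorm_two_eq (f : Eu n → ℂ) (μ : Measure (Eu n)) :
    eLpNorm f 2 μ = (∫⁻ x, ‖f x‖ₑ ^ (2 : ℝ) ∂μ) ^ (1 / (2 : ℝ)) := by
  rw [eLpNorm_eq_lintegral_rpow_enorm_toReal (by norm_num) (by norm_num)]; norm_num

lemma lintegral_enorm_mul_le_eLpNorm {μ : Measure (Eu n)} {f g : Eu n → ℂ}
    (hf : AEStronglyMeasurable f μ) (hg : AEStronglyMeasurable g μ) :
    ∫⁻ x, ‖f x‖ₑ * ‖g x‖ₑ ∂μ ≤ eLpNorm f 2 μ * eLpNorm g 2 μ := by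
  rw [eLpNorm_two_eq, eLpNorm_two_eq]
  exact ENNReal.lintegral_mul_le_Lp_mul_Lq _ Real.HolderConjugate.two_two hf.enorm hg.enorm

lemma lintegral_enorm_le_eLpNorm {μ : Measure (Eu n)} {f : Eu n → ℂ}
    (hf : AEStronglyMeasurable f μ) :
    ∫⁻ x, ‖f x‖ₑ ∂μ ≤ eLpNorm f 2 μ * μ univ ^ (1 / (2 : ℝ)) := by
  have h := lintegral_enorm_mul_le_eLpNorm hf (g := fun _ => (1 : ℂ)) aestronglyMeasurable_const
  rw [eLpNorm_two_eq (fun _ => (1 : ℂ))] at h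
  simpa using h

lemma integrable_mul_of_memLp {f g : Eu n → ℂ} (hf : MemLp f 2 volume) (hg : MemLp g 2 volume) :
    Integrable (fun x => f x * g x) volume := by
  refine ⟨hf.1.mul hg.1, ?_⟩
  refine lt_of_le_of_lt ?_ (ENNReal.mul_lt_top hf.2 hg.2)
  simp_rw [enorm_mul]
  exact lintegral_enorm_mul_le_eLpNorm hf.1 hg.1

lemma integrable_of_memLp_of_isBounded {f : Eu n → ℂ} (hf : MemLp f 2 volume)
    (hb : Bornology.IsBounded (Function.support f)) : Integrable f volume := by
  set E := closure (Function.support f)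
  have hE : MeasurableSet E := isClosed_closure.measurableSet
  have hEt : volume E ≠ ∞ := hb.isCompact_closure.measure_lt_top.ne
  have h1 : f = E.indicator f := by
    ext x
    by_cases hx : x ∈ E
    · rw [indicator_of_mem hx]
    · rw [indicator_of_notMem hx]
      by_contra h
      exact hx (subset_closure h)
  rw [h1, integrable_indicator_iff hE]
  refine ⟨hf.1.restrict, lt_of_le_of_lt (lintegral_enorm_le_eLpNorm hf.1.restrict) ?_⟩
  rw [Measure.restrict_apply_univ]
  exact ENNReal.mul_lt_top (lt_of_le_of_lt (eLpNorm_mono_measure _ Measure.restrict_le_self) hf.2)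
    (ENNReal.rpow_lt_top_of_nonneg (by positivity) hEt)

lemma star_add_LTwo (f g : LTwo n) : star (f + g) = star f + star g := by
  refine Lp.ext ?_
  filter_upwards [Lp.coeFn_star (f + g), Lp.coeFn_add f g, Lp.coeFn_add (star f) (star g),
    Lp.coeFn_star f, Lp.coeFn_star g] with x h1 h2 h3 h4 h5
  simp only [h1, h3, Pi.star_apply, Pi.add_apply, h2, h4, h5, star_add]

lemma star_smul_LTwo (c : ℂ) (f : LTwo n) : star (c • f) = star c • star f := by
  refine Lp.ext ?_
  filter_upwards [Lp.coeFn_star (c • f), Lp.coeFn_smul c f, Lp.coeFn_smul (star c) (star f),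
    Lp.coeFn_star f] with x h1 h2 h3 h4
  simp only [h1, h3, Pi.star_apply, Pi.smul_apply, h2, h4, star_smul]

lemma norm_star_LTwo (f : LTwo n) : ‖star f‖ = ‖f‖ := by
  rw [Lp.norm_def, Lp.norm_def]
  congr 1
  refine eLpNorm_congr_norm_ae ?_
  filter_upwards [Lp.coeFn_star f] with x h
  rw [h, Pi.star_apply, norm_star]

lemma transpose_add (S : LTwo n →L[ℂ] LTwo n) (f g : LTwo n) :
    transpose S (f + g) = transpose S f + transpose S g := by
  rw [transpose, transpose, transpose, star_add_LTwo, map_add, star_add_LTwo]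

lemma transpose_smul (S : LTwo n →L[ℂ] LTwo n) (c : ℂ) (f : LTwo n) :
    transpose S (c • f) = c • transpose S f := by
  rw [transpose, transpose, star_smul_LTwo, map_smul, star_smul_LTwo, star_star]

lemma norm_transpose_le (S : LTwo n →L[ℂ] LTwo n) (f : LTwo n) : ‖transpose S f‖ ≤ ‖S‖ * ‖f‖ := by
  rw [transpose, norm_star_LTwo]
  refine (ContinuousLinearMap.le_opNorm _ _).trans ?_
  rw [norm_star_LTwo, LinearIsometryEquiv.norm_map]

/-- The transpose of a bounded operator on `L²`, as a bounded operator. -/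
def transposeL (S : LTwo n →L[ℂ] LTwo n) : LTwo n →L[ℂ] LTwo n :=
  LinearMap.mkContinuous
    { toFun := transpose S
      map_add' := transpose_add S
      map_smul' := transpose_smul S } ‖S‖ (norm_transpose_le S)

lemma transposeL_apply (S : LTwo n →L[ℂ] LTwo n) (f : LTwo n) : transposeL S f = transpose S f := rfl

lemma integral_transposeL (S : LTwo n →L[ℂ] LTwo n) {f g : Eu n → ℂ} (hf : MemLp f 2 volume)
    (hg : MemLp g 2 volume) :
    ∫ x, transposeL S (toL2 f) x * g x = ∫ x, f x * S (toL2 g) x := by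
  have h := integral_transpose S (toL2 g) (toL2 f)
  have h1 : ∫ x, S (toL2 g) x * toL2 f x = ∫ x, f x * S (toL2 g) x :=
    integral_congr_ae (by filter_upwards [coeFn_toL2 hf] with x hx; rw [hx, mul_comm])
  have h2 : ∫ x, toL2 g x * transpose S (toL2 f) x = ∫ x, transposeL S (toL2 f) x * g x :=
    integral_congr_ae (by filter_upwards [coeFn_toL2 hg] with x hx; rw [hx, mul_comm, transposeL_apply])
  rw [← h1, h, h2]

end L2

/-! ### Calderón–Zygmund operators -/

section Kernel

variable {n : ℕ} {δ A : ℝ} {K : Eu n → Eu n → ℂ}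

lemma IsStandardKernel.swap (hK : IsStandardKernel δ A K) :
    IsStandardKernel δ A fun x y => K y x where
  delta_pos := hK.delta_pos
  const_pos := hK.const_pos
  size x y h := by rw [norm_sub_rev]; exact hK.size y x h.symm
  regular_left x x' y h h' hle := by
    rw [norm_sub_rev x y, norm_sub_rev x' y] at hle ⊢
    exact hK.regular_right y x x' h.symm h'.symm hle
  regular_right x y y' h h' hle := by
    rw [norm_sub_rev x y, norm_sub_rev x y'] at hle ⊢
    exact hK.regular_left y y' x h.symm h'.symm hle

/-- The regularity estimates in the two variables make the kernel locally Hölder continuous off the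
diagonal; this serves to obtain joint measurability. -/
lemma IsStandardKernel.continuousOn (hK : IsStandardKernel δ A K) :
    ContinuousOn (Function.uncurry K) {z | z.1 ≠ z.2} := by
  rintro ⟨x₀, y₀⟩ (h : x₀ ≠ y₀)
  refine ContinuousAt.continuousWithinAt ?_
  set d := ‖x₀ - y₀‖ with hd
  have hd0 : 0 < d := norm_pos_iff.2 (sub_ne_zero.2 h)
  have hA := hK.const_pos
  have hδ := hK.delta_pos
  rw [ContinuousAt, tendsto_iff_norm_sub_tendsto_zero]
  set B := A / d ^ ((n : ℝ) + δ) with hB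
  have hlim : Tendsto (fun z : Eu n × Eu n => B * (‖z.1 - x₀‖ ^ δ + ‖z.2 - y₀‖ ^ δ)) (𝓝 (x₀, y₀)) (𝓝 0) := by
    have hc : Continuous fun z : Eu n × Eu n => B * (‖z.1 - x₀‖ ^ δ + ‖z.2 - y₀‖ ^ δ) := by
      refine continuous_const.mul (Continuous.add ?_ ?_)
      · exact (by fun_prop : Continuous fun z : Eu n × Eu n => ‖z.1 - x₀‖).rpow_const fun _ => Or.inr hδ.le
      · exact (by fun_prop : Continuous fun z : Eu n × Eu n => ‖z.2 - y₀‖).rpow_const fun _ => Or.inr hδ.le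
    have := hc.tendsto (x₀, y₀)
    simpa [Real.zero_rpow hδ.ne'] using this
  refine squeeze_zero' (Eventually.of_forall fun _ => norm_nonneg _) ?_ hlim
  have hball : Metric.ball (x₀, y₀) (d / 8) ∈ 𝓝 (x₀, y₀) := Metric.ball_mem_nhds _ (by positivity)
  filter_upwards [hball] with z hz
  obtain ⟨x, y⟩ := z
  rw [Metric.mem_ball, Prod.dist_eq, max_lt_iff, dist_eq_norm, dist_eq_norm] at hz
  obtain ⟨hx, hy⟩ := hz
  simp only at hx hy
  have h1 : d ≤ ‖x₀ - y‖ + ‖y - y₀‖ := by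
    calc d = ‖(x₀ - y) + (y - y₀)‖ := by rw [hd]; congr 1; abel
      _ ≤ _ := norm_add_le _ _
  have h2 : ‖x₀ - y‖ ≤ ‖x - y‖ + ‖x - x₀‖ := by
    calc ‖x₀ - y‖ = ‖(x - y) - (x - x₀)‖ := by congr 1; abel
      _ ≤ _ := norm_sub_le _ _
  have hne1 : x ≠ y := sub_ne_zero.1 (norm_pos_iff.1 (by linarith))
  have hne2 : x₀ ≠ y := sub_ne_zero.1 (norm_pos_iff.1 (by linarith))
  have e1 : ‖K x y - K x₀ y‖ ≤ B * ‖x - x₀‖ ^ δ := by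
    refine (hK.regular_left x x₀ y hne1 hne2 ?_).trans ?_
    · have := le_max_left ‖x - y‖ ‖x₀ - y‖; linarith
    · rw [hB, div_mul_eq_mul_div]
      gcongr; linarith
  have e2 : ‖K x₀ y - K x₀ y₀‖ ≤ B * ‖y - y₀‖ ^ δ := by
    refine (hK.regular_right x₀ y y₀ hne2 h ?_).trans ?_
    · have := le_max_left ‖x₀ - y‖ ‖x₀ - y₀‖; linarith
    · rw [hB, div_mul_eq_mul_div]
      gcongr
      have := norm_nonneg (x₀ - y); linarith
  simp only [Function.uncurry]
  calc ‖K x y - K x₀ y₀‖ = ‖(K x y - K x₀ y) + (K x₀ y - K x₀ y₀)‖ := by congr 1; abel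
    _ ≤ _ := norm_add_le _ _
    _ ≤ _ := by rw [mul_add]; exact add_le_add e1 e2

/-- The kernel with value `0` on the diagonal. -/
def offDiag (K : Eu n → Eu n → ℂ) (x y : Eu n) : ℂ := if x = y then 0 else K x y

lemma offDiag_of_ne {x y : Eu n} (h : x ≠ y) : offDiag K x y = K x y := if_neg h

lemma isStandardKernel_offDiag (hK : IsStandardKernel δ A K) : IsStandardKernel δ A (offDiag K) where
  delta_pos := hK.delta_pos
  const_pos := hK.const_pos
  size x y h := by rw [offDiag_of_ne h]; exact hK.size x y h
  regular_left x x' y h h' hle := by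
    rw [offDiag_of_ne h, offDiag_of_ne h']; exact hK.regular_left x x' y h h' hle
  regular_right x y y' h h' hle := by
    rw [offDiag_of_ne h, offDiag_of_ne h']; exact hK.regular_right x y y' h h' hle

lemma IsStandardKernel.measurable_offDiag (hK : IsStandardKernel δ A K) :
    Measurable (Function.uncurry (offDiag K)) := by
  classical
  have hms : MeasurableSet {z : Eu n × Eu n | z.1 ≠ z.2} :=
    (isClosed_eq continuous_fst continuous_snd).measurableSet.compl
  have h := ContinuousOn.measurable_piecewise (g := fun _ => (0 : ℂ)) hK.continuousOn
    continuousOn_const hms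
  convert h using 1
  ext ⟨x, y⟩
  by_cases hxy : x = y
  · subst hxy; simp [offDiag, Set.piecewise, Function.uncurry]
  · simp [offDiag, Set.piecewise, hxy, Function.uncurry]

lemma IsStandardKernel.enorm_le (hK : IsStandardKernel δ A K) {ε : ℝ} (hε : 0 < ε) {x y : Eu n}
    (h : ε ≤ ‖x - y‖) : ‖K x y‖ₑ ≤ ENNReal.ofReal (A / ε ^ n) := by
  have hA := hK.const_pos
  have hne : x ≠ y := sub_ne_zero.1 (norm_pos_iff.1 (by linarith))
  rw [← ofReal_norm]
  refine ENNReal.ofReal_le_ofReal ((hK.size x y hne).trans ?_)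
  gcongr

/-- The sets `E` and `F` have positive distance. -/
def Separated (E F : Set (Eu n)) : Prop := ∃ ε : ℝ, 0 < ε ∧ ∀ x ∈ E, ∀ y ∈ F, ε ≤ ‖x - y‖

lemma Separated.symm {E F : Set (Eu n)} (h : Separated E F) : Separated F E := by
  obtain ⟨ε, h0, h⟩ := h
  exact ⟨ε, h0, fun x hx y hy => by rw [norm_sub_rev]; exact h y hy x hx⟩

/-- A bounded operator on `L²` which is associated with the measurable standard kernel `K` in the
weak sense. -/
structure IsCZ (δ A : ℝ) (K : Eu n → Eu n → ℂ) (S : LTwo n →L[ℂ] LTwo n) : Prop where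
  kernel : IsStandardKernel δ A K
  meas : Measurable (Function.uncurry K)
  repr : ∀ f g : Eu n → ℂ, MemLp f 2 volume → MemLp g 2 volume →
    Bornology.IsBounded (Function.support f) → Bornology.IsBounded (Function.support g) →
    Separated (Function.support g) (Function.support f) →
    ∫ x, S (toL2 f) x * g x = ∫ x, (∫ y, K x y * f y) * g x

lemma integrable_kernel_mul (hK : IsStandardKernel δ A K) (hm : Measurable (Function.uncurry K))
    {f g : Eu n → ℂ} (hf : Integrable f) (hg : Integrable g)
    (h : Separated (Function.support g) (Function.support f)) :
    Integrable (Function.uncurry fun x y => K x y * f y * g x) (volume.prod volume) := by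
  obtain ⟨ε, hε, h⟩ := h
  have h1 : Integrable (fun z : Eu n × Eu n => g z.1 * f z.2) (volume.prod volume) := hg.mul_prod hf
  have hA := hK.const_pos
  refine (h1.norm.const_mul (A / ε ^ n)).mono' ?_ ?_
  · have h2 : AEStronglyMeasurable (fun z : Eu n × Eu n => Function.uncurry K z * (g z.1 * f z.2))
        (volume.prod volume) := hm.aestronglyMeasurable.mul h1.1
    refine h2.congr (Eventually.of_forall fun z => ?_)
    simp only [Function.uncurry]; ring
  · refine Eventually.of_forall fun z => ?_
    obtain ⟨x, y⟩ := z
    simp only [Function.uncurry]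
    by_cases hgx : g x = 0
    · simp [hgx]
    by_cases hfy : f y = 0
    · simp [hfy]
    have h3 := h x hgx y hfy
    have hne : x ≠ y := sub_ne_zero.1 (norm_pos_iff.1 (by linarith))
    rw [mul_assoc, norm_mul, mul_comm (f y)]
    gcongr
    refine (hK.size x y hne).trans ?_
    gcongr

/-- For separated bounded supports the kernel is bounded on the relevant product set, so Fubini
exchanges the variables. The class is thus closed under transposition, and every estimate below
holds for both operators. -/
lemma isCZ_transposeL {S : LTwo n →L[ℂ] LTwo n} (hS : IsCZ δ A K S) :
    IsCZ δ A (fun x y => K y x) (transposeL S) where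
  kernel := hS.kernel.swap
  meas := hS.meas.comp measurable_swap
  repr f g hf hg hfb hgb h := by
    have h1 := hS.repr g f hg hf hgb hfb h.symm
    rw [integral_transposeL S hf hg]
    simp_rw [mul_comm (f _)]
    rw [h1]
    have hi := integrable_kernel_mul hS.kernel hS.meas
      (integrable_of_memLp_of_isBounded hg hgb) (integrable_of_memLp_of_isBounded hf hfb) h.symm
    calc _ = ∫ x, ∫ y, K x y * g y * f x := by simp_rw [integral_mul_const]
      _ = ∫ y, ∫ x, K x y * g y * f x := integral_integral_swap hi
      _ = _ := by
        refine integral_congr_ae (Eventually.of_forall fun y => ?_)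
        simp only
        rw [← integral_mul_const]
        congr 1; ext x; ring

/-- The pointwise kernel representation off the support. -/
lemma IsCZ.ae_eq_integral {S : LTwo n →L[ℂ] LTwo n} (hS : IsCZ δ A K S) {f : Eu n → ℂ}
    (hf : MemLp f 2 volume) (hfb : Bornology.IsBounded (Function.support f)) {E : Set (Eu n)}
    (hE : MeasurableSet E) (hEb : Bornology.IsBounded E) (h : Separated E (Function.support f)) :
    ∀ᵐ x, x ∈ E → S (toL2 f) x = ∫ y, K x y * f y := by
  have hfi := integrable_of_memLp_of_isBounded hf hfb
  have hEt : volume E ≠ ∞ := hEb.measure_lt_top.ne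
  have hsupp : Function.support (E.indicator fun _ => (1 : ℂ)) ⊆ E := support_indicator_subset
  have hsep : ∀ {E' : Set (Eu n)}, E' ⊆ E →
      Separated (Function.support (E'.indicator fun _ => (1 : ℂ))) (Function.support f) := by
    intro E' hE'
    obtain ⟨ε, h0, h⟩ := h
    exact ⟨ε, h0, fun x hx => h x (hE' (support_indicator_subset hx))⟩
  have hind : ∀ {E' : Set (Eu n)}, MeasurableSet E' → E' ⊆ E →
      MemLp (E'.indicator fun _ => (1 : ℂ)) 2 volume := fun hm hE' =>
    memLp_indicator_const 2 hm 1 (Or.inr (measure_ne_top_of_subset hE' hEt))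
  have hu : ∀ (u : Eu n → ℂ) (E' : Set (Eu n)), MeasurableSet E' →
      ∫ x, u x * (E'.indicator fun _ => (1 : ℂ)) x = ∫ x in E', u x := fun u E' hm => by
    rw [← integral_indicator hm]
    congr 1; ext x
    by_cases hx : x ∈ E' <;> simp [hx]
  rw [← ae_restrict_iff' hE]
  have hk := integrable_kernel_mul hS.kernel hS.meas hfi
    ((integrable_indicator_iff hE).2 (integrableOn_const hEt (C := (1 : ℂ)))) (hsep subset_rfl)
  have hki : IntegrableOn (fun x => ∫ y, K x y * f y) E := by
    have := hk.integral_prod_left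
    simp only [Function.uncurry, integral_mul_const] at this
    rw [← integrable_indicator_iff hE]
    refine this.congr (Eventually.of_forall fun x => ?_)
    by_cases hx : x ∈ E <;> simp [hx]
  have hSi : IntegrableOn (S (toL2 f)) E := by
    rw [← integrable_indicator_iff hE]
    refine (integrable_mul_of_memLp (Lp.memLp (S (toL2 f))) (hind hE subset_rfl)).congr
      (Eventually.of_forall fun x => ?_)
    by_cases hx : x ∈ E <;> simp [hx]
  -- The weak representation is tested against indicators of measurable subsets of E, which
  -- determine both sides almost everywhere on E.
  refine Integrable.ae_eq_of_forall_setIntegral_eq _ _ hSi hki fun E' hE' _ => ?_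
  rw [Measure.restrict_restrict hE']
  have h2 : MeasurableSet (E' ∩ E) := hE'.inter hE
  have h3 := hS.repr f _ hf (hind h2 inter_subset_right) hfb
    (hEb.subset (support_indicator_subset.trans inter_subset_right)) (hsep inter_subset_right)
  rw [hu _ _ h2, hu _ _ h2] at h3
  exact h3

end Kernel

/-! ### From the representation for smooth functions to the representation on L². -/

section Extension

variable {n : ℕ} {δ A : ℝ} {K : Eu n → Eu n → ℂ}

open scoped Manifold ContDiff in
lemma exists_cutoff {s t : Set (Eu n)} (hs : IsClosed s) (ht : IsClosed t) (hd : Disjoint s t) :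
    ∃ χ : Eu n → ℝ, ContDiff ℝ ∞ χ ∧ (∀ x ∈ s, χ x = 0) ∧ (∀ x ∈ t, χ x = 1) ∧
      ∀ x, ‖χ x‖ ≤ 1 := by
  obtain ⟨χ, h0, h1, h⟩ := exists_contMDiffMap_zero_one_of_isClosed (n := (⊤ : ℕ∞)) 𝓘(ℝ, Eu n) hs ht hd
  refine ⟨χ, contMDiff_iff_contDiff.1 χ.contMDiff, h0, h1, fun x => ?_⟩
  rw [Real.norm_eq_abs, abs_le]
  have := h x
  exact ⟨by linarith [this.1], this.2⟩

/-- Approximation by smooth functions with control of the support. -/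
lemma exists_schwartz_approx {f : Eu n → ℂ} (hf : MemLp f 2 volume) {s : Set (Eu n)}
    (hs : IsClosed s) (hd : Disjoint s (closure (Function.support f))) {η : ℝ} (hη : 0 < η) :
    ∃ u : 𝓢(Eu n, ℂ), HasCompactSupport u ∧ (∀ x ∈ s, u x = 0) ∧
      eLpNorm (f - ⇑u) 2 volume ≤ ENNReal.ofReal η := by
  -- Multiplying a smooth approximation by a cutoff equal to 1 on the support of f and 0 on s does
  -- not increase the L² error.
  obtain ⟨χ, hχ, h0, h1, hle⟩ := exists_cutoff hs isClosed_closure hd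
  obtain ⟨g, hg1, hg2, hg3⟩ := hf.exist_eLpNorm_sub_le (by norm_num) (by norm_num) hη
  have hu : ContDiff ℝ _ fun x => (χ x : ℂ) * g x := (Complex.ofRealCLM.contDiff.comp hχ).mul hg2
  have hc : HasCompactSupport fun x => (χ x : ℂ) * g x := hg1.mul_left
  refine ⟨hc.toSchwartzMap hu, hc, fun x hx => ?_, ?_⟩
  · simp [h0 x hx]
  · refine le_trans (eLpNorm_mono fun x => ?_) hg3
    have : (f - ⇑(hc.toSchwartzMap hu)) x = (χ x : ℂ) * (f - g) x := by
      simp only [Pi.sub_apply, HasCompactSupport.toSchwartzMap_toFun, mul_sub]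
      congr 1
      by_cases hx : f x = 0
      · simp [hx]
      · rw [h1 x (subset_closure hx)]; simp
    rw [this, norm_mul]
    calc _ ≤ 1 * ‖(f - g) x‖ := by
          gcongr
          rw [Complex.norm_real]; exact hle x
      _ = _ := one_mul _

lemma eq_of_forall_enorm_sub_le {z w : ℂ} {C : ℝ≥0∞} (hC : C ≠ ∞)
    (h : ∀ η : ℝ, 0 < η → ‖z - w‖ₑ ≤ C * ENNReal.ofReal η) : z = w := by
  have hlim : Tendsto (fun η : ℝ => C * ENNReal.ofReal η) (𝓝[>] 0) (𝓝 0) := by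
    have : Tendsto (fun η : ℝ => C * ENNReal.ofReal η) (𝓝 0) (𝓝 (C * ENNReal.ofReal 0)) :=
      ENNReal.Tendsto.const_mul (ENNReal.continuous_ofReal.tendsto 0) (Or.inr hC)
    simp only [ENNReal.ofReal_zero, mul_zero] at this
    exact this.mono_left nhdsWithin_le_nhds
  have h0 : ‖z - w‖ₑ ≤ 0 := ge_of_tendsto hlim (by
    filter_upwards [self_mem_nhdsWithin] with η hη using h η hη)
  have : z - w = 0 := by simpa using h0
  exact sub_eq_zero.1 this

lemma enorm_integral_apply_mul_le (S : LTwo n →L[ℂ] LTwo n) {f g : Eu n → ℂ} (hf : MemLp f 2 volume)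
    (hg : MemLp g 2 volume) : ‖∫ x, S (toL2 f) x * g x‖ₑ ≤
      ‖S‖ₑ * eLpNorm f 2 volume * eLpNorm g 2 volume := by
  refine (enorm_integral_le_lintegral_enorm _).trans ?_
  simp_rw [enorm_mul]
  refine (lintegral_enorm_mul_le_eLpNorm (Lp.aestronglyMeasurable _) hg.1).trans ?_
  gcongr
  exact eLpNorm_apply_toL2_le S hf

lemma enorm_integral_kernel_mul_le (hK : IsStandardKernel δ A K) {f g : Eu n → ℂ}
    (hg : AEStronglyMeasurable g volume) {ε : ℝ} (hε : 0 < ε)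
    (h : ∀ x, g x ≠ 0 → ∀ y, f y ≠ 0 → ε ≤ ‖x - y‖) :
    ‖∫ x, (∫ y, K x y * f y) * g x‖ₑ ≤
      ENNReal.ofReal (A / ε ^ n) * (∫⁻ y, ‖f y‖ₑ) * ∫⁻ x, ‖g x‖ₑ := by
  refine (enorm_integral_le_lintegral_enorm _).trans ?_
  have hc : ENNReal.ofReal (A / ε ^ n) ≠ ∞ := ENNReal.ofReal_ne_top
  calc _ ≤ ∫⁻ x, (ENNReal.ofReal (A / ε ^ n) * ∫⁻ y, ‖f y‖ₑ) * ‖g x‖ₑ := by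
        refine lintegral_mono fun x => ?_
        rw [enorm_mul]
        by_cases hgx : g x = 0
        · simp [hgx]
        gcongr
        refine (enorm_integral_le_lintegral_enorm _).trans ?_
        rw [← lintegral_const_mul' _ _ hc]
        refine lintegral_mono fun y => ?_
        rw [enorm_mul]
        by_cases hfy : f y = 0
        · simp [hfy]
        gcongr
        exact hK.enorm_le hε (h x hgx y hfy)
    _ = _ := lintegral_const_mul'' _ hg.enorm

/-- Density argument. The approximants u of f vanish near the support of g and outside a ball. The
left side is then continuous by the L² bound of the operator. The right side is continuous because
the kernel is bounded on the separated supports and f - u lives on a set of finite measure, so its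
L¹ norm is controlled by its L² norm. -/
lemma isCZ_l2Extension {T : 𝓢(Eu n, ℂ) →L[ℂ] 𝓢'(Eu n, ℂ)} (hT : IsCalderonZygmund δ A K T) :
    IsCZ δ A (offDiag K) (l2Extension T) where
  kernel := isStandardKernel_offDiag hT.kernel
  meas := hT.kernel.measurable_offDiag
  repr f g hf hg hfb hgb hsep := by
    obtain ⟨ε, hε, hsep⟩ := hsep
    have hfi := integrable_of_memLp_of_isBounded hf hfb
    have hgi := integrable_of_memLp_of_isBounded hg hgb
    obtain ⟨R, hR⟩ := hfb.subset_ball (0 : Eu n)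
    -- the closed set off which the approximations live
    set s : Set (Eu n) := Metric.cthickening (ε / 2) (Function.support g) ∪ (Metric.ball 0 (R + 1))ᶜ with hs
    have hscl : IsClosed s := Metric.isClosed_cthickening.union Metric.isOpen_ball.isClosed_compl
    have hsb : Bornology.IsBounded sᶜ := by
      refine (Metric.isBounded_ball (x := (0 : Eu n)) (r := R + 1)).subset fun x hx => ?_
      by_contra h
      exact hx (Or.inr h)
    have hfar : ∀ x, g x ≠ 0 → ∀ y, y ∉ s → ε / 2 ≤ ‖x - y‖ := by
      intro x hx y hy
      by_contra hlt
      refine hy (Or.inl (Metric.mem_cthickening_of_dist_le y x _ _ hx ?_))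
      rw [dist_comm, dist_eq_norm]; exact (not_le.1 hlt).le
    have hd : Disjoint s (closure (Function.support f)) := by
      rw [Set.disjoint_right]
      intro y hy hys
      rcases hys with hys | hys
      · have h1 : Metric.infEDist y (Function.support g) ≤ ENNReal.ofReal (ε / 2) := hys
        have h2 : closure (Function.support f) ⊆
            {y | ENNReal.ofReal ε ≤ Metric.infEDist y (Function.support g)} := by
          refine closure_minimal (fun y hy => ?_)
            (isClosed_le continuous_const Metric.continuous_infEDist)
          rw [mem_ofPred_eq, Metric.le_infEDist]
          intro x hx
          rw [edist_comm, edist_dist, dist_eq_norm]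
          exact ENNReal.ofReal_le_ofReal (hsep x hx y hy)
        have h3 := (h2 hy).trans h1
        rw [ENNReal.ofReal_le_ofReal_iff (by positivity)] at h3
        linarith
      · refine hys (Metric.closedBall_subset_ball (by linarith : R < R + 1) ?_)
        exact closure_minimal (hR.trans Metric.ball_subset_closedBall) Metric.isClosed_closedBall hy
    set G := ∫⁻ x, ‖g x‖ₑ with hG
    set V := volume sᶜ ^ (1 / (2 : ℝ)) with hV
    have hVt : V ≠ ∞ := ENNReal.rpow_ne_top_of_nonneg (by positivity) hsb.measure_lt_top.ne
    have hK := isStandardKernel_offDiag hT.kernel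
    refine eq_of_forall_enorm_sub_le (C := ‖l2Extension T‖ₑ * eLpNorm g 2 volume +
      ENNReal.ofReal (A / (ε / 2) ^ n) * V * G) ?_ fun η hη => ?_
    · refine ENNReal.add_ne_top.2 ⟨ENNReal.mul_ne_top enorm_ne_top hg.2.ne,
        ENNReal.mul_ne_top (ENNReal.mul_ne_top ENNReal.ofReal_ne_top hVt) hgi.2.ne⟩
    obtain ⟨u, huc, hu0, hu⟩ := exists_schwartz_approx hf hscl hd hη
    have hu2 : MemLp u 2 volume := u.memLp 2 volume
    have hfu : MemLp (f - ⇑u) 2 volume := hf.sub hu2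
    have hfus : ∀ y, (f - ⇑u) y ≠ 0 → y ∉ s := fun y hy hys => by
      have h1 : f y = 0 := by
        by_contra h
        exact Set.disjoint_left.1 hd hys (subset_closure h)
      exact hy (by simp [h1, hu0 y hys])
    have hus : Function.support u ⊆ sᶜ := fun y hy hys => hy (hu0 y hys)
    have hui := integrable_of_memLp_of_isBounded hu2 (hsb.subset hus)
    -- the representation for the smooth function
    have hrepr : ∫ x, l2Extension T (toL2 u) x * g x = ∫ x, (∫ y, offDiag K x y * u y) * g x := by
      refine integral_congr_ae ?_
      have hto : toL2 u = u.toLp 2 volume := toL2_of_memLp hu2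
      rw [hto]
      filter_upwards [hT.repr u huc] with x hx
      by_cases hgx : g x = 0
      · simp [hgx]
      have hxu : x ∉ tsupport u := by
        intro hxs
        have h1 : tsupport u ⊆ {y | ε / 2 ≤ ‖x - y‖} :=
          closure_minimal (fun y hy => hfar x hgx y (hus hy))
            (isClosed_le continuous_const (by fun_prop))
        have h2 := h1 hxs
        rw [mem_ofPred_eq, sub_self, norm_zero] at h2
        linarith
      rw [hx hxu]
      congr 2
      ext y
      by_cases hxy : x = y
      · subst hxy
        rw [image_eq_zero_of_notMem_tsupport hxu]; simp
      · rw [offDiag_of_ne hxy]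
    have e1 : ∫ x, l2Extension T (toL2 f) x * g x =
        (∫ x, l2Extension T (toL2 (f - ⇑u)) x * g x) + ∫ x, l2Extension T (toL2 u) x * g x := by
      rw [← integral_add (integrable_mul_of_memLp (Lp.memLp _) hg)
        (integrable_mul_of_memLp (Lp.memLp _) hg)]
      refine integral_congr_ae ?_
      have h1 : l2Extension T (toL2 f) = l2Extension T (toL2 (f - ⇑u)) + l2Extension T (toL2 u) := by
        rw [← map_add, ← toL2_add hfu hu2, sub_add_cancel]
      filter_upwards [Lp.coeFn_add (l2Extension T (toL2 (f - ⇑u))) (l2Extension T (toL2 u))] with x hx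
      rw [h1, hx, Pi.add_apply, add_mul]
    have hint : ∀ {v : Eu n → ℂ}, Integrable v → (∀ y, v y ≠ 0 → y ∉ s) →
        Integrable (Function.uncurry fun x y => offDiag K x y * v y * g x) (volume.prod volume) :=
      fun hv hvs => integrable_kernel_mul hK hT.kernel.measurable_offDiag hv hgi
        ⟨ε / 2, by positivity, fun x hx y hy => hfar x hx y (hvs y hy)⟩
    have e2 : ∫ x, (∫ y, offDiag K x y * f y) * g x = (∫ x, (∫ y, offDiag K x y * (f - ⇑u) y) * g x) +
        ∫ x, (∫ y, offDiag K x y * u y) * g x := by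
      have i1 := hint (hfi.sub hui) hfus
      have i2 := hint hui fun y hy => hus hy
      simp_rw [← integral_mul_const]
      have h3 := integral_integral_add i1 i2
      simp only [Function.uncurry] at h3
      rw [← h3]
      refine integral_congr_ae (Eventually.of_forall fun x => ?_)
      simp only
      congr 1; ext y; simp only [Pi.sub_apply]; ring
    rw [e1, e2, hrepr, add_sub_add_right_eq_sub]
    refine enorm_sub_le.trans ?_
    rw [add_mul]
    refine add_le_add ?_ ?_
    · refine (enorm_integral_apply_mul_le _ hfu hg).trans ?_
      calc _ = ‖l2Extension T‖ₑ * eLpNorm g 2 volume * eLpNorm (f - ⇑u) 2 volume := by ring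
        _ ≤ _ := by gcongr
    · refine (enorm_integral_kernel_mul_le hK hg.1 (by positivity : 0 < ε / 2)
        fun x hx y hy => hfar x hx y (hfus y hy)).trans ?_
      calc _ ≤ ENNReal.ofReal (A / (ε / 2) ^ n) * (ENNReal.ofReal η * V) * G := by
            gcongr
            have h1 : ∫⁻ y, ‖(f - ⇑u) y‖ₑ = ∫⁻ y in sᶜ, ‖(f - ⇑u) y‖ₑ := by
              rw [← lintegral_indicator hscl.measurableSet.compl]
              refine lintegral_congr fun y => ?_
              by_cases hy : y ∈ s
              · rw [indicator_of_notMem (by simpa using hy)]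
                by_contra h
                exact hfus y (by simpa using h) hy
              · rw [indicator_of_mem (by simpa using hy)]
            rw [h1]
            refine (lintegral_enorm_le_eLpNorm hfu.1.restrict).trans ?_
            rw [Measure.restrict_apply_univ]
            gcongr
            exact (eLpNorm_mono_measure _ Measure.restrict_le_self).trans hu
        _ = _ := by ring

end Extension

section Phase

/-- The phase factor: `z * phase z = ‖z‖`. -/
def phase (z : ℂ) : ℂ := conj z / ‖z‖

lemma mul_phase (z : ℂ) : z * phase z = ‖z‖ := by
  rcases eq_or_ne z 0 with rfl | h
  · simp [phase]
  · have : (‖z‖ : ℂ) ≠ 0 := by simpa using h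
    rw [phase, ← mul_div_assoc, Complex.mul_conj, Complex.normSq_eq_norm_sq]
    push_cast
    field_simp

lemma norm_phase_le (z : ℂ) : ‖phase z‖ ≤ 1 := by
  rw [phase, norm_div, RCLike.norm_conj, Complex.norm_real, norm_norm]
  exact div_self_le_one _

lemma measurable_phase : Measurable phase := by
  unfold phase; fun_prop

end Phase

/-! ### Local Lorentz bounds for Calderón–Zygmund operators by bootstrapping from L². -/

section Local

variable {n : ℕ} {p q s δ A : ℝ} {K : Eu n → Eu n → ℂ} {S : LTwo n →L[ℂ] LTwo n}

/-- A local bound of `S` from `L^s` to `L¹`. -/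
def LocType (S : LTwo n →L[ℂ] LTwo n) (s : ℝ) : Prop :=
  ∃ C : ℝ≥0, ∀ (i : DyadicIndex n) (f : Eu n → ℂ), MemLp f 2 volume → (∀ x, x ∉ tri i → f x = 0) →
    ∫⁻ x in tri i, ‖S (toL2 f) x‖ₑ ≤ C * (volume (dyadicCube i) * av s (fun x => ‖f x‖ₑ) i)

lemma eLpNorm_two_eq_av {f : Eu n → ℂ} {i : DyadicIndex n} (hf : ∀ x, x ∉ tri i → f x = 0) :
    eLpNorm f 2 volume = volume (dyadicCube i) ^ (1 / (2 : ℝ)) * av 2 (fun x => ‖f x‖ₑ) i := by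
  rw [eLpNorm_two_eq, av, ← ENNReal.mul_rpow_of_nonneg _ _ (by positivity), ← mul_assoc,
    ENNReal.mul_inv_cancel (volume_dyadicCube_ne_zero i) (volume_dyadicCube_ne_top i), one_mul]
  congr 1
  rw [← lintegral_indicator (measurableSet_tri i)]
  refine lintegral_congr fun x => ?_
  by_cases hx : x ∈ tri i
  · rw [indicator_of_mem hx]
  · rw [indicator_of_notMem hx, hf x hx]; simp

/-- Boundedness on L² and the Cauchy–Schwarz inequality on the tripled cube; this starts the
bootstrap. -/
lemma locType_two (S : LTwo n →L[ℂ] LTwo n) : LocType S 2 := by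
  refine ⟨‖S‖₊ * (3 ^ n : ℝ≥0) ^ (1 / (2 : ℝ)), fun i f hf hi => ?_⟩
  set V := volume (dyadicCube i)
  have h1 := lintegral_enorm_le_eLpNorm (μ := volume.restrict (tri i))
    (Lp.aestronglyMeasurable (S (toL2 f))).restrict
  rw [Measure.restrict_apply_univ] at h1
  calc _ ≤ _ := h1
    _ ≤ (‖S‖ₑ * (V ^ (1 / (2 : ℝ)) * av 2 (fun x => ‖f x‖ₑ) i)) * (3 ^ n * V) ^ (1 / (2 : ℝ)) := by
        gcongr
        · rw [← eLpNorm_two_eq_av hi]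
          exact (eLpNorm_mono_measure _ Measure.restrict_le_self).trans (eLpNorm_apply_toL2_le S hf)
        · exact volume_tri_le i
    _ = ‖S‖ₑ * (3 ^ n) ^ (1 / (2 : ℝ)) * (V ^ (1 / (2 : ℝ)) * V ^ (1 / (2 : ℝ)) * av 2 (fun x => ‖f x‖ₑ) i) := by
        rw [ENNReal.mul_rpow_of_nonneg _ _ (by positivity)]; ring
    _ = _ := by
        rw [← ENNReal.rpow_add _ _ (volume_dyadicCube_ne_zero i) (volume_dyadicCube_ne_top i)]
        norm_num
        rw [ENNReal.coe_rpow_of_nonneg _ (by positivity)]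
        push_cast
        rfl

lemma tp_ofReal_side_rpow (i : DyadicIndex n) (x : ℝ) :
    ENNReal.ofReal (side i ^ x) = tp (-(i.1 * x)) := by
  rw [tp_eq_ofReal, side]
  congr 1
  rw [← Real.rpow_intCast, ← Real.rpow_mul (by norm_num)]
  congr 1; push_cast; ring

/-- The oscillation of the kernel on a cube, tested against a function supported far away. -/
lemma exists_kernel_osc_le (hK : IsStandardKernel δ A K) : ∃ C : ℝ≥0,
    ∀ (i : DyadicIndex n) (x x' : Eu n) (f : Eu n → ℝ≥0∞), AEMeasurable f →
      x ∈ dyadicCube i → x' ∈ dyadicCube i → (∀ y ∈ tri (anc (n + 1) i), f y = 0) →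
      ∫⁻ y, ‖K x y - K x' y‖ₑ * f y ≤ C * ∑' k : ℕ, tp (-(δ * k)) * av 1 f (anc k i) := by
  have hA := hK.const_pos
  have hδ := hK.delta_pos
  -- The factors 2^δ and 2^n replace the last tripled ancestor that avoids y by the first one that
  -- contains it.
  refine ⟨(A * n ^ δ).toNNReal * tpn δ * tpn n, fun i x x' f hfm hx hx' hf => ?_⟩
  have key : ∀ y, ‖K x y - K x' y‖ₑ * f y ≤ ∑' k : ℕ, ((A * n ^ δ).toNNReal * tpn δ * tpn n) *
      (tp (-(δ * k)) * ((volume (dyadicCube (anc k i)))⁻¹ * (tri (anc k i)).indicator f y)) := by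
    intro y
    by_cases hfy : f y = 0
    · simp [hfy]
    classical
    have hex := exists_mem_tri_anc i y
    -- The first tripled ancestor containing y selects the term of the series that dominates the
    -- kernel at y: y lies outside the preceding one, hence at distance at least its side length
    -- from the cube.
    set k := Nat.find hex with hk
    have hky : y ∈ tri (anc k i) := Nat.find_spec hex
    have hkn : n + 1 < k := by
      by_contra h
      exact hfy (hf y (tri_anc_mono i (not_lt.1 h) hky))
    obtain ⟨l, hl⟩ : ∃ l, k = l + 1 := ⟨k - 1, by omega⟩
    have hly : y ∉ tri (anc l i) := Nat.find_min hex (by omega)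
    have hnl : n + 1 ≤ l := by omega
    have hs := side_pos i
    have hd : ∀ z ∈ dyadicCube i, 2 ^ l * side i ≤ ‖z - y‖ := fun z hz => by
      rw [← side_anc, norm_sub_rev]; exact side_le_norm_sub hly (mem_anc l hz)
    have hne : ∀ z ∈ dyadicCube i, z ≠ y := fun z hz => by
      have h1 := hd z hz
      have h2 : 0 < 2 ^ l * side i := by positivity
      exact sub_ne_zero.1 (norm_pos_iff.1 (by linarith))
    have hxx : ‖x - x'‖ ≤ n * side i := norm_sub_le_of_mem hx hx'
    -- The generation gap n + 1 is chosen for this inequality: the diameter of the cube, at most n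
    -- times its side, is at most half the distance to y, as the regularity of the kernel requires.
    have h2n : (n : ℝ) * 2 ≤ 2 ^ l := by
      have h3 : (n : ℝ) ≤ 2 ^ n := by exact_mod_cast Nat.lt_two_pow_self.le
      calc (n : ℝ) * 2 ≤ 2 ^ n * 2 := by gcongr
        _ = 2 ^ (n + 1) := by ring
        _ ≤ 2 ^ l := pow_le_pow_right₀ (by norm_num) hnl
    have hreg : ‖K x y - K x' y‖ ≤ A * n ^ δ * (side i ^ δ * ((2 ^ l * side i) ^ ((n : ℝ) + δ))⁻¹) := by
      refine (hK.regular_left x x' y (hne x hx) (hne x' hx') ?_).trans ?_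
      · have h1 := le_max_left ‖x - y‖ ‖x' - y‖
        have h2 := hd x hx
        nlinarith
      · rw [div_eq_mul_inv, show A * n ^ δ * (side i ^ δ * ((2 ^ l * side i) ^ ((n : ℝ) + δ))⁻¹) =
          A * (n * side i) ^ δ * ((2 ^ l * side i) ^ ((n : ℝ) + δ))⁻¹ by
            rw [Real.mul_rpow (x := (n : ℝ)) (by positivity) hs.le]; ring]
        have h3 : 2 ^ l * side i ≤ ‖x - y‖ + ‖x' - y‖ :=
          (hd x hx).trans (le_add_of_nonneg_right (norm_nonneg _))
        gcongr
    refine le_trans ?_ (ENNReal.le_tsum k)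
    rw [indicator_of_mem hky]
    simp only [← mul_assoc]
    refine mul_le_mul' ?_ le_rfl
    rw [← ofReal_norm]
    refine (ENNReal.ofReal_le_ofReal hreg).trans (le_of_eq ?_)
    rw [ENNReal.ofReal_mul (by positivity), ENNReal.ofReal_mul (q := ((2 ^ l * side i) ^ _)⁻¹) (by positivity),
      ← side_anc, ENNReal.ofReal_inv_of_pos (by have := side_pos (anc l i); positivity),
      tp_ofReal_side_rpow, tp_ofReal_side_rpow, volume_dyadicCube, tp_inv, tp_inv, ← tp_add,
      coe_tpn, coe_tpn, mul_assoc, mul_assoc, mul_assoc, ← tp_add, ← tp_add, ← tp_add]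
    congr 2
    simp only [anc, hl]
    push_cast
    ring
  calc _ ≤ _ := lintegral_mono key
    _ = _ := by
      have hm : ∀ k : ℕ, AEMeasurable (fun y => (((A * n ^ δ).toNNReal * tpn δ * tpn n : ℝ≥0) : ℝ≥0∞) *
          (tp (-(δ * k)) * ((volume (dyadicCube (anc k i)))⁻¹ * (tri (anc k i)).indicator f y))) :=
        fun k => ((((hfm.indicator (measurableSet_tri _)).const_mul _).const_mul _).const_mul _)
      push_cast at hm
      rw [lintegral_tsum hm]
      push_cast
      rw [← ENNReal.tsum_mul_left]
      congr 1; ext k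
      rw [lintegral_const_mul'' _ (((hfm.indicator (measurableSet_tri _)).const_mul _).const_mul _),
        lintegral_const_mul'' _ ((hfm.indicator (measurableSet_tri _)).const_mul _),
        lintegral_const_mul'' _ (hfm.indicator (measurableSet_tri _)),
        lintegral_indicator (measurableSet_tri _), av]
      simp

lemma coeFn_apply_add (S : LTwo n →L[ℂ] LTwo n) {f g : Eu n → ℂ} (hf : MemLp f 2 volume)
    (hg : MemLp g 2 volume) :
    ∀ᵐ x, S (toL2 (f + g)) x = S (toL2 f) x + S (toL2 g) x := by
  rw [toL2_add hf hg, map_add]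
  exact Lp.coeFn_add _ _

/-- The oscillation of `S f` on a cube. -/
lemma exists_osc_le (hS : IsCZ δ A K S) (hs : 1 < s) (hT : LocType S s) : ∃ C : ℝ≥0,
    ∀ (i : DyadicIndex n) (f : Eu n → ℂ), MemLp f 2 volume → Bornology.IsBounded (Function.support f) →
      ∃ c : ℂ, ∫⁻ x in dyadicCube i, ‖S (toL2 f) x - c‖ₑ ≤
        C * (volume (dyadicCube i) * ∑' k : ℕ, tp (-(δ * k)) * av s (fun x => ‖f x‖ₑ) (anc k i)) := by
  obtain ⟨C₁, hC₁⟩ := hT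
  obtain ⟨C₂, hC₂⟩ := exists_kernel_osc_le hS.kernel
  set m := n + 1 with hm
  refine ⟨C₁ * tpn (m * n) * tpn (δ * m) + C₂ * tpn (n * 2 / s.conjExponent), fun i f hf hfb => ?_⟩
  -- Near and far parts. The near part is handled by the local bound `LocType`, the far part by the
  -- oscillation of the kernel.
  set f₁ : Eu n → ℂ := (tri (anc m i)).indicator f with hf₁
  set f₂ : Eu n → ℂ := (tri (anc m i))ᶜ.indicator f with hf₂
  have hmt := measurableSet_tri (anc m i)
  have h₁ : MemLp f₁ 2 volume := hf.indicator hmt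
  have h₂ : MemLp f₂ 2 volume := hf.indicator hmt.compl
  have hsum : f = f₁ + f₂ := (indicator_self_add_compl _ _).symm
  have h₂b : Bornology.IsBounded (Function.support f₂) := hfb.subset (by
    rw [hf₂, Set.support_indicator]; exact inter_subset_right)
  have h₂i := integrable_of_memLp_of_isBounded h₂ h₂b
  have hsepx : ∀ x ∈ dyadicCube i, ∀ y ∈ Function.support f₂, side (anc m i) ≤ ‖x - y‖ := by
    intro x hx y hy
    have : y ∉ tri (anc m i) := fun h => hy (by simp [f₂, h])
    rw [norm_sub_rev]
    exact side_le_norm_sub this (mem_anc m hx)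
  have hker : ∀ᵐ x, x ∈ dyadicCube i → S (toL2 f₂) x = ∫ y, K x y * f₂ y :=
    hS.ae_eq_integral h₂ h₂b (measurableSet_dyadicCube i) (isBounded_dyadicCube i)
      ⟨side (anc m i), side_pos _, hsepx⟩
  have hKi : ∀ x ∈ dyadicCube i, Integrable fun y => K x y * f₂ y := by
    intro x hx
    have hA := hS.kernel.const_pos
    have hsp := side_pos (anc m i)
    refine (h₂i.norm.const_mul (A / side (anc m i) ^ n)).mono'
      ((hS.meas.comp measurable_prodMk_left).aestronglyMeasurable.mul h₂i.1)
      (Eventually.of_forall fun y => ?_)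
    by_cases hy : f₂ y = 0
    · simp [hy]
    have h3 := hsepx x hx y hy
    have hne : x ≠ y := sub_ne_zero.1 (norm_pos_iff.1 (by linarith))
    rw [norm_mul]
    gcongr
    refine (hS.kernel.size x y hne).trans ?_
    gcongr
  obtain ⟨x₀, hx₀⟩ := dyadicCube_nonempty i
  have hfm : AEMeasurable fun x => ‖f x‖ₑ := hf.1.enorm
  have hle₂ : ∀ y, ‖f₂ y‖ₑ ≤ ‖f y‖ₑ := fun y => by
    by_cases hy : y ∈ tri (anc m i) <;> simp [f₂, hy]
  set 𝒮 := ∑' k : ℕ, tp (-(δ * k)) * av s (fun x => ‖f x‖ₑ) (anc k i) with h𝒮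
  have e2 : ∀ᵐ x, x ∈ dyadicCube i → ‖S (toL2 f₂) x - ∫ y, K x₀ y * f₂ y‖ₑ ≤
      C₂ * tpn (n * 2 / s.conjExponent) * 𝒮 := by
    filter_upwards [hker] with x hx hxi
    rw [hx hxi, ← integral_sub (hKi x hxi) (hKi x₀ hx₀)]
    refine (enorm_integral_le_lintegral_enorm _).trans ?_
    calc _ = ∫⁻ y, ‖K x y - K x₀ y‖ₑ * ‖f₂ y‖ₑ := by
          refine lintegral_congr fun y => ?_
          rw [← sub_mul, enorm_mul]
      _ ≤ C₂ * ∑' k : ℕ, tp (-(δ * k)) * av 1 (fun y => ‖f₂ y‖ₑ) (anc k i) :=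
          hC₂ i x x₀ _ h₂.1.enorm hxi hx₀ fun y hy => by
            have : y ∈ tri (anc m i) := hy
            simp [f₂, this]
      _ ≤ C₂ * ∑' k : ℕ, tp (-(δ * k)) *
            (tpn (n * 2 / s.conjExponent) * av s (fun y => ‖f y‖ₑ) (anc k i)) := by
          refine mul_le_mul' le_rfl (ENNReal.tsum_le_tsum fun k => mul_le_mul' le_rfl ?_)
          exact (av_mono one_pos fun y _ => hle₂ y).trans (av_one_exponent_le hs hfm _)
      _ = _ := by
          rw [h𝒮, mul_assoc, ← ENNReal.tsum_mul_left (a := (tpn (n * 2 / s.conjExponent) : ℝ≥0∞))]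
          congr 1; congr 1; ext k; ring
  have e1 : ∫⁻ x in dyadicCube i, ‖S (toL2 f₁) x‖ₑ ≤
      C₁ * tpn (m * n) * tpn (δ * m) * (volume (dyadicCube i) * 𝒮) := by
    calc _ ≤ ∫⁻ x in tri (anc m i), ‖S (toL2 f₁) x‖ₑ :=
          lintegral_mono_set ((dyadicCube_subset_anc m i).trans (dyadicCube_subset_tri _))
      _ ≤ C₁ * (volume (dyadicCube (anc m i)) * av s (fun x => ‖f₁ x‖ₑ) (anc m i)) :=
          hC₁ _ _ h₁ fun x hx => by simp [f₁, hx]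
      _ = C₁ * (volume (dyadicCube (anc m i)) * av s (fun x => ‖f x‖ₑ) (anc m i)) := by
          congr 2
          exact le_antisymm (av_mono (by linarith) fun x hx => by simp [f₁, hx])
            (av_mono (by linarith) fun x hx => by simp [f₁, hx])
      _ = C₁ * tpn (m * n) * tpn (δ * m) * (volume (dyadicCube i) *
            (tp (-(δ * m)) * av s (fun x => ‖f x‖ₑ) (anc m i))) := by
          rw [volume_anc, coe_tpn, coe_tpn]
          calc _ = C₁ * tp (m * n) * (tp (δ * m) * tp (-(δ * m))) * (volume (dyadicCube i) *
                  av s (fun x => ‖f x‖ₑ) (anc m i)) := by rw [tp_mul_tp_neg]; ring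
            _ = _ := by ring
      _ ≤ _ := by
          gcongr
          exact ENNReal.le_tsum (f := fun k : ℕ => tp (-(δ * k)) * av s (fun x => ‖f x‖ₑ) (anc k i)) m
  -- The constant is the value of the far part at a fixed point of the cube.
  refine ⟨∫ y, K x₀ y * f₂ y, ?_⟩
  calc _ ≤ ∫⁻ x in dyadicCube i, (‖S (toL2 f₁) x‖ₑ + C₂ * tpn (n * 2 / s.conjExponent) * 𝒮) := by
        refine setLIntegral_mono_ae' (measurableSet_dyadicCube i) ?_
        filter_upwards [e2, coeFn_apply_add S h₁ h₂] with x hx2 hxs hxi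
        rw [hsum, hxs, add_sub_assoc]
        exact (enorm_add_le _ _).trans (add_le_add le_rfl (hx2 hxi))
    _ = (∫⁻ x in dyadicCube i, ‖S (toL2 f₁) x‖ₑ) +
          C₂ * tpn (n * 2 / s.conjExponent) * 𝒮 * volume (dyadicCube i) := by
        rw [lintegral_add_right _ measurable_const, setLIntegral_const]
    _ ≤ _ := by
        push_cast
        rw [add_mul]
        refine add_le_add e1 (le_of_eq (by ring))

lemma integrableOn_coeFn (f : LTwo n) (i : DyadicIndex n) : IntegrableOn f (dyadicCube i) := by
  refine ⟨(Lp.aestronglyMeasurable f).restrict, ?_⟩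
  refine lt_of_le_of_lt (lintegral_enorm_le_eLpNorm (Lp.aestronglyMeasurable f).restrict) ?_
  rw [Measure.restrict_apply_univ]
  exact ENNReal.mul_lt_top (lt_of_le_of_lt (eLpNorm_mono_measure _ Measure.restrict_le_self)
    (Lp.memLp f).2) (ENNReal.rpow_lt_top_of_nonneg (by positivity) (volume_dyadicCube_ne_top i))

/-- Local Lorentz space bounds for a Calderón–Zygmund operator. -/
lemma exists_lorN_apply_le (hn : 0 < n) (hS : IsCZ δ A K S) (hs : 1 < s) (hsp : s < p) (hq : 0 < q)
    (hT : LocType S s) : ∃ C : ℝ≥0, ∀ (i : DyadicIndex n) (v : Fin n → Fin 3) (f : Eu n → ℂ),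
      MemLp f 2 volume → (∀ x, x ∉ tri i → f x = 0) →
      lorN p q (volume.restrict (dyadicCube (nb v i))) (fun x => ‖S (toL2 f) x‖ₑ) ≤
        C * lorN p q volume (fun x => ‖f x‖ₑ) := by
  have hp : 0 < p := by linarith
  obtain ⟨C₁, hC₁⟩ := exists_osc_le hS hs hT
  obtain ⟨G, hG⟩ := exists_geom hS.kernel.delta_pos
  obtain ⟨C₂, hC₂⟩ := exists_fefferman_stein hn hp hq
  obtain ⟨C₃, hC₃⟩ := exists_lorN_mxs_le hn hs.le hsp hq
  obtain ⟨C₄, hC₄⟩ := exists_av_le_lorN hn hs.le hsp hq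
  obtain ⟨C₅, hC₅⟩ := hT
  refine ⟨C₂ * (2 * (C₁ * G) * C₃ + C₅ * C₄), fun i v f hf hi => ?_⟩
  set F := fun x => ‖f x‖ₑ with hF
  have hFm : AEMeasurable F := hf.1.enorm
  have hfb : Bornology.IsBounded (Function.support f) :=
    (isBounded_tri i).subset fun x hx => by_contra fun h => hx (hi x h)
  have hvol := volume_nb v i
  -- The averages over ancestors in the oscillation estimate are all bounded by the maximal function
  -- at any point of the cube, which supplies the majorant in the Fefferman–Stein inequality.
  refine (hC₂ (nb v i) (S (toL2 f)) (fun x => C₁ * G * mxs s F x) (integrableOn_coeFn _ _) ?_).trans ?_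
  · intro j k _
    obtain ⟨c, hc⟩ := hC₁ j f hf hfb
    refine ⟨c, fun x hx => hc.trans ?_⟩
    calc _ ≤ C₁ * (volume (dyadicCube j) * ∑' k : ℕ, tp (-(δ * k)) * mxs s F x) := by
          gcongr with k
          exact av_le_mxs (by linarith) _ hx k
      _ = _ := by rw [ENNReal.tsum_mul_right, hG]; ring
  · push_cast
    rw [mul_assoc (C₂ : ℝ≥0∞)]
    refine mul_le_mul' le_rfl ?_
    rw [add_mul]
    refine add_le_add ?_ ?_
    · have hct : (C₁ : ℝ≥0∞) * G ≠ ∞ := ENNReal.mul_ne_top ENNReal.coe_ne_top ENNReal.coe_ne_top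
      calc _ ≤ lorN p q volume (fun x => C₁ * G * mxs s F x) :=
            lorN_mono_measure hq hp Measure.restrict_le_self
        _ ≤ 2 * (C₁ * G) * lorN p q volume (mxs s F) := lorN_const_mul_le hp hq _ hct
        _ ≤ _ := by
          rw [mul_assoc (2 * ((C₁ : ℝ≥0∞) * G))]
          gcongr
          exact hC₃ F hFm
    · rw [hvol]
      calc _ ≤ (volume (dyadicCube i))⁻¹ * (C₅ * (volume (dyadicCube i) * av s F i)) *
            volume (dyadicCube i) ^ (1 / p) := by
            gcongr
            exact (lintegral_mono_set fun x hx => mem_tri_iff.2 ⟨v, hx⟩).trans (hC₅ i f hf hi)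
        _ = C₅ * ((volume (dyadicCube i))⁻¹ * volume (dyadicCube i)) *
              (av s F i * volume (dyadicCube i) ^ (1 / p)) := by ring
        _ ≤ _ := by
          rw [ENNReal.inv_mul_cancel (volume_dyadicCube_ne_zero i) (volume_dyadicCube_ne_top i),
            mul_one, mul_assoc]
          exact mul_le_mul' le_rfl (hC₄ F i hFm)

/-- By duality, the local bounds hold for all exponents. -/
lemma locType_of_lt_two (hn : 0 < n) (hS : IsCZ δ A K S) (hs : 1 < s) (hs2 : s < 2) : LocType S s := by
  have hc := Real.HolderConjugate.conjExponent hs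
  set s' := s.conjExponent with hs'
  have hs'2 : 2 < s' := by
    rw [hs', Real.conjExponent, lt_div_iff₀ (by linarith)]; linarith
  have hs'0 : 0 < s' := by linarith
  have hSt := isCZ_transposeL hS
  -- The exponent 2 suffices for the transpose on L^{s'}, because s < 2 means s' > 2.
  obtain ⟨C₁, hC₁⟩ := exists_lorN_apply_le hn hSt (by norm_num) hs'2 hs'0 (locType_two _)
  obtain ⟨C₂, hC₂⟩ := exists_av_le_of_forall_nb (n := n) hs'0
  obtain ⟨C₃, hC₃⟩ := exists_lorN_const_le hs'0 hs'0
  refine ⟨C₂ * (C₁ * (C₃ * (3 ^ n) ^ (1 / s'))), fun i f hf hi => ?_⟩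
  -- Pairing S f with its conjugate phase gives the L¹ norm. The operator then moves to the bounded
  -- function φ, whose image has L^{s'} average bounded by a constant.
  set φ : Eu n → ℂ := (tri i).indicator fun x => phase (S (toL2 f) x) with hφ
  have htm := measurableSet_tri i
  have htt : volume (tri i) ≠ ∞ := (isBounded_tri i).measure_lt_top.ne
  have hSm := Lp.aestronglyMeasurable (S (toL2 f))
  have hφm : AEStronglyMeasurable φ volume :=
    ((measurable_phase.comp_aemeasurable hSm.aemeasurable).aestronglyMeasurable).indicator htm
  have hφle : ∀ x, ‖φ x‖ₑ ≤ (tri i).indicator (fun _ => 1) x := fun x => by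
    by_cases hx : x ∈ tri i
    · simp only [φ, indicator_of_mem hx]
      rw [← ofReal_norm, ← ENNReal.ofReal_one]
      exact ENNReal.ofReal_le_ofReal (norm_phase_le _)
    · simp [φ, hx]
  have hφ2 : MemLp φ 2 volume := by
    refine (memLp_indicator_const 2 htm (1 : ℂ) (Or.inr htt)).mono hφm (Eventually.of_forall fun x => ?_)
    by_cases hx : x ∈ tri i
    · simp only [φ, indicator_of_mem hx, norm_one]; exact norm_phase_le _
    · simp [φ, hx]
  have h1 : ∫ x, S (toL2 f) x * φ x = ∫ x, f x * transposeL S (toL2 φ) x := by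
    have h := integral_transposeL S hφ2 hf
    rw [integral_congr_ae (Eventually.of_forall fun x => mul_comm (f x) _), h]
    exact integral_congr_ae (Eventually.of_forall fun x => mul_comm _ _)
  have h2 : ∫⁻ x in tri i, ‖S (toL2 f) x‖ₑ = ‖∫ x, S (toL2 f) x * φ x‖ₑ := by
    have h3 : ∀ x, S (toL2 f) x * φ x = (((tri i).indicator (fun x => ‖S (toL2 f) x‖) x : ℝ) : ℂ) := by
      intro x
      by_cases hx : x ∈ tri i
      · simp only [φ, indicator_of_mem hx]; exact mul_phase _
      · simp [φ, hx]
    have hi1 : Integrable (fun x => S (toL2 f) x * φ x) := integrable_mul_of_memLp (Lp.memLp _) hφ2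
    have hi2 : Integrable ((tri i).indicator (fun x => ‖S (toL2 f) x‖)) := by
      refine hi1.norm.congr (Eventually.of_forall fun x => ?_)
      simp only [h3, Complex.norm_real, Real.norm_eq_abs]
      exact abs_of_nonneg (indicator_nonneg (fun _ _ => norm_nonneg _) _)
    simp_rw [h3]
    have h4 : ∫ x, (((tri i).indicator (fun x => ‖S (toL2 f) x‖) x : ℝ) : ℂ) =
        ((∫ x, (tri i).indicator (fun x => ‖S (toL2 f) x‖) x : ℝ) : ℂ) := integral_ofReal
    rw [h4, ← ofReal_norm, Complex.norm_real, Real.norm_of_nonneg (integral_nonneg fun x =>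
      indicator_nonneg (fun _ _ => norm_nonneg _) _),
      ofReal_integral_eq_lintegral_ofReal hi2 (Eventually.of_forall fun x =>
      indicator_nonneg (fun _ _ => norm_nonneg _) _), ← lintegral_indicator htm]
    refine lintegral_congr fun x => ?_
    by_cases hx : x ∈ tri i <;> simp [hx]
  rw [h2, h1]
  have h5 : av s' (fun x => ‖transposeL S (toL2 φ) x‖ₑ) i ≤ C₂ * (C₁ * (C₃ * (3 ^ n) ^ (1 / s'))) := by
    refine hC₂ _ i _ (Lp.aestronglyMeasurable _).enorm fun v => ?_
    refine (hC₁ i v φ hφ2 fun x hx => by simp [φ, hx]).trans ?_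
    rw [mul_assoc]
    gcongr
    calc _ ≤ lorN s' s' volume ((tri i).indicator fun _ => 1) := lorN_mono hs'0 hs'0 hφle
      _ = lorN s' s' (volume.restrict (tri i)) (fun _ => 1) := (lorN_restrict htm).symm
      _ ≤ C₃ * (1 * volume (tri i) ^ (1 / s')) := by
          have := hC₃ (volume.restrict (tri i)) 1 ENNReal.one_ne_top
          rwa [Measure.restrict_apply_univ] at this
      _ ≤ C₃ * (3 ^ n * volume (dyadicCube i)) ^ (1 / s') := by
          rw [one_mul]; gcongr; exact volume_tri_le i
      _ = _ := by rw [ENNReal.mul_rpow_of_nonneg _ _ (by positivity), mul_assoc]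
  calc _ ≤ ∫⁻ x, ‖f x‖ₑ * ‖transposeL S (toL2 φ) x‖ₑ := by
        refine (enorm_integral_le_lintegral_enorm _).trans (le_of_eq ?_)
        simp_rw [enorm_mul]
    _ = ∫⁻ x in tri i, ‖f x‖ₑ * ‖transposeL S (toL2 φ) x‖ₑ := by
        rw [← lintegral_indicator htm]
        refine lintegral_congr fun x => ?_
        by_cases hx : x ∈ tri i
        · rw [indicator_of_mem hx]
        · rw [indicator_of_notMem hx, hi x hx]; simp
    _ ≤ volume (dyadicCube i) * (av s (fun x => ‖f x‖ₑ) i * av s' (fun x => ‖transposeL S (toL2 φ) x‖ₑ) i) :=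
        setLIntegral_mul_le_av hc hf.1.enorm (Lp.aestronglyMeasurable _).enorm subset_rfl
    _ ≤ volume (dyadicCube i) * (av s (fun x => ‖f x‖ₑ) i * (C₂ * (C₁ * (C₃ * (3 ^ n) ^ (1 / s'))))) := by
        gcongr
    _ = _ := by
        push_cast
        rw [ENNReal.coe_rpow_of_nonneg _ (by positivity)]
        push_cast; ring

end Local

section LinGeom

lemma exists_geom_lin {ε : ℝ} (hε : 0 < ε) : ∃ C : ℝ≥0, ∑' k : ℕ, tp (-(ε * k)) * (1 + k) = C := by
  set r : ℝ := (2 : ℝ) ^ (-ε) with hr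
  have hr0 : 0 < r := by positivity
  have hr1 : r < 1 := Real.rpow_lt_one_of_one_lt_of_neg (by norm_num) (by linarith)
  have hs : Summable fun k : ℕ => r ^ k * (1 + k) := by
    have h1 := summable_pow_mul_geometric_of_norm_lt_one 1 (r := r) (by
      rwa [Real.norm_of_nonneg hr0.le])
    have h2 := summable_geometric_of_lt_one hr0.le hr1
    refine (h2.add h1).congr fun k => ?_
    ring
  have ht := hs.tsum_ofReal_ne_top
  have he : ∀ k : ℕ, ENNReal.ofReal (r ^ k * (1 + k)) = tp (-(ε * k)) * (1 + k) := fun k => by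
    rw [ENNReal.ofReal_mul (by positivity), tp_eq_ofReal]
    congr 1
    · congr 1
      rw [hr, ← Real.rpow_natCast, ← Real.rpow_mul (by norm_num)]
      congr 1; ring
    · rw [ENNReal.ofReal_add (by norm_num) (by positivity), ENNReal.ofReal_one, ENNReal.ofReal_natCast]
  simp_rw [he] at ht
  exact ⟨_, (ENNReal.coe_toNNReal ht).symm⟩

end LinGeom

/-! ### The commutator near the support of the function. -/

section Comm

variable {n : ℕ} {p q s δ A : ℝ} {K : Eu n → Eu n → ℂ} {S : LTwo n →L[ℂ] LTwo n} {b : Eu n → ℂ}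

lemma exists_subset_tri_anc {E : Set (Eu n)} (hE : Bornology.IsBounded E) (i : DyadicIndex n) :
    ∃ k, E ⊆ tri (anc k i) := by
  obtain ⟨y, hy⟩ := dyadicCube_nonempty i
  obtain ⟨R, hR⟩ := hE.subset_ball y
  obtain ⟨k, hk⟩ := pow_unbounded_of_one_lt (R / side i) (by norm_num : (1 : ℝ) < 2)
  refine ⟨k, fun x hx => ?_⟩
  by_contra h
  have h1 := side_le_norm_sub h (mem_anc k hy)
  have h2 := hR hx
  rw [Metric.mem_ball, dist_eq_norm] at h2
  rw [side_anc] at h1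
  rw [div_lt_iff₀ (side_pos i)] at hk
  linarith

lemma MemLcInfty.memLp {g : Eu n → ℂ} (hg : MemLcInfty g) (p : ℝ≥0∞) : MemLp g p volume :=
  hg.1.mono_exponent_of_measure_support_ne_top (s := tsupport g)
    (fun _ hx => image_eq_zero_of_notMem_tsupport hx) hg.2.measure_lt_top.ne le_top

lemma MemLcInfty.isBounded {g : Eu n → ℂ} (hg : MemLcInfty g) :
    Bornology.IsBounded (Function.support g) :=
  hg.2.isBounded.subset (subset_tsupport g)

lemma MemLcInfty.exists_bound {g : Eu n → ℂ} (hg : MemLcInfty g) :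
    ∃ M : ℝ≥0, ∀ᵐ x, ‖g x‖ₑ ≤ M := by
  refine ⟨(eLpNorm g ∞ volume).toNNReal, ?_⟩
  rw [ENNReal.coe_toNNReal hg.1.2.ne]
  exact ae_le_eLpNormEssSup

lemma MemLcInfty.indicator {g : Eu n → ℂ} (hg : MemLcInfty g) {E : Set (Eu n)}
    (hE : MeasurableSet E) : MemLcInfty (E.indicator g) :=
  ⟨hg.1.indicator hE, hg.2.mono (by rw [Set.support_indicator]; exact inter_subset_right)⟩

lemma MemLcInfty.lorN_ne_top {g : Eu n → ℂ} (hg : MemLcInfty g) (hp : 0 < p) (hq : 0 < q) :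
    lorN p q volume (fun x => ‖g x‖ₑ) ≠ ∞ := by
  obtain ⟨M, hM⟩ := hg.exists_bound
  exact lorN_ne_top_of_bdd hp hq (A := tsupport g) hg.2.measure_lt_top.ne
    (fun x hx => by simp [image_eq_zero_of_notMem_tsupport hx]) ENNReal.coe_ne_top hM

lemma MemLcInfty.memLp_mul (hn : 0 < n) (hb : MemBMO b) {g : Eu n → ℂ} (hg : MemLcInfty g) :
    MemLp (fun x => b x * g x) 2 volume := by
  obtain ⟨k, hk⟩ := exists_subset_tri_anc hg.isBounded ((0, 0) : DyadicIndex n)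
  set i := anc k ((0, 0) : DyadicIndex n)
  obtain ⟨C, hC⟩ := exists_av_sub_bmean_le hn hb (p := 2) (by norm_num)
  obtain ⟨M, hM⟩ := hg.exists_bound
  have hbm := hb.1.aestronglyMeasurable
  -- The John–Nirenberg inequality puts b minus its mean in L⁴ on the tripled cube carrying g, and g
  -- is bounded. The mean times g is added back afterwards.
  have h1 : MemLp (fun x => (b x - bmean b i) * g x) 2 volume := by
    refine ⟨(hbm.sub aestronglyMeasurable_const).mul hg.1.1, ?_⟩
    rw [eLpNorm_two_eq_av (i := i) fun x hx => by
      have : g x = 0 := by_contra fun h => hx (hk h)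
      simp [this]]
    refine ENNReal.mul_lt_top (ENNReal.rpow_lt_top_of_nonneg (by positivity) (volume_dyadicCube_ne_top i)) ?_
    have h2 : av 2 (fun x => ‖(b x - bmean b i) * g x‖ₑ) i ≤ av 2 (fun x => ‖b x - bmean b i‖ₑ * M) i := by
      unfold av
      gcongr ((volume (dyadicCube i))⁻¹ * ?_) ^ (1 / (2 : ℝ))
      refine lintegral_mono_ae (ae_restrict_of_ae ?_)
      filter_upwards [hM] with x hx
      rw [enorm_mul]
      gcongr
    refine h2.trans_lt ?_
    refine (av_mul_le (by norm_num) Real.HolderConjugate.two_two (by fun_prop)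
      aemeasurable_const i).trans_lt (ENNReal.mul_lt_top ?_ ?_)
    · obtain ⟨C, hC⟩ := exists_av_sub_bmean_le hn hb (p := 2 * 2) (by norm_num)
      have := hC i 0
      rw [anc_zero] at this
      exact this.trans_lt (by simp)
    · unfold av
      refine ENNReal.rpow_lt_top_of_nonneg (by positivity) (ENNReal.mul_ne_top
        (by simpa using volume_dyadicCube_ne_zero i) ?_)
      rw [setLIntegral_const]
      exact ENNReal.mul_ne_top (ENNReal.rpow_ne_top_of_nonneg (by positivity) ENNReal.coe_ne_top)
        (isBounded_tri i).measure_lt_top.ne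
  have h2 := h1.add ((hg.memLp 2).const_mul (bmean b i))
  refine h2.congr_norm (hbm.mul hg.1.1) (Eventually.of_forall fun x => ?_)
  simp only [Pi.add_apply]; congr 1; ring

lemma MemLcInfty.memLp_sub_mul (hn : 0 < n) (hb : MemBMO b) {g : Eu n → ℂ} (hg : MemLcInfty g) (c : ℂ) :
    MemLp (fun x => (b x - c) * g x) 2 volume := by
  have h := (hg.memLp_mul hn hb).sub ((hg.memLp 2).const_mul c)
  refine h.congr_norm ((hb.1.aestronglyMeasurable.sub aestronglyMeasurable_const).mul hg.1.1)
    (Eventually.of_forall fun x => ?_)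
  simp only [Pi.sub_apply, sub_mul]

/-- Constants commute with S. The freedom to subtract the mean of b on the cube under consideration
is what makes the commutator estimates possible. -/
lemma commutator_sub_const (hn : 0 < n) (hb : MemBMO b) {g : Eu n → ℂ} (hg : MemLcInfty g) (c : ℂ) :
    ∀ᵐ x, commutator S b g x = (b x - c) * S (toL2 g) x - S (toL2 fun y => (b y - c) * g y) x := by
  have h1 : toL2 (fun y => (b y - c) * g y) = toL2 (fun y => b y * g y) - c • toL2 g := by
    rw [← toL2_smul c (hg.memLp 2), ← toL2_sub (hg.memLp_mul hn hb) ((hg.memLp 2).const_smul c)]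
    refine toL2_congr (Eventually.of_forall fun x => ?_)
    simp only [Pi.sub_apply, Pi.smul_apply, smul_eq_mul, sub_mul]
  rw [h1, map_sub, map_smul]
  filter_upwards [Lp.coeFn_sub (S (toL2 fun y => b y * g y)) (c • S (toL2 g)),
    Lp.coeFn_smul c (S (toL2 g))] with x h2 h3
  simp only [commutator, h2, Pi.sub_apply, h3, Pi.smul_apply, smul_eq_mul]
  ring

lemma aestronglyMeasurable_commutator (S : LTwo n → LTwo n) (hb : MemBMO b) (g : Eu n → ℂ) :
    AEStronglyMeasurable (commutator S b g) volume :=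
  (hb.1.aestronglyMeasurable.mul (Lp.aestronglyMeasurable _)).sub (Lp.aestronglyMeasurable _)

lemma exists_av_sub_bmean_mul_le (hn : 0 < n) (hb : MemBMO b) (hs : 1 < s) : ∃ C : ℝ≥0,
    ∀ (i : DyadicIndex n) (k : ℕ) (g : Eu n → ℂ), AEStronglyMeasurable g volume →
      av s (fun x => ‖(b x - bmean b i) * g x‖ₑ) (anc k i) ≤
        C * (1 + k) * av (s * s) (fun x => ‖g x‖ₑ) (anc k i) := by
  have hc := (Real.HolderConjugate.conjExponent hs).symm
  have hs' : 0 < s * s.conjExponent := mul_pos (by linarith) hc.pos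
  obtain ⟨C, hC⟩ := exists_av_sub_bmean_le hn hb hs'
  refine ⟨C, fun i k g hg => ?_⟩
  have hbm := hb.1.aestronglyMeasurable
  simp_rw [enorm_mul]
  refine (av_mul_le (by linarith) hc (by fun_prop) hg.enorm _).trans ?_
  gcongr
  exact hC i k

/-- The oscillation of the commutator. -/
lemma exists_commutator_osc_le (hn : 0 < n) (hS : IsCZ δ A K S) (hb : MemBMO b) (hs : 1 < s)
    (hT : LocType S s) : ∃ C : ℝ≥0, ∀ (j : DyadicIndex n) (E : Set (Eu n)) (g : Eu n → ℂ),
      MemLcInfty g → MeasurableSet E → dyadicCube j ⊆ E → ∃ c : ℂ, ∀ x ∈ dyadicCube j,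
        ∫⁻ y in dyadicCube j, ‖commutator S b g y - c‖ₑ ≤
          C * (mxs s (E.indicator fun y => ‖S (toL2 g) y‖ₑ) x + mxs (s * s) (fun y => ‖g y‖ₑ) x) *
            volume (dyadicCube j) := by
  have hc := (Real.HolderConjugate.conjExponent hs)
  have hbm := hb.1.aestronglyMeasurable
  obtain ⟨C₁, hC₁⟩ := exists_osc_le hS hs hT
  obtain ⟨C₂, hC₂⟩ := exists_av_sub_bmean_le hn hb hc.symm.pos
  obtain ⟨C₃, hC₃⟩ := exists_av_sub_bmean_mul_le hn hb hs
  obtain ⟨G, hG⟩ := exists_geom_lin hS.kernel.delta_pos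
  refine ⟨C₂ + C₁ * C₃ * G, fun j E g hg hE hjE => ?_⟩
  have hf := hg.memLp_sub_mul hn hb (bmean b j)
  obtain ⟨c, hc1⟩ := hC₁ j _ hf (hg.isBounded.subset fun x hx h => hx (by simp [h]))
  -- In [b - c',S]g the term S((b - c')g) enters with a minus sign, so the constant approximating it
  -- changes sign.
  refine ⟨-c, fun x hx => ?_⟩
  -- Only the values of S g on E enter. This localization is needed because the Lorentz norm of S g
  -- is so far controlled only on the cubes near the support of g.
  set H := E.indicator fun y => ‖S (toL2 g) y‖ₑ with hH
  have hHm : AEMeasurable H := (Lp.aestronglyMeasurable _).enorm.indicator hE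
  have h1 : ∫⁻ y in dyadicCube j, ‖b y - bmean b j‖ₑ * ‖S (toL2 g) y‖ₑ ≤
      volume (dyadicCube j) * (C₂ * mxs s H x) := by
    calc _ = ∫⁻ y in dyadicCube j, ‖b y - bmean b j‖ₑ * H y := by
          refine setLIntegral_congr_fun (measurableSet_dyadicCube j) fun y hy => ?_
          simp only [hH, indicator_of_mem (hjE hy)]
      _ ≤ volume (dyadicCube j) * (av s.conjExponent (fun y => ‖b y - bmean b j‖ₑ) j * av s H j) :=
          setLIntegral_mul_le_av hc.symm (by fun_prop) hHm (dyadicCube_subset_tri j)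
      _ ≤ _ := by
          gcongr
          · have := hC₂ j 0
            rw [anc_zero] at this
            simpa using this
          · have := av_le_mxs (by linarith) H hx (s := s) 0
            rwa [anc_zero] at this
  have h2 : ∫⁻ y in dyadicCube j, ‖S (toL2 fun y => (b y - bmean b j) * g y) y - c‖ₑ ≤
      volume (dyadicCube j) * (C₁ * C₃ * G * mxs (s * s) (fun y => ‖g y‖ₑ) x) := by
    calc _ ≤ _ := hc1
      _ ≤ C₁ * (volume (dyadicCube j) * ∑' k : ℕ, tp (-(δ * k)) * (C₃ * (1 + k) *
            mxs (s * s) (fun y => ‖g y‖ₑ) x)) := by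
          gcongr with k
          refine (hC₃ j k g hg.1.1).trans ?_
          gcongr
          exact av_le_mxs (by nlinarith) _ hx k
      _ = C₁ * (volume (dyadicCube j) * (C₃ * (∑' k : ℕ, tp (-(δ * k)) * (1 + k)) *
            mxs (s * s) (fun y => ‖g y‖ₑ) x)) := by
          rw [← ENNReal.tsum_mul_left (a := (C₃ : ℝ≥0∞)), ← ENNReal.tsum_mul_right]
          congr 3; ext k; ring
      _ = _ := by rw [hG]; ring
  calc _ ≤ ∫⁻ y in dyadicCube j, (‖b y - bmean b j‖ₑ * ‖S (toL2 g) y‖ₑ +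
        ‖S (toL2 fun y => (b y - bmean b j) * g y) y - c‖ₑ) := by
        refine lintegral_mono_ae (ae_restrict_of_ae ?_)
        filter_upwards [commutator_sub_const (S := S) hn hb hg (bmean b j)] with y hy
        rw [hy, ← enorm_mul, sub_neg_eq_add, sub_add]
        exact enorm_sub_le
    _ = _ := lintegral_add_left' ((by fun_prop : AEMeasurable fun y => ‖b y - bmean b j‖ₑ).restrict.mul
        (Lp.aestronglyMeasurable _).enorm.restrict) _
    _ ≤ _ := add_le_add h1 h2
    _ ≤ volume (dyadicCube j) * ((C₂ + C₁ * C₃ * G) * mxs s H x) +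
          volume (dyadicCube j) * ((C₂ + C₁ * C₃ * G) * mxs (s * s) (fun y => ‖g y‖ₑ) x) := by
        gcongr
        · exact le_self_add
        · exact le_add_self
    _ = _ := by push_cast; ring

/-- The bound s < 2 permits `locType_of_lt_two`; s < p and s·s < p leave room for the two maximal
functions M_s and M_{s²}, the second arising from Hölder's inequality applied to (b - c)g. -/
lemma exists_small_exponent (hp : 1 < p) : ∃ s : ℝ, 1 < s ∧ s < 2 ∧ s < p ∧ s * s < p := by
  refine ⟨1 + min ((p - 1) / 4) (1 / 2), ?_, ?_, ?_, ?_⟩ <;>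
  · have h1 := min_le_left ((p - 1) / 4) (1 / 2 : ℝ)
    have h2 := min_le_right ((p - 1) / 4) (1 / 2 : ℝ)
    have h3 : 0 < min ((p - 1) / 4) (1 / 2 : ℝ) := lt_min (by linarith) (by norm_num)
    nlinarith

/-- The commutator near the support. -/
lemma exists_lorN_commutator_local_le (hn : 0 < n) (hS : IsCZ δ A K S) (hb : MemBMO b) (hp : 1 < p)
    (hq : 0 < q) : ∃ C : ℝ≥0, ∀ (i : DyadicIndex n) (v : Fin n → Fin 3) (g : Eu n → ℂ),
      MemLcInfty g → (∀ x, x ∉ tri i → g x = 0) →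
      lorN p q (volume.restrict (dyadicCube (nb v i))) (fun x => ‖commutator S b g x‖ₑ) ≤
        C * lorN p q volume (fun x => ‖g x‖ₑ) := by
  obtain ⟨s, hs, hs2, hsp, hssp⟩ := exists_small_exponent hp
  have hp0 : 0 < p := by linarith
  have hss : 1 < s * s := by nlinarith
  have hT := locType_of_lt_two hn hS hs hs2
  have hc := (Real.HolderConjugate.conjExponent hs)
  have hbm := hb.1.aestronglyMeasurable
  obtain ⟨C₁, hC₁⟩ := exists_commutator_osc_le hn hS hb hs hT
  obtain ⟨C₂, hC₂⟩ := exists_fefferman_stein hn hp0 hq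
  obtain ⟨C₃, hC₃⟩ := exists_lorN_mxs_le hn hs.le hsp hq
  obtain ⟨C₄, hC₄⟩ := exists_lorN_mxs_le hn hss.le hssp hq
  obtain ⟨C₅, hC₅⟩ := exists_lorN_add_le hp0 hq
  obtain ⟨C₆, hC₆⟩ := exists_lorN_apply_le hn hS hs hsp hq hT
  obtain ⟨C₇, hC₇⟩ := exists_av_le_lorN hn hs.le hsp hq
  obtain ⟨C₈, hC₈⟩ := exists_av_le_lorN hn hss.le hssp hq
  obtain ⟨C₉, hC₉⟩ := exists_av_sub_bmean_le hn hb hc.symm.pos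
  obtain ⟨C₁₀, hC₁₀⟩ := exists_av_sub_bmean_mul_le hn hb hs
  obtain ⟨C₁₁, hC₁₁⟩ := hT
  refine ⟨C₂ * (2 * C₁ * (C₅ * (C₃ * C₆ + C₄)) + (C₉ * (C₇ * C₆) + C₁₁ * C₁₀ * C₈)),
    fun i v g hg hi => ?_⟩
  set Q' := dyadicCube (nb v i) with hQ'
  have hQm : MeasurableSet Q' := measurableSet_dyadicCube _
  set H := Q'.indicator fun y => ‖S (toL2 g) y‖ₑ with hH
  set F := fun y => ‖g y‖ₑ with hF
  have hHm : AEMeasurable H := (Lp.aestronglyMeasurable _).enorm.indicator hQm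
  have hFm : AEMeasurable F := hg.1.1.enorm
  have hHF : lorN p q volume H ≤ C₆ * lorN p q volume F := by
    rw [hH, ← lorN_restrict hQm]
    exact hC₆ i v g (hg.memLp 2) hi
  have hsub : Q' ⊆ tri i := fun x hx => mem_tri_iff.2 ⟨v, hx⟩
  have hV0 := volume_dyadicCube_ne_zero i
  have hVt := volume_dyadicCube_ne_top i
  set V := volume (dyadicCube i) with hV
  have hvol : volume Q' = V := volume_nb v i
  -- the average
  have havg : ∫⁻ y in Q', ‖commutator S b g y‖ₑ ≤
      V * (C₉ * av s H i) + C₁₁ * (V * (C₁₀ * av (s * s) F i)) := by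
    calc _ ≤ ∫⁻ y in Q', (‖b y - bmean b i‖ₑ * H y +
          ‖S (toL2 fun y => (b y - bmean b i) * g y) y‖ₑ) := by
          refine setLIntegral_mono_ae' hQm ?_
          filter_upwards [commutator_sub_const (S := S) hn hb hg (bmean b i)] with y hy hyQ
          rw [hy, hH, indicator_of_mem hyQ, ← enorm_mul]
          exact enorm_sub_le
      _ = (∫⁻ y in Q', ‖b y - bmean b i‖ₑ * H y) +
            ∫⁻ y in Q', ‖S (toL2 fun y => (b y - bmean b i) * g y) y‖ₑ :=
          lintegral_add_left' ((by fun_prop : AEMeasurable fun y => ‖b y - bmean b i‖ₑ).restrict.mul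
            hHm.restrict) _
      _ ≤ V * (av s.conjExponent (fun y => ‖b y - bmean b i‖ₑ) i * av s H i) +
            C₁₁ * (V * av s (fun x => ‖(b x - bmean b i) * g x‖ₑ) i) := by
          refine add_le_add (setLIntegral_mul_le_av hc.symm (by fun_prop) hHm hsub) ?_
          exact (lintegral_mono_set hsub).trans (hC₁₁ i _ (hg.memLp_sub_mul hn hb _)
            fun x hx => by simp [hi x hx])
      _ ≤ _ := by
          have h1 := hC₉ i 0
          have h2 := hC₁₀ i 0 g hg.1.1
          simp only [anc_zero, Nat.cast_zero, add_zero, mul_one] at h1 h2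
          gcongr
  -- The averages of H and of g are finite because their Lorentz norms are, which gives the
  -- integrability that the Fefferman–Stein inequality presupposes.
  have hFI : IntegrableOn (commutator S b g) Q' := by
    refine ⟨(aestronglyMeasurable_commutator _ hb g).restrict, ?_⟩
    have hF' : lorN p q volume F < ∞ := (hg.lorN_ne_top hp0 hq).lt_top
    have hVp : V ^ (1 / p) ≠ 0 := (ENNReal.rpow_pos (pos_iff_ne_zero.2 hV0) hVt).ne'
    refine havg.trans_lt (ENNReal.add_lt_top.2 ⟨?_, ?_⟩)
    · refine ENNReal.mul_lt_top hVt.lt_top (ENNReal.mul_lt_top ENNReal.coe_lt_top ?_)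
      refine ENNReal.lt_top_of_mul_ne_top_left (b := V ^ (1 / p)) (ne_of_lt ?_) hVp
      exact (hC₇ H i hHm).trans_lt (ENNReal.mul_lt_top ENNReal.coe_lt_top
        (hHF.trans_lt (ENNReal.mul_lt_top ENNReal.coe_lt_top hF')))
    · refine ENNReal.mul_lt_top ENNReal.coe_lt_top (ENNReal.mul_lt_top hVt.lt_top
        (ENNReal.mul_lt_top ENNReal.coe_lt_top ?_))
      refine ENNReal.lt_top_of_mul_ne_top_left (b := V ^ (1 / p)) (ne_of_lt ?_) hVp
      exact (hC₈ F i hFm).trans_lt (ENNReal.mul_lt_top ENNReal.coe_lt_top hF')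
  refine (hC₂ (nb v i) (commutator S b g)
    (fun x => C₁ * (mxs s H x + mxs (s * s) F x)) hFI ?_).trans ?_
  -- Descendants of Q' lie in Q', so the oscillation estimate applies with E = Q'.
  · intro j k hjk
    exact hC₁ j Q' g hg hQm (by rw [hQ', ← hjk]; exact dyadicCube_subset_anc k j)
  · push_cast
    rw [mul_assoc (C₂ : ℝ≥0∞)]
    refine mul_le_mul' le_rfl ?_
    rw [add_mul]
    refine add_le_add ?_ ?_
    · calc _ ≤ lorN p q volume (fun x => C₁ * (mxs s H x + mxs (s * s) F x)) :=
            lorN_mono_measure hq hp0 Measure.restrict_le_self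
        _ ≤ 2 * C₁ * lorN p q volume (fun x => mxs s H x + mxs (s * s) F x) :=
            lorN_const_mul_le hp0 hq _ ENNReal.coe_ne_top
        _ ≤ 2 * C₁ * (C₅ * (C₃ * (C₆ * lorN p q volume F) + C₄ * lorN p q volume F)) := by
            refine mul_le_mul' le_rfl ((hC₅ _ _ _).trans ?_)
            gcongr
            · exact (hC₃ H hHm).trans (by gcongr)
            · exact hC₄ F hFm
        _ = _ := by ring
    · rw [hvol]
      calc _ ≤ V⁻¹ * (V * (C₉ * av s H i) + C₁₁ * (V * (C₁₀ * av (s * s) F i))) * V ^ (1 / p) := by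
            gcongr
        _ = (V⁻¹ * V) * (C₉ * (av s H i * V ^ (1 / p)) + C₁₁ * C₁₀ * (av (s * s) F i * V ^ (1 / p))) := by
            ring
        _ ≤ 1 * (C₉ * (C₇ * (C₆ * lorN p q volume F)) + C₁₁ * C₁₀ * (C₈ * lorN p q volume F)) := by
            rw [ENNReal.inv_mul_cancel hV0 hVt]
            refine mul_le_mul' le_rfl (add_le_add (mul_le_mul' le_rfl ?_) (mul_le_mul' le_rfl ?_))
            · exact (hC₇ H i hHm).trans (by gcongr)
            · exact hC₈ F i hFm
        _ = _ := by ring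

end Comm

/-! ### Decay of the commutator on dyadic shells, and its transpose. -/

section Far

variable {n : ℕ} {p q s δ A : ℝ} {K : Eu n → Eu n → ℂ} {S : LTwo n →L[ℂ] LTwo n} {b : Eu n → ℂ}

/-- The part of the cube `nb v (anc k i)` that is not covered by the dilates of earlier ancestors. -/
def shell (i : DyadicIndex n) : ℕ × (Fin n → Fin 3) → Set (Eu n)
  | (0, v) => dyadicCube (nb v (anc 0 i))
  | (k + 1, v) => dyadicCube (nb v (anc (k + 1) i)) \ tri (anc k i)

lemma shell_subset (i : DyadicIndex n) (kv : ℕ × (Fin n → Fin 3)) :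
    shell i kv ⊆ dyadicCube (nb kv.2 (anc kv.1 i)) := by
  obtain ⟨_ | k, v⟩ := kv
  · exact subset_rfl
  · exact sdiff_subset

lemma measurableSet_shell (i : DyadicIndex n) (kv : ℕ × (Fin n → Fin 3)) :
    MeasurableSet (shell i kv) := by
  obtain ⟨_ | k, v⟩ := kv
  · exact measurableSet_dyadicCube _
  · exact (measurableSet_dyadicCube _).diff (measurableSet_tri _)

lemma exists_mem_shell (i : DyadicIndex n) (x : Eu n) : ∃ kv, x ∈ shell i kv := by
  classical
  have hex := exists_mem_tri_anc i x
  have h1 := Nat.find_spec hex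
  rcases hk : Nat.find hex with _ | k
  · rw [hk] at h1
    obtain ⟨v, hv⟩ := mem_tri_iff.1 h1
    exact ⟨(0, v), hv⟩
  · rw [hk] at h1
    obtain ⟨v, hv⟩ := mem_tri_iff.1 h1
    exact ⟨(k + 1, v), hv, Nat.find_min hex (by omega)⟩

lemma disjoint_nb (i : DyadicIndex n) {v w : Fin n → Fin 3} (h : v ≠ w) :
    Disjoint (dyadicCube (nb v i)) (dyadicCube (nb w i)) := by
  rw [Set.disjoint_left]
  intro x hx hx'
  have h3 : nb v i = nb w i := (mem_dyadicCube_iff.1 hx).symm.trans (mem_dyadicCube_iff.1 hx')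
  refine h (funext fun l => ?_)
  have h4 := congrFun (congrArg Prod.snd h3) l
  simp only [nb] at h4
  apply Fin.ext
  omega

lemma eq_sum_indicator_nb {i : DyadicIndex n} {g : Eu n → ℂ} (hg : ∀ x, x ∉ tri i → g x = 0) :
    g = ∑ v, (dyadicCube (nb v i)).indicator g := by
  ext x
  rw [Finset.sum_apply]
  by_cases hx : x ∈ tri i
  · obtain ⟨v, hv⟩ := mem_tri_iff.1 hx
    rw [Finset.sum_eq_single v, indicator_of_mem hv]
    · intro w _ hw
      exact indicator_of_notMem (fun hw' => Set.disjoint_left.1 (disjoint_nb i hw) hw' hv) g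
    · simp
  · rw [hg x hx]; symm
    refine Finset.sum_eq_zero fun v _ => ?_
    rw [indicator_apply_eq_zero]; exact fun _ => hg x hx

/-- The commutator far from the support, pointwise. -/
lemma commutator_far_le (hn : 0 < n) (hS : IsCZ δ A K S) (hb : MemBMO b) (i : DyadicIndex n) (k : ℕ)
    (v : Fin n → Fin 3) {g : Eu n → ℂ} (hg : MemLcInfty g) (hi : ∀ x, x ∉ dyadicCube i → g x = 0) :
    ∀ᵐ x, x ∈ shell i (k + 1, v) → ‖commutator S b g x‖ₑ ≤
      ENNReal.ofReal A * (volume (dyadicCube (anc k i)))⁻¹ *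
        ((∫⁻ y, ‖g y‖ₑ) + ∫⁻ y, ‖b y - bmean b i‖ₑ * ‖g y‖ₑ) * (‖b x - bmean b i‖ₑ + 1) := by
  have hbm := hb.1.aestronglyMeasurable
  set E := shell i (k + 1, v) with hE
  have hEm : MeasurableSet E := measurableSet_shell _ _
  have hEb : Bornology.IsBounded E := (isBounded_dyadicCube _).subset (shell_subset i _)
  have hd : ∀ x ∈ E, ∀ y ∈ dyadicCube i, side (anc k i) ≤ ‖x - y‖ :=
    fun x hx y hy => side_le_norm_sub hx.2 (mem_anc k hy)
  have hsupp : Function.support g ⊆ dyadicCube i := fun x hx => by_contra fun h => hx (hi x h)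
  set h : Eu n → ℂ := fun y => (b y - bmean b i) * g y with hh
  have hh2 : MemLp h 2 volume := hg.memLp_sub_mul hn hb _
  have hhsupp : Function.support h ⊆ dyadicCube i := fun x hx => hsupp fun h0 => hx (by simp [hh, h0])
  -- On the shell, the distance to the support is at least the side of the k-th ancestor, so the
  -- size bound of the kernel is A divided by the volume of that ancestor.
  have hrep : ∀ f : Eu n → ℂ, MemLp f 2 volume → Function.support f ⊆ dyadicCube i →
      ∀ᵐ x, x ∈ E → ‖S (toL2 f) x‖ₑ ≤
        ENNReal.ofReal A * (volume (dyadicCube (anc k i)))⁻¹ * ∫⁻ y, ‖f y‖ₑ := by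
    intro f hf hfs
    filter_upwards [hS.ae_eq_integral hf ((isBounded_dyadicCube i).subset hfs) hEm hEb
      ⟨_, side_pos (anc k i), fun x hx y hy => hd x hx y (hfs hy)⟩] with x hx hxE
    rw [hx hxE]
    refine (enorm_integral_le_lintegral_enorm _).trans ?_
    rw [← lintegral_const_mul'' _ hf.1.enorm]
    refine lintegral_mono fun y => ?_
    rw [enorm_mul]
    by_cases hy : f y = 0
    · simp [hy]
    gcongr
    refine (hS.kernel.enorm_le (side_pos (anc k i)) (hd x hxE y (hfs hy))).trans (le_of_eq ?_)
    have hs := side_pos (anc k i)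
    rw [div_eq_mul_inv, ENNReal.ofReal_mul hS.kernel.const_pos.le,
      ENNReal.ofReal_inv_of_pos (by positivity), volume_dyadicCube, ← tp_ofReal_side_rpow,
      Real.rpow_natCast]
  filter_upwards [hrep g (hg.memLp 2) hsupp, hrep h hh2 hhsupp,
    commutator_sub_const (S := S) hn hb hg (bmean b i)] with x h1 h2 h3 hxE
  rw [h3]
  refine enorm_sub_le.trans ?_
  rw [enorm_mul]
  set W := ENNReal.ofReal A * (volume (dyadicCube (anc k i)))⁻¹
  have e2 : ∫⁻ y, ‖h y‖ₑ = ∫⁻ y, ‖b y - bmean b i‖ₑ * ‖g y‖ₑ := by simp_rw [hh, enorm_mul]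
  calc _ ≤ ‖b x - bmean b i‖ₑ * (W * ∫⁻ y, ‖g y‖ₑ) + W * ∫⁻ y, ‖b y - bmean b i‖ₑ * ‖g y‖ₑ := by
        rw [← e2]
        gcongr
        · exact h1 hxE
        · exact h2 hxE
    -- Two nonnegative terms are added so that the bound factors into a constant times (‖b x - bmean
    -- b i‖ + 1).
    _ ≤ ‖b x - bmean b i‖ₑ * (W * ∫⁻ y, ‖g y‖ₑ) + W * (∫⁻ y, ‖b y - bmean b i‖ₑ * ‖g y‖ₑ) +
          (W * (∫⁻ y, ‖g y‖ₑ) + W * (∫⁻ y, ‖b y - bmean b i‖ₑ * ‖g y‖ₑ) * ‖b x - bmean b i‖ₑ) :=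
        le_self_add
    _ = _ := by ring

/-- The commutator on the shells around the support. -/
lemma exists_lorN_commutator_shell_le (hn : 0 < n) (hS : IsCZ δ A K S) (hb : MemBMO b) (hp : 1 < p)
    (hq : 0 < q) : ∃ C : ℝ≥0, ∀ (i : DyadicIndex n) (kv : ℕ × (Fin n → Fin 3)) (g : Eu n → ℂ),
      MemLcInfty g → (∀ x, x ∉ dyadicCube i → g x = 0) →
      lorN p q volume ((shell i kv).indicator fun x => ‖commutator S b g x‖ₑ) ≤
        C * ((1 + kv.1) * tp (-(kv.1 * n * (1 - 1 / p)))) * lorN p q volume (fun x => ‖g x‖ₑ) := by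
  obtain ⟨s, hs, -, hsp, -⟩ := exists_small_exponent hp
  have hp0 : 0 < p := by linarith
  have hc := (Real.HolderConjugate.conjExponent hs)
  have hbm := hb.1.aestronglyMeasurable
  obtain ⟨C₁, hC₁⟩ := exists_lorN_commutator_local_le hn hS hb hp hq
  obtain ⟨C₂, hC₂⟩ := exists_lorN_sub_bmean_le hn hb hp0 hq
  obtain ⟨C₃, hC₃⟩ := exists_av_sub_bmean_le hn hb hc.symm.pos
  obtain ⟨C₄, hC₄⟩ := exists_av_le_lorN hn hs.le hsp hq
  obtain ⟨C₅, hC₅⟩ := exists_lorN_const_le hp0 hq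
  obtain ⟨C₆, hC₆⟩ := exists_lorN_add_le hp0 hq
  set D := tpn (n * 2 / s.conjExponent) with hD
  refine ⟨C₁ + 2 * A.toNNReal * tpn n * ((D + C₃) * C₄) * (C₆ * (C₂ + C₅)), ?_⟩
  rintro i ⟨k, v⟩ g hg hi
  simp only
  set F := fun x => ‖g x‖ₑ with hF
  have hFm : AEMeasurable F := hg.1.1.enorm
  have hLt : lorN p q volume F < ∞ := (hg.lorN_ne_top hp0 hq).lt_top
  have hi' : ∀ x, x ∉ tri i → g x = 0 := fun x hx => hi x fun h => hx (dyadicCube_subset_tri i h)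
  rcases k with _ | k
  · have h1 := hC₁ i v g hg hi'
    rw [lorN_restrict (measurableSet_dyadicCube _)] at h1
    have h0 : shell i (0, v) = dyadicCube (nb v i) := by rw [shell, anc_zero]
    rw [h0]
    refine h1.trans ?_
    simp only [Nat.cast_zero, zero_mul, neg_zero, tp_zero, add_zero, mul_one]
    gcongr
    exact_mod_cast le_self_add
  have hsupp : ∀ f : Eu n → ℝ≥0∞, (∀ x, x ∉ dyadicCube i → f x = 0) →
      ∫⁻ y, f y = ∫⁻ y in dyadicCube i, f y := fun f hf => by
    rw [← lintegral_indicator (measurableSet_dyadicCube i)]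
    refine lintegral_congr fun x => ?_
    by_cases hx : x ∈ dyadicCube i
    · rw [indicator_of_mem hx]
    · rw [indicator_of_notMem hx, hf x hx]
  set V := volume (dyadicCube i) with hV
  have hV0 : V ≠ 0 := volume_dyadicCube_ne_zero i
  have hVt : V ≠ ∞ := volume_dyadicCube_ne_top i
  have hW : (∫⁻ y, ‖g y‖ₑ) + ∫⁻ y, ‖b y - bmean b i‖ₑ * ‖g y‖ₑ ≤ (D + C₃) * (V * av s F i) := by
    rw [add_mul]
    refine add_le_add ?_ ?_
    · rw [hsupp _ fun x hx => by simp [hi x hx]]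
      refine (setLIntegral_le_av F (dyadicCube_subset_tri i)).trans ?_
      calc _ ≤ V * (D * av s F i) := by gcongr; exact av_one_exponent_le hs hFm i
        _ = _ := by ring
    · rw [hsupp _ fun x hx => by simp [hi x hx]]
      refine (setLIntegral_mul_le_av hc.symm (by fun_prop) hFm (dyadicCube_subset_tri i)).trans ?_
      have h1 := hC₃ i 0
      simp only [anc_zero, Nat.cast_zero, add_zero, mul_one] at h1
      calc _ ≤ V * (C₃ * av s F i) := by gcongr
        _ = _ := by ring
  set W := (∫⁻ y, ‖g y‖ₑ) + ∫⁻ y, ‖b y - bmean b i‖ₑ * ‖g y‖ₑ with hWdef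
  have hav : av s F i * V ^ (1 / p) ≤ C₄ * lorN p q volume F := hC₄ F i hFm
  have hVp : V ^ (1 / p) ≠ 0 := (ENNReal.rpow_pos (pos_iff_ne_zero.2 hV0) hVt).ne'
  -- Finiteness of the constant factor is required for pulling it out of the Lorentz norm.
  have hWt : W ≠ ∞ := by
    refine ne_top_of_le_ne_top ?_ hW
    refine ENNReal.mul_ne_top (by simp) (ENNReal.mul_ne_top hVt ?_)
    exact (ENNReal.lt_top_of_mul_ne_top_left (hav.trans_lt
      (ENNReal.mul_lt_top ENNReal.coe_lt_top hLt)).ne hVp).ne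
  have hct : ENNReal.ofReal A * (volume (dyadicCube (anc k i)))⁻¹ * W ≠ ∞ :=
    ENNReal.mul_ne_top (ENNReal.mul_ne_top ENNReal.ofReal_ne_top
      (by simpa using volume_dyadicCube_ne_zero (anc k i))) hWt
  set R := dyadicCube (nb v (anc (k + 1) i)) with hR
  have hRm : MeasurableSet R := measurableSet_dyadicCube _
  have hRv : volume R = tp ((k + 1 : ℕ) * n) * V := by rw [hR, volume_nb, volume_anc]
  have hbR : lorN p q (volume.restrict R) (fun x => ‖b x - bmean b i‖ₑ + 1) ≤
      C₆ * (C₂ + C₅) * ((1 + (k + 1 : ℕ)) * (tp ((k + 1 : ℕ) * n) * V) ^ (1 / p)) := by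
    calc _ ≤ C₆ * (C₂ * (1 + (k + 1 : ℕ)) * (tp ((k + 1 : ℕ) * n) * V) ^ (1 / p) +
          C₅ * (1 * (tp ((k + 1 : ℕ) * n) * V) ^ (1 / p))) := by
          refine (hC₆ _ _ _).trans ?_
          gcongr
          · rw [← volume_anc]; exact hC₂ i (k + 1) v
          · have := hC₅ (volume.restrict R) 1 ENNReal.one_ne_top
            rwa [Measure.restrict_apply_univ, hRv] at this
      _ ≤ C₆ * (C₂ * (1 + (k + 1 : ℕ)) * (tp ((k + 1 : ℕ) * n) * V) ^ (1 / p) +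
          C₅ * ((1 + (k + 1 : ℕ)) * (tp ((k + 1 : ℕ) * n) * V) ^ (1 / p))) := by
          gcongr
          exact le_self_add
      _ = _ := by ring
  calc _ ≤ lorN p q volume (R.indicator fun x =>
        ENNReal.ofReal A * (volume (dyadicCube (anc k i)))⁻¹ * W * (‖b x - bmean b i‖ₑ + 1)) := by
        refine lorN_mono_ae hq hp0 ?_
        filter_upwards [commutator_far_le hn hS hb i k v hg hi] with x hx
        by_cases hxE : x ∈ shell i (k + 1, v)
        · rw [indicator_of_mem hxE, indicator_of_mem (shell_subset i _ hxE)]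
          exact hx hxE
        · rw [indicator_of_notMem hxE]; exact zero_le
    _ = lorN p q (volume.restrict R) (fun x =>
        ENNReal.ofReal A * (volume (dyadicCube (anc k i)))⁻¹ * W * (‖b x - bmean b i‖ₑ + 1)) :=
        (lorN_restrict hRm).symm
    _ ≤ 2 * (ENNReal.ofReal A * (volume (dyadicCube (anc k i)))⁻¹ * W) *
          (C₆ * (C₂ + C₅) * ((1 + (k + 1 : ℕ)) * (tp ((k + 1 : ℕ) * n) * V) ^ (1 / p))) :=
        (lorN_const_mul_le hp0 hq _ hct).trans (mul_le_mul' le_rfl hbR)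
    _ ≤ 2 * (ENNReal.ofReal A * (tp (k * n) * V)⁻¹ * ((D + C₃) * (V * av s F i))) *
          (C₆ * (C₂ + C₅) * ((1 + (k + 1 : ℕ)) * (tp ((k + 1 : ℕ) * n) * V) ^ (1 / p))) := by
        rw [volume_anc]
        gcongr
    _ = 2 * ENNReal.ofReal A * (D + C₃) * (C₆ * (C₂ + C₅)) * (1 + (k + 1 : ℕ)) *
          (tp n * tp (-((k + 1 : ℕ) * n * (1 - 1 / p)))) * (V⁻¹ * V) * (av s F i * V ^ (1 / p)) := by
        have e1 : (tp (k * n) * V)⁻¹ = tp (-(k * n)) * V⁻¹ := by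
          rw [ENNReal.mul_inv (Or.inl (tp_ne_zero _)) (Or.inl (tp_ne_top _)), tp_inv]
        have e2 : (tp ((k + 1 : ℕ) * n) * V) ^ (1 / p) = tp ((k + 1 : ℕ) * n / p) * V ^ (1 / p) := by
          rw [ENNReal.mul_rpow_of_nonneg _ _ (by positivity), tp_rpow, mul_one_div]
        -- The kernel contributes the inverse volume of the k-th ancestor, the Lorentz norm of a
        -- constant the power 1/p of the volume of the next one; the mismatch of one generation is
        -- the factor 2^n.
        have e3 : tp n * tp (-((k + 1 : ℕ) * n * (1 - 1 / p))) =
            tp (-(k * n)) * tp ((k + 1 : ℕ) * n / p) := by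
          rw [← tp_add, ← tp_add]; congr 1; push_cast; ring
        rw [e1, e2, e3]; ring
    _ ≤ 2 * ENNReal.ofReal A * (D + C₃) * (C₆ * (C₂ + C₅)) * (1 + (k + 1 : ℕ)) *
          (tp n * tp (-((k + 1 : ℕ) * n * (1 - 1 / p)))) * 1 * (C₄ * lorN p q volume F) := by
        rw [ENNReal.inv_mul_cancel hV0 hVt]
        gcongr
    _ = (2 * ENNReal.ofReal A * tp n * ((D + C₃) * C₄) * (C₆ * (C₂ + C₅))) *
          ((1 + (k + 1 : ℕ)) * tp (-((k + 1 : ℕ) * n * (1 - 1 / p)))) * lorN p q volume F := by ring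
    _ ≤ _ := by
        push_cast
        rw [coe_tpn n]
        gcongr
        exact le_add_self

lemma enorm_le_tsum_shell (i : DyadicIndex n) (f : Eu n → ℝ≥0∞) (x : Eu n) :
    f x ≤ ∑' kv, (shell i kv).indicator f x := by
  obtain ⟨kv, h⟩ := exists_mem_shell i x
  refine le_trans ?_ (ENNReal.le_tsum kv)
  rw [indicator_of_mem h]

lemma commutator_finset_sum (hn : 0 < n) (hb : MemBMO b) {ι : Type*} (t : Finset ι) {g : ι → Eu n → ℂ}
    (hg : ∀ i ∈ t, MemLcInfty (g i)) :
    ∀ᵐ x, commutator S b (∑ i ∈ t, g i) x = ∑ i ∈ t, commutator S b (g i) x := by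
  have h1 : toL2 (fun y => b y * (∑ i ∈ t, g i) y) = ∑ i ∈ t, toL2 (fun y => b y * g i y) := by
    rw [← toL2_finset_sum t fun i hi => (hg i hi).memLp_mul hn hb]
    refine toL2_congr (Eventually.of_forall fun y => ?_)
    simp only [Finset.sum_apply, Finset.mul_sum]
  have h2 := toL2_finset_sum t fun i hi => (hg i hi).memLp 2
  have key : ∀ u : ι → LTwo n, ∀ᵐ x, (∑ i ∈ t, u i : LTwo n) x = ∑ i ∈ t, u i x := fun u => by
    filter_upwards [Lp.coeFn_finsetSum t u] with x hx
    rw [hx, Finset.sum_apply]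
  filter_upwards [key fun i => S (toL2 (g i)), key fun i => S (toL2 fun y => b y * g i y)] with x h3 h4
  simp only [commutator, h1, h2, map_sum, h3, h4, Finset.sum_sub_distrib, Finset.mul_sum]

lemma exists_tsum_shell_weight (hn : 0 < n) {ε : ℝ} (hε : 0 < ε) : ∃ C : ℝ≥0,
    ∑' kv : ℕ × (Fin n → Fin 3), (1 + (kv.1 : ℝ≥0∞)) * tp (-(kv.1 * n * ε)) = C := by
  have hn' : (0 : ℝ) < n := by exact_mod_cast hn
  obtain ⟨G, hG⟩ := exists_geom_lin (mul_pos hn' hε)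
  refine ⟨3 ^ n * G, ?_⟩
  rw [ENNReal.tsum_prod']
  simp only [tsum_fintype, Finset.sum_const, nsmul_eq_mul]
  rw [ENNReal.tsum_mul_left]
  have : ∀ k : ℕ, (1 + (k : ℝ≥0∞)) * tp (-(k * n * ε)) = tp (-((n * ε) * k)) * (1 + k) := fun k => by
    rw [mul_comm]; congr 2; ring
  simp_rw [this, hG]
  simp

/-- The shell norms form a convergent series because p > 1, and Minkowski's inequality for countable
sums adds them up. -/
lemma exists_lorN_commutator_le (hn : 0 < n) (hS : IsCZ δ A K S) (hb : MemBMO b) (hp : 1 < p)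
    (hq : 1 < q) : ∃ C : ℝ≥0, ∀ (i : DyadicIndex n) (g : Eu n → ℂ),
      MemLcInfty g → (∀ x, x ∉ dyadicCube i → g x = 0) →
      lorN p q volume (fun x => ‖commutator S b g x‖ₑ) ≤ C * lorN p q volume (fun x => ‖g x‖ₑ) := by
  have hp0 : 0 < p := by linarith
  have hq0 : 0 < q := by linarith
  obtain ⟨C₁, hC₁⟩ := exists_lorN_commutator_shell_le hn hS hb hp hq0
  obtain ⟨C₂, hC₂⟩ := exists_lorN_tsum_le hp hq
  obtain ⟨G, hG⟩ := exists_tsum_shell_weight hn (ε := 1 - 1 / p) (by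
    rw [sub_pos, div_lt_one hp0]; exact hp)
  refine ⟨C₂ * (C₁ * G), fun i g hg hi => ?_⟩
  have hcm : AEMeasurable fun x => ‖commutator S b g x‖ₑ :=
    (aestronglyMeasurable_commutator _ hb _).enorm
  refine ((lorN_mono hq0 hp0 fun x => enorm_le_tsum_shell i _ x).trans (hC₂ volume _ fun kv =>
    hcm.indicator (measurableSet_shell _ kv))).trans ?_
  refine (mul_le_mul' le_rfl (ENNReal.tsum_le_tsum fun kv => hC₁ i kv g hg hi)).trans ?_
  rw [ENNReal.tsum_mul_right, ENNReal.tsum_mul_left, hG]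
  push_cast
  exact le_of_eq (by ring)

/-- Commutators of test functions belong to all Lorentz spaces. -/
lemma lorN_commutator_ne_top (hn : 0 < n) (hS : IsCZ δ A K S) (hb : MemBMO b) (hp : 1 < p)
    (hq : 1 < q) {g : Eu n → ℂ} (hg : MemLcInfty g) :
    lorN p q volume (fun x => ‖commutator S b g x‖ₑ) ≠ ∞ := by
  have hp0 : 0 < p := by linarith
  have hq0 : 0 < q := by linarith
  obtain ⟨C₁, hC₁⟩ := exists_lorN_commutator_le hn hS hb hp hq
  obtain ⟨C₂, hC₂⟩ := exists_lorN_tsum_le hp hq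
  obtain ⟨k, hk⟩ := exists_subset_tri_anc hg.isBounded ((0, 0) : DyadicIndex n)
  set i := anc k ((0, 0) : DyadicIndex n)
  set gv : (Fin n → Fin 3) → Eu n → ℂ := fun v => (dyadicCube (nb v i)).indicator g with hgv
  have hgvL : ∀ v, MemLcInfty (gv v) := fun v => hg.indicator (measurableSet_dyadicCube _)
  have hsum : g = ∑ v, gv v := eq_sum_indicator_nb fun x hx => by_contra fun h => hx (hk h)
  have hle : ∀ᵐ x, ‖commutator S b g x‖ₑ ≤ ∑' v, ‖commutator S b (gv v) x‖ₑ := by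
    have h := commutator_finset_sum (S := S) hn hb Finset.univ fun v _ => hgvL v
    rw [← hsum] at h
    filter_upwards [h] with x hx
    rw [hx, tsum_fintype]
    exact enorm_sum_le _ _
  refine ne_top_of_le_ne_top ?_ ((lorN_mono_ae hq0 hp0 hle).trans (hC₂ volume _ fun v =>
    (aestronglyMeasurable_commutator _ hb _).enorm))
  refine ENNReal.mul_ne_top ENNReal.coe_ne_top ?_
  rw [tsum_fintype]
  refine ENNReal.sum_ne_top.2 fun v _ => ne_top_of_le_ne_top ?_
    (hC₁ (nb v i) (gv v) (hgvL v) fun x hx => indicator_of_notMem hx g)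
  exact ENNReal.mul_ne_top ENNReal.coe_ne_top ((hgvL v).lorN_ne_top hp0 hq0)

/-- The commutators of `S` and of its transpose are dual to each other up to the sign. -/
lemma integral_commutator_transpose (hn : 0 < n) (hb : MemBMO b) {g φ : Eu n → ℂ} (hg : MemLcInfty g)
    (hφ : MemLcInfty φ) :
    ∫ x, commutator (transposeL S) b g x * φ x = -∫ x, g x * commutator S b φ x := by
  have hbg := hg.memLp_mul hn hb
  have hbφ := hφ.memLp_mul hn hb
  have h1 := integral_transposeL S (hg.memLp 2) hbφ
  have h2 := integral_transposeL S hbg (hφ.memLp 2)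
  have e1 : ∫ x, commutator (transposeL S) b g x * φ x =
      (∫ x, transposeL S (toL2 g) x * (b x * φ x)) -
        ∫ x, transposeL S (toL2 fun y => b y * g y) x * φ x := by
    rw [← integral_sub (integrable_mul_of_memLp (Lp.memLp _) hbφ)
      (integrable_mul_of_memLp (Lp.memLp _) (hφ.memLp 2))]
    congr 1; ext x; simp only [commutator]; ring
  have e2 : ∫ x, g x * commutator S b φ x = (∫ x, (b x * g x) * S (toL2 φ) x) -
      ∫ x, g x * S (toL2 fun y => b y * φ y) x := by
    rw [← integral_sub (integrable_mul_of_memLp hbg (Lp.memLp _))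
      (integrable_mul_of_memLp (hg.memLp 2) (Lp.memLp _))]
    congr 1; ext x; simp only [commutator]; ring
  rw [e1, e2, h1, h2]; ring

end Far

/-! ### Sequence spaces -/

section Seq

variable {ι : Type*} {ρ : ℝ}

/-- The `ℓ^ρ` norm for a finite exponent. -/
def sn (ρ : ℝ) (a : ι → ℝ≥0∞) : ℝ≥0∞ := (∑' i, a i ^ ρ) ^ (1 / ρ)

lemma seqNorm_eq_sn {r : ℝ≥0∞} (hr : r ≠ ∞) (a : ι → ℝ≥0∞) : seqNorm r a = sn r.toReal a := by
  rw [seqNorm, if_neg hr, sn]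

lemma sn_mono (hρ : 0 < ρ) {a b : ι → ℝ≥0∞} (h : ∀ i, a i ≤ b i) : sn ρ a ≤ sn ρ b := by
  unfold sn
  gcongr with i
  exact h i

lemma sn_rpow (hρ : 0 < ρ) (a : ι → ℝ≥0∞) : sn ρ a ^ ρ = ∑' i, a i ^ ρ := by
  rw [sn, ← ENNReal.rpow_mul, one_div_mul_cancel hρ.ne', ENNReal.rpow_one]

lemma sn_const_mul (hρ : 0 < ρ) (c : ℝ≥0∞) (a : ι → ℝ≥0∞) : sn ρ (fun i => c * a i) = c * sn ρ a := by
  unfold sn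
  simp_rw [ENNReal.mul_rpow_of_nonneg _ _ hρ.le]
  rw [ENNReal.tsum_mul_left, ENNReal.mul_rpow_of_nonneg _ _ (by positivity), ← ENNReal.rpow_mul,
    mul_one_div_cancel hρ.ne', ENNReal.rpow_one]

lemma le_sn (hρ : 0 < ρ) (a : ι → ℝ≥0∞) (i : ι) : a i ≤ sn ρ a := by
  calc a i = (a i ^ ρ) ^ (1 / ρ) := by
        rw [← ENNReal.rpow_mul, mul_one_div_cancel hρ.ne', ENNReal.rpow_one]
    _ ≤ _ := ENNReal.rpow_le_rpow (ENNReal.le_tsum (f := fun i => a i ^ ρ) i) (by positivity)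

lemma seqNorm_mono {r : ℝ≥0∞} {a b : ι → ℝ≥0∞} (h : ∀ i, a i ≤ b i) :
    seqNorm r a ≤ seqNorm r b := by
  unfold seqNorm
  split_ifs
  · exact iSup_mono h
  · gcongr with i; exact h i

lemma seqNorm_const_mul {r : ℝ≥0∞} (hr : 0 < r) (c : ℝ≥0∞) (a : ι → ℝ≥0∞) :
    seqNorm r (fun i => c * a i) = c * seqNorm r a := by
  by_cases h : r = ∞
  · simp only [seqNorm, if_pos h, ENNReal.mul_iSup]
  · rw [seqNorm_eq_sn h, seqNorm_eq_sn h, sn_const_mul (ENNReal.toReal_pos hr.ne' h)]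

lemma tsum_mul_le_sn {r r' : ℝ} (h : r.HolderConjugate r') (a b : ι → ℝ≥0∞) :
    ∑' i, a i * b i ≤ sn r a * sn r' b := by
  let _ : MeasurableSpace ι := ⊤
  have h1 := ENNReal.lintegral_mul_le_Lp_mul_Lq (Measure.count : Measure ι) h
    (f := a) (g := b) measurable_from_top.aemeasurable measurable_from_top.aemeasurable
  simpa only [lintegral_count, Pi.mul_apply, sn] using h1

/-- Jensen's inequality for the weights w, obtained from Hölder after splitting w = w^{1/ρ'}
w^{1/ρ}. It is the form of Schur's test used for the block coefficients. -/
lemma rpow_tsum_mul_le (hρ : 1 ≤ ρ) (w x : ι → ℝ≥0∞) :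
    (∑' i, w i * x i) ^ ρ ≤ (∑' i, w i) ^ (ρ - 1) * ∑' i, w i * x i ^ ρ := by
  rcases hρ.eq_or_lt with rfl | hρ1
  · simp
  have hρ0 : 0 < ρ := by linarith
  have hc := Real.HolderConjugate.conjExponent hρ1
  set ρ' := ρ.conjExponent
  have hρ' : 0 < ρ' := hc.symm.pos
  have h1 := tsum_mul_le_sn hc.symm (fun i => w i ^ (1 / ρ')) fun i => w i ^ (1 / ρ) * x i
  have e0 : ∀ i, w i ^ (1 / ρ') * (w i ^ (1 / ρ) * x i) = w i * x i := fun i => by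
    rw [← mul_assoc, ← ENNReal.rpow_add_of_nonneg _ _ (by positivity) (by positivity), one_div, one_div,
      hc.symm.inv_add_inv_eq_one, ENNReal.rpow_one]
  have e1 : sn ρ' (fun i => w i ^ (1 / ρ')) = (∑' i, w i) ^ (1 / ρ') := by
    unfold sn
    simp_rw [← ENNReal.rpow_mul]
    rw [one_div_mul_cancel hρ'.ne']
    simp
  simp_rw [e0] at h1
  rw [e1] at h1
  calc _ ≤ ((∑' i, w i) ^ (1 / ρ') * sn ρ fun i => w i ^ (1 / ρ) * x i) ^ ρ :=
        ENNReal.rpow_le_rpow h1 hρ0.le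
    _ = _ := by
        rw [ENNReal.mul_rpow_of_nonneg _ _ hρ0.le, sn_rpow hρ0, ← ENNReal.rpow_mul]
        congr 1
        · congr 1
          have := hc.sub_one_mul_conj
          field_simp
          linarith
        · congr 1; ext i
          rw [ENNReal.mul_rpow_of_nonneg _ _ hρ0.le, ← ENNReal.rpow_mul, one_div_mul_cancel hρ0.ne',
            ENNReal.rpow_one]

lemma sum_rpow_le_rpow_sum {θ : ℝ} (hθ : 1 ≤ θ) (x : ι → ℝ≥0∞) :
    ∑' i, x i ^ θ ≤ (∑' i, x i) ^ θ := by
  have h0 : 0 < θ := by linarith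
  rcases eq_or_ne (∑' i, x i) ∞ with h | h
  · rw [h, ENNReal.top_rpow_of_pos h0]; exact le_top
  calc ∑' i, x i ^ θ ≤ ∑' i, x i * (∑' i, x i) ^ (θ - 1) := by
        refine ENNReal.tsum_le_tsum fun i => ?_
        rcases eq_or_ne (x i) 0 with hx | hx
        · rw [hx, ENNReal.zero_rpow_of_pos h0, zero_mul]
        have hxt : x i ≠ ∞ := ne_top_of_le_ne_top h (ENNReal.le_tsum i)
        calc x i ^ θ = x i ^ (1 + (θ - 1)) := by congr 1; ring
          _ = x i * x i ^ (θ - 1) := by rw [ENNReal.rpow_add _ _ hx hxt, ENNReal.rpow_one]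
          _ ≤ _ := by
            gcongr
            exact ENNReal.le_tsum i
    _ = (∑' i, x i) ^ (1 + (θ - 1)) := by
        rw [ENNReal.tsum_mul_right, ENNReal.rpow_add_of_nonneg _ _ (by norm_num) (by linarith),
          ENNReal.rpow_one]
    _ = _ := by congr 1; ring

end Seq

/-! ### Bourgain–Morrey–Lorentz norms -/

section Morrey

variable {n : ℕ} {p q t : ℝ} {r : ℝ≥0∞}

/-- The discrete variant of the Bourgain–Morrey–Lorentz norm. -/
def mN (p q t : ℝ) (r : ℝ≥0∞) (F : Eu n → ℝ≥0∞) : ℝ≥0∞ :=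
  seqNorm r fun i : DyadicIndex n =>
    volume (dyadicCube i) ^ (1 / t - 1 / p) * lorN p q (volume.restrict (dyadicCube i)) F

lemma exists_bmlNorm_le (hp : 0 < p) (hq : 0 < q) (hr : 0 < r) : ∃ C : ℝ≥0, ∀ f : Eu n → ℂ,
    bmlNorm p q t r f ≤ C * mN p q t r fun x => ‖f x‖ₑ := by
  obtain ⟨C, hC⟩ := exists_lorentzNorm_le hp hq
  refine ⟨C, fun f => ?_⟩
  rw [mN, ← seqNorm_const_mul hr]
  refine seqNorm_mono fun i => ?_
  rw [mul_left_comm]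
  gcongr
  exact hC _ _

lemma exists_mN_le (hp : 0 < p) (hq : 0 < q) (hr : 0 < r) : ∃ C : ℝ≥0, ∀ f : Eu n → ℂ,
    mN p q t r (fun x => ‖f x‖ₑ) ≤ C * bmlNorm p q t r f := by
  obtain ⟨C, hC⟩ := exists_lorN_le hp hq
  refine ⟨C, fun f => ?_⟩
  rw [bmlNorm, ← seqNorm_const_mul hr]
  refine seqNorm_mono fun i => ?_
  rw [mul_left_comm (C : ℝ≥0∞)]
  gcongr
  exact hC _ _

/-- On a cube the Lorentz norm is dominated by the `L^v` norm for larger `v`. -/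
lemma exists_lorN_restrict_le (hn : 0 < n) (hp : 1 < p) (hq : 1 < q) {v : ℝ} (hpv : p < v) :
    ∃ C : ℝ≥0, ∀ (i : DyadicIndex n) (F : Eu n → ℝ≥0∞), AEMeasurable F →
      lorN p q (volume.restrict (dyadicCube i)) F ≤
        C * (volume (dyadicCube i) ^ (1 / p - 1 / v) * (∫⁻ x in dyadicCube i, F x ^ v) ^ (1 / v)) := by
  have hcp := Real.HolderConjugate.conjExponent hp
  have hcq := Real.HolderConjugate.conjExponent hq
  have hv : 1 < v := by linarith
  have hcv := Real.HolderConjugate.conjExponent hv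
  set p' := p.conjExponent
  set q' := q.conjExponent
  set v' := v.conjExponent
  have hp0 := hcp.pos
  have hv0 := hcv.pos
  have hp0' := hcp.symm.pos
  have hv0' := hcv.symm.pos
  have ep := hcp.inv_add_inv_eq_one
  have ev := hcv.inv_add_inv_eq_one
  have hvp : v' < p' := by
    have : p'⁻¹ < v'⁻¹ := by
      have h1 : v⁻¹ < p⁻¹ := (inv_lt_inv₀ hv0 hp0).2 hpv
      linarith
    exact (inv_lt_inv₀ hp0' hv0').1 this
  obtain ⟨C₁, hC₁⟩ := exists_lorN_le_of_forall hcp hcq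
  obtain ⟨C₂, hC₂⟩ := exists_av_le_lorN hn hcv.symm.lt.le hvp hcq.symm.pos
  refine ⟨C₁ * C₂, fun i F hF => ?_⟩
  have hQ := measurableSet_dyadicCube i
  have hV0 := volume_dyadicCube_ne_zero i
  have hVt := volume_dyadicCube_ne_top i
  set V := volume (dyadicCube i)
  push_cast
  rw [mul_assoc]
  -- By duality it suffices to pair with g. Hölder's inequality uses the exponents v and v', and
  -- since v' < p' the L^{v'} average of g is controlled by its L^{p',q'} norm.
  refine hC₁ _ F _ hF.restrict fun g hg _ => ?_
  have h1 : (∫⁻ x in dyadicCube i, g x ^ v') ^ (1 / v') ≤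
      V ^ (1 / v') * av v' ((dyadicCube i).indicator g) i := by
    rw [av, ← ENNReal.mul_rpow_of_nonneg _ _ (by positivity), ← mul_assoc,
      ENNReal.mul_inv_cancel hV0 hVt, one_mul]
    gcongr ?_ ^ (1 / v')
    calc _ = ∫⁻ x in dyadicCube i, (dyadicCube i).indicator g x ^ v' :=
          setLIntegral_congr_fun hQ fun x hx => by simp [hx]
      _ ≤ _ := lintegral_mono_set (dyadicCube_subset_tri i)
  have h2 := hC₂ ((dyadicCube i).indicator g) i (hg.indicator hQ).aemeasurable
  rw [← lorN_restrict hQ] at h2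
  have e1 : V ^ (1 / v') = V ^ (1 / p - 1 / v) * V ^ (1 / p') := by
    rw [← ENNReal.rpow_add _ _ hV0 hVt]
    congr 1
    simp only [one_div]; linarith
  calc _ ≤ (∫⁻ x in dyadicCube i, F x ^ v) ^ (1 / v) * (∫⁻ x in dyadicCube i, g x ^ v') ^ (1 / v') :=
        ENNReal.lintegral_mul_le_Lp_mul_Lq _ hcv hF.restrict hg.aemeasurable
    _ ≤ (∫⁻ x in dyadicCube i, F x ^ v) ^ (1 / v) * (V ^ (1 / p - 1 / v) *
          (av v' ((dyadicCube i).indicator g) i * V ^ (1 / p'))) := by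
        refine mul_le_mul' le_rfl (h1.trans (le_of_eq ?_))
        rw [e1]; ring
    _ ≤ (∫⁻ x in dyadicCube i, F x ^ v) ^ (1 / v) * (V ^ (1 / p - 1 / v) *
          (C₂ * lorN p' q' (volume.restrict (dyadicCube i)) g)) := by gcongr
    _ = _ := by ring

lemma tsum_setLIntegral_le (j : ℤ) (F : Eu n → ℝ≥0∞) :
    ∑' m : Fin n → ℤ, ∫⁻ x in dyadicCube ((j, m) : DyadicIndex n), F x ≤ ∫⁻ x, F x := by
  rw [← lintegral_iUnion (fun m => measurableSet_dyadicCube _)]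
  · exact setLIntegral_le_lintegral _ _
  · intro m m' h
    rw [Function.onFun, Set.disjoint_left]
    intro x (hx : x ∈ dyadicCube ((j, m) : DyadicIndex n)) (hx' : x ∈ dyadicCube ((j, m') : DyadicIndex n))
    have h1 : ((j, m) : DyadicIndex n) = (j, m') :=
      (mem_dyadicCube_iff.1 hx).symm.trans (mem_dyadicCube_iff.1 hx')
    exact h (congrArg Prod.snd h1)

lemma tsum_generation_le {v R : ℝ} (hv : 0 < v) (hvR : v ≤ R) (j : ℤ) (F : Eu n → ℝ≥0∞) :
    ∑' m : Fin n → ℤ, ((∫⁻ x in dyadicCube ((j, m) : DyadicIndex n), F x ^ v) ^ (1 / v)) ^ R ≤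
      ((∫⁻ x, F x ^ v) ^ (1 / v)) ^ R := by
  have h1 : 1 ≤ R / v := (one_le_div hv).2 hvR
  simp_rw [← ENNReal.rpow_mul]
  have e : 1 / v * R = R / v := by ring
  rw [e]
  refine (sum_rpow_le_rpow_sum h1 _).trans ?_
  gcongr
  exact tsum_setLIntegral_le j _

/-- Functions which belong to all Lorentz spaces belong to the Bourgain–Morrey–Lorentz space. -/
lemma mN_ne_top (hn : 0 < n) (hp : 1 < p) (hq : 1 < q)
    (hptr : (p < t ∧ ENNReal.ofReal t < r ∧ r < ∞) ∨ (p ≤ t ∧ r = ∞)) {F : Eu n → ℝ≥0∞}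
    (hF : AEMeasurable F) (h : ∀ p' q' : ℝ, 1 < p' → 1 < q' → lorN p' q' volume F ≠ ∞) :
    mN p q t r F ≠ ∞ := by
  have hn' : (0 : ℝ) < n := by exact_mod_cast hn
  have hp0 : 0 < p := by linarith
  have hLv : ∀ v : ℝ, 1 < v → (∫⁻ x, F x ^ v) ^ (1 / v) ≠ ∞ := fun v hv => by
    obtain ⟨C, hC⟩ := exists_lintegral_rpow_le (p := v) (by linarith)
    exact ne_top_of_le_ne_top (ENNReal.mul_ne_top ENNReal.coe_ne_top (h v v hv hv)) (hC volume F hF)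
  rcases hptr with ⟨hpt, htr, hr⟩ | ⟨hpt, hr⟩
  · have ht0 : 0 < t := by linarith
    set R := r.toReal with hR
    have htR : t < R := by
      rw [hR]; exact (ENNReal.ofReal_lt_iff_lt_toReal ht0.le hr.ne).1 htr
    have hR0 : 0 < R := by linarith
    rw [mN, seqNorm_eq_sn hr.ne, ← hR]
    refine ENNReal.rpow_ne_top_of_nonneg (by positivity) ?_
    -- each generation
    have hgen : ∀ v : ℝ, p < v → v ≤ R → ∃ M : ℝ≥0∞, M ≠ ∞ ∧ ∀ j : ℤ, ∑' m : Fin n → ℤ,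
        (volume (dyadicCube ((j, m) : DyadicIndex n)) ^ (1 / t - 1 / p) *
          lorN p q (volume.restrict (dyadicCube ((j, m) : DyadicIndex n))) F) ^ R ≤
        tp (-(j * n * ((1 / t - 1 / v) * R))) * M := by
      intro v hpv hvR
      obtain ⟨C, hC⟩ := exists_lorN_restrict_le hn hp hq hpv
      refine ⟨C ^ R * ((∫⁻ x, F x ^ v) ^ (1 / v)) ^ R, ?_, fun j => ?_⟩
      · exact ENNReal.mul_ne_top (ENNReal.rpow_ne_top_of_nonneg hR0.le ENNReal.coe_ne_top)
          (ENNReal.rpow_ne_top_of_nonneg hR0.le (hLv v (by linarith)))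
      calc _ ≤ ∑' m : Fin n → ℤ, tp (-(j * n * ((1 / t - 1 / v) * R))) * (C ^ R *
            ((∫⁻ x in dyadicCube ((j, m) : DyadicIndex n), F x ^ v) ^ (1 / v)) ^ R) := by
            refine ENNReal.tsum_le_tsum fun m => ?_
            set i : DyadicIndex n := (j, m)
            set V := volume (dyadicCube i) with hV
            have hV0 := volume_dyadicCube_ne_zero i
            have hVt := volume_dyadicCube_ne_top i
            calc _ ≤ (V ^ (1 / t - 1 / p) * (C * (V ^ (1 / p - 1 / v) *
                  (∫⁻ x in dyadicCube i, F x ^ v) ^ (1 / v)))) ^ R := by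
                  gcongr
                  exact hC i F hF
              _ = (V ^ (1 / t - 1 / v) * (C * (∫⁻ x in dyadicCube i, F x ^ v) ^ (1 / v))) ^ R := by
                  congr 1
                  rw [show 1 / t - 1 / v = (1 / t - 1 / p) + (1 / p - 1 / v) by ring,
                    ENNReal.rpow_add _ _ hV0 hVt]
                  ring
              _ = _ := by
                  rw [ENNReal.mul_rpow_of_nonneg _ _ hR0.le, ENNReal.mul_rpow_of_nonneg _ _ hR0.le,
                    ← ENNReal.rpow_mul, hV, volume_dyadicCube, tp_rpow]
                  congr 2; simp only [i]; ring
        _ = tp (-(j * n * ((1 / t - 1 / v) * R))) * (C ^ R * ∑' m : Fin n → ℤ,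
            ((∫⁻ x in dyadicCube ((j, m) : DyadicIndex n), F x ^ v) ^ (1 / v)) ^ R) := by
            rw [ENNReal.tsum_mul_left, ENNReal.tsum_mul_left]
        _ ≤ _ := by
            gcongr
            exact tsum_generation_le (by linarith) hvR j F
    -- The factor 2^{-jn(1/t-1/v)R} decays for small cubes (j ≥ 0) when v = R > t, and for large
    -- cubes (j ≤ 0) when v lies strictly between p and t. This uses p < t < r.
    obtain ⟨M₁, hM₁, h₁⟩ := hgen R (by linarith) le_rfl
    obtain ⟨M₂, hM₂, h₂⟩ := hgen ((p + t) / 2) (by linarith) (by linarith)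
    set v := (p + t) / 2 with hv
    have hvt : v < t := by linarith
    have hv0 : 0 < v := by linarith
    rw [ENNReal.tsum_prod']
    set T : ℤ → ℝ≥0∞ := fun j => ∑' m : Fin n → ℤ,
        (volume (dyadicCube ((j, m) : DyadicIndex n)) ^ (1 / t - 1 / p) *
          lorN p q (volume.restrict (dyadicCube ((j, m) : DyadicIndex n))) F) ^ R with hT
    have hε₁ : 0 < n * ((1 / t - 1 / R) * R) := by
      have : 1 / R < 1 / t := one_div_lt_one_div_of_lt ht0 htR
      have : 0 < 1 / t - 1 / R := by linarith
      positivity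
    have hε₂ : 0 < n * ((1 / v - 1 / t) * R) := by
      have : 1 / t < 1 / v := one_div_lt_one_div_of_lt hv0 hvt
      have : 0 < 1 / v - 1 / t := by linarith
      positivity
    obtain ⟨G₁, hG₁⟩ := exists_geom hε₁
    obtain ⟨G₂, hG₂⟩ := exists_geom hε₂
    have hsplit : ∑' j, T j ≤ (∑' j : ℤ, if 0 ≤ j then T j else 0) + ∑' j : ℤ, if j ≤ 0 then T j else 0 := by
      rw [← ENNReal.tsum_add]
      refine ENNReal.tsum_le_tsum fun j => ?_
      rcases le_total 0 j with hj | hj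
      · rw [if_pos hj]; exact le_self_add
      · rw [if_pos hj]; exact le_add_self
    rw [tsum_int_ge, tsum_int_le] at hsplit
    have b₁ : ∑' j : ℕ, T (0 + j) ≤ G₁ * M₁ := by
      rw [← hG₁, ← ENNReal.tsum_mul_right]
      refine ENNReal.tsum_le_tsum fun j => (h₁ (0 + j)).trans (le_of_eq ?_)
      congr 2; push_cast; ring
    have b₂ : ∑' j : ℕ, T (0 - j) ≤ G₂ * M₂ := by
      rw [← hG₂, ← ENNReal.tsum_mul_right]
      refine ENNReal.tsum_le_tsum fun j => (h₂ (0 - j)).trans (le_of_eq ?_)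
      congr 2; push_cast; ring
    refine ne_top_of_le_ne_top ?_ (hsplit.trans (add_le_add b₁ b₂))
    exact ENNReal.add_ne_top.2 ⟨ENNReal.mul_ne_top ENNReal.coe_ne_top hM₁,
      ENNReal.mul_ne_top ENNReal.coe_ne_top hM₂⟩
  · rw [mN, seqNorm, if_pos hr]
    rcases hpt.eq_or_lt with rfl | hpt
    · refine ne_top_of_le_ne_top (h p q hp hq) (iSup_le fun i => ?_)
      rw [sub_self, ENNReal.rpow_zero, one_mul]
      exact lorN_mono_measure (by linarith) hp0 Measure.restrict_le_self
    · obtain ⟨C, hC⟩ := exists_lorN_restrict_le hn hp hq hpt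
      have ht0 : 0 < t := by linarith
      refine ne_top_of_le_ne_top (ENNReal.mul_ne_top (ENNReal.coe_ne_top (r := C))
        (hLv t (by linarith))) (iSup_le fun i => ?_)
      have hV0 := volume_dyadicCube_ne_zero i
      have hVt := volume_dyadicCube_ne_top i
      calc _ ≤ volume (dyadicCube i) ^ (1 / t - 1 / p) * (C * (volume (dyadicCube i) ^ (1 / p - 1 / t) *
            (∫⁻ x in dyadicCube i, F x ^ t) ^ (1 / t))) := by gcongr; exact hC i F hF
        _ = (volume (dyadicCube i) ^ (1 / t - 1 / p) * volume (dyadicCube i) ^ (1 / p - 1 / t)) *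
              (C * (∫⁻ x in dyadicCube i, F x ^ t) ^ (1 / t)) := by ring
        _ ≤ _ := by
            rw [← ENNReal.rpow_add _ _ hV0 hVt]
            simp only [sub_add_sub_cancel, sub_self, ENNReal.rpow_zero, one_mul]
            gcongr
            exact Measure.restrict_le_self

end Morrey

/-! ### Absolutely convergent series of functions -/

section Series

variable {X : Type*} [MeasurableSpace X] {μ : Measure X} {ι : Type*} {G : ι → X → ℂ}

lemma aestronglyMeasurable_tsum [Countable ι] (hG : ∀ i, AEStronglyMeasurable (G i) μ) :
    AEStronglyMeasurable (fun x => ∑' i, G i x) μ :=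
  (AEMeasurable.tsum fun i => (hG i).aemeasurable).aestronglyMeasurable

lemma ae_tsum_enorm_ne_top [Countable ι] (hG : ∀ i, AEStronglyMeasurable (G i) μ)
    (h : ∑' i, ∫⁻ x, ‖G i x‖ₑ ∂μ ≠ ∞) : ∀ᵐ x ∂μ, ∑' i, ‖G i x‖ₑ ≠ ∞ := by
  rw [← lintegral_tsum fun i => (hG i).enorm] at h
  filter_upwards [ae_lt_top' (AEMeasurable.tsum fun i => (hG i).enorm) h] with x hx using hx.ne

lemma enorm_tsum_sub_sum_le {g : ι → ℂ} (hg : ∑' i, ‖g i‖ₑ ≠ ∞) (s : Finset ι) :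
    ‖(∑' i, g i) - ∑ i ∈ s, g i‖ₑ ≤ ∑' i : {i // i ∉ s}, ‖g i‖ₑ := by
  have h1 : Summable g := (tsum_enorm_ne_top_iff_summable_norm.1 hg).of_norm
  rw [← h1.sum_add_tsum_subtype_compl s, add_sub_cancel_left]
  exact enorm_tsum_le_tsum_enorm

lemma tendsto_lintegral_tsum_sub_sum [Countable ι] (hG : ∀ i, AEStronglyMeasurable (G i) μ)
    (h : ∑' i, ∫⁻ x, ‖G i x‖ₑ ∂μ ≠ ∞) :
    Tendsto (fun s : Finset ι => ∫⁻ x, ‖(∑' i, G i x) - ∑ i ∈ s, G i x‖ₑ ∂μ) atTop (𝓝 0) := by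
  refine tendsto_of_tendsto_of_tendsto_of_le_of_le tendsto_const_nhds
    (ENNReal.tendsto_tsum_compl_atTop_zero h) (fun _ => zero_le) fun s => ?_
  simp only
  rw [← lintegral_tsum fun i => (hG _).enorm]
  refine lintegral_mono_ae ?_
  filter_upwards [ae_tsum_enorm_ne_top hG h] with x hx
  exact enorm_tsum_sub_sum_le hx s

lemma tsum_fiberwise_of_enorm {κ : Type*} {g : ι → ℂ} (hg : ∑' i, ‖g i‖ₑ ≠ ∞) (π : ι → κ) :
    ∑' j, ∑' i : π ⁻¹' {j}, g i = ∑' i, g i := by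
  have h1 : Summable g := (tsum_enorm_ne_top_iff_summable_norm.1 hg).of_norm
  exact (h1.hasSum.tsum_fiberwise π).tsum_eq

lemma integrable_tsum [Countable ι] (hG : ∀ i, AEStronglyMeasurable (G i) μ)
    (h : ∑' i, ∫⁻ x, ‖G i x‖ₑ ∂μ ≠ ∞) : Integrable (fun x => ∑' i, G i x) μ := by
  refine ⟨aestronglyMeasurable_tsum hG, ?_⟩
  rw [hasFiniteIntegral_iff_enorm]
  calc _ ≤ ∫⁻ x, ∑' i, ‖G i x‖ₑ ∂μ := lintegral_mono fun x => enorm_tsum_le_tsum_enorm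
    _ < ∞ := by rw [lintegral_tsum fun i => (hG i).enorm]; exact h.lt_top

end Series

lemma eq_zero_of_lorN_eq_zero {X : Type*} [MeasurableSpace X] {μ : Measure X} {p q : ℝ} (hp : 0 < p)
    (hq : 0 < q) {f : X → ℝ≥0∞} (h : lorN p q μ f = 0) : ∀ᵐ x ∂μ, f x = 0 := by
  have h1 : ∀ k : ℤ, μ {x | tp k < f x} = 0 := fun k => by
    have h2 : ∀ k : ℤ, (tp k * μ {x | tp k < f x} ^ (1 / p)) ^ q = 0 := by
      have := (ENNReal.rpow_eq_zero_iff_of_pos (by positivity)).1 h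
      intro k
      exact ENNReal.tsum_eq_zero.1 this k
    have h3 := (ENNReal.rpow_eq_zero_iff_of_pos hq).1 (h2 k)
    rcases mul_eq_zero.1 h3 with h4 | h4
    · exact absurd h4 (tp_ne_zero _)
    · exact (ENNReal.rpow_eq_zero_iff_of_pos (by positivity)).1 h4
  filter_upwards [ae_all_iff.2 fun k : ℤ => (ae_iff.2 (by simpa using h1 k) : ∀ᵐ x ∂μ, ¬ tp k < f x)] with x hx
  by_contra h0
  rcases eq_or_ne (f x) ∞ with ht | ht
  · exact hx 0 (by rw [ht]; exact (tp_ne_top _).lt_top)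
  · obtain ⟨k, hk, -⟩ := exists_tp_lt_le h0 ht
    exact hx k hk

/-! ### Families of blocks -/

/-- The exponents of the Bourgain–Morrey–Lorentz space and of its predual. -/
structure DualExponents (p q t : ℝ) (r : ℝ≥0∞) (a c τ : ℝ) (R : ℝ≥0∞) : Prop where
  hp : p.HolderConjugate a
  hq : q.HolderConjugate c
  ht : t.HolderConjugate τ
  hR : R ≠ ∞
  hr : (r = ∞ ∧ R = 1) ∨ (r ≠ ∞ ∧ r.toReal.HolderConjugate R.toReal)
  hptr : (p < t ∧ ENNReal.ofReal t < r ∧ r < ∞) ∨ (p ≤ t ∧ r = ∞)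

section Blocks

variable {n : ℕ} {p q t a c τ u : ℝ} {r R : ℝ≥0∞}

/-- Because of this identity the normalization of blocks and that of the Morrey norm carry the same
power 1/t - 1/p of the volume. -/
lemma DualExponents.one_div_sub (H : DualExponents p q t r a c τ R) :
    1 / a - 1 / τ = 1 / t - 1 / p := by
  have h1 := H.hp.inv_add_inv_eq_one
  have h2 := H.ht.inv_add_inv_eq_one
  simp only [one_div]; linarith

lemma DualExponents.one_le (H : DualExponents p q t r a c τ R) : 1 ≤ R.toReal := by
  rcases H.hr with ⟨-, h⟩ | ⟨-, h⟩
  · simp [h]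
  · exact h.symm.lt.le

lemma DualExponents.pos (H : DualExponents p q t r a c τ R) : 0 < R.toReal :=
  zero_lt_one.trans_le H.one_le

lemma DualExponents.tsum_mul_le (H : DualExponents p q t r a c τ R) {ι : Type*} (d m : ι → ℝ≥0∞) :
    ∑' i, d i * m i ≤ sn R.toReal d * seqNorm r m := by
  rcases H.hr with ⟨h1, h2⟩ | ⟨h1, h2⟩
  · simp only [h2, sn, ENNReal.toReal_one, ENNReal.rpow_one, div_one, seqNorm, if_pos h1]
    rw [← ENNReal.tsum_mul_right]
    gcongr with i
    exact le_iSup m i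
  · rw [seqNorm_eq_sn h1]
    exact tsum_mul_le_sn h2.symm d m

/-- A family of functions `f α` on dyadic cubes `i α`, bounded by `e α` in the normalized Lorentz
norm; `d` bounds the sums of the `e α` over each cube. -/
structure IsBlockFamily {ι : Type} (a c u : ℝ) (i : ι → DyadicIndex n) (f : ι → Eu n → ℂ)
    (e : ι → ℝ≥0∞) (d : DyadicIndex n → ℝ≥0∞) : Prop where
  meas : ∀ α, AEStronglyMeasurable (f α) volume
  supp : ∀ α x, x ∉ dyadicCube (i α) → f α x = 0
  norm_le : ∀ α, lorN a c volume (fun x => ‖f α x‖ₑ) ≤ e α * volume (dyadicCube (i α)) ^ u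
  sum_le : ∀ j, ∑' α : i ⁻¹' {j}, e α ≤ d j

/-- Lorentz Hölder on each cube, followed by Hölder between ℓ^R and ℓ^r over cubes. Stating it for
absolute values and for families with several functions per cube allows integrals and sums to be
exchanged freely afterwards. -/
lemma exists_tsum_lintegral_le (H : DualExponents p q t r a c τ R) : ∃ C : ℝ≥0,
    ∀ {ι : Type} (i : ι → DyadicIndex n) (f : ι → Eu n → ℂ) (e : ι → ℝ≥0∞)
      (d : DyadicIndex n → ℝ≥0∞), IsBlockFamily a c (1 / t - 1 / p) i f e d →
      ∀ F : Eu n → ℝ≥0∞, AEMeasurable F →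
        ∑' α, ∫⁻ x, ‖f α x‖ₑ * F x ≤ C * (sn R.toReal d * mN p q t r F) := by
  obtain ⟨C, hC⟩ := exists_lorentz_holder H.hp H.hq
  refine ⟨C, fun {ι} i f e d hf F hF => ?_⟩
  set m : DyadicIndex n → ℝ≥0∞ := fun j =>
    volume (dyadicCube j) ^ (1 / t - 1 / p) * lorN p q (volume.restrict (dyadicCube j)) F with hm
  have h1 : ∀ α, ∫⁻ x, ‖f α x‖ₑ * F x ≤ C * (e α * m (i α)) := fun α => by
    have hQ := measurableSet_dyadicCube (i α)
    have e1 : ∀ x, ‖f α x‖ₑ * F x = (dyadicCube (i α)).indicator F x * ‖f α x‖ₑ := fun x => by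
      by_cases hx : x ∈ dyadicCube (i α)
      · rw [indicator_of_mem hx, mul_comm]
      · rw [indicator_of_notMem hx, hf.supp α x hx]; simp
    simp_rw [e1]
    refine (hC _ _ _ (hF.indicator hQ) (hf.meas α).enorm).trans ?_
    rw [← lorN_restrict hQ]
    calc _ ≤ C * (lorN p q (volume.restrict (dyadicCube (i α))) F *
          (e α * volume (dyadicCube (i α)) ^ (1 / t - 1 / p))) := by gcongr; exact hf.norm_le α
      _ = _ := by rw [hm]; ring
  calc _ ≤ ∑' α, C * (e α * m (i α)) := ENNReal.tsum_le_tsum h1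
    _ = C * ∑' j, ∑' α : i ⁻¹' {j}, e α * m (i α) := by
        rw [ENNReal.tsum_mul_left, ENNReal.tsum_fiberwise (fun α => e α * m (i α)) i]
    _ = C * ∑' j, (∑' α : i ⁻¹' {j}, e α) * m j := by
        congr 2; ext j
        rw [← ENNReal.tsum_mul_right]
        exact tsum_congr fun α => by rw [show i α = j from α.2]
    _ ≤ C * ∑' j, d j * m j := by gcongr with j; exact hf.sum_le j
    _ ≤ _ := by gcongr; exact H.tsum_mul_le d m

lemma DualExponents.mN_ne_top (H : DualExponents p q t r a c τ R) (hn : 0 < n) {F : Eu n → ℝ≥0∞}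
    (hF : AEMeasurable F) (h : ∀ p' q' : ℝ, 1 < p' → 1 < q' → lorN p' q' volume F ≠ ∞) :
    mN p q t r F ≠ ∞ :=
  BourgainMorreyLorentz.mN_ne_top hn H.hp.lt H.hq.lt H.hptr hF h

lemma DualExponents.mN_indicator_ne_top (H : DualExponents p q t r a c τ R) (hn : 0 < n)
    {S : Set (Eu n)} (hS : MeasurableSet S) (hv : volume S ≠ ∞) :
    mN p q t r (S.indicator fun _ => 1) ≠ ∞ := by
  refine H.mN_ne_top hn (aemeasurable_const.indicator hS) fun p' q' hp' hq' => ?_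
  exact lorN_ne_top_of_bdd (by linarith) (by linarith) hv (fun x hx => indicator_of_notMem hx _)
    ENNReal.one_ne_top (Eventually.of_forall fun x => indicator_le_self' (fun _ _ => zero_le) x)

/-- The indicator of a set of finite measure belongs to the Bourgain–Morrey–Lorentz space, so
pairing with it yields absolute convergence in L¹ on that set. -/
lemma IsBlockFamily.tsum_setLIntegral_ne_top (H : DualExponents p q t r a c τ R) (hn : 0 < n)
    {ι : Type} {i : ι → DyadicIndex n} {f : ι → Eu n → ℂ} {e : ι → ℝ≥0∞}
    {d : DyadicIndex n → ℝ≥0∞} (hf : IsBlockFamily a c (1 / t - 1 / p) i f e d)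
    (hd : sn R.toReal d ≠ ∞) {S : Set (Eu n)} (hS : MeasurableSet S) (hv : volume S ≠ ∞) :
    ∑' α, ∫⁻ x in S, ‖f α x‖ₑ ≠ ∞ := by
  obtain ⟨C, hC⟩ := exists_tsum_lintegral_le (n := n) H
  have h1 := hC i f e d hf (S.indicator fun _ => 1) (aemeasurable_const.indicator hS)
  refine ne_top_of_le_ne_top ?_ ((le_of_eq ?_).trans h1)
  · exact ENNReal.mul_ne_top ENNReal.coe_ne_top
      (ENNReal.mul_ne_top hd (H.mN_indicator_ne_top hn hS hv))
  · refine tsum_congr fun α => ?_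
    rw [← lintegral_indicator hS]
    refine lintegral_congr fun x => ?_
    by_cases hx : x ∈ S <;> simp [hx]

lemma IsBlockFamily.ae_tsum_ne_top (H : DualExponents p q t r a c τ R) (hn : 0 < n)
    {ι : Type} [Countable ι] {i : ι → DyadicIndex n} {f : ι → Eu n → ℂ} {e : ι → ℝ≥0∞}
    {d : DyadicIndex n → ℝ≥0∞} (hf : IsBlockFamily a c (1 / t - 1 / p) i f e d)
    (hd : sn R.toReal d ≠ ∞) : ∀ᵐ x, ∑' α, ‖f α x‖ₑ ≠ ∞ := by
  have h1 : ∀ k : ℕ, ∀ᵐ x, x ∈ Metric.closedBall (0 : Eu n) k → ∑' α, ‖f α x‖ₑ ≠ ∞ := fun k => by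
    rw [← ae_restrict_iff' Metric.isClosed_closedBall.measurableSet]
    exact ae_tsum_enorm_ne_top (fun α => (hf.meas α).restrict)
      (hf.tsum_setLIntegral_ne_top H hn hd Metric.isClosed_closedBall.measurableSet
        measure_closedBall_lt_top.ne)
  filter_upwards [ae_all_iff.2 h1] with x hx
  obtain ⟨k, hk⟩ := exists_nat_ge ‖x‖
  exact hx k (by simpa using hk)

lemma blockNorm_congr_ae {f g : Eu n → ℂ} (h : f =ᵐ[volume] g) :
    blockNorm a c τ R f = blockNorm a c τ R g := by
  have : ∀ lam b, IsBlockDecomposition a c τ f lam b ↔ IsBlockDecomposition a c τ g lam b := by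
    intro lam b
    refine and_congr_right fun _ => forall₂_congr fun S _ => ?_
    have : (fun s : Finset (DyadicIndex n) => ∫⁻ x in S, ‖f x - ∑ i ∈ s, lam i * b i x‖ₑ) =
        fun s => ∫⁻ x in S, ‖g x - ∑ i ∈ s, lam i * b i x‖ₑ := by
      ext s
      exact lintegral_congr_ae ((ae_restrict_of_ae h).mono fun x hx => by simp only [hx])
    rw [this]
  simp only [blockNorm, this]

/-- A sum of functions on dyadic cubes belongs to the block space. -/
lemma exists_blockNorm_le (H : DualExponents p q t r a c τ R) (hn : 0 < n) : ∃ C : ℝ≥0,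
    ∀ {ι : Type} [Countable ι] (i : ι → DyadicIndex n) (f : ι → Eu n → ℂ) (e : ι → ℝ≥0∞)
      (d : DyadicIndex n → ℝ≥0∞), IsBlockFamily a c (1 / t - 1 / p) i f e d → sn R.toReal d ≠ ∞ →
      blockNorm a c τ R (fun x => ∑' α, f α x) ≤ C * sn R.toReal d := by
  have ha := H.hp.symm
  have hc := H.hq.symm
  obtain ⟨C₁, hC₁⟩ := exists_lorentzNorm_le ha.pos hc.pos
  obtain ⟨C₂, hC₂⟩ := exists_lorN_tsum_le ha.lt hc.lt
  -- The first summand normalizes the blocks; the summand 1 makes D nonzero, so that a coefficient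
  -- vanishes exactly when d j does.
  set D : ℝ≥0 := 2 * C₁ * C₂ + 1 with hD
  refine ⟨D, fun {ι} _ i f e d hf hd => ?_⟩
  set G : DyadicIndex n → Eu n → ℂ := fun j x => ∑' α : i ⁻¹' {j}, f α x with hG
  have hGm : ∀ j, AEStronglyMeasurable (G j) volume := fun j =>
    aestronglyMeasurable_tsum fun α => hf.meas α
  have hGn : ∀ j, lorN a c volume (fun x => ‖G j x‖ₑ) ≤
      C₂ * (d j * volume (dyadicCube j) ^ (1 / t - 1 / p)) := fun j => by
    calc _ ≤ lorN a c volume (fun x => ∑' α : i ⁻¹' {j}, ‖f α x‖ₑ) :=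
          lorN_mono hc.pos ha.pos fun x => enorm_tsum_le_tsum_enorm
      _ ≤ C₂ * ∑' α : i ⁻¹' {j}, lorN a c volume (fun x => ‖f α x‖ₑ) :=
          hC₂ volume _ fun α => (hf.meas α).enorm
      _ ≤ C₂ * ∑' α : i ⁻¹' {j}, e α * volume (dyadicCube j) ^ (1 / t - 1 / p) := by
          gcongr with α
          have := hf.norm_le α
          rwa [show i α = j from α.2] at this
      _ ≤ _ := by
          rw [ENNReal.tsum_mul_right]
          gcongr
          exact hf.sum_le j
  have hdt : ∀ j, d j ≠ ∞ := fun j => ne_top_of_le_ne_top hd (le_sn H.pos d j)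
  -- All functions on the same cube are merged into one block. If d j = 0, their sum has norm zero
  -- and vanishes almost everywhere, so the value of the inverse at 0 is harmless.
  set lam : DyadicIndex n → ℂ := fun j => ((D * (d j).toNNReal : ℝ≥0) : ℝ) with hlam
  have hle : ∀ j, ‖lam j‖ₑ = D * d j := fun j => by
    have h1 : ‖lam j‖₊ = D * (d j).toNNReal := by ext; simp [hlam]
    rw [enorm_eq_nnnorm, h1, ENNReal.coe_mul, ENNReal.coe_toNNReal (hdt j)]
  set b : DyadicIndex n → Eu n → ℂ := fun j x => (lam j)⁻¹ * G j x with hb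
  have hlb : ∀ j, ∀ᵐ x, lam j * b j x = G j x := fun j => by
    by_cases h0 : lam j = 0
    · have hd0 : d j = 0 := by
        have := hle j
        rw [h0, enorm_zero] at this
        exact (mul_eq_zero.1 this.symm).resolve_left (by simp [hD])
      have h1 := hGn j
      rw [hd0, zero_mul, mul_zero] at h1
      filter_upwards [eq_zero_of_lorN_eq_zero ha.pos hc.pos (le_antisymm h1 zero_le)] with x hx
      rw [h0, zero_mul, enorm_eq_zero.1 hx]
    · exact Eventually.of_forall fun x => by rw [hb]; field_simp
  have hdec : IsBlockDecomposition a c τ (fun x => ∑' α, f α x) lam b := by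
    refine ⟨fun j => ⟨(hGm j).const_mul _, fun x hx => ?_, ?_⟩, fun S hS => ?_⟩
    · simp only [hb, hG]
      rw [tsum_congr (g := fun _ => 0), tsum_zero, mul_zero]
      intro α
      exact hf.supp α x (by rwa [show i α = j from α.2])
    · refine (hC₁ volume _).trans ?_
      rw [H.one_div_sub]
      by_cases h0 : lam j = 0
      · simp [hb, h0, lorN_zero ha.pos hc.pos]
      · have hd0 : d j ≠ 0 := fun h => h0 (by simp [hlam, h])
        have h1 := lorN_const_mul_le (μ := volume) (f := fun x => ‖G j x‖ₑ) ha.pos hc.pos ‖(lam j)⁻¹‖ₑ enorm_ne_top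
        simp only [hb, enorm_mul]
        have e1 : ‖(lam j)⁻¹‖ₑ * (D * d j) = 1 := by
          rw [← hle, ← enorm_mul, inv_mul_cancel₀ h0, enorm_one]
        calc _ ≤ C₁ * (2 * ‖(lam j)⁻¹‖ₑ * (C₂ * (d j * volume (dyadicCube j) ^ (1 / t - 1 / p)))) := by
              gcongr
              exact h1.trans (by gcongr; exact hGn j)
          _ = (2 * C₁ * C₂ : ℝ≥0) * (‖(lam j)⁻¹‖ₑ * d j) * volume (dyadicCube j) ^ (1 / t - 1 / p) := by
              push_cast; ring
          _ ≤ D * (‖(lam j)⁻¹‖ₑ * d j) * volume (dyadicCube j) ^ (1 / t - 1 / p) := by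
              gcongr
              exact_mod_cast le_self_add
          _ = _ := by rw [mul_left_comm, e1, one_mul]
    · have hfin := hf.tsum_setLIntegral_ne_top H hn hd hS.measurableSet hS.measure_lt_top.ne
      have hGfin : ∑' j, ∫⁻ x in S, ‖G j x‖ₑ ≠ ∞ := by
        refine ne_top_of_le_ne_top hfin ?_
        rw [← ENNReal.tsum_fiberwise _ i]
        refine ENNReal.tsum_le_tsum fun j => ?_
        rw [← lintegral_tsum fun α => (hf.meas _).restrict.enorm]
        exact lintegral_mono fun x => enorm_tsum_le_tsum_enorm
      refine (tendsto_lintegral_tsum_sub_sum (fun j => (hGm j).restrict) hGfin).congr fun s => ?_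
      refine lintegral_congr_ae (ae_restrict_of_ae ?_)
      filter_upwards [hf.ae_tsum_ne_top H hn hd, ae_all_iff.2 hlb] with x hx hx'
      rw [← tsum_fiberwise_of_enorm hx i, Finset.sum_congr rfl fun j _ => hx' j]
  refine (iInf₂_le_of_le lam b (iInf_le _ hdec)).trans ?_
  rw [seqNorm_eq_sn H.hR]
  simp_rw [hle]
  rw [sn_const_mul H.pos]

end Blocks

/-! ### Bounded pieces of a function in a Lorentz space -/

section Levels

variable {X : Type*} [MeasurableSpace X] {μ : Measure X} {p q : ℝ}

/-- Absolute continuity of the norm for finite q: each level set has finite measure, so the measures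
decrease to zero by continuity from above, and dominated convergence for counting measure on the
levels finishes. -/
lemma tendsto_lorN_indicator_le (hp : 0 < p) (hq : 0 < q) {f : X → ℂ} (hf : AEStronglyMeasurable f μ)
    (h : lorN p q μ (fun x => ‖f x‖ₑ) ≠ ∞) :
    Tendsto (fun N : ℕ => lorN p q μ fun x => ‖{x | (N : ℝ) ≤ ‖f x‖}.indicator f x‖ₑ) atTop (𝓝 0) := by
  have hs : lorSum p q μ (fun x => ‖f x‖ₑ) ≠ ∞ := by
    rw [← lorN_rpow hq]; exact ENNReal.rpow_ne_top_of_nonneg hq.le h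
  suffices h1 : Tendsto (fun N : ℕ => lorSum p q μ fun x => ‖{x | (N : ℝ) ≤ ‖f x‖}.indicator f x‖ₑ)
      atTop (𝓝 0) by
    have h2 := (ENNReal.continuous_rpow_const (y := 1 / q)).continuousAt.tendsto.comp h1
    rw [ENNReal.zero_rpow_of_pos (by positivity)] at h2
    exact h2
  let _ : MeasurableSpace ℤ := ⊤
  have key := tendsto_lintegral_of_dominated_convergence (μ := (Measure.count : Measure ℤ))
    (F := fun (N : ℕ) (k : ℤ) =>
      (tp k * μ {x | tp k < ‖{x | (N : ℝ) ≤ ‖f x‖}.indicator f x‖ₑ} ^ (1 / p)) ^ q)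
    (f := fun _ => 0) (fun k : ℤ => (tp k * μ {x | tp k < ‖f x‖ₑ} ^ (1 / p)) ^ q)
    (fun N => measurable_from_top)
    (fun N => Eventually.of_forall fun k => by
      refine ENNReal.rpow_le_rpow (mul_le_mul' le_rfl (ENNReal.rpow_le_rpow (measure_mono
        fun x hx => ?_) (by positivity))) hq.le
      rw [mem_ofPred_eq] at hx ⊢
      exact hx.trans_le (enorm_indicator_le_enorm_self _ _))
    (by rw [lintegral_count]; exact hs)
    (Eventually.of_forall fun k => by
      have hfin : μ {x | tp k < ‖f x‖ₑ} ≠ ∞ := meas_ne_top_of_lorSum hp hq hs k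
      have h3 : Tendsto (fun N : ℕ => μ {x | tp k < ‖{x | (N : ℝ) ≤ ‖f x‖}.indicator f x‖ₑ}) atTop (𝓝 0) := by
        have hsub : ∀ M N : ℕ, M ≤ N → {x | tp k < ‖{x | (N : ℝ) ≤ ‖f x‖}.indicator f x‖ₑ} ⊆
            {x | tp k < ‖{x | (M : ℝ) ≤ ‖f x‖}.indicator f x‖ₑ} := fun M N hMN x hx => by
          rw [mem_ofPred_eq] at hx ⊢
          refine hx.trans_le (enorm_indicator_le_of_subset (fun y hy => ?_) _ _)
          rw [mem_ofPred_eq] at hy ⊢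
          exact le_trans (by exact_mod_cast hMN) hy
        have h4 := tendsto_measure_iInter_atTop (μ := μ)
          (s := fun N : ℕ => {x | tp k < ‖{x | (N : ℝ) ≤ ‖f x‖}.indicator f x‖ₑ})
          (fun N => nullMeasurableSet_lt aemeasurable_const (hf.indicator₀
            (nullMeasurableSet_le aemeasurable_const hf.norm.aemeasurable)).enorm) hsub ⟨0, ?_⟩
        · refine h4.trans (le_of_eq ?_)
          rw [← measure_empty (μ := μ)]
          congr 2
          refine eq_empty_of_forall_notMem fun x hx => ?_
          obtain ⟨N, hN⟩ := exists_nat_gt ‖f x‖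
          have h5 : tp k < ‖{x | (N : ℝ) ≤ ‖f x‖}.indicator f x‖ₑ := mem_iInter.1 hx N
          rw [indicator_of_notMem (by simpa using hN), enorm_zero] at h5
          exact not_lt_zero h5
        · exact ne_top_of_le_ne_top hfin (measure_mono fun x hx => by
            rw [mem_ofPred_eq] at hx ⊢
            exact hx.trans_le (enorm_indicator_le_enorm_self _ _))
      have h5 := (ENNReal.continuous_rpow_const (y := 1 / p)).continuousAt.tendsto.comp h3
      rw [ENNReal.zero_rpow_of_pos (by positivity)] at h5
      have h6 := (ENNReal.continuous_rpow_const (y := q)).continuousAt.tendsto.comp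
        (ENNReal.Tendsto.const_mul (a := tp k) h5 (Or.inr (tp_ne_top _)))
      rw [mul_zero, ENNReal.zero_rpow_of_pos hq] at h6
      exact h6)
  simpa [lintegral_count, lorSum] using key

/-- A function in a Lorentz space is a sum of bounded functions on disjoint level sets whose norms
are summable. -/
lemma exists_levels (hp : 0 < p) (hq : 0 < q) {f : X → ℂ} (hf : AEStronglyMeasurable f μ)
    (h : lorN p q μ (fun x => ‖f x‖ₑ) ≠ ∞) : ∃ L : X → ℕ,
      (∀ m, NullMeasurableSet (L ⁻¹' {m}) μ) ∧ (∀ m, ∃ M : ℝ≥0, ∀ x ∈ L ⁻¹' {m}, ‖f x‖ₑ ≤ M) ∧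
      ∑' m, lorN p q μ (fun x => ‖(L ⁻¹' {m}).indicator f x‖ₑ) ≤ 3 * lorN p q μ fun x => ‖f x‖ₑ := by
  classical
  set B := lorN p q μ fun x => ‖f x‖ₑ with hB
  have hsm : ∀ m : ℕ, ∀ᶠ N : ℕ in atTop,
      lorN p q μ (fun x => ‖{x | (N : ℝ) ≤ ‖f x‖}.indicator f x‖ₑ) ≤ tp (-m) * B := fun m => by
    rcases eq_or_ne B 0 with h0 | h0
    · refine Eventually.of_forall fun N => ?_
      rw [h0, mul_zero, ← h0]
      exact lorN_mono hq hp fun x => enorm_indicator_le_enorm_self _ _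
    · exact (tendsto_lorN_indicator_le hp hq hf h).eventually_le_const
        (pos_iff_ne_zero.2 (mul_ne_zero (tp_ne_zero _) h0))
  have hex : ∀ m : ℕ, ∃ N₀ : ℕ, ∀ N ≥ N₀,
      lorN p q μ (fun x => ‖{x | (N : ℝ) ≤ ‖f x‖}.indicator f x‖ₑ) ≤ tp (-m) * B :=
    fun m => eventually_atTop.1 (hsm m)
  choose N₀ hN₀ using hex
  -- The partial sums make the thresholds increasing, the summand m makes them unbounded, and they
  -- still dominate the N₀ m.
  set N : ℕ → ℕ := fun m => m + ∑ l ∈ Finset.range (m + 1), N₀ l with hN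
  have hN1 : ∀ m, N₀ m ≤ N m := fun m =>
    (Finset.single_le_sum (f := N₀) (fun _ _ => Nat.zero_le _) (Finset.self_mem_range_succ m)).trans
      (Nat.le_add_left _ _)
  have hNm : Monotone N := monotone_nat_of_le_succ fun m => by
    simp only [hN, Finset.sum_range_succ _ (m + 1)]; omega
  have hfind : ∀ x, ∃ m, ‖f x‖ < N m := fun x => by
    obtain ⟨m, hm⟩ := exists_nat_gt ‖f x‖
    exact ⟨m, hm.trans_le (by exact_mod_cast Nat.le_add_right _ _)⟩
  set L : X → ℕ := fun x => Nat.find (hfind x) with hL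
  have hle : ∀ x m, L x ≤ m ↔ ‖f x‖ < N m := fun x m => by
    rw [hL]; simp only [Nat.find_le_iff]
    constructor
    · rintro ⟨l, hl, h⟩
      exact h.trans_le (by exact_mod_cast hNm hl)
    · exact fun h => ⟨m, le_rfl, h⟩
  have hnm : ∀ m, NullMeasurableSet {x | L x ≤ m} μ := fun m => by
    simp_rw [hle]
    exact nullMeasurableSet_lt hf.norm.aemeasurable aemeasurable_const
  refine ⟨L, fun m => ?_, fun m => ⟨N m, fun x (hx : L x = m) => ?_⟩, ?_⟩
  · rcases m with _ | m
    · convert hnm 0 using 1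
      ext x; simp
    · convert (hnm (m + 1)).diff (hnm m) using 1
      ext x; simp; omega
  · have h1 := ((hle x m).1 hx.le).le
    rw [enorm_eq_nnnorm]
    exact_mod_cast h1
  -- The bottom piece has norm at most B. The piece m + 1 lies where ‖f‖ ≥ N m and so has norm at
  -- most 2^{-m} B. The total is B + 2B.
  · rw [tsum_eq_zero_add' ENNReal.summable]
    calc _ ≤ B + ∑' m : ℕ, tp (-m) * B := by
          gcongr with m
          · exact lorN_mono hq hp fun x => enorm_indicator_le_enorm_self _ _
          · refine le_trans (lorN_mono hq hp fun x => ?_) (hN₀ m (N m) (hN1 m))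
            refine enorm_indicator_le_of_subset ?_ _ _
            intro x (hx : L x = m + 1)
            by_contra h0
            have := (hle x m).2 (not_le.1 h0)
            omega
      _ ≤ _ := by
          rw [ENNReal.tsum_mul_right]
          have : ∑' m : ℕ, tp (-m) = 2 := by
            have := ENNReal.tsum_geometric (2⁻¹)
            rw [ENNReal.one_sub_inv_two, inv_inv] at this
            rw [← this]
            refine tsum_congr fun m => ?_
            rw [← tp_inv, tp_nat, ENNReal.inv_pow]
          rw [this]
          refine le_of_eq ?_; ring

end Levels

lemma tsum_indicator_preimage {X M : Type*} [AddCommMonoid M] [TopologicalSpace M] (f : X → M) (L : X → ℕ) (x : X) :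
    ∑' m, (L ⁻¹' {m}).indicator f x = f x := by
  rw [tsum_eq_single (L x) fun m hm => indicator_of_notMem (fun h => hm (by simpa using h.symm)) f]
  exact indicator_of_mem (s := L ⁻¹' {L x}) rfl f

lemma tsum_fst_preimage {A B : Type*} (e : A × B → ℝ≥0∞) (j : A) :
    ∑' α : (Prod.fst : A × B → A) ⁻¹' {j}, e α = ∑' m, e (j, m) := by
  rw [tsum_subtype, ENNReal.tsum_prod', tsum_eq_single j]
  · exact tsum_congr fun m => indicator_of_mem (s := (Prod.fst : A × B → A) ⁻¹' {j}) rfl e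
  · intro i hi
    refine ENNReal.tsum_eq_zero.2 fun m => indicator_of_notMem (fun h => hi ?_) e
    simpa using h

section Decomposition

variable {n : ℕ} {p q t a c τ : ℝ} {r R : ℝ≥0∞}

lemma memLcInfty_of_bounded {E : Set (Eu n)} (hE : Bornology.IsBounded E) {f : Eu n → ℂ}
    (hf : AEStronglyMeasurable f volume) (h0 : ∀ x, x ∉ E → f x = 0) {M : ℝ≥0}
    (hM : ∀ᵐ x, ‖f x‖ₑ ≤ M) : MemLcInfty f := by
  refine ⟨memLp_top_of_bound hf M ?_, HasCompactSupport.of_support_subset_isCompact hE.isCompact_closure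
    fun x hx => subset_closure (by_contra fun h => hx (h0 x h))⟩
  filter_upwards [hM] with x hx
  rw [enorm_eq_nnnorm] at hx
  exact_mod_cast hx

/-- Elements of the block space are sums of bounded functions. -/
lemma exists_decomposition (H : DualExponents p q t r a c τ R) (hn : 0 < n) : ∃ C : ℝ≥0,
    ∀ (g : Eu n → ℂ) (Λ : ℝ≥0), AEStronglyMeasurable g volume → blockNorm a c τ R g < Λ →
      ∃ (f : DyadicIndex n × ℕ → Eu n → ℂ) (e : DyadicIndex n × ℕ → ℝ≥0∞),
        IsBlockFamily a c (1 / t - 1 / p) Prod.fst f e (fun i => ∑' m, e (i, m)) ∧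
        (∀ α, MemLcInfty (f α)) ∧ sn R.toReal (fun i => ∑' m, e (i, m)) ≤ C * Λ ∧
        ∀ᵐ x, g x = ∑' α, f α x := by
  have ha := H.hp.symm
  have hc := H.hq.symm
  obtain ⟨C₁, hC₁⟩ := exists_lorN_le ha.pos hc.pos
  refine ⟨6 * C₁, fun g Λ hg hΛ => ?_⟩
  obtain ⟨lam, hΛ⟩ := iInf_lt_iff.1 hΛ
  obtain ⟨b, hΛ⟩ := iInf_lt_iff.1 hΛ
  obtain ⟨⟨hb, hconv⟩, hΛ⟩ := iInf_lt_iff.1 hΛ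
  rw [seqNorm_eq_sn H.hR] at hΛ
  set u := 1 / t - 1 / p with hu
  have hbn : ∀ i, lorN a c volume (fun x => ‖b i x‖ₑ) ≤ C₁ * volume (dyadicCube i) ^ u := fun i => by
    refine (hC₁ volume (b i)).trans ?_
    gcongr
    rw [hu, ← H.one_div_sub]
    exact (hb i).2.2
  have hV : ∀ (i : DyadicIndex n) (s : ℝ), volume (dyadicCube i) ^ s ≠ ∞ := fun i s =>
    ENNReal.rpow_ne_top_of_ne_zero (volume_dyadicCube_ne_zero i) (volume_dyadicCube_ne_top i)
  have hVV : ∀ i : DyadicIndex n, volume (dyadicCube i) ^ (-u) * volume (dyadicCube i) ^ u = 1 := fun i => by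
    rw [← ENNReal.rpow_add _ _ (volume_dyadicCube_ne_zero i) (volume_dyadicCube_ne_top i),
      neg_add_cancel, ENNReal.rpow_zero]
  choose L hLm hLM hLs using fun i => exists_levels ha.pos hc.pos (hb i).1
    (ne_top_of_le_ne_top (ENNReal.mul_ne_top ENNReal.coe_ne_top (hV i u)) (hbn i))
  set f : DyadicIndex n × ℕ → Eu n → ℂ := fun α x => lam α.1 * (L α.1 ⁻¹' {α.2}).indicator (b α.1) x with hf
  -- The factor 2 pays for homogeneity up to a constant; with the factor 3 from summing the levels
  -- it produces 6 C₁.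
  set e : DyadicIndex n × ℕ → ℝ≥0∞ := fun α => 2 * ‖lam α.1‖ₑ *
    lorN a c volume (fun x => ‖(L α.1 ⁻¹' {α.2}).indicator (b α.1) x‖ₑ) *
      volume (dyadicCube α.1) ^ (-u) with he
  have hfm : ∀ α, AEStronglyMeasurable (f α) volume := fun α =>
    ((hb α.1).1.indicator₀ (hLm _ _)).const_mul _
  have hf0 : ∀ α x, x ∉ dyadicCube α.1 → f α x = 0 := fun α x hx => by
    simp [hf, (hb α.1).2.1 x hx]
  have hfam : IsBlockFamily a c u Prod.fst f e (fun i => ∑' m, e (i, m)) := by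
    refine ⟨hfm, hf0, fun α => ?_, fun j => (tsum_fst_preimage e j).le⟩
    simp only [hf, enorm_mul, he]
    rw [mul_assoc, hVV, mul_one]
    exact lorN_const_mul_le ha.pos hc.pos _ enorm_ne_top
  have hed : ∀ i, ∑' m, e (i, m) ≤ (6 * C₁ : ℝ≥0) * ‖lam i‖ₑ := fun i => by
    simp only [he]
    rw [ENNReal.tsum_mul_right, ENNReal.tsum_mul_left]
    calc _ ≤ 2 * ‖lam i‖ₑ * (3 * (C₁ * volume (dyadicCube i) ^ u)) * volume (dyadicCube i) ^ (-u) := by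
          gcongr
          exact (hLs i).trans (by gcongr; exact hbn i)
      _ = 2 * ‖lam i‖ₑ * (3 * C₁) * (volume (dyadicCube i) ^ (-u) * volume (dyadicCube i) ^ u) := by ring
      _ = _ := by rw [hVV]; push_cast; ring
  have hsn : sn R.toReal (fun i => ∑' m, e (i, m)) ≤ (6 * C₁ : ℝ≥0) * Λ := by
    refine (sn_mono H.pos hed).trans ?_
    rw [sn_const_mul H.pos]
    gcongr
  have hsnt : sn R.toReal (fun i => ∑' m, e (i, m)) ≠ ∞ :=
    ne_top_of_le_ne_top (ENNReal.mul_ne_top ENNReal.coe_ne_top ENNReal.coe_ne_top) hsn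
  refine ⟨f, e, hfam, fun α => ?_, hsn, ?_⟩
  · obtain ⟨M, hM⟩ := hLM α.1 α.2
    refine memLcInfty_of_bounded (isBounded_dyadicCube α.1) (hfm α) (hf0 α) (M := ‖lam α.1‖₊ * M)
      (Eventually.of_forall fun x => ?_)
    simp only [hf, enorm_mul]
    rw [ENNReal.coe_mul, ← enorm_eq_nnnorm]
    gcongr
    by_cases hx : x ∈ L α.1 ⁻¹' {α.2}
    · rw [indicator_of_mem hx]; exact hM x hx
    · rw [indicator_of_notMem hx]; simp
  · have hfG : ∀ i x, ∑' m, f (i, m) x = lam i * b i x := fun i x => by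
      simp only [hf]
      rw [tsum_mul_left, tsum_indicator_preimage]
    -- The partial sums converge in L¹ on S both to g, by the block decomposition, and to the
    -- absolutely convergent series; the limits agree almost everywhere.
    have hloc : ∀ S : Set (Eu n), IsCompact S → ∀ᵐ x ∂volume.restrict S, g x = ∑' i, lam i * b i x := by
      intro S hS
      have hGm : ∀ i, AEStronglyMeasurable (fun x => lam i * b i x) (volume.restrict S) := fun i =>
        (hb i).1.restrict.const_mul _
      have hfin : ∑' i, ∫⁻ x in S, ‖lam i * b i x‖ₑ ≠ ∞ := by
        refine ne_top_of_le_ne_top (hfam.tsum_setLIntegral_ne_top H hn hsnt hS.measurableSet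
          hS.measure_lt_top.ne) ?_
        rw [ENNReal.tsum_prod' (f := fun α : DyadicIndex n × ℕ => ∫⁻ x in S, ‖f α x‖ₑ)]
        refine ENNReal.tsum_le_tsum fun i => ?_
        rw [← lintegral_tsum fun m => (hfm _).restrict.enorm]
        refine lintegral_mono fun x => ?_
        rw [← hfG]
        exact enorm_tsum_le_tsum_enorm
      have h1 := tendsto_lintegral_tsum_sub_sum hGm hfin
      have h2 := (hconv S hS).add h1
      rw [add_zero] at h2
      have h3 : ∫⁻ x in S, ‖g x - ∑' i, lam i * b i x‖ₑ = 0 := by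
        refine le_antisymm (ge_of_tendsto' h2 fun s => ?_) zero_le
        have hsm : AEStronglyMeasurable (fun x => ∑ i ∈ s, lam i * b i x) (volume.restrict S) :=
          Finset.aestronglyMeasurable_fun_sum s fun i _ => hGm i
        refine le_trans ?_ (lintegral_add_left' (f := fun x => ‖g x - ∑ i ∈ s, lam i * b i x‖ₑ)
          (hg.restrict.sub hsm).enorm _).le
        refine lintegral_mono fun x => ?_
        calc _ = ‖(g x - ∑ i ∈ s, lam i * b i x) - ((∑' i, lam i * b i x) - ∑ i ∈ s, lam i * b i x)‖ₑ := by
              congr 1; ring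
          _ ≤ _ := enorm_sub_le
      have h4 := (lintegral_eq_zero_iff' (hg.restrict.sub (aestronglyMeasurable_tsum hGm)).enorm).1 h3
      filter_upwards [h4] with x hx
      exact sub_eq_zero.1 (enorm_eq_zero.1 hx)
    have hall : ∀ᵐ x, g x = ∑' i, lam i * b i x := by
      filter_upwards [ae_all_iff.2 fun k : ℕ => (ae_restrict_iff' Metric.isClosed_closedBall.measurableSet).1
        (hloc (Metric.closedBall (0 : Eu n) k) (isCompact_closedBall _ _))] with x hx
      obtain ⟨k, hk⟩ := exists_nat_ge ‖x‖
      exact hx k (by simpa using hk)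
    filter_upwards [hall, hfam.ae_tsum_ne_top H hn hsnt] with x hx hx'
    have hsum : Summable fun α => f α x := (tsum_enorm_ne_top_iff_summable_norm.1 hx').of_norm
    rw [hx, hsum.tsum_prod]
    exact tsum_congr fun i => (hfG i x).symm

end Decomposition

/-! ### Commutators on block spaces -/

section Weights

variable {n : ℕ} {p q t a c τ : ℝ} {r R : ℝ≥0∞}

/-- A cube contributing to j is determined by its index modulo 2^k in each coordinate, since the
quotient is prescribed; there are 2^{kn} residue vectors. -/
lemma tsum_descendants_le (k : ℕ) (v : Fin n → Fin 3) (j : DyadicIndex n) :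
    ∑' i : DyadicIndex n, (if nb v (anc k i) = j then 1 else 0 : ℝ≥0∞) ≤ tp (k * n) := by
  set D : Set (DyadicIndex n) := {i | nb v (anc k i) = j} with hD
  have h1 : ∑' i : DyadicIndex n, (if nb v (anc k i) = j then 1 else 0 : ℝ≥0∞) = ∑' i : D, 1 := by
    rw [tsum_subtype D fun _ => (1 : ℝ≥0∞)]
    refine tsum_congr fun i => ?_
    by_cases h : nb v (anc k i) = j
    · rw [if_pos h, indicator_of_mem (show i ∈ D from h)]
    · rw [if_neg h, indicator_of_notMem (show i ∉ D from h)]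
  have hpos : (0 : ℤ) < 2 ^ k := by positivity
  set φ : D → Fin n → Fin (2 ^ k) := fun i l => ⟨(i.1.2 l % 2 ^ k).toNat, by
    have h1 := Int.emod_nonneg (i.1.2 l) hpos.ne'
    have h2 := Int.emod_lt_of_pos (i.1.2 l) hpos
    zify; rw [Int.toNat_of_nonneg h1]; exact h2⟩ with hφ
  have hinj : Function.Injective φ := by
    intro i i' h
    have e1 : nb v (anc k i.1) = nb v (anc k i'.1) := i.2.trans i'.2.symm
    refine Subtype.ext (Prod.ext ?_ (funext fun l => ?_))
    · have := congrArg Prod.fst e1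
      simp only [nb, anc] at this
      linarith
    · have h2 := congrArg Fin.val (congrFun h l)
      simp only [hφ] at h2
      have h3 : i.1.2 l % 2 ^ k = i'.1.2 l % 2 ^ k := by
        have := congrArg (Nat.cast : ℕ → ℤ) h2
        rwa [Int.toNat_of_nonneg (Int.emod_nonneg _ hpos.ne'),
          Int.toNat_of_nonneg (Int.emod_nonneg _ hpos.ne')] at this
      have h4 : i.1.2 l / 2 ^ k = i'.1.2 l / 2 ^ k := by
        have := congrFun (congrArg Prod.snd e1) l
        simp only [nb, anc] at this
        linarith
      rw [← Int.mul_ediv_add_emod (i.1.2 l) (2 ^ k), h3, h4, Int.mul_ediv_add_emod]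
  rw [h1]
  refine (ENNReal.tsum_comp_le_tsum_of_injective hinj fun _ => (1 : ℝ≥0∞)).trans (le_of_eq ?_)
  rw [tsum_fintype, Finset.sum_const, Finset.card_univ]
  simp only [Fintype.card_fun, Fintype.card_fin, nsmul_eq_mul, mul_one]
  rw [mul_comm, tp_mul_nat, tp_nat]
  push_cast
  rw [← pow_mul, ← pow_mul, mul_comm]

/-- The value is κ = 1/r, read as 0 for r = ∞. Its strict inequality with 1/t is where t < r enters
the boundedness of the commutator. -/
lemma DualExponents.exists_kappa (H : DualExponents p q t r a c τ R) :
    ∃ κ : ℝ, κ < 1 / t ∧ (1 - κ) * R.toReal = 1 := by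
  have ht := H.ht.pos
  rcases H.hr with ⟨-, h⟩ | ⟨h0, h⟩
  · exact ⟨0, by positivity, by simp [h]⟩
  · rcases H.hptr with ⟨-, htr, hr⟩ | ⟨-, hr⟩
    · refine ⟨1 / r.toReal, one_div_lt_one_div_of_lt ht
        ((ENNReal.ofReal_lt_iff_lt_toReal ht.le hr.ne).1 htr), ?_⟩
      have h1 := h.inv_add_inv_eq_one
      have h2 := h.symm.pos
      rw [show 1 - 1 / r.toReal = R.toReal⁻¹ by rw [one_div]; linarith]
      exact inv_mul_cancel₀ h2.ne'
    · exact absurd hr h0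

/-- Schur's test. The weight w carries 2^{-kn(1/t-κ+1)}: summed over the 2^{kn} cubes leading to j
it gives a convergent series in k. The compensating factor 2^{kn(1-κ)} in x becomes 2^{kn} after the
power ρ. Since each shell of each cube leads to exactly one j, the sum over j closes with the same
constant W. -/
lemma exists_sn_shell_le (H : DualExponents p q t r a c τ R) (hn : 0 < n) : ∃ W : ℝ≥0,
    ∀ d : DyadicIndex n → ℝ≥0∞,
      sn R.toReal (fun j => ∑' (kv : ℕ × (Fin n → Fin 3)) (i : DyadicIndex n),
        (if nb kv.2 (anc kv.1 i) = j then 1 else 0) *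
          ((1 + kv.1) * tp (-(kv.1 * n * (1 / t))) * d i)) ≤ W * sn R.toReal d := by
  obtain ⟨κ, hκ, hκR⟩ := H.exists_kappa
  obtain ⟨W, hW⟩ := exists_tsum_shell_weight hn (ε := 1 / t - κ) (by linarith)
  have hR := H.pos
  have hR1 := H.one_le
  set ρ := R.toReal
  refine ⟨W, fun d => ?_⟩
  set w : DyadicIndex n → (ℕ × (Fin n → Fin 3)) × DyadicIndex n → ℝ≥0∞ := fun j z =>
    (if nb z.1.2 (anc z.1.1 z.2) = j then 1 else 0) * ((1 + z.1.1) * tp (-(z.1.1 * n * (1 / t - κ + 1)))) with hw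
  set x : (ℕ × (Fin n → Fin 3)) × DyadicIndex n → ℝ≥0∞ := fun z => tp (z.1.1 * n * (1 - κ)) * d z.2 with hx
  have e1 : ∀ j, ∑' (kv : ℕ × (Fin n → Fin 3)) (i : DyadicIndex n),
        (if nb kv.2 (anc kv.1 i) = j then 1 else 0) *
          ((1 + kv.1) * tp (-(kv.1 * n * (1 / t))) * d i) = ∑' z, w j z * x z := fun j => by
    rw [ENNReal.tsum_prod' (f := fun z => w j z * x z)]
    refine tsum_congr fun kv => tsum_congr fun i => ?_
    simp only [hw, hx]
    rw [show -(kv.1 * n * (1 / t)) = -(kv.1 * n * (1 / t - κ + 1)) + (kv.1 * n * (1 - κ) : ℝ) by ring, tp_add]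
    ring
  have hwj : ∀ j, ∑' z, w j z ≤ W := fun j => by
    rw [ENNReal.tsum_prod' (f := w j), ← hW]
    refine ENNReal.tsum_le_tsum fun kv => ?_
    simp only [hw]
    rw [ENNReal.tsum_mul_right]
    calc _ ≤ tp (kv.1 * n) * ((1 + kv.1) * tp (-(kv.1 * n * (1 / t - κ + 1)))) := by
          gcongr; exact tsum_descendants_le _ _ _
      _ = (1 + kv.1) * (tp (kv.1 * n) * tp (-(kv.1 * n * (1 / t - κ + 1)))) := by ring
      _ = _ := by rw [← tp_add]; congr 2; ring
  have hsum : ∑' j, ∑' z, w j z * x z ^ ρ = W * ∑' i, d i ^ ρ := by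
    rw [ENNReal.tsum_comm, ENNReal.tsum_prod' (f := fun z => ∑' j, w j z * x z ^ ρ), ← hW,
      ← ENNReal.tsum_mul_right]
    refine tsum_congr fun kv => ?_
    rw [← ENNReal.tsum_mul_left]
    refine tsum_congr fun i => ?_
    simp only [hw, hx]
    rw [ENNReal.tsum_mul_right, ENNReal.tsum_mul_right, tsum_ite_eq', one_mul,
      ENNReal.mul_rpow_of_nonneg _ _ hR.le, tp_rpow,
      show kv.1 * n * (1 - κ) * ρ = (kv.1 * n : ℝ) by rw [mul_assoc, hκR, mul_one], ← mul_assoc,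
      mul_assoc _ (tp _) (tp _), ← tp_add]
    congr 3; ring
  simp_rw [e1]
  calc _ ≤ (∑' j, (W : ℝ≥0∞) ^ (ρ - 1) * ∑' z, w j z * x z ^ ρ) ^ (1 / ρ) := by
        unfold sn
        gcongr with j
        refine (rpow_tsum_mul_le hR1 (w j) x).trans ?_
        gcongr
        exact hwj j
    _ = ((W : ℝ≥0∞) ^ ρ * ∑' i, d i ^ ρ) ^ (1 / ρ) := by
        rw [ENNReal.tsum_mul_left, hsum, ← mul_assoc]
        congr 2
        nth_rw 2 [← ENNReal.rpow_one (W : ℝ≥0∞)]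
        rw [← ENNReal.rpow_add_of_nonneg _ _ (by linarith) (by norm_num)]
        congr 1; ring
    _ = _ := by
        rw [ENNReal.mul_rpow_of_nonneg _ _ (by positivity), ← ENNReal.rpow_mul, mul_one_div_cancel hR.ne',
          ENNReal.rpow_one, sn]

end Weights

section BlockCommutator

variable {n : ℕ} {p q t a c τ δ A : ℝ} {r R : ℝ≥0∞} {K : Eu n → Eu n → ℂ} {S : LTwo n →L[ℂ] LTwo n}
  {b : Eu n → ℂ}

lemma tsum_shell_indicator {M : Type*} [AddCommMonoid M] [TopologicalSpace M] (i : DyadicIndex n)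
    (f : Eu n → M) (x : Eu n) :
    ∑' kv, (shell i kv).indicator f x = f x := by
  have hdisj : ∀ kv kv', x ∈ shell i kv → x ∈ shell i kv' → kv = kv' := by
    have hlt : ∀ kv kv' : ℕ × (Fin n → Fin 3), x ∈ shell i kv → x ∈ shell i kv' → ¬ kv.1 < kv'.1 := by
      rintro ⟨k, v⟩ ⟨_ | k', v'⟩ h h' hlt
      · simp at hlt
      · have h1 : x ∈ tri (anc k i) := mem_tri_iff.2 ⟨v, shell_subset i _ h⟩
        have h2 : x ∈ dyadicCube (nb v' (anc (k' + 1) i)) \ tri (anc k' i) := h'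
        exact h2.2 (tri_anc_mono i (Nat.lt_succ_iff.1 hlt) h1)
    intro kv kv' h h'
    have h1 := hlt kv kv' h h'
    have h2 := hlt kv' kv h' h
    have hk : kv.1 = kv'.1 := by omega
    refine Prod.ext hk (by_contra fun hne => ?_)
    refine Set.disjoint_left.1 (disjoint_nb (anc kv.1 i) hne) (shell_subset i _ h) ?_
    rw [hk]
    exact shell_subset i _ h'
  obtain ⟨kv, h⟩ := exists_mem_shell i x
  rw [tsum_eq_single kv fun kv' hne => indicator_of_notMem (fun h' => hne (hdisj _ _ h' h)) f,
    indicator_of_mem h]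

/-- The parts of the commutators of a family of functions on the shells around their cubes. -/
def shellFamily {ι : Type} (S : LTwo n → LTwo n) (b : Eu n → ℂ) (i : ι → DyadicIndex n)
    (f : ι → Eu n → ℂ) (z : ι × (ℕ × (Fin n → Fin 3))) : Eu n → ℂ :=
  (shell (i z.1) z.2).indicator (commutator S b (f z.1))

/-- For the exponent a = p' the shell decay is 2^{-kn/p}. Passing to the normalization of the k-th
ancestor multiplies it by 2^{-kn(1/t-1/p)}, which leaves (1+k)2^{-kn/t}, the weight in
`exists_sn_shell_le`. -/
lemma exists_isBlockFamily_shellFamily (H : DualExponents p q t r a c τ R) (hn : 0 < n)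
    (hS : IsCZ δ A K S) (hb : MemBMO b) : ∃ C : ℝ≥0, ∀ {ι : Type} (i : ι → DyadicIndex n)
      (f : ι → Eu n → ℂ) (e : ι → ℝ≥0∞) (d : DyadicIndex n → ℝ≥0∞),
      IsBlockFamily a c (1 / t - 1 / p) i f e d → (∀ α, MemLcInfty (f α)) →
      ∃ (e' : ι × (ℕ × (Fin n → Fin 3)) → ℝ≥0∞) (d' : DyadicIndex n → ℝ≥0∞),
        IsBlockFamily a c (1 / t - 1 / p) (fun z => nb z.2.2 (anc z.2.1 (i z.1)))
          (shellFamily S b i f) e' d' ∧ sn R.toReal d' ≤ C * sn R.toReal d := by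
  have ha := H.hp.symm
  have hc := H.hq.symm
  obtain ⟨C, hC⟩ := exists_lorN_commutator_shell_le hn hS hb ha.lt hc.pos
  obtain ⟨W, hW⟩ := exists_sn_shell_le (n := n) H hn
  refine ⟨C * W, fun {ι} i f e d hf hfL => ?_⟩
  set wt : ℕ × (Fin n → Fin 3) → ℝ≥0∞ := fun kv => (1 + kv.1) * tp (-(kv.1 * n * (1 / t))) with hwt
  set e' : ι × (ℕ × (Fin n → Fin 3)) → ℝ≥0∞ := fun z => C * (wt z.2 * e z.1) with he'
  set d' : DyadicIndex n → ℝ≥0∞ := fun j => C * ∑' (kv : ℕ × (Fin n → Fin 3)) (i : DyadicIndex n),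
        (if nb kv.2 (anc kv.1 i) = j then 1 else 0) * (wt kv * d i) with hd'
  refine ⟨e', d', ⟨fun z => (aestronglyMeasurable_commutator _ hb _).indicator (measurableSet_shell _ _),
    fun z x hx => indicator_of_notMem (fun h => hx (shell_subset _ _ h)) _, fun z => ?_, fun j => ?_⟩, ?_⟩
  · have h1 := hC (i z.1) z.2 (f z.1) (hfL z.1) (hf.supp z.1)
    have e1 : (fun x => ‖shellFamily S b i f z x‖ₑ) =
        (shell (i z.1) z.2).indicator fun x => ‖commutator S b (f z.1) x‖ₑ := by
      ext x; exact enorm_indicator_eq_indicator_enorm _ _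
    rw [e1]
    refine h1.trans ((mul_le_mul' le_rfl (hf.norm_le z.1)).trans (le_of_eq ?_))
    have ep := H.hp.inv_add_inv_eq_one
    rw [volume_nb, volume_anc, ENNReal.mul_rpow_of_ne_zero (tp_ne_zero _) (volume_dyadicCube_ne_zero _),
      tp_rpow, he', hwt]
    simp only
    rw [show -((z.2.1 : ℝ) * n * (1 - 1 / a)) = -(z.2.1 * n * (1 / t)) + z.2.1 * n * (1 / t - 1 / p) by
      rw [show 1 - 1 / a = 1 / p by simp only [one_div]; linarith]; ring, tp_add]
    ring
  · simp only [hd']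
    rw [tsum_subtype ((fun z : ι × (ℕ × (Fin n → Fin 3)) => nb z.2.2 (anc z.2.1 (i z.1))) ⁻¹' {j}) e',
      ENNReal.tsum_prod', ENNReal.tsum_comm, ← ENNReal.tsum_mul_left]
    refine ENNReal.tsum_le_tsum fun kv => ?_
    rw [← ENNReal.tsum_mul_left, ← ENNReal.tsum_fiberwise _ i]
    refine ENNReal.tsum_le_tsum fun j' => ?_
    by_cases hj : nb kv.2 (anc kv.1 j') = j
    · rw [if_pos hj, one_mul]
      refine le_trans (ENNReal.tsum_le_tsum (g := fun α : i ⁻¹' {j'} => (C : ℝ≥0∞) * (wt kv * e α))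
        fun α => indicator_le_self' (fun _ _ => zero_le) _) ?_
      rw [ENNReal.tsum_mul_left, ENNReal.tsum_mul_left]
      gcongr
      exact hf.sum_le j'
    · refine le_of_eq_of_le ?_ zero_le
      refine ENNReal.tsum_eq_zero.2 fun α => indicator_of_notMem (fun h => hj ?_) _
      rw [← show i α = j' from α.2]; exact h
  · rw [hd', sn_const_mul H.pos, ENNReal.coe_mul, mul_assoc]
    gcongr
    exact hW d

/-- The commutators of a family of functions on cubes, paired with a function of the
Bourgain–Morrey–Lorentz space. -/
lemma exists_tsum_lintegral_commutator_le (H : DualExponents p q t r a c τ R) (hn : 0 < n)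
    (hS : IsCZ δ A K S) (hb : MemBMO b) : ∃ C : ℝ≥0, ∀ {ι : Type} (i : ι → DyadicIndex n)
      (f : ι → Eu n → ℂ) (e : ι → ℝ≥0∞) (d : DyadicIndex n → ℝ≥0∞),
      IsBlockFamily a c (1 / t - 1 / p) i f e d → (∀ α, MemLcInfty (f α)) →
      ∀ F : Eu n → ℝ≥0∞, AEMeasurable F →
        ∑' α, ∫⁻ x, ‖commutator S b (f α) x‖ₑ * F x ≤ C * (sn R.toReal d * mN p q t r F) := by
  obtain ⟨C₁, hC₁⟩ := exists_isBlockFamily_shellFamily H hn hS hb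
  obtain ⟨C₂, hC₂⟩ := exists_tsum_lintegral_le (n := n) H
  refine ⟨C₂ * C₁, fun {ι} i f e d hf hfL F hF => ?_⟩
  obtain ⟨e', d', hf', hd'⟩ := hC₁ i f e d hf hfL
  have hcm : ∀ α, AEMeasurable fun x => ‖commutator S b (f α) x‖ₑ :=
    fun α => (aestronglyMeasurable_commutator _ hb _).enorm
  calc _ ≤ ∑' z, ∫⁻ x, ‖shellFamily S b i f z x‖ₑ * F x := by
        rw [ENNReal.tsum_prod']
        refine ENNReal.tsum_le_tsum fun α => ?_
        refine le_trans ?_ (lintegral_tsum (f := fun kv x => ‖shellFamily S b i f (α, kv) x‖ₑ * F x)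
          fun kv => (hf'.meas (α, kv)).enorm.mul hF).le
        refine lintegral_mono fun x => ?_
        simp only
        rw [ENNReal.tsum_mul_right]
        gcongr
        refine (enorm_le_tsum_shell (i α) (fun x => ‖commutator S b (f α) x‖ₑ) x).trans (le_of_eq ?_)
        exact tsum_congr fun kv => (enorm_indicator_eq_indicator_enorm _ _).symm
    _ ≤ C₂ * (sn R.toReal d' * mN p q t r F) := hC₂ _ _ e' d' hf' F hF
    _ ≤ C₂ * (C₁ * sn R.toReal d * mN p q t r F) := by gcongr
    _ = _ := by push_cast; ring

/-- The commutator on the block space. -/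
lemma exists_commutator_block (H : DualExponents p q t r a c τ R) (hn : 0 < n)
    (hS : IsCZ δ A K S) (hb : MemBMO b) : ∃ C : ℝ≥0, ∀ (g : Eu n → ℂ) (Λ : ℝ≥0),
      AEStronglyMeasurable g volume → blockNorm a c τ R g < Λ → ∃ k : Eu n → ℂ,
        AEStronglyMeasurable k volume ∧ blockNorm a c τ R k ≤ C * Λ ∧
        ∀ F G : Eu n → ℂ, AEStronglyMeasurable F volume → AEStronglyMeasurable G volume →
          mN p q t r (fun x => ‖F x‖ₑ) ≠ ∞ → mN p q t r (fun x => ‖G x‖ₑ) ≠ ∞ →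
          (∀ φ, MemLcInfty φ → ∫ x, F x * φ x = -∫ x, G x * commutator S b φ x) →
          Integrable (fun x => F x * g x) volume ∧ Integrable (fun x => G x * k x) volume ∧
            ∫ x, F x * g x = -∫ x, G x * k x := by
  obtain ⟨C₀, hC₀⟩ := exists_decomposition (n := n) H hn
  obtain ⟨C₁, hC₁⟩ := exists_isBlockFamily_shellFamily H hn hS hb
  obtain ⟨C₂, hC₂⟩ := exists_blockNorm_le (n := n) H hn
  obtain ⟨C₃, hC₃⟩ := exists_tsum_lintegral_le (n := n) H
  obtain ⟨C₄, hC₄⟩ := exists_tsum_lintegral_commutator_le H hn hS hb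
  refine ⟨C₂ * C₁ * C₀, fun g Λ hg hΛ => ?_⟩
  obtain ⟨f, e, hf, hfL, hsn, hgf⟩ := hC₀ g Λ hg hΛ
  obtain ⟨e', d', hf', hd'⟩ := hC₁ _ f e _ hf hfL
  have hsnt := ne_top_of_le_ne_top (ENNReal.mul_ne_top ENNReal.coe_ne_top ENNReal.coe_ne_top) hsn
  have hdt : sn R.toReal d' ≠ ∞ :=
    ne_top_of_le_ne_top (ENNReal.mul_ne_top ENNReal.coe_ne_top hsnt) hd'
  have hcm : ∀ α, AEStronglyMeasurable (commutator S b (f α)) volume :=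
    fun α => aestronglyMeasurable_commutator _ hb _
  set k : Eu n → ℂ := fun x => ∑' α, commutator S b (f α) x with hk
  have hkF : ∀ᵐ x, k x = ∑' z, shellFamily S b Prod.fst f z x := by
    filter_upwards [hf'.ae_tsum_ne_top H hn hdt] with x hx
    have hsum : Summable fun z => shellFamily S b Prod.fst f z x :=
      (tsum_enorm_ne_top_iff_summable_norm.1 hx).of_norm
    rw [hsum.tsum_prod]
    refine tsum_congr fun α => ?_
    simp only [shellFamily]
    exact (tsum_shell_indicator α.1 (commutator S b (f α)) x).symm
  -- The adjoint relation between F and G passes termwise from test functions to g. It is used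
  -- twice: with F a commutator of the transpose and G a test function, to identify k, and with F =
  -- h and G = f, to obtain the defining relation of the theorem.
  refine ⟨k, aestronglyMeasurable_tsum hcm, ?_, fun F G hF hG hFt hGt hFG => ?_⟩
  · rw [blockNorm_congr_ae hkF]
    calc _ ≤ C₂ * sn R.toReal d' := hC₂ _ _ e' d' hf' hdt
      _ ≤ C₂ * (C₁ * (C₀ * Λ)) := by gcongr; exact hd'.trans (by gcongr)
      _ = _ := by push_cast; ring
  · have h1 : ∑' α, ∫⁻ x, ‖F x * f α x‖ₑ ≠ ∞ := by
      refine ne_top_of_le_ne_top ?_ ((le_of_eq ?_).trans (hC₃ _ f e _ hf _ hF.enorm))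
      · exact ENNReal.mul_ne_top ENNReal.coe_ne_top (ENNReal.mul_ne_top hsnt hFt)
      · refine tsum_congr fun α => lintegral_congr fun x => ?_
        rw [enorm_mul, mul_comm]
    have h2 : ∑' α, ∫⁻ x, ‖G x * commutator S b (f α) x‖ₑ ≠ ∞ := by
      refine ne_top_of_le_ne_top ?_ ((le_of_eq ?_).trans (hC₄ _ f e _ hf hfL _ hG.enorm))
      · exact ENNReal.mul_ne_top ENNReal.coe_ne_top (ENNReal.mul_ne_top hsnt hGt)
      · refine tsum_congr fun α => lintegral_congr fun x => ?_
        rw [enorm_mul, mul_comm]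
    have hFm : ∀ α, AEStronglyMeasurable (fun x => F x * f α x) volume := fun α => hF.mul (hfL α).1.1
    have hGm : ∀ α, AEStronglyMeasurable (fun x => G x * commutator S b (f α) x) volume :=
      fun α => hG.mul (hcm α)
    have eF : (fun x => F x * g x) =ᵐ[volume] fun x => ∑' α, F x * f α x := by
      filter_upwards [hgf] with x hx
      rw [hx, tsum_mul_left]
    have eG : (fun x => G x * k x) =ᵐ[volume] fun x => ∑' α, G x * commutator S b (f α) x :=
      Eventually.of_forall fun x => tsum_mul_left.symm
    refine ⟨(integrable_tsum hFm h1).congr eF.symm, (integrable_tsum hGm h2).congr eG.symm, ?_⟩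
    rw [integral_congr_ae eF, integral_congr_ae eG, integral_tsum hFm h1, integral_tsum hGm h2, ← tsum_neg]
    exact tsum_congr fun α => hFG _ (hfL α)

end BlockCommutator

/-! ### Test functions, separation by pairings, and the extension of the commutator. -/

section Test

variable {n : ℕ} {p q t a c τ δ A : ℝ} {r R : ℝ≥0∞} {K : Eu n → Eu n → ℂ} {S : LTwo n →L[ℂ] LTwo n}
  {b : Eu n → ℂ}

lemma memLcInfty_indicator_one {s : Set (Eu n)} (hs : IsCompact s) :
    MemLcInfty (s.indicator fun _ => (1 : ℂ)) :=
  memLcInfty_of_bounded hs.isBounded (aestronglyMeasurable_const.indicator hs.measurableSet)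
    (fun _ hx => indicator_of_notMem hx _) (M := 1) (Eventually.of_forall fun _ =>
      (enorm_indicator_le_enorm_self _ _).trans (by simp))

lemma ae_eq_of_forall_integral_mul_eq {k k' : Eu n → ℂ}
    (hk : ∀ φ, MemLcInfty φ → Integrable (fun x => φ x * k x) volume)
    (hk' : ∀ φ, MemLcInfty φ → Integrable (fun x => φ x * k' x) volume)
    (h : ∀ φ, MemLcInfty φ → ∫ x, φ x * k x = ∫ x, φ x * k' x) : k =ᵐ[volume] k' := by
  have e : ∀ (s : Set (Eu n)) (f : Eu n → ℂ), (fun x => s.indicator (fun _ => (1 : ℂ)) x * f x) = s.indicator f :=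
    fun s f => by ext x; by_cases hx : x ∈ s <;> simp [hx]
  have hi : ∀ f : Eu n → ℂ, (∀ φ, MemLcInfty φ → Integrable (fun x => φ x * f x) volume) →
      ∀ s, IsCompact s → IntegrableOn f s volume := fun f hf s hs => by
    have := hf _ (memLcInfty_indicator_one hs)
    rw [e] at this
    exact (integrable_indicator_iff hs.measurableSet).1 this
  have h0 : k - k' =ᵐ[volume] 0 := by
    refine ae_eq_zero_of_forall_setIntegral_isCompact_eq_zero' ?_ fun s hs => ?_
    · rw [locallyIntegrable_iff]
      exact fun s hs => (hi k hk s hs).sub (hi k' hk' s hs)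
    · have h1 := h _ (memLcInfty_indicator_one hs)
      rw [e, e, integral_indicator hs.measurableSet, integral_indicator hs.measurableSet] at h1
      simp only [Pi.sub_apply]
      rw [integral_sub (hi k hk s hs) (hi k' hk' s hs), h1, sub_self]
  filter_upwards [h0] with x hx
  exact sub_eq_zero.1 hx

lemma blockNorm_zero (H : DualExponents p q t r a c τ R) (hn : 0 < n) :
    blockNorm a c τ R (fun _ : Eu n => (0 : ℂ)) = 0 := by
  obtain ⟨C, hC⟩ := exists_blockNorm_le (n := n) H hn
  have h0 : sn R.toReal (fun _ : DyadicIndex n => 0) = 0 := by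
    simp [sn, ENNReal.zero_rpow_of_pos, H.pos]
  have h := hC (ι := Empty) (fun z => z.elim) (fun z => z.elim) (fun z => z.elim) (fun _ => 0)
    ⟨fun z => z.elim, fun z => z.elim, fun z => z.elim, fun j => by simp⟩ (by simp [h0])
  rw [h0, mul_zero] at h
  simpa using h

/-- Pairing with the indicator of a ball bounds the L¹ norm on that ball by the block norm, so
limits in the block space are unique almost everywhere. -/
lemma eq_zero_of_blockNorm_eq_zero (H : DualExponents p q t r a c τ R) (hn : 0 < n) {g : Eu n → ℂ}
    (hg : AEStronglyMeasurable g volume) (h : blockNorm a c τ R g = 0) : ∀ᵐ x, g x = 0 := by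
  obtain ⟨C₀, hC₀⟩ := exists_decomposition (n := n) H hn
  obtain ⟨C, hC⟩ := exists_tsum_lintegral_le (n := n) H
  have key : ∀ k : ℕ, ∀ᵐ x, x ∈ Metric.closedBall (0 : Eu n) k → g x = 0 := fun k => by
    set s := Metric.closedBall (0 : Eu n) k
    have hs : MeasurableSet s := Metric.isClosed_closedBall.measurableSet
    have hm := H.mN_indicator_ne_top hn hs measure_closedBall_lt_top.ne
    set m := mN p q t r (s.indicator fun _ => 1)
    have h1 : ∀ Λ : ℝ≥0, 0 < Λ → ∫⁻ x in s, ‖g x‖ₑ ≤ (C * (C₀ * m)) * Λ := fun Λ hΛ => by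
      obtain ⟨f, e, hf, -, hsn, hgf⟩ := hC₀ g Λ hg (by rw [h]; exact_mod_cast hΛ)
      have h2 := hC _ f e _ hf (s.indicator fun _ => 1) (aemeasurable_const.indicator hs)
      calc ∫⁻ x in s, ‖g x‖ₑ = ∫⁻ x, ‖g x‖ₑ * s.indicator (fun _ => 1) x := by
            rw [← lintegral_indicator hs]
            refine lintegral_congr fun x => ?_
            by_cases hx : x ∈ s <;> simp [hx]
        _ ≤ ∫⁻ x, ∑' α, ‖f α x‖ₑ * s.indicator (fun _ => 1) x := by
            refine lintegral_mono_ae ?_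
            filter_upwards [hgf] with x hx
            rw [ENNReal.tsum_mul_right, hx]
            gcongr
            exact enorm_tsum_le_tsum_enorm
        _ = ∑' α, ∫⁻ x, ‖f α x‖ₑ * s.indicator (fun _ => 1) x :=
            lintegral_tsum fun α => (hf.meas α).enorm.mul (aemeasurable_const.indicator hs)
        _ ≤ C * (sn R.toReal (fun i => ∑' m, e (i, m)) * m) := h2
        _ ≤ C * ((C₀ * Λ) * m) := by gcongr
        _ = _ := by ring
    have hM : (C * (C₀ * m) : ℝ≥0∞) ≠ ∞ :=
      ENNReal.mul_ne_top ENNReal.coe_ne_top (ENNReal.mul_ne_top ENNReal.coe_ne_top hm)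
    have h2 : ∫⁻ x in s, ‖g x‖ₑ = 0 := by
      refine le_antisymm (ENNReal.le_of_forall_pos_le_add fun ε hε _ => ?_) zero_le
      rw [zero_add]
      set M := (C * (C₀ * m) : ℝ≥0∞).toNNReal with hMdef
      refine (h1 (ε / (M + 1)) (by positivity)).trans ?_
      rw [← ENNReal.coe_toNNReal hM, ← hMdef]
      norm_cast
      rw [mul_div_assoc', div_le_iff₀ (by positivity), mul_comm]
      gcongr
      exact le_self_add
    rw [lintegral_eq_zero_iff' hg.restrict.enorm] at h2
    rw [← ae_restrict_iff' hs]
    filter_upwards [h2] with x hx using enorm_eq_zero.1 hx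
  filter_upwards [ae_all_iff.2 key] with x hx
  obtain ⟨k, hk⟩ := exists_nat_ge ‖x‖
  exact hx k (by simpa using hk)

/-- Test functions are finite sums of blocks. -/
lemma MemLcInfty.exists_isBlockFamily (H : DualExponents p q t r a c τ R) {φ : Eu n → ℂ}
    (hφ : MemLcInfty φ) : ∃ (i : (Fin n → Fin 3) → DyadicIndex n) (f : (Fin n → Fin 3) → Eu n → ℂ)
      (e : (Fin n → Fin 3) → ℝ≥0∞) (d : DyadicIndex n → ℝ≥0∞),
      IsBlockFamily a c (1 / t - 1 / p) i f e d ∧ (∀ v, MemLcInfty (f v)) ∧ sn R.toReal d ≠ ∞ ∧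
        φ = ∑ v, f v := by
  have ha := H.hp.symm
  have hc := H.hq.symm
  obtain ⟨k, hk⟩ := exists_subset_tri_anc hφ.isBounded ((0, 0) : DyadicIndex n)
  set i := anc k ((0, 0) : DyadicIndex n)
  set f : (Fin n → Fin 3) → Eu n → ℂ := fun v => (dyadicCube (nb v i)).indicator φ with hf
  have hfL : ∀ v, MemLcInfty (f v) := fun v => hφ.indicator (measurableSet_dyadicCube _)
  set u := 1 / t - 1 / p
  set e : (Fin n → Fin 3) → ℝ≥0∞ := fun v =>
    lorN a c volume (fun x => ‖f v x‖ₑ) * volume (dyadicCube (nb v i)) ^ (-u) with he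
  have het : ∀ v, e v ≠ ∞ := fun v => ENNReal.mul_ne_top ((hfL v).lorN_ne_top ha.pos hc.pos)
    (ENNReal.rpow_ne_top_of_ne_zero (volume_dyadicCube_ne_zero _) (volume_dyadicCube_ne_top _))
  refine ⟨fun v => nb v i, f, e, fun j => ∑' v : (fun v => nb v i) ⁻¹' {j}, e v,
    ⟨fun v => (hfL v).1.1, fun v x hx => indicator_of_notMem hx _, fun v => ?_, fun j => le_rfl⟩, hfL, ?_, ?_⟩
  · rw [he]
    simp only
    rw [mul_assoc, ← ENNReal.rpow_add _ _ (volume_dyadicCube_ne_zero _) (volume_dyadicCube_ne_top _),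
      neg_add_cancel, ENNReal.rpow_zero, mul_one]
  · refine ENNReal.rpow_ne_top_of_nonneg (by have := H.pos; positivity)
      (ne_top_of_le_ne_top ?_ (sum_rpow_le_rpow_sum H.one_le _))
    refine ENNReal.rpow_ne_top_of_nonneg H.pos.le ?_
    rw [ENNReal.tsum_fiberwise e fun v => nb v i, tsum_fintype]
    exact ENNReal.sum_ne_top.2 fun v _ => het v
  · exact eq_sum_indicator_nb fun x hx => by_contra fun h => hx (hk h)

lemma MemLcInfty.memBlock (H : DualExponents p q t r a c τ R) (hn : 0 < n) {φ : Eu n → ℂ}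
    (hφ : MemLcInfty φ) : MemBlock a c τ R φ := by
  obtain ⟨C, hC⟩ := exists_blockNorm_le (n := n) H hn
  obtain ⟨i, f, e, d, hf, -, hd, h⟩ := hφ.exists_isBlockFamily H
  refine ⟨hφ.1.1, ?_⟩
  have h1 := hC i f e d hf hd
  have h2 : (fun x => ∑' v, f v x) = φ := by
    rw [h]; ext x; rw [tsum_fintype, Finset.sum_apply]
  rw [h2] at h1
  exact h1.trans_lt (ENNReal.mul_lt_top ENNReal.coe_lt_top hd.lt_top)

lemma MemLcInfty.mN_ne_top (H : DualExponents p q t r a c τ R) (hn : 0 < n) {φ : Eu n → ℂ}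
    (hφ : MemLcInfty φ) : mN p q t r (fun x => ‖φ x‖ₑ) ≠ ∞ :=
  H.mN_ne_top hn hφ.1.1.enorm fun _ _ hp' hq' => hφ.lorN_ne_top (by linarith) (by linarith)

lemma mN_commutator_ne_top (H : DualExponents p q t r a c τ R) (hn : 0 < n) (hS : IsCZ δ A K S)
    (hb : MemBMO b) {φ : Eu n → ℂ} (hφ : MemLcInfty φ) :
    mN p q t r (fun x => ‖commutator S b φ x‖ₑ) ≠ ∞ :=
  H.mN_ne_top hn (aestronglyMeasurable_commutator _ hb _).enorm fun _ _ hp' hq' =>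
    lorN_commutator_ne_top hn hS hb hp' hq' hφ

lemma lintegral_commutator_mul_ne_top (H : DualExponents p q t r a c τ R) (hn : 0 < n)
    (hS : IsCZ δ A K S) (hb : MemBMO b) {φ : Eu n → ℂ} (hφ : MemLcInfty φ) {F : Eu n → ℝ≥0∞}
    (hF : AEMeasurable F) (hFt : mN p q t r F ≠ ∞) :
    ∫⁻ x, ‖commutator S b φ x‖ₑ * F x ≠ ∞ := by
  obtain ⟨C, hC⟩ := exists_tsum_lintegral_commutator_le H hn hS hb
  obtain ⟨i, f, e, d, hf, hfL, hd, h⟩ := hφ.exists_isBlockFamily H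
  have hcm : ∀ v, AEMeasurable fun x => ‖commutator S b (f v) x‖ₑ :=
    fun v => (aestronglyMeasurable_commutator _ hb _).enorm
  refine ne_top_of_le_ne_top (ENNReal.mul_ne_top (ENNReal.coe_ne_top (r := C))
    (ENNReal.mul_ne_top hd hFt)) (le_trans ?_ (hC i f e d hf hfL F hF))
  refine le_trans ?_ (lintegral_tsum (f := fun v x => ‖commutator S b (f v) x‖ₑ * F x)
    fun v => (hcm v).mul hF).le
  refine lintegral_mono_ae ?_
  filter_upwards [commutator_finset_sum (S := S) hn hb Finset.univ fun v _ => hfL v] with x hx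
  rw [h, hx]
  rw [ENNReal.tsum_mul_right, tsum_fintype]
  gcongr
  exact enorm_sum_le _ _

lemma integrable_mul_commutator (H : DualExponents p q t r a c τ R) (hn : 0 < n)
    (hS : IsCZ δ A K S) (hb : MemBMO b) {φ : Eu n → ℂ} (hφ : MemLcInfty φ) {F : Eu n → ℂ}
    (hF : AEStronglyMeasurable F volume) (hFt : mN p q t r (fun x => ‖F x‖ₑ) ≠ ∞) :
    Integrable (fun x => F x * commutator S b φ x) volume := by
  refine ⟨hF.mul (aestronglyMeasurable_commutator _ hb _), ?_⟩
  rw [hasFiniteIntegral_iff_enorm]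
  simp_rw [enorm_mul, mul_comm ‖F _‖ₑ]
  exact (lintegral_commutator_mul_ne_top H hn hS hb hφ hF.enorm hFt).lt_top

/-- The extension of the commutator to the block space. -/
lemma exists_isBlockCommutator (H : DualExponents p q t r a c τ R) (hn : 0 < n) (hS : IsCZ δ A K S)
    (hb : MemBMO b) {g : Eu n → ℂ} (hg : MemBlock a c τ R g) : ∃ k : Eu n → ℂ,
      IsBlockCommutator a c τ R S b g k ∧
        ∀ F G : Eu n → ℂ, AEStronglyMeasurable F volume → AEStronglyMeasurable G volume →
          mN p q t r (fun x => ‖F x‖ₑ) ≠ ∞ → mN p q t r (fun x => ‖G x‖ₑ) ≠ ∞ →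
          (∀ φ, MemLcInfty φ → ∫ x, F x * φ x = -∫ x, G x * commutator S b φ x) →
          Integrable (fun x => F x * g x) volume ∧ Integrable (fun x => G x * k x) volume ∧
            ∫ x, F x * g x = -∫ x, G x * k x := by
  have hSt := isCZ_transposeL hS
  obtain ⟨C, hC⟩ := exists_commutator_block H hn hS hb
  obtain ⟨Λ, hΛ, -⟩ := ENNReal.lt_iff_exists_nnreal_btwn.1 hg.2
  obtain ⟨k, hkm, hk, hrel⟩ := hC g Λ hg.1 hΛ
  refine ⟨k, ⟨hg, ⟨hkm, hk.trans_lt (ENNReal.mul_lt_top ENNReal.coe_lt_top ENNReal.coe_lt_top)⟩,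
    fun u hu hug => ?_⟩, hrel⟩
  -- With G = φ and F the commutator of the transpose at φ, the pairing of k' with φ depends on g'
  -- alone; hence the outcome does not depend on the chosen decomposition.
  have htest : ∀ (g' k' : Eu n → ℂ), (∀ F G : Eu n → ℂ, AEStronglyMeasurable F volume →
      AEStronglyMeasurable G volume →
          mN p q t r (fun x => ‖F x‖ₑ) ≠ ∞ → mN p q t r (fun x => ‖G x‖ₑ) ≠ ∞ →
          (∀ φ, MemLcInfty φ → ∫ x, F x * φ x = -∫ x, G x * commutator S b φ x) →
          Integrable (fun x => F x * g' x) volume ∧ Integrable (fun x => G x * k' x) volume ∧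
            ∫ x, F x * g' x = -∫ x, G x * k' x) → ∀ φ, MemLcInfty φ →
      Integrable (fun x => commutator (transposeL S) b φ x * g' x) volume ∧
        Integrable (fun x => φ x * k' x) volume ∧
        ∫ x, commutator (transposeL S) b φ x * g' x = -∫ x, φ x * k' x :=
    fun g' k' h φ hφ => h _ φ (aestronglyMeasurable_commutator _ hb _) hφ.1.1
      (mN_commutator_ne_top H hn hSt hb hφ) (hφ.mN_ne_top H hn)
      fun ψ hψ => integral_commutator_transpose hn hb hφ hψ
  rw [ENNReal.tendsto_nhds_zero]
  intro ε hε
  set ε' : ℝ≥0 := (min ε 1).toNNReal with hε'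
  have hε't : (ε' : ℝ≥0∞) = min ε 1 := ENNReal.coe_toNNReal (ne_top_of_le_ne_top ENNReal.one_ne_top (min_le_right _ _))
  have hε'0 : 0 < ε' := by
    rw [← ENNReal.coe_pos, hε't]; exact lt_min hε one_pos
  have hΛ' : (0 : ℝ≥0∞) < (ε' / (C + 1) : ℝ≥0) := by rw [ENNReal.coe_pos]; positivity
  filter_upwards [hug.eventually_lt_const hΛ'] with j hj
  obtain ⟨kj, hkjm, hkj, hrelj⟩ := hC _ _ ((hu j).1.1.sub hg.1) hj
  -- The function kj built from a decomposition of u j - g of small norm has the same pairings with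
  -- test functions as the difference on the left, so the norm bound for kj applies to that
  -- difference.
  have hae : commutator S b (u j) - k =ᵐ[volume] kj := by
    have i1 : ∀ φ, MemLcInfty φ → Integrable (fun x => φ x * commutator S b (u j) x) volume := fun φ hφ =>
      integrable_mul_commutator H hn hS hb (hu j) hφ.1.1 (hφ.mN_ne_top H hn)
    have e1 : ∀ φ : Eu n → ℂ, (fun x => φ x * (commutator S b (u j) - k) x) =
        fun x => φ x * commutator S b (u j) x - φ x * k x := fun φ => by
      ext x; simp only [Pi.sub_apply]; ring
    refine ae_eq_of_forall_integral_mul_eq (fun φ hφ => ?_) (fun φ hφ => (htest _ _ hrelj φ hφ).2.1)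
      fun φ hφ => ?_
    · rw [e1]
      exact (i1 φ hφ).sub (htest _ _ hrel φ hφ).2.1
    · obtain ⟨a1, a2, a3⟩ := htest _ _ hrel φ hφ
      obtain ⟨b1, b2, b3⟩ := htest _ _ hrelj φ hφ
      have e2 : (fun x => commutator (transposeL S) b φ x * u j x) =
          fun x => commutator (transposeL S) b φ x * (u j - g) x + commutator (transposeL S) b φ x * g x := by
        ext x; simp only [Pi.sub_apply]; ring
      have h3 := integral_commutator_transpose (S := S) hn hb hφ (hu j)
      rw [e2, integral_add b1 a1, b3, a3] at h3
      rw [e1, integral_sub (i1 φ hφ) a2]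
      linear_combination h3
  rw [blockNorm_congr_ae hae]
  refine hkj.trans ?_
  calc (C : ℝ≥0∞) * (ε' / (C + 1) : ℝ≥0) ≤ ε' := by
        norm_cast
        rw [mul_div_assoc', div_le_iff₀ (by positivity), mul_comm]
        gcongr
        exact le_self_add
    _ ≤ ε := by rw [hε't]; exact min_le_left _ _

/-- The constant sequence φ is admissible in the definition of the extension, so the distance
between commutator and extension is zero in the block norm. -/
lemma IsBlockCommutator.ae_eq_commutator (H : DualExponents p q t r a c τ R) (hn : 0 < n)
    (hb : MemBMO b) {φ k : Eu n → ℂ} (hφ : MemLcInfty φ) (h : IsBlockCommutator a c τ R S b φ k) :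
    k =ᵐ[volume] commutator S b φ := by
  have h1 := h.2.2 (fun _ => φ) (fun _ => hφ) (by
    rw [sub_self]
    exact tendsto_const_nhds.congr fun _ => (blockNorm_zero H hn).symm)
  have h2 := tendsto_nhds_unique h1 tendsto_const_nhds
  filter_upwards [eq_zero_of_blockNorm_eq_zero H hn
    ((aestronglyMeasurable_commutator S hb φ).sub h.2.1.1) h2.symm] with x hx
  exact (sub_eq_zero.1 hx).symm

end Test

/-! ### The weak formulation of the commutator on Bourgain–Morrey–Lorentz spaces -/

lemma enorm_integral_eq_of_nonneg {X : Type*} [MeasurableSpace X] {μ : Measure X} {F : X → ℂ}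
    (hF : Integrable F μ) (h : ∀ x, F x = (‖F x‖ : ℂ)) : ‖∫ x, F x ∂μ‖ₑ = ∫⁻ x, ‖F x‖ₑ ∂μ := by
  rw [← ofReal_integral_norm_eq_lintegral_enorm hF, integral_congr_ae (Eventually.of_forall h),
    integral_complex_ofReal, ← ofReal_norm, Complex.norm_real, Real.norm_eq_abs,
    abs_of_nonneg (integral_nonneg fun x => norm_nonneg _)]

section Weak

variable {n : ℕ} {p q t a c τ δ A : ℝ} {r R : ℝ≥0∞} {K : Eu n → Eu n → ℂ} {S : LTwo n →L[ℂ] LTwo n}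
  {b : Eu n → ℂ}

/-- `h = [b, S] f` tested against bounded functions with compact support. -/
def IsWeakCommutator (S : LTwo n →L[ℂ] LTwo n) (b f h : Eu n → ℂ) : Prop :=
  ∀ φ, MemLcInfty φ → Integrable (fun x => h x * φ x) volume ∧
    ∫ x, h x * φ x = -∫ x, f x * commutator (transposeL S) b φ x

/-- The normalized Lorentz norms of a function on dyadic cubes. -/
def cubeN (p q t : ℝ) (F : Eu n → ℝ≥0∞) (i : DyadicIndex n) : ℝ≥0∞ :=
  volume (dyadicCube i) ^ (1 / t - 1 / p) * lorN p q (volume.restrict (dyadicCube i)) F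

/-- On each cube with θ i ≠ 0 the converse of Hölder's inequality gives a bounded nearly norming
function for h. Scaled and multiplied by the phase of h it becomes φ i, of norm at most 2 θ i times
the power 1/t - 1/p of the volume, and with pairing at least θ i · y i. The weak relation moves
these pairings to f and the commutators of φ i. The y i are strict lower bounds because the norms of
h may be infinite a priori and norming functions need not exist. -/
lemma exists_tsum_mul_le_of_isWeakCommutator (H : DualExponents p q t r a c τ R) (hn : 0 < n)
    (hS : IsCZ δ A K S) (hb : MemBMO b) : ∃ C₀ C : ℝ≥0, ∀ f h : Eu n → ℂ,
      AEStronglyMeasurable f volume → AEStronglyMeasurable h volume → IsWeakCommutator S b f h →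
      ∀ θ y : DyadicIndex n → ℝ≥0,
        (∀ i, θ i ≠ 0 → C₀ * y i < cubeN p q t (fun x => ‖h x‖ₑ) i) →
        ∑' i, (θ i : ℝ≥0∞) * y i ≤
          C * (sn R.toReal (fun i => (θ i : ℝ≥0∞)) * mN p q t r fun x => ‖f x‖ₑ) := by
  have ha := H.hp.symm
  have hc := H.hq.symm
  obtain ⟨C₀, hC₀⟩ := exists_lorN_le_of_forall H.hp H.hq
  obtain ⟨C₁, hC₁⟩ := exists_tsum_lintegral_commutator_le H hn (isCZ_transposeL hS) hb
  refine ⟨C₀, C₁ * 2, fun f h hf hh hw θ y hy => ?_⟩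
  set u := 1 / t - 1 / p with hu
  have hV0 : ∀ (i : DyadicIndex n) (s : ℝ), volume (dyadicCube i) ^ s ≠ 0 := fun i s =>
    (ENNReal.rpow_pos (pos_iff_ne_zero.2 (volume_dyadicCube_ne_zero i)) (volume_dyadicCube_ne_top i)).ne'
  have hVt : ∀ (i : DyadicIndex n) (s : ℝ), volume (dyadicCube i) ^ s ≠ ∞ := fun i s =>
    ENNReal.rpow_ne_top_of_ne_zero (volume_dyadicCube_ne_zero i) (volume_dyadicCube_ne_top i)
  have hVV : ∀ i : DyadicIndex n, volume (dyadicCube i) ^ u * volume (dyadicCube i) ^ (-u) = 1 := fun i => by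
    rw [← ENNReal.rpow_add _ _ (volume_dyadicCube_ne_zero i) (volume_dyadicCube_ne_top i),
      add_neg_cancel, ENNReal.rpow_zero]
  have hex : ∀ i, ∃ g : Eu n → ℝ≥0∞, Measurable g ∧ (∃ M : ℝ≥0, ∀ x, g x ≤ M) ∧ (θ i ≠ 0 →
      y i * volume (dyadicCube i) ^ (-u) * lorN a c (volume.restrict (dyadicCube i)) g <
        ∫⁻ x in dyadicCube i, ‖h x‖ₑ * g x) := fun i => by
    by_cases h0 : θ i = 0
    · exact ⟨fun _ => 0, measurable_const, ⟨0, fun _ => zero_le⟩, fun h => absurd h0 h⟩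
    by_contra hcon
    push Not at hcon
    refine (hy i h0).not_ge ?_
    have h1 := hC₀ (volume.restrict (dyadicCube i)) (fun x => ‖h x‖ₑ) (y i * volume (dyadicCube i) ^ (-u))
      hh.restrict.enorm fun g hg hM => (hcon g hg hM).2
    calc cubeN p q t (fun x => ‖h x‖ₑ) i
        ≤ volume (dyadicCube i) ^ u * (C₀ * (y i * volume (dyadicCube i) ^ (-u))) := by
          unfold cubeN; gcongr
      _ = C₀ * y i * (volume (dyadicCube i) ^ u * volume (dyadicCube i) ^ (-u)) := by ring
      _ = C₀ * y i := by rw [hVV, mul_one]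
  choose g hgm hgM hg using hex
  set N : DyadicIndex n → ℝ≥0∞ := fun i => lorN a c (volume.restrict (dyadicCube i)) (g i) with hN
  have hNt : ∀ i, N i ≠ ∞ := fun i => by
    obtain ⟨M, hM⟩ := hgM i
    exact lorN_ne_top_of_bdd ha.pos hc.pos (A := univ)
      (by rw [Measure.restrict_apply_univ]; exact volume_dyadicCube_ne_top i)
      (fun x hx => absurd (mem_univ x) hx) ENNReal.coe_ne_top (Eventually.of_forall hM)
  have hN0 : ∀ i, θ i ≠ 0 → N i ≠ 0 := fun i h0 hN0 => by
    have h1 := hg i h0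
    have h2 : ∫⁻ x in dyadicCube i, ‖h x‖ₑ * g i x = 0 := by
      rw [lintegral_congr_ae (g := fun _ => 0), lintegral_zero]
      filter_upwards [eq_zero_of_lorN_eq_zero ha.pos hc.pos hN0] with x hx
      rw [hx, mul_zero]
    rw [h2] at h1
    exact not_lt_zero h1
  -- The scaling makes the Lorentz norm of k i · g i comparable to θ i times the block
  -- normalization.
  set k : DyadicIndex n → ℝ≥0 := fun i => (θ i * volume (dyadicCube i) ^ u * (N i)⁻¹).toNNReal with hk
  have hkt : ∀ i, (k i : ℝ≥0∞) * N i = θ i * volume (dyadicCube i) ^ u := fun i => by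
    by_cases h0 : θ i = 0
    · simp [hk, h0]
    · rw [hk]
      simp only
      rw [ENNReal.coe_toNNReal (ENNReal.mul_ne_top (ENNReal.mul_ne_top ENNReal.coe_ne_top (hVt i u))
        (ENNReal.inv_ne_top.2 (hN0 i h0))), mul_assoc, ENNReal.inv_mul_cancel (hN0 i h0) (hNt i), mul_one]
  set φ : DyadicIndex n → Eu n → ℂ := fun i =>
    (dyadicCube i).indicator fun x => ((k i * (g i x).toNNReal : ℝ≥0) : ℝ) * phase (h x) with hφ
  have hφm : ∀ i, AEStronglyMeasurable (φ i) volume := fun i => by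
    refine AEStronglyMeasurable.indicator (AEMeasurable.aestronglyMeasurable ?_) (measurableSet_dyadicCube i)
    refine AEMeasurable.mul (Measurable.aemeasurable ?_) (measurable_phase.comp_aemeasurable hh.aemeasurable)
    exact Complex.measurable_ofReal.comp (measurable_const.mul (hgm i).ennreal_toNNReal).coe_nnreal_real
  have hφle : ∀ i x, ‖φ i x‖ₑ ≤ (dyadicCube i).indicator (fun x => k i * g i x) x := fun i x => by
    by_cases hx : x ∈ dyadicCube i
    · rw [indicator_of_mem hx, hφ]
      simp only [indicator_of_mem hx, enorm_mul]
      obtain ⟨M, hM⟩ := hgM i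
      have e1 : ‖(((k i * (g i x).toNNReal : ℝ≥0) : ℝ) : ℂ)‖ₑ = k i * g i x := by
        have : ‖(((k i * (g i x).toNNReal : ℝ≥0) : ℝ) : ℂ)‖₊ = k i * (g i x).toNNReal := by ext; simp
        rw [enorm_eq_nnnorm, this, ENNReal.coe_mul,
          ENNReal.coe_toNNReal (ne_top_of_le_ne_top ENNReal.coe_ne_top (hM x))]
      rw [e1]
      refine mul_le_of_le_one_right' ?_
      rw [← ofReal_norm, ENNReal.ofReal_le_one]
      exact norm_phase_le _
    · simp [hφ, hx]
  have hφL : ∀ i, MemLcInfty (φ i) := fun i => by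
    obtain ⟨M, hM⟩ := hgM i
    refine memLcInfty_of_bounded (isBounded_dyadicCube i) (hφm i) (fun x hx => indicator_of_notMem hx _)
      (M := k i * M) (Eventually.of_forall fun x => (hφle i x).trans
        ((indicator_le_self' (fun _ _ => zero_le) x).trans ?_))
    rw [ENNReal.coe_mul]
    gcongr
    exact hM x
  have hfam : IsBlockFamily a c u id φ (fun i => 2 * θ i) (fun i => 2 * θ i) := by
    refine ⟨hφm, fun i x hx => indicator_of_notMem hx _, fun i => ?_, fun j => ?_⟩
    · calc _ ≤ lorN a c (volume.restrict (dyadicCube i)) fun x => k i * g i x := by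
            rw [lorN_restrict (measurableSet_dyadicCube i)]
            exact lorN_mono hc.pos ha.pos (hφle i)
        _ ≤ 2 * k i * N i := lorN_const_mul_le ha.pos hc.pos _ ENNReal.coe_ne_top
        _ = _ := by rw [mul_assoc, hkt, ← mul_assoc]; rfl
    · rw [preimage_id, tsum_singleton j fun i => 2 * (θ i : ℝ≥0∞)]
  have hkey : ∀ i, (θ i : ℝ≥0∞) * y i ≤ ∫⁻ x, ‖commutator (transposeL S) b (φ i) x‖ₑ * ‖f x‖ₑ := fun i => by
    by_cases h0 : θ i = 0
    · simp [h0]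
    obtain ⟨hi, he⟩ := hw (φ i) (hφL i)
    obtain ⟨M, hM⟩ := hgM i
    have e1 : ∀ x, h x * φ i x =
        (((dyadicCube i).indicator (fun x => (k i * (g i x).toNNReal : ℝ) * ‖h x‖) x : ℝ) : ℂ) := fun x => by
      by_cases hx : x ∈ dyadicCube i
      · simp only [hφ, indicator_of_mem hx]
        push_cast
        rw [mul_left_comm, mul_phase]
      · simp [hφ, hx]
    have e2 : ∀ x, h x * φ i x = (‖h x * φ i x‖ : ℂ) := fun x => by
      rw [e1, Complex.norm_real, Real.norm_of_nonneg]
      exact indicator_nonneg (fun x _ => by positivity) x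
    have e3 : ∀ x, ‖h x * φ i x‖ₑ = (dyadicCube i).indicator (fun x => k i * (‖h x‖ₑ * g i x)) x := fun x => by
      rw [e1, ← ofReal_norm, Complex.norm_real, Real.norm_of_nonneg
        (indicator_nonneg (fun x _ => by positivity) x)]
      by_cases hx : x ∈ dyadicCube i
      · simp only [indicator_of_mem hx]
        rw [ENNReal.ofReal_mul (by positivity), ENNReal.ofReal_mul (by positivity), ENNReal.ofReal_coe_nnreal,
          ENNReal.ofReal_coe_nnreal, ENNReal.coe_toNNReal (ne_top_of_le_ne_top ENNReal.coe_ne_top (hM x)),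
          ofReal_norm]
        ring
      · simp [hx]
    have e4 := enorm_integral_eq_of_nonneg hi e2
    simp_rw [e3] at e4
    rw [lintegral_indicator (measurableSet_dyadicCube i), lintegral_const_mul' _ _ ENNReal.coe_ne_top] at e4
    calc (θ i : ℝ≥0∞) * y i = k i * (y i * volume (dyadicCube i) ^ (-u) * N i) := by
          rw [show (k i : ℝ≥0∞) * (y i * volume (dyadicCube i) ^ (-u) * N i) =
            (k i * N i) * (y i * volume (dyadicCube i) ^ (-u)) by ring, hkt,
            show (θ i : ℝ≥0∞) * volume (dyadicCube i) ^ u * (y i * volume (dyadicCube i) ^ (-u)) =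
              θ i * y i * (volume (dyadicCube i) ^ u * volume (dyadicCube i) ^ (-u)) by ring, hVV, mul_one]
      _ ≤ k i * ∫⁻ x in dyadicCube i, ‖h x‖ₑ * g i x := by gcongr; exact (hg i h0).le
      _ = ‖∫ x, h x * φ i x‖ₑ := e4.symm
      _ = ‖∫ x, f x * commutator (transposeL S) b (φ i) x‖ₑ := by rw [he, enorm_neg]
      _ ≤ ∫⁻ x, ‖f x * commutator (transposeL S) b (φ i) x‖ₑ := enorm_integral_le_lintegral_enorm _
      _ = _ := by simp_rw [enorm_mul, mul_comm]
  refine (ENNReal.tsum_le_tsum hkey).trans ((hC₁ id φ _ _ hfam hφL _ hf.enorm).trans (le_of_eq ?_))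
  rw [sn_const_mul H.pos]
  push_cast
  ring

/-- The main a priori estimate. -/
lemma exists_mN_le_of_isWeakCommutator (H : DualExponents p q t r a c τ R) (hn : 0 < n)
    (hS : IsCZ δ A K S) (hb : MemBMO b) : ∃ C : ℝ≥0, ∀ f h : Eu n → ℂ,
      AEStronglyMeasurable f volume → AEStronglyMeasurable h volume → IsWeakCommutator S b f h →
      mN p q t r (fun x => ‖f x‖ₑ) ≠ ∞ →
      mN p q t r (fun x => ‖h x‖ₑ) ≤ C * mN p q t r fun x => ‖f x‖ₑ := by
  obtain ⟨C₀, C, hC⟩ := exists_tsum_mul_le_of_isWeakCommutator H hn hS hb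
  have hρ := H.pos
  refine ⟨2 * (C₀ + 1) * C, fun f h hf hh hw hft => ?_⟩
  set B := mN p q t r fun x => ‖f x‖ₑ with hB
  set m := cubeN p q t fun x => ‖h x‖ₑ with hm
  -- Testing with θ concentrated on one cube shows first that each local norm of h is finite; this
  -- already settles r = ∞.
  have hsingle : ∀ i, m i ≤ (C₀ + 1 : ℝ≥0) * (C * B) := fun i => by
    by_contra hcon
    rw [not_le, mul_comm, ← ENNReal.lt_div_iff_mul_lt (by left; simp) (by left; simp)] at hcon
    obtain ⟨y, hy1, hy2⟩ := ENNReal.lt_iff_exists_nnreal_btwn.1 hcon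
    refine hy1.not_ge ?_
    rw [ENNReal.lt_div_iff_mul_lt (by left; simp) (by left; simp)] at hy2
    classical
    have h1 := hC f h hf hh hw (Pi.single i 1) (fun _ => y) fun j hj => by
      have hji : j = i := by
        by_contra hne
        exact hj (Pi.single_eq_of_ne hne _)
      subst hji
      refine lt_of_le_of_lt ?_ hy2
      rw [mul_comm]
      gcongr
      exact_mod_cast le_self_add
    have h2 : sn R.toReal (fun j => ((Pi.single i 1 : DyadicIndex n → ℝ≥0) j : ℝ≥0∞)) = 1 := by
      unfold sn
      rw [tsum_eq_single i fun j hj => by simp [Pi.single_eq_of_ne hj, ENNReal.zero_rpow_of_pos hρ]]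
      simp
    rw [tsum_eq_single i fun j hj => by simp [Pi.single_eq_of_ne hj], h2] at h1
    simpa using h1
  have hmt : ∀ i, m i ≠ ∞ := fun i => ne_top_of_le_ne_top (ENNReal.mul_ne_top ENNReal.coe_ne_top
    (ENNReal.mul_ne_top ENNReal.coe_ne_top hft)) (hsingle i)
  have hmN : mN p q t r (fun x => ‖h x‖ₑ) = seqNorm r m := rfl
  rw [hmN]
  rcases H.hr with ⟨hr, -⟩ | ⟨hr, hrR⟩
  · rw [seqNorm, if_pos hr]
    refine iSup_le fun i => (hsingle i).trans ?_
    rw [← mul_assoc]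
    gcongr
    norm_cast
    gcongr
    exact le_mul_of_one_le_left' one_le_two
  · have hr0 := hrR.pos
    have hr1 := hrR.lt
    rw [seqNorm_eq_sn hr]
    set s := r.toReal
    set ρ := R.toReal
    -- With y = m / D one has C₀ y i < m i wherever y i ≠ 0, as the discretized duality requires.
    set D : ℝ≥0 := 2 * (C₀ + 1) with hD
    have hD0 : (D : ℝ≥0∞) ≠ 0 := by simp [hD]
    set y : DyadicIndex n → ℝ≥0 := fun i => (m i / D).toNNReal with hy
    have hyt : ∀ i, (y i : ℝ≥0∞) = m i / D := fun i =>
      ENNReal.coe_toNNReal (ENNReal.div_ne_top (hmt i) hD0)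
    have hym : ∀ i, D * (y i : ℝ≥0∞) = m i := fun i => by
      rw [hyt, ENNReal.mul_div_cancel hD0 ENNReal.coe_ne_top]
    have hfin : ∀ F : Finset (DyadicIndex n), ∑ i ∈ F, (y i : ℝ≥0∞) ^ s ≤ (C * B) ^ s := fun F => by
      classical
      set Z := ∑ i ∈ F, (y i : ℝ≥0∞) ^ s with hZ
      have hZt : Z ≠ ∞ := ENNReal.sum_ne_top.2 fun i _ => ENNReal.rpow_ne_top_of_nonneg hr0.le ENNReal.coe_ne_top
      -- The extremal sequence y^{s-1} for ℓ^s duality, cut to a finite set so that Z is finite and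
      -- its power 1/ρ can be cancelled.
      set θ : DyadicIndex n → ℝ≥0 := fun i => if i ∈ F then y i ^ (s - 1) else 0 with hθ
      have h1 := hC f h hf hh hw θ y fun i hi => by
        have hy0 : y i ≠ 0 := fun h0 => hi (by
          simp only [hθ, h0, NNReal.zero_rpow (by linarith : s - 1 ≠ 0), ite_self])
        have h2 : (C₀ * y i : ℝ≥0) < D * y i := by
          have : C₀ < D := by
            rw [hD, mul_add, two_mul, add_assoc]
            exact lt_add_of_pos_right _ (by positivity)
          exact mul_lt_mul_of_pos_right this (pos_iff_ne_zero.2 hy0)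
        calc (C₀ : ℝ≥0∞) * y i < D * y i := by exact_mod_cast h2
          _ = _ := hym i
      have e1 : ∑' i, (θ i : ℝ≥0∞) * y i = Z := by
        rw [tsum_eq_sum (s := F) fun i hi => by simp [hθ, hi]]
        refine Finset.sum_congr rfl fun i hi => ?_
        simp only [hθ, if_pos hi]
        rw [ENNReal.coe_rpow_of_nonneg _ (by linarith)]
        nth_rw 2 [← ENNReal.rpow_one (y i : ℝ≥0∞)]
        rw [← ENNReal.rpow_add_of_nonneg _ _ (by linarith) (by norm_num), sub_add_cancel]
      have e2 : sn ρ (fun i => (θ i : ℝ≥0∞)) = Z ^ (1 / ρ) := by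
        unfold sn
        rw [tsum_eq_sum (s := F) fun i hi => by simp [hθ, hi, ENNReal.zero_rpow_of_pos hρ]]
        congr 1
        refine Finset.sum_congr rfl fun i hi => ?_
        simp only [hθ, if_pos hi]
        rw [ENNReal.coe_rpow_of_nonneg _ (by linarith), ← ENNReal.rpow_mul, hrR.sub_one_mul_conj]
      rw [e1, e2] at h1
      rcases eq_or_ne Z 0 with hZ0 | hZ0
      · rw [hZ0]; exact zero_le
      have hZs : Z ^ (1 / s) ≤ C * B := by
        have e3 : Z = Z ^ (1 / ρ) * Z ^ (1 / s) := by
          rw [← ENNReal.rpow_add _ _ hZ0 hZt, one_div, one_div, add_comm, hrR.inv_add_inv_eq_one, ENNReal.rpow_one]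
        have h2 : Z ^ (1 / ρ) * Z ^ (1 / s) ≤ Z ^ (1 / ρ) * (C * B) := by
          rw [← e3]; refine h1.trans (le_of_eq ?_); ring
        exact (ENNReal.mul_le_mul_iff_right (ENNReal.rpow_pos (pos_iff_ne_zero.2 hZ0) hZt).ne'
          (ENNReal.rpow_ne_top_of_nonneg (by positivity) hZt)).1 h2
      calc Z = (Z ^ (1 / s)) ^ s := by rw [← ENNReal.rpow_mul, one_div_mul_cancel hr0.ne', ENNReal.rpow_one]
        _ ≤ _ := ENNReal.rpow_le_rpow hZs hr0.le
    have hsn : sn s (fun i => (y i : ℝ≥0∞)) ≤ C * B := by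
      calc _ ≤ ((C * B) ^ s) ^ (1 / s) := by
            unfold sn
            refine ENNReal.rpow_le_rpow ?_ (by positivity)
            rw [ENNReal.tsum_eq_iSup_sum]
            exact iSup_le hfin
        _ = _ := by rw [← ENNReal.rpow_mul, mul_one_div_cancel hr0.ne', ENNReal.rpow_one]
    calc sn s m = sn s (fun i => D * (y i : ℝ≥0∞)) := by congr 1; ext i; exact (hym i).symm
      _ = D * sn s (fun i => (y i : ℝ≥0∞)) := sn_const_mul hr0 _ _
      _ ≤ D * (C * B) := by gcongr
      _ = _ := by push_cast; ring

end Weak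

/-! ### Construction of the weak commutator. -/

section Existence

variable {n : ℕ} {p q t a c τ δ A : ℝ} {r R : ℝ≥0∞} {K : Eu n → Eu n → ℂ} {S : LTwo n →L[ℂ] LTwo n}
  {b : Eu n → ℂ}

lemma cubeN_le_mN (H : DualExponents p q t r a c τ R) (F : Eu n → ℝ≥0∞) (i : DyadicIndex n) :
    cubeN p q t F i ≤ mN p q t r F := by
  change _ ≤ seqNorm r (cubeN p q t F)
  rcases H.hr with ⟨hr, -⟩ | ⟨hr, hrR⟩
  · rw [seqNorm, if_pos hr]; exact le_iSup (cubeN p q t F) i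
  · rw [seqNorm_eq_sn hr]; exact le_sn hrR.pos _ i

/-- The commutator on a cube of a function supported on a shell around this cube. -/
lemma exists_setLIntegral_commutator_le (hn : 0 < n) (hS : IsCZ δ A K S) (hb : MemBMO b)
    (hp : p.HolderConjugate a) (hq : q.HolderConjugate c) : ∃ C : ℝ≥0,
    ∀ (i : DyadicIndex n) (kv : ℕ × (Fin n → Fin 3)) (g : Eu n → ℂ), MemLcInfty g →
      (∀ x, x ∉ shell i kv → g x = 0) → ∫⁻ x in dyadicCube i, ‖commutator S b g x‖ₑ ≤
        C * ((1 + kv.1) * tp (-(kv.1 * n * (1 - 1 / a))) * volume (dyadicCube i) ^ (1 / a)) *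
          lorN p q volume fun x => ‖g x‖ₑ := by
  have hSt := isCZ_transposeL hS
  obtain ⟨C₁, hC₁⟩ := exists_lorentz_holder hp hq
  obtain ⟨C₂, hC₂⟩ := exists_lorN_commutator_shell_le hn hSt hb hp.symm.lt hq.symm.pos
  obtain ⟨C₃, hC₃⟩ := exists_lorN_const_le hp.symm.pos hq.symm.pos
  refine ⟨C₁ * C₂ * C₃, fun i kv g hg hsupp => ?_⟩
  have hQ := measurableSet_dyadicCube i
  -- The conjugate phase turns the L¹ norm on the cube into a pairing with a bounded function
  -- supported there.
  set φ : Eu n → ℂ := (dyadicCube i).indicator fun x => phase (commutator S b g x) with hφ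
  have hcm : ∀ (T : LTwo n →L[ℂ] LTwo n) (g : Eu n → ℂ), AEStronglyMeasurable (commutator T b g) volume :=
    fun T g => aestronglyMeasurable_commutator T hb g
  have hφle : ∀ x, ‖φ x‖ₑ ≤ (dyadicCube i).indicator (fun _ => 1) x := fun x => by
    by_cases hx : x ∈ dyadicCube i
    · rw [hφ, indicator_of_mem hx, indicator_of_mem hx, ← ofReal_norm, ENNReal.ofReal_le_one]
      exact norm_phase_le _
    · simp [hφ, hx]
  have hφL : MemLcInfty φ := memLcInfty_of_bounded (isBounded_dyadicCube i)
    ((measurable_phase.comp_aemeasurable (hcm S g).aemeasurable).aestronglyMeasurable.indicator hQ)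
    (fun x hx => indicator_of_notMem hx _) (M := 1) (Eventually.of_forall fun x =>
      (hφle x).trans (indicator_le_self' (fun _ _ => zero_le) x))
  have e1 : ∀ x, φ x * commutator S b g x =
      (((dyadicCube i).indicator (fun x => ‖commutator S b g x‖) x : ℝ) : ℂ) := fun x => by
    by_cases hx : x ∈ dyadicCube i
    · simp only [hφ, indicator_of_mem hx]
      rw [mul_comm, mul_phase]
    · simp [hφ, hx]
  have e2 : ∀ x, ‖φ x * commutator S b g x‖ = (dyadicCube i).indicator (fun x => ‖commutator S b g x‖) x :=
    fun x => by
      rw [e1, Complex.norm_real, Real.norm_of_nonneg (indicator_nonneg (fun x _ => norm_nonneg _) x)]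
  have e3 : ∀ x, ‖φ x * commutator S b g x‖ₑ =
      (dyadicCube i).indicator (fun x => ‖commutator S b g x‖ₑ) x := fun x => by
    rw [← ofReal_norm, e2]
    by_cases hx : x ∈ dyadicCube i
    · simp only [indicator_of_mem hx, ofReal_norm]
    · simp [hx]
  have hint : Integrable (fun x => φ x * commutator S b g x) volume := by
    refine ⟨hφL.1.1.mul (hcm S g), ?_⟩
    rw [hasFiniteIntegral_iff_enorm]
    have h := hC₁ volume (fun x => ‖φ x‖ₑ) (fun x => ‖commutator S b g x‖ₑ) hφL.1.1.enorm (hcm S g).enorm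
    simp_rw [enorm_mul]
    exact h.trans_lt (ENNReal.mul_lt_top ENNReal.coe_lt_top (ENNReal.mul_lt_top
      (hφL.lorN_ne_top hp.pos hq.pos).lt_top
      (lorN_commutator_ne_top hn hS hb hp.symm.lt hq.symm.lt hg).lt_top))
  have e4 := enorm_integral_eq_of_nonneg hint fun x => by rw [e2, e1]
  simp_rw [e3] at e4
  rw [lintegral_indicator hQ] at e4
  have hsh := measurableSet_shell i kv
  -- Moving the commutator to φ exchanges source and target: the shell estimate for the transpose
  -- applies to φ, which lives on the cube.
  rw [← e4, ← enorm_neg, ← integral_commutator_transpose hn hb hφL hg]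
  calc _ ≤ ∫⁻ x, ‖commutator (transposeL S) b φ x * g x‖ₑ := enorm_integral_le_lintegral_enorm _
    _ = ∫⁻ x, ‖g x‖ₑ * (shell i kv).indicator (fun x => ‖commutator (transposeL S) b φ x‖ₑ) x := by
        refine lintegral_congr fun x => ?_
        by_cases hx : x ∈ shell i kv
        · rw [indicator_of_mem hx, enorm_mul, mul_comm]
        · rw [hsupp x hx]; simp
    _ ≤ C₁ * (lorN p q volume (fun x => ‖g x‖ₑ) * lorN a c volume
          ((shell i kv).indicator fun x => ‖commutator (transposeL S) b φ x‖ₑ)) :=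
        hC₁ _ _ _ hg.1.1.enorm ((hcm _ _).enorm.indicator hsh)
    _ ≤ C₁ * (lorN p q volume (fun x => ‖g x‖ₑ) * (C₂ * ((1 + kv.1) * tp (-(kv.1 * n * (1 - 1 / a)))) *
          (C₃ * volume (dyadicCube i) ^ (1 / a)))) := by
        gcongr
        refine (hC₂ i kv φ hφL fun x hx => indicator_of_notMem hx _).trans ?_
        gcongr
        refine (lorN_mono hq.symm.pos hp.symm.pos hφle).trans ?_
        rw [← lorN_restrict hQ]
        refine (hC₃ _ 1 ENNReal.one_ne_top).trans (le_of_eq ?_)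
        rw [one_mul, Measure.restrict_apply_univ]
    _ = _ := by push_cast; ring

/-- The commutator on a fixed cube. -/
lemma exists_local_commutator (H : DualExponents p q t r a c τ R) (hn : 0 < n) (hS : IsCZ δ A K S)
    (hb : MemBMO b) {f : Eu n → ℂ} (hf : AEStronglyMeasurable f volume)
    (hft : mN p q t r (fun x => ‖f x‖ₑ) ≠ ∞) (i : DyadicIndex n) : ∃ h : Eu n → ℂ,
      AEStronglyMeasurable h volume ∧ ∀ φ, MemLcInfty φ → (∀ x, x ∉ dyadicCube i → φ x = 0) →
        Integrable (fun x => h x * φ x) volume ∧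
          ∫ x, h x * φ x = -∫ x, f x * commutator (transposeL S) b φ x := by
  have hSt := isCZ_transposeL hS
  have ht := H.ht.pos
  obtain ⟨C, hC⟩ := exists_setLIntegral_commutator_le hn hS hb H.hp H.hq
  obtain ⟨W, hW⟩ := exists_tsum_shell_weight hn (ε := 1 / t) (by positivity)
  set u := 1 / t - 1 / p with hu
  set B := mN p q t r fun x => ‖f x‖ₑ with hB
  set F : ℕ × (Fin n → Fin 3) → Eu n → ℂ := fun kv => (shell i kv).indicator f with hF
  have hFm : ∀ kv, AEStronglyMeasurable (F kv) volume := fun kv => hf.indicator (measurableSet_shell _ _)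
  have hFn : ∀ kv : ℕ × (Fin n → Fin 3), lorN p q volume (fun x => ‖F kv x‖ₑ) ≤
      tp (-(kv.1 * n * u)) * (volume (dyadicCube i) ^ (-u) * B) := fun kv => by
    set j := nb kv.2 (anc kv.1 i)
    have h1 := cubeN_le_mN H (fun x => ‖f x‖ₑ) j
    have hV : volume (dyadicCube j) = tp (kv.1 * n) * volume (dyadicCube i) := by
      rw [volume_nb, volume_anc]
    calc _ ≤ lorN p q (volume.restrict (dyadicCube j)) fun x => ‖f x‖ₑ := by
          rw [lorN_restrict (measurableSet_dyadicCube j)]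
          refine lorN_mono H.hq.pos H.hp.pos fun x => ?_
          simp only [hF]
          rw [enorm_indicator_eq_indicator_enorm]
          exact indicator_le_indicator_of_subset (shell_subset i kv) (fun _ => zero_le) x
      _ = volume (dyadicCube j) ^ (-u) * cubeN p q t (fun x => ‖f x‖ₑ) j := by
          rw [cubeN, ← mul_assoc, ← ENNReal.rpow_add _ _ (volume_dyadicCube_ne_zero _)
            (volume_dyadicCube_ne_top _), neg_add_cancel, ENNReal.rpow_zero, one_mul]
      _ ≤ volume (dyadicCube j) ^ (-u) * B := by gcongr
      _ = _ := by
          rw [hV, ENNReal.mul_rpow_of_ne_zero (tp_ne_zero _) (volume_dyadicCube_ne_zero _), tp_rpow, mul_assoc]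
          congr 2; ring
  have hVt : ∀ s : ℝ, volume (dyadicCube i) ^ s ≠ ∞ := fun s =>
    ENNReal.rpow_ne_top_of_ne_zero (volume_dyadicCube_ne_zero i) (volume_dyadicCube_ne_top i)
  choose L hLm hLM hLs using fun kv => exists_levels H.hp.pos H.hq.pos (hFm kv)
    (ne_top_of_le_ne_top (ENNReal.mul_ne_top (tp_ne_top _) (ENNReal.mul_ne_top (hVt _) hft)) (hFn kv))
  -- The function f is cut into shells around the cube and each shell into bounded levels, so that
  -- the commutator is defined on every piece.
  set g : (ℕ × (Fin n → Fin 3)) × ℕ → Eu n → ℂ := fun z => (L z.1 ⁻¹' {z.2}).indicator (F z.1) with hg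
  have hg0 : ∀ z x, x ∉ shell i z.1 → g z x = 0 := fun z x hx => by simp [hg, hF, hx]
  have hgL : ∀ z, MemLcInfty (g z) := fun z => by
    obtain ⟨M, hM⟩ := hLM z.1 z.2
    refine memLcInfty_of_bounded ((isBounded_dyadicCube _).subset (shell_subset i z.1))
      ((hFm z.1).indicator₀ (hLm _ _)) (hg0 z) (M := M) (Eventually.of_forall fun x => ?_)
    by_cases hx : x ∈ L z.1 ⁻¹' {z.2}
    · simp only [hg]; rw [indicator_of_mem hx]; exact hM x hx
    · simp only [hg]; rw [indicator_of_notMem hx]; simp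
  have hcm : ∀ (T : LTwo n →L[ℂ] LTwo n) (g : Eu n → ℂ), AEStronglyMeasurable (commutator T b g) volume :=
    fun T g => aestronglyMeasurable_commutator T hb g
  -- The commutator decays like (1+k)2^{-kn/p} in the shell, while the norm of f there is of order
  -- at most 2^{-kn(1/t-1/p)}; the product (1+k)2^{-kn/t} is summable.
  have hsum : ∑' z, ∫⁻ x in dyadicCube i, ‖commutator S b (g z) x‖ₑ ≠ ∞ := by
    set D := (C : ℝ≥0∞) * volume (dyadicCube i) ^ (1 / a) * (3 * (volume (dyadicCube i) ^ (-u) * B)) with hD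
    have hDt : D ≠ ∞ := ENNReal.mul_ne_top (ENNReal.mul_ne_top ENNReal.coe_ne_top (hVt _))
      (ENNReal.mul_ne_top (by norm_num) (ENNReal.mul_ne_top (hVt _) hft))
    refine ne_top_of_le_ne_top (ENNReal.mul_ne_top (ENNReal.coe_ne_top (r := W)) hDt) ?_
    rw [ENNReal.tsum_prod' (f := fun z => ∫⁻ x in dyadicCube i, ‖commutator S b (g z) x‖ₑ), ← hW,
      ← ENNReal.tsum_mul_right]
    refine ENNReal.tsum_le_tsum fun kv => ?_
    refine (ENNReal.tsum_le_tsum fun l => hC i kv (g (kv, l)) (hgL _) (hg0 (kv, l))).trans ?_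
    rw [ENNReal.tsum_mul_left]
    have ep := H.hp.inv_add_inv_eq_one
    calc _ ≤ C * ((1 + kv.1) * tp (-(kv.1 * n * (1 - 1 / a))) * volume (dyadicCube i) ^ (1 / a)) *
          (3 * (tp (-(kv.1 * n * u)) * (volume (dyadicCube i) ^ (-u) * B))) := by
          gcongr
          exact (hLs kv).trans (by gcongr; exact hFn kv)
      _ = (1 + kv.1) * (tp (-(kv.1 * n * (1 - 1 / a))) * tp (-(kv.1 * n * u))) * D := by rw [hD]; ring
      _ = _ := by
          rw [← tp_add, show 1 - 1 / a = 1 / p by simp only [one_div]; linarith]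
          congr 3; rw [hu]; ring
  refine ⟨fun x => ∑' z, commutator S b (g z) x, aestronglyMeasurable_tsum fun z => hcm _ _,
    fun φ hφ hφ0 => ?_⟩
  have hgx : ∀ {M : Type} [AddCommMonoid M] [TopologicalSpace M] (G : Eu n → M) (x : Eu n),
      ∑' kv, ∑' l, (L kv ⁻¹' {l}).indicator ((shell i kv).indicator G) x = G x := fun G x => by
    simp_rw [tsum_indicator_preimage, tsum_shell_indicator]
  have hm1 : ∀ z, AEStronglyMeasurable (fun x => commutator S b (g z) x * φ x) volume :=
    fun z => (hcm S (g z)).mul hφ.1.1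
  have hm2 : ∀ z, AEStronglyMeasurable (fun x => g z x * commutator (transposeL S) b φ x) volume :=
    fun z => (hgL z).1.1.mul (hcm _ φ)
  have hs1 : ∑' z, ∫⁻ x, ‖commutator S b (g z) x * φ x‖ₑ ≠ ∞ := by
    obtain ⟨M, hM⟩ := hφ.exists_bound
    refine ne_top_of_le_ne_top (ENNReal.mul_ne_top hsum (ENNReal.coe_ne_top (r := M))) ?_
    rw [← ENNReal.tsum_mul_right]
    refine ENNReal.tsum_le_tsum fun z => ?_
    rw [← lintegral_mul_const' _ _ ENNReal.coe_ne_top, ← lintegral_indicator (measurableSet_dyadicCube i)]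
    refine lintegral_mono_ae ?_
    filter_upwards [hM] with x hx
    by_cases hxi : x ∈ dyadicCube i
    · rw [indicator_of_mem hxi, enorm_mul]; gcongr
    · rw [hφ0 x hxi]; simp
  have hs2 : ∑' z, ∫⁻ x, ‖g z x * commutator (transposeL S) b φ x‖ₑ ≠ ∞ := by
    rw [← lintegral_tsum fun z => (hm2 z).enorm]
    refine ne_top_of_le_ne_top (lintegral_commutator_mul_ne_top H hn hSt hb hφ hf.enorm hft)
      (le_of_eq (lintegral_congr fun x => ?_))
    simp_rw [enorm_mul]
    rw [ENNReal.tsum_mul_right, mul_comm, ENNReal.tsum_prod' (f := fun z => ‖g z x‖ₑ)]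
    congr 1
    rw [← hgx (fun x => ‖f x‖ₑ) x]
    refine tsum_congr fun kv => tsum_congr fun l => ?_
    simp only [hg, hF, enorm_indicator_eq_indicator_enorm]
  have e1 : (fun x => (∑' z, commutator S b (g z) x) * φ x) = fun x => ∑' z, commutator S b (g z) x * φ x := by
    ext x; exact tsum_mul_right.symm
  have e2 : (fun x => f x * commutator (transposeL S) b φ x) =
      fun x => ∑' z, g z x * commutator (transposeL S) b φ x := by
    ext x
    have hfin : ∑' z, ‖g z x‖ₑ ≠ ∞ := by
      rw [ENNReal.tsum_prod' (f := fun z => ‖g z x‖ₑ)]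
      simp only [hg, hF, enorm_indicator_eq_indicator_enorm]
      rw [hgx (fun x => ‖f x‖ₑ) x]
      exact enorm_ne_top
    have hsm : Summable fun z => g z x := (tsum_enorm_ne_top_iff_summable_norm.1 hfin).of_norm
    rw [tsum_mul_right, hsm.tsum_prod]
    simp only [hg, hF]
    rw [hgx]
  rw [e1, e2, integral_tsum hm1 hs1, integral_tsum hm2 hs2, ← tsum_neg]
  refine ⟨integrable_tsum hm1 hs1, tsum_congr fun z => ?_⟩
  have h3 := integral_commutator_transpose (S := S) hn hb hφ (hgL z)
  simp_rw [mul_comm (g z _), h3, neg_neg, mul_comm (φ _)]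

lemma MemLcInfty.exists_eq_sum_indicator {φ : Eu n → ℂ} (hφ : MemLcInfty φ) :
    ∃ s : Finset (Fin n → ℤ), φ = ∑ m ∈ s, (dyadicCube ((0, m) : DyadicIndex n)).indicator φ := by
  classical
  obtain ⟨M, hM⟩ := hφ.isBounded.exists_norm_le
  obtain ⟨N, hN⟩ := exists_nat_ge M
  refine ⟨Fintype.piFinset fun _ => Finset.Icc (-(N + 1 : ℤ)) (N + 1), ?_⟩
  ext x
  rw [Finset.sum_apply]
  by_cases hx : φ x = 0
  · rw [hx]; symm
    exact Finset.sum_eq_zero fun m _ => by rw [indicator_apply_eq_zero]; exact fun _ => hx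
  have hQ := mem_idxAt (n := n) 0 x
  rw [Finset.sum_eq_single (idxAt 0 x).2]
  · exact (indicator_of_mem (s := dyadicCube (((0 : ℤ), (idxAt 0 x).2) : DyadicIndex n)) hQ φ).symm
  · intro m _ hm
    refine indicator_of_notMem (fun h => hm ?_) φ
    exact (congrArg Prod.snd (mem_dyadicCube_iff.1 h)).symm
  · intro h
    refine absurd (Fintype.mem_piFinset.2 fun l => ?_) h
    have h1 := abs_le.1 ((PiLp.norm_apply_le x l).trans ((hM x hx).trans hN))
    simp only [idxAt, zpow_zero, one_mul, Finset.mem_Icc]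
    constructor
    · rw [Int.le_floor]; push_cast; linarith
    · have := (Int.floor_le (x l)).trans h1.2
      have h2 : ⌊x l⌋ ≤ (N : ℤ) := (Int.cast_le (R := ℝ)).1 (by push_cast; exact this)
      omega

/-- The local solutions on unit cubes are glued. A test function meets only finitely many unit
cubes, so the weak relation follows by finite additivity. -/
lemma exists_isWeakCommutator (H : DualExponents p q t r a c τ R) (hn : 0 < n) (hS : IsCZ δ A K S)
    (hb : MemBMO b) {f : Eu n → ℂ} (hf : AEStronglyMeasurable f volume)
    (hft : mN p q t r (fun x => ‖f x‖ₑ) ≠ ∞) :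
    ∃ h : Eu n → ℂ, AEStronglyMeasurable h volume ∧ IsWeakCommutator S b f h := by
  choose h hm hw using fun m : Fin n → ℤ => exists_local_commutator H hn hS hb hf hft ((0, m) : DyadicIndex n)
  set Q : (Fin n → ℤ) → Set (Eu n) := fun m => dyadicCube ((0, m) : DyadicIndex n) with hQ
  have hQm : ∀ m, MeasurableSet (Q m) := fun m => measurableSet_dyadicCube _
  set k : Eu n → ℂ := fun x => ∑' m, (Q m).indicator (h m) x with hk
  have hkx : ∀ m x, x ∈ Q m → k x = h m x := fun m x hx => by
    simp only [hk]
    rw [tsum_eq_single m, indicator_of_mem hx]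
    intro m' hm'
    refine indicator_of_notMem (fun hx' => hm' ?_) _
    have h1 : x ∈ dyadicCube ((0, m') : DyadicIndex n) := hx'
    have h2 : x ∈ dyadicCube ((0, m) : DyadicIndex n) := hx
    have h3 := mem_dyadicCube_iff.1 h1
    have h4 := mem_dyadicCube_iff.1 h2
    exact congrArg Prod.snd (h3.symm.trans h4)
  refine ⟨k, aestronglyMeasurable_tsum fun m => (hm m).indicator (hQm m), fun φ hφ => ?_⟩
  obtain ⟨s, hs⟩ := hφ.exists_eq_sum_indicator
  have hφm : ∀ m, MemLcInfty ((Q m).indicator φ) := fun m => hφ.indicator (hQm m)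
  have hw' := fun m => hw m ((Q m).indicator φ) (hφm m) fun x hx => indicator_of_notMem hx φ
  have e1 : (fun x => k x * φ x) = fun x => ∑ m ∈ s, h m x * (Q m).indicator φ x := by
    ext x
    have hsx := congrFun hs x
    rw [Finset.sum_apply] at hsx
    conv_lhs => rw [hsx]
    rw [Finset.mul_sum]
    refine Finset.sum_congr rfl fun m _ => ?_
    by_cases hx : x ∈ Q m
    · rw [hkx m x hx]
    · rw [indicator_of_notMem hx]; simp
  have e2 : (fun x => f x * commutator (transposeL S) b φ x) =ᵐ[volume]
      fun x => ∑ m ∈ s, f x * commutator (transposeL S) b ((Q m).indicator φ) x := by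
    filter_upwards [commutator_finset_sum (S := transposeL S) hn hb s fun m _ => hφm m] with x hx
    rw [← Finset.mul_sum, ← hx, ← hs]
  rw [e1, integral_congr_ae e2, integral_finsetSum _ fun m _ => (hw' m).1, integral_finsetSum _ fun m _ =>
    integrable_mul_commutator H hn (isCZ_transposeL hS) hb (hφm m) hf hft, ← Finset.sum_neg_distrib]
  exact ⟨integrable_finsetSum _ fun m _ => (hw' m).1, Finset.sum_congr rfl fun m _ => (hw' m).2⟩

end Existence

/-! ### Equivalence of the weak formulation and the definition by duality. -/

section Duality

variable {n : ℕ} {p q t a c τ δ A : ℝ} {r R : ℝ≥0∞} {K : Eu n → Eu n → ℂ} {S : LTwo n →L[ℂ] LTwo n}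
  {b : Eu n → ℂ}

lemma DualExponents.conjExponent (hq : 1 < q) (hp : 1 < p)
    (hptr : (p < t ∧ ENNReal.ofReal t < r ∧ r < ∞) ∨ (p ≤ t ∧ r = ∞)) :
    DualExponents p q t r p.conjExponent q.conjExponent t.conjExponent r.conjExponent := by
  have ht : 1 < t := by rcases hptr with h | h <;> linarith [h.1]
  have hr : 1 < r := by
    rcases hptr with h | h
    · exact lt_of_le_of_lt (by rw [← ENNReal.ofReal_one]; exact ENNReal.ofReal_le_ofReal ht.le) h.2.1
    · rw [h.2]; exact ENNReal.one_lt_top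
  refine ⟨.conjExponent hp, .conjExponent hq, .conjExponent ht, ?_, ?_, hptr⟩
  · rw [ENNReal.conjExponent]
    exact ENNReal.add_ne_top.2 ⟨ENNReal.one_ne_top, ENNReal.inv_ne_top.2 (tsub_pos_of_lt hr).ne'⟩
  · rcases eq_or_ne r ∞ with rfl | hr'
    · exact .inl ⟨rfl, by simp [ENNReal.conjExponent]⟩
    · refine .inr ⟨hr', ?_⟩
      lift r to ℝ≥0 using hr'
      have h1 : 1 < r := by exact_mod_cast hr
      rw [← ENNReal.coe_conjExponent h1]
      exact NNReal.holderConjugate_coe_iff.2 (.conjExponent h1)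

lemma DualExponents.pos_left (H : DualExponents p q t r a c τ R) : 0 < r := by
  rcases H.hr with ⟨h, -⟩ | ⟨-, h⟩
  · simp [h]
  · exact (ENNReal.toReal_pos_iff.1 h.pos).1

lemma DualExponents.seqNorm_add_ne_top (H : DualExponents p q t r a c τ R) {ι : Type*} {u v : ι → ℝ≥0∞}
    (hu : seqNorm r u ≠ ∞) (hv : seqNorm r v ≠ ∞) : seqNorm r (fun i => u i + v i) ≠ ∞ := by
  rcases H.hr with ⟨hr, -⟩ | ⟨hr, h⟩
  · simp only [seqNorm, if_pos hr] at hu hv ⊢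
    exact ne_top_of_le_ne_top (ENNReal.add_ne_top.2 ⟨hu, hv⟩)
      (iSup_le fun i => add_le_add (le_iSup u i) (le_iSup v i))
  · rw [seqNorm_eq_sn hr] at hu hv ⊢
    have hu' := ENNReal.rpow_ne_top_of_nonneg h.nonneg hu
    have hv' := ENNReal.rpow_ne_top_of_nonneg h.nonneg hv
    rw [sn_rpow h.pos] at hu' hv'
    refine ENNReal.rpow_ne_top_of_nonneg (one_div_nonneg.2 h.nonneg) (ne_top_of_le_ne_top
      (ENNReal.mul_ne_top (ENNReal.rpow_ne_top_of_nonneg (y := r.toReal - 1) (by linarith [h.lt])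
        (by norm_num : (2 : ℝ≥0∞) ≠ ∞)) (ENNReal.add_ne_top.2 ⟨hu', hv'⟩))
      ((ENNReal.tsum_le_tsum fun i => ENNReal.rpow_add_le_mul_rpow_add_rpow (u i) (v i) h.lt.le).trans ?_))
    rw [ENNReal.tsum_mul_left, ENNReal.tsum_add]

lemma mN_add_const_smul_ne_top (H : DualExponents p q t r a c τ R) {f g : Eu n → ℂ} (k : ℂ)
    (hf : mN p q t r (fun x => ‖f x‖ₑ) ≠ ∞) (hg : mN p q t r (fun x => ‖g x‖ₑ) ≠ ∞) :
    mN p q t r (fun x => ‖(f + k • g) x‖ₑ) ≠ ∞ := by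
  obtain ⟨C, hC⟩ := exists_lorN_add_le H.hp.pos H.hq.pos
  have h1 : ∀ i, cubeN p q t (fun x => ‖(f + k • g) x‖ₑ) i ≤
      C * cubeN p q t (fun x => ‖f x‖ₑ) i + C * (2 * ‖k‖ₑ) * cubeN p q t (fun x => ‖g x‖ₑ) i := fun i => by
    simp only [cubeN]
    set V := volume (dyadicCube i) ^ (1 / t - 1 / p)
    set μ := volume.restrict (dyadicCube i)
    calc _ ≤ V * (C * (lorN p q μ (fun x => ‖f x‖ₑ) + 2 * ‖k‖ₑ * lorN p q μ fun x => ‖g x‖ₑ)) := by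
          gcongr
          refine (lorN_mono H.hq.pos H.hp.pos fun x => ?_).trans ((hC μ (fun x => ‖f x‖ₑ)
            fun x => ‖k‖ₑ * ‖g x‖ₑ).trans ?_)
          · rw [Pi.add_apply, Pi.smul_apply, smul_eq_mul, ← enorm_mul]
            exact enorm_add_le _ _
          · gcongr
            exact lorN_const_mul_le H.hp.pos H.hq.pos _ enorm_ne_top
      _ = _ := by ring
  have hD : (C : ℝ≥0∞) * (2 * ‖k‖ₑ) ≠ ∞ :=
    ENNReal.mul_ne_top ENNReal.coe_ne_top (ENNReal.mul_ne_top (by norm_num) enorm_ne_top)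
  change seqNorm r (cubeN p q t fun x => ‖(f + k • g) x‖ₑ) ≠ ∞
  change seqNorm r (cubeN p q t fun x => ‖f x‖ₑ) ≠ ∞ at hf
  change seqNorm r (cubeN p q t fun x => ‖g x‖ₑ) ≠ ∞ at hg
  refine ne_top_of_le_ne_top ?_ (seqNorm_mono h1)
  have hf' := ENNReal.mul_ne_top (ENNReal.coe_ne_top (r := C)) hf
  have hg' := ENNReal.mul_ne_top hD hg
  rw [← seqNorm_const_mul H.pos_left] at hf' hg'
  exact H.seqNorm_add_ne_top hf' hg'

lemma DualExponents.memBML_iff (H : DualExponents p q t r a c τ R) {f : Eu n → ℂ} :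
    MemBML p q t r f ↔ AEStronglyMeasurable f volume ∧ mN p q t r (fun x => ‖f x‖ₑ) ≠ ∞ := by
  obtain ⟨C₁, h₁⟩ := exists_bmlNorm_le (n := n) (t := t) H.hp.pos H.hq.pos H.pos_left
  obtain ⟨C₂, h₂⟩ := exists_mN_le (n := n) (t := t) H.hp.pos H.hq.pos H.pos_left
  exact and_congr_right fun _ =>
    ⟨fun h => ne_top_of_le_ne_top (ENNReal.mul_ne_top ENNReal.coe_ne_top h.ne) (h₂ f),
      fun h => (h₁ f).trans_lt (ENNReal.mul_lt_top ENNReal.coe_lt_top h.lt_top)⟩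

lemma IsWeakCommutator.ae_eq {f h h' : Eu n → ℂ} (hw : IsWeakCommutator S b f h)
    (hw' : IsWeakCommutator S b f h') : h' =ᵐ[volume] h := by
  refine ae_eq_of_forall_integral_mul_eq (fun φ hφ => ?_) (fun φ hφ => ?_) fun φ hφ => ?_
  · simpa only [mul_comm] using (hw' φ hφ).1
  · simpa only [mul_comm] using (hw φ hφ).1
  · simp_rw [mul_comm (φ _)]
    rw [(hw' φ hφ).2, (hw φ hφ).2]

lemma IsWeakCommutator.add_const_smul (H : DualExponents p q t r a c τ R) (hn : 0 < n)
    (hS : IsCZ δ A K S) (hb : MemBMO b) {f₁ f₂ h₁ h₂ : Eu n → ℂ} (k : ℂ) (hf₁ : MemBML p q t r f₁)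
    (hf₂ : MemBML p q t r f₂) (hw₁ : IsWeakCommutator S b f₁ h₁) (hw₂ : IsWeakCommutator S b f₂ h₂) :
    IsWeakCommutator S b (f₁ + k • f₂) (h₁ + k • h₂) := by
  intro φ hφ
  have hSt := isCZ_transposeL hS
  rw [H.memBML_iff] at hf₁ hf₂
  have i₁ := integrable_mul_commutator H hn hSt hb hφ hf₁.1 hf₁.2
  have i₂ := integrable_mul_commutator H hn hSt hb hφ hf₂.1 hf₂.2
  simp only [Pi.add_apply, Pi.smul_apply, smul_eq_mul, add_mul, mul_assoc]
  refine ⟨(hw₁ φ hφ).1.add ((hw₂ φ hφ).1.const_mul k), ?_⟩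
  rw [integral_add (hw₁ φ hφ).1 ((hw₂ φ hφ).1.const_mul k), integral_add i₁ (i₂.const_mul k),
    integral_const_mul, integral_const_mul, (hw₁ φ hφ).2, (hw₂ φ hφ).2]
  ring

variable {T : 𝓢(Eu n, ℂ) →L[ℂ] 𝓢'(Eu n, ℂ)}

/-- Test functions belong to the block space, and there the extended commutator agrees with the
original one almost everywhere. -/
lemma IsCommutator.isWeakCommutator (H : DualExponents p q t r p.conjExponent q.conjExponent t.conjExponent r.conjExponent)
    (hn : 0 < n) (hb : MemBMO b) {f h : Eu n → ℂ} (hc : IsCommutator p q t r T b f h) :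
    IsWeakCommutator (l2Extension T) b f h := by
  intro φ hφ
  obtain ⟨k, hk, h1, -, h3⟩ := hc.2.2 φ (hφ.memBlock H hn)
  have hk' : k =ᵐ[volume] commutator (transposeL (l2Extension T)) b φ :=
    IsBlockCommutator.ae_eq_commutator (S := transposeL (l2Extension T)) H hn hb hφ hk
  refine ⟨h1, h3.trans (congrArg _ (integral_congr_ae ?_))⟩
  filter_upwards [hk'] with x hx
  rw [hx]

/-- The extension to the block space comes with the transfer of adjoint relations from test
functions to all g, applied here to the pair (h, f). -/
lemma IsWeakCommutator.isCommutator (H : DualExponents p q t r p.conjExponent q.conjExponent t.conjExponent r.conjExponent)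
    (hn : 0 < n) (hT : IsCalderonZygmund δ A K T) (hb : MemBMO b) {f h : Eu n → ℂ}
    (hw : IsWeakCommutator (l2Extension T) b f h) (hf : MemBML p q t r f) (hh : MemBML p q t r h) :
    IsCommutator p q t r T b f h := by
  refine ⟨hf, hh, fun g hg => ?_⟩
  obtain ⟨k, hk, hFG⟩ := exists_isBlockCommutator H hn (isCZ_transposeL (isCZ_l2Extension hT)) hb hg
  rw [H.memBML_iff] at hf hh
  exact ⟨k, hk, hFG h f hh.1 hf.1 hh.2 hf.2 fun φ hφ => (hw φ hφ).2⟩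

lemma IsWeakCommutator.memBML (H : DualExponents p q t r a c τ R) (hn : 0 < n) (hS : IsCZ δ A K S)
    (hb : MemBMO b) {f h : Eu n → ℂ} (hw : IsWeakCommutator S b f h) (hf : MemBML p q t r f)
    (hh : AEStronglyMeasurable h volume) : MemBML p q t r h := by
  obtain ⟨C, hC⟩ := exists_mN_le_of_isWeakCommutator H hn hS hb
  rw [H.memBML_iff] at hf ⊢
  exact ⟨hh, ne_top_of_le_ne_top (ENNReal.mul_ne_top ENNReal.coe_ne_top hf.2) (hC f h hf.1 hh hw hf.2)⟩

end Duality

end BourgainMorreyLorentz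

end

open BourgainMorreyLorentz in
theorem mainTheorem9 (n : ℕ) (hn : 0 < n) (p q t : ℝ) (r : ℝ≥0∞) (hq : 1 < q) (hp : 1 < p)
    (hptr : (p < t ∧ ENNReal.ofReal t < r ∧ r < ∞) ∨ (p ≤ t ∧ r = ∞))
    (δ A : ℝ) (K : EuclideanSpace ℝ (Fin n) → EuclideanSpace ℝ (Fin n) → ℂ)
    (T : 𝓢(EuclideanSpace ℝ (Fin n), ℂ) →L[ℂ] 𝓢'(EuclideanSpace ℝ (Fin n), ℂ))
    (hT : IsCalderonZygmund δ A K T)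
    (b : EuclideanSpace ℝ (Fin n) → ℂ) (hb : MemBMO b) :
    (∀ f, MemBML p q t r f →
      ∃ h, IsCommutator p q t r T b f h ∧
        ∀ h', IsCommutator p q t r T b f h' → h' =ᵐ[volume] h) ∧
    (∀ (c : ℂ) (f₁ f₂ h₁ h₂ : EuclideanSpace ℝ (Fin n) → ℂ),
      IsCommutator p q t r T b f₁ h₁ → IsCommutator p q t r T b f₂ h₂ →
        IsCommutator p q t r T b (f₁ + c • f₂) (h₁ + c • h₂)) ∧
    ∃ C : NNReal, ∀ f h, IsCommutator p q t r T b f h →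
      bmlNorm p q t r h ≤ C * bmlNorm p q t r f := by
  have H := DualExponents.conjExponent hq hp hptr
  have hS := isCZ_l2Extension hT
  -- Each claim is reduced to the weak relation, where uniqueness, linearity and the a priori bound
  -- are available.
  refine ⟨fun f hf => ?_, fun c f₁ f₂ h₁ h₂ hc₁ hc₂ => ?_, ?_⟩
  · obtain ⟨h, hm, hw⟩ := exists_isWeakCommutator H hn hS hb hf.1 (H.memBML_iff.1 hf).2
    exact ⟨h, hw.isCommutator H hn hT hb hf (hw.memBML H hn hS hb hf hm),
      fun h' hc => hw.ae_eq (hc.isWeakCommutator H hn hb)⟩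
  · have hw := (hc₁.isWeakCommutator H hn hb).add_const_smul H hn hS hb c hc₁.1 hc₂.1
      (hc₂.isWeakCommutator H hn hb)
    have hf₁ := H.memBML_iff.1 hc₁.1
    have hf₂ := H.memBML_iff.1 hc₂.1
    have hf : MemBML p q t r (f₁ + c • f₂) := H.memBML_iff.2
      ⟨hf₁.1.add (hf₂.1.const_smul c), mN_add_const_smul_ne_top H c hf₁.2 hf₂.2⟩
    exact hw.isCommutator H hn hT hb hf
      (hw.memBML H hn hS hb hf (hc₁.2.1.1.add (hc₂.2.1.1.const_smul c)))
  · obtain ⟨C, hC⟩ := exists_mN_le_of_isWeakCommutator H hn hS hb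
    obtain ⟨C₁, h₁⟩ := exists_bmlNorm_le (n := n) (t := t) H.hp.pos H.hq.pos H.pos_left
    obtain ⟨C₂, h₂⟩ := exists_mN_le (n := n) (t := t) H.hp.pos H.hq.pos H.pos_left
    refine ⟨C₁ * (C * C₂), fun f h hc => ?_⟩
    have hf := H.memBML_iff.1 hc.1
    calc bmlNorm p q t r h ≤ C₁ * mN p q t r (fun x => ‖h x‖ₑ) := h₁ h
      _ ≤ C₁ * (C * (C₂ * bmlNorm p q t r f)) := by
          gcongr
          refine (hC f h hf.1 hc.2.1.1 (hc.isWeakCommutator H hn hb) hf.2).trans ?_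
          gcongr
          exact h₂ f
      _ = _ := by push_cast; ring
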